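/- **Conventions.** For a string $A$ of non-negative integers, the *sparse encoding* $\mathrm{enc}(A)\in\{0,1\}^*$ encodes $A$ from left to right: each symbol $u>0$ is written as $1\cdot\gamma(u)$ and each inclusion-wise maximal run $0^x$ ($x\ge 1$) as $0\cdot\gamma(x)$, where $\gamma(x)$ is the Elias-$\gamma$ code, i.e. $\lfloor\log_2 x\rfloor$ zeros followed by the binary representation of $x$, most significant bit first. A *single-stream transducer* with states $[0,q)$ and alphabet $[0,\sigma)$ consists of an initial state $s_0$ and a transition function $\delta:[0,q)\times[0,\sigma)\to[0,q)\times[0,\sigma)$; on input $S$ of length $n$ it produces the string $T$ of length $n$ defined by $\delta(s_i,S[i])=(s_{i+1},T[i])$ for $0\le i<n$. The model is the word RAM: memory cells and registers hold words, programs are fixed (independent of the word length), and each arithmetic, bitwise, shift, load, store or comparison operation takes unit time; a bitmask is stored in consecutive bits of memory. The length of a word is at least $\kappa w$ bits for a sufficiently large constant $\kappa$, so that numbers in $2^{O(w)}$ fit in a word. The transition function is accessible only by evaluating it at a state and a symbol. **Theorem.** There are two programs, *preprocess* and *query*, such that for every constant $C$ there is a constant $\kappa$, and for every constant $c$ there is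 then a constant $K$, with the following property. Let $w$ and $N$ be integers with $2\le N\le 2^w$, let the word length be $b\ge\kappa w$ bits, and consider a single-stream transducer with states $[0,q)$ and alphabet $[0,\sigma)$, where $q,\sigma\le 2^{Cw}$, such that evaluating the transition function with input symbol $x$ (at any state) takes at most $c\,(1+\log_2(1+x)/\log_2 N)$ time. Given $b,N,q,\sigma,s_0$, and with arbitrary initial memory contents, *preprocess* takes at most $K\,qN$ time and computes a data structure in the first $D\le K\,qN$ memory cells, without modifying other cells. Afterwards, for every input string $S\in[0,\sigma)^n$ with $n\le 2^{Cw}$, for which the transducer produces the output $T$, the following holds. The memory has room for the data structure, $\mathrm{enc}(S)$ and $\mathrm{enc}(T)$. If the data structure is in place, $\mathrm{enc}(S)$ is stored elsewhere in memory (given by its address and length), and the address of a disjoint output area is given, then *query* writes $\mathrm{enc}(T)$ to the output area, reports its length, modifies no cell outside of the output area, and takes time at most $$K\left(1+\frac{|\mathrm{enc}(S)|+|\mathrm{enc}(T)|}{\log_2 N}\right).$$ -/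

import Mathlib

/-! ### Sparse encodings -/

/-- The Elias-gamma code of a positive integer `x`: `⌊log₂ x⌋` zeros, followed by the binary
representation of `x`, most significant bit first (`false` is the bit 0, `true` the bit 1). -/
def eliasGamma (x : ℕ) : List Bool :=
  List.replicate (Nat.log 2 x) false ++ (Nat.bits x).reverse

/-- The token of a zero-run of length `z`; nothing is written for an empty run. -/
def zeroRunToken (z : ℕ) : List Bool :=
  if z = 0 then [] else false :: eliasGamma z

/-- The token of a non-zero symbol. -/
def literalToken (u : ℕ) : List Bool :=
  true :: eliasGamma u

/-- Sparse encoding of `0 ^ z` followed by the given string, where `z` counts the zeros of the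
current run that have been read but not yet encoded. -/
def sparseEncodingAux : ℕ → List ℕ → List Bool
  | z, [] => zeroRunToken z
  | z, 0 :: l => sparseEncodingAux (z + 1) l
  | z, (u + 1) :: l => zeroRunToken z ++ literalToken (u + 1) ++ sparseEncodingAux 0 l

/-- The sparse encoding of a string of non-negative integers: from left to right, every non-zero
symbol gives a literal token and every maximal run of zeros gives a zero-run token. -/
def sparseEncoding (A : List ℕ) : List Bool :=
  sparseEncodingAux 0 A

/-! ### Single-stream transducers -/

/-- A deterministic single-stream transducer with states `[0, q)` and alphabet `[0, σ)`. -/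
structure Transducer (q σ : ℕ) where
  init : Fin q
  step : Fin q → Fin σ → Fin q × Fin σ

namespace Transducer

/-- The output string produced on an input string, starting in state `s`. -/
def outputFrom {q σ : ℕ} (A : Transducer q σ) : Fin q → List (Fin σ) → List (Fin σ)
  | _, [] => []
  | s, x :: l => (A.step s x).2 :: outputFrom A (A.step s x).1 l

/-- The output string produced on an input string, starting in the initial state. -/
def output {q σ : ℕ} (A : Transducer q σ) (S : List (Fin σ)) : List (Fin σ) :=
  A.outputFrom A.init S

end Transducer

/-- The sparse encoding of a string over the alphabet `[0, σ)`. -/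
def senc {σ : ℕ} (S : List (Fin σ)) : List Bool :=
  sparseEncoding (S.map (fun x => (x : ℕ)))

/-! ### The word RAM

Words have `b` bits, and the memory consists of `2 ^ b` words. A program uses finitely many
registers, each of which holds one word, and does not depend on `b`. -/

namespace WordRAM

/-- Contents of registers and memory. -/
structure State (b : ℕ) where
  reg : ℕ → BitVec b
  mem : BitVec b → BitVec b

/-- The arithmetic and bitwise operations on words. -/
inductive BinOp
  | add | sub | mul | div | mod | and | or | xor | shl | shr

/-- Unsigned arithmetic modulo `2 ^ b`, integer division and remainder, bitwise operations,
and logical shifts (of the first argument, by the second argument). -/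
def BinOp.apply {b : ℕ} : BinOp → BitVec b → BitVec b → BitVec b
  | add, x, y => x + y
  | sub, x, y => x - y
  | mul, x, y => x * y
  | div, x, y => x / y
  | mod, x, y => x % y
  | and, x, y => x &&& y
  | or, x, y => x ||| y
  | xor, x, y => x ^^^ y
  | shl, x, y => x <<< y
  | shr, x, y => x >>> y

/-- Comparisons of two registers. -/
inductive Test
  | eq (i j : ℕ)
  | ne (i j : ℕ)
  | lt (i j : ℕ)
  | le (i j : ℕ)

/-- Outcome of a comparison; words are compared as unsigned integers. -/
def Test.holds {b : ℕ} (st : State b) : Test → Prop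
  | eq i j => (st.reg i).toNat = (st.reg j).toNat
  | ne i j => (st.reg i).toNat ≠ (st.reg j).toNat
  | lt i j => (st.reg i).toNat < (st.reg j).toNat
  | le i j => (st.reg i).toNat ≤ (st.reg j).toNat

/-- Programs in structured form. -/
inductive Prog
  /-- do nothing -/
  | nop
  /-- `reg d := n` -/
  | const (d n : ℕ)
  /-- `reg d := f (reg i) (reg j)` -/
  | op (f : BinOp) (d i j : ℕ)
  /-- `reg d := mem (reg i)` -/
  | load (d i : ℕ)
  /-- `mem (reg i) := reg j` -/
  | store (i j : ℕ)
  /-- evaluate the transition function of the transducer in state `reg i` with input symbol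
  `reg j`; the new state goes to `reg d` and the output symbol to `reg e` -/
  | transition (d e i j : ℕ)
  | seq (p p' : Prog)
  | branch (c : Test) (p p' : Prog)
  | loop (c : Test) (p : Prog)

namespace State

def setReg {b : ℕ} (st : State b) (d : ℕ) (v : BitVec b) : State b :=
  { st with reg := Function.update st.reg d v }

def setMem {b : ℕ} (st : State b) (a v : BitVec b) : State b :=
  { st with mem := Function.update st.mem a v }

end State

/-- `Exec A cost p st st' t`: the program `p`, started in `st`, halts in `st'` after `t` time
units. Every instruction and every test takes one unit, except that evaluating the transition
function of `A` in state `s` with input symbol `x` takes `cost s x` units. A program that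
evaluates the transition function outside of its domain has no execution. -/
inductive Exec {b q σ : ℕ} (A : Transducer q σ) (cost : Fin q → Fin σ → ℕ) :
    Prog → State b → State b → ℕ → Prop
  | nop (st : State b) : Exec A cost .nop st st 0
  | const (d n : ℕ) (st : State b) :
      Exec A cost (.const d n) st (st.setReg d (BitVec.ofNat b n)) 1
  | op (f : BinOp) (d i j : ℕ) (st : State b) :
      Exec A cost (.op f d i j) st (st.setReg d (f.apply (st.reg i) (st.reg j))) 1
  | load (d i : ℕ) (st : State b) :
      Exec A cost (.load d i) st (st.setReg d (st.mem (st.reg i))) 1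
  | store (i j : ℕ) (st : State b) :
      Exec A cost (.store i j) st (st.setMem (st.reg i) (st.reg j)) 1
  | transition (d e i j : ℕ) (st : State b) (s : Fin q) (x : Fin σ)
      (hs : (st.reg i).toNat = s) (hx : (st.reg j).toNat = x) :
      Exec A cost (.transition d e i j) st
        ((st.setReg d (BitVec.ofNat b ((A.step s x).1 : ℕ))).setReg e
          (BitVec.ofNat b ((A.step s x).2 : ℕ)))
        (cost s x)
  | seq {p p' : Prog} {st st' st'' : State b} {t t' : ℕ}
      (h : Exec A cost p st st' t) (h' : Exec A cost p' st' st'' t') :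
      Exec A cost (.seq p p') st st'' (t + t')
  | branch_true {c : Test} {p p' : Prog} {st st' : State b} {t : ℕ}
      (hc : c.holds st) (h : Exec A cost p st st' t) :
      Exec A cost (.branch c p p') st st' (1 + t)
  | branch_false {c : Test} {p p' : Prog} {st st' : State b} {t : ℕ}
      (hc : ¬ c.holds st) (h : Exec A cost p' st st' t) :
      Exec A cost (.branch c p p') st st' (1 + t)
  | loop_true {c : Test} {p : Prog} {st st' st'' : State b} {t t' : ℕ}
      (hc : c.holds st) (h : Exec A cost p st st' t)
      (h' : Exec A cost (.loop c p) st' st'' t') :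
      Exec A cost (.loop c p) st st'' (1 + t + t')
  | loop_false {c : Test} {p : Prog} {st : State b} (hc : ¬ c.holds st) :
      Exec A cost (.loop c p) st st 1

/-- Number of words reserved for storing the bitmask `B` with `b` bits per word. -/
def cells (b : ℕ) (B : List Bool) : ℕ :=
  B.length / b + 1

/-- The bitmask `B` is stored in consecutive bits of memory, starting with the most significant
bit of the word at address `a`. -/
def Stores {b : ℕ} (st : State b) (a : ℕ) (B : List Bool) : Prop :=
  ∀ (i : ℕ) (hi : i < B.length),
    (st.mem (BitVec.ofNat b (a + i / b))).getMsbD (i % b) = B[i]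

end WordRAM

/-!
The transducer is simulated directly on the sparse encoding. Let `L` be the least positive integer
with `N ≤ 4 ^ L`, so that `L` is proportional to `log N`. The preprocessing builds two structures.

* A table (`DS`, `EntryOK`) with an entry for every state and every index `i ≤ 2 * 2 ^ L`. The
  indices below `2 ^ L` stand for blocks of `L` input bits, and the index `2 ^ L + d` for a run of
  `d` zeros. An entry tells which state is reached, how much of the input has been used, and a
  summary `Rec` of the output, from which the encoder can continue after any number of pending
  zeros. Its computation stops early before output symbols `≥ 2 ^ L`, and when `L` bits of output
  are complete. An entry takes time `O(2 ^ L)`, so the table takes time `O(q * 4 ^ L) = O(q * N)`.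
* A structure for long runs of zeros. The map `skipStep` follows the input symbol zero while the
  output is zero. Its functional graph is cut into a forest (`Forest`), which is decomposed into
  long paths. Each path with `n` states is extended upwards to a ladder of `(2 ^ L + 1) * n` states.
  Jumping to the top of a ladder multiplies the position on the path by at least `2 ^ L`, so that
  `x` steps take time `O(1 + log x / L)` (`climb_spec`). On a cycle, the remaining number of
  steps is first reduced modulo the length of the cycle. The ladders take `O(q * 2 ^ L)` cells.

A query (`iterCode`) repeats the following: skip pending zeros while the output is zero, use one
entry of the table, and take one step without the table. The output passes through an accumulator
of one word, so that appending up to a word of bits takes constant time (`put_spec`), and a run of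
zeros in the output is only counted until it ends. An iteration either consumes `L` bits of input
or produces about `L` bits of output, up to a pending run of zeros, whose skipping is paid by a
credit proportional to `L + log x`. This is an argument with the potential `pot` (`iter_spec`,
`query_spec`): all costs, including those of long tokens and of transitions with large input or
output symbols, are at most the number of bits that are consumed or produced, divided by `L`, up to
constant factors.

The programs are written in a structured language `Cmd` over natural-number variables. Its
semantics `wp` is a weakest-precondition calculus with a clock, in which every operation has to be
free of overflow and underflow, and `Cmd.code` translates it to the word RAM. Soundness of the
translation, with equal running times, is `Cmd.code_exec`.
-/

open WordRAM

namespace SparseTransducer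

/-! ### A structured language over natural-number variables -/

/-- The program variables. The first five are the registers in which the programs receive their
arguments. Some of the others have a fixed meaning: `vB` is the word length, `vL` the block length
`L`, `vP` its power `2 ^ L`, `vMB`, `vGB` and `vLB` are the addresses of the bit length table, the
table of chunks and the ladders; `vLead`, `vMv`, `vMl`, `vTz` hold a summary of output, `vAcc`,
`vR`, `vOw` the accumulator of the output, `vZ` the zeros pending in the output, `vX` those pending
in the input, and `vS` the state of the transducer. -/
inductive Var
  | vR0 | vR1 | vR2 | vR3 | vR4
  | vB | vN | vQ | vSig | vS0 | vL | vP | vMB | vGB | vLB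
  | vSy | vSz | vT0 | vT1 | vT2 | vT3
  | vY | vLead | vMv | vMl | vTz
  | vPv | vPl | vAcc | vR | vOw
  | vV | vV1 | vJ | vK | vU | vTy | vTl
  | vA | vLen | vO | vX | vZ | vPos | vS | vD | vRt | vO0 | vDd | vI | vE | vCb | vX1
  | vC | vBase | vIdx | vCnt | vLast | vAl | vSt | vGo | vZero | vF
  deriving DecidableEq

/-- The machine register that holds a variable. -/
def Var.idx : Var → ℕ := Var.ctorIdx

theorem Var.idx_injective : Function.Injective Var.idx := by
  intro x y h
  have hx := Var.ofNat_ctorIdx x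
  have hy := Var.ofNat_ctorIdx y
  unfold Var.idx at h
  rw [← hx, ← hy, h]

theorem Var.idx_lt (v : Var) : v.idx < 100 := by
  cases v <;> decide

/-- Expressions over the variables, built with the operations of the word RAM. -/
inductive Ex
  | var (v : Var)
  | num (n : ℕ)
  | bin (f : BinOp) (e₁ e₂ : Ex)

instance : Coe Var Ex := ⟨.var⟩
instance (n : ℕ) : OfNat Ex n := ⟨.num n⟩
instance : Add Ex := ⟨.bin .add⟩
instance : Sub Ex := ⟨.bin .sub⟩
instance : Mul Ex := ⟨.bin .mul⟩
instance : Div Ex := ⟨.bin .div⟩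
instance : Mod Ex := ⟨.bin .mod⟩

/-- Left shift; bits that leave the word are lost. -/
infixl:75 " ≪≪ " => Ex.bin BinOp.shl
/-- Right shift. -/
infixl:75 " ≫≫ " => Ex.bin BinOp.shr

/-- Values of variables and memory cells as natural numbers, and a clock. -/
structure NS where
  reg : Var → ℕ
  mem : ℕ → ℕ
  time : ℕ

namespace NS

/-- Assign to a variable. -/
def set (s : NS) (d : Var) (v : ℕ) : NS := { s with reg := Function.update s.reg d v }
/-- Write to a memory cell. -/
def put (s : NS) (a v : ℕ) : NS := { s with mem := Function.update s.mem a v }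
/-- Let time pass. -/
def tick (s : NS) (t : ℕ) : NS := { s with time := s.time + t }

@[simp] theorem set_reg (s : NS) (d d' : Var) (v : ℕ) :
    (s.set d v).reg d' = if d' = d then v else s.reg d' := by
  simp [set, Function.update_apply]
@[simp] theorem set_mem (s : NS) (d : Var) (v : ℕ) : (s.set d v).mem = s.mem := rfl
@[simp] theorem set_time (s : NS) (d : Var) (v : ℕ) : (s.set d v).time = s.time := rfl
@[simp] theorem put_reg (s : NS) (a v : ℕ) : (s.put a v).reg = s.reg := rfl
@[simp] theorem put_mem (s : NS) (a v : ℕ) : (s.put a v).mem = Function.update s.mem a v := rfl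
@[simp] theorem put_time (s : NS) (a v : ℕ) : (s.put a v).time = s.time := rfl
@[simp] theorem tick_reg (s : NS) (t : ℕ) : (s.tick t).reg = s.reg := rfl
@[simp] theorem tick_mem (s : NS) (t : ℕ) : (s.tick t).mem = s.mem := rfl
@[simp] theorem tick_time (s : NS) (t : ℕ) : (s.tick t).time = s.time + t := rfl

end NS

/-- The operations on natural numbers that the machine operations implement if `okOp` holds. -/
def natOp (b : ℕ) : BinOp → ℕ → ℕ → ℕ
  | .add, x, y => x + y
  | .sub, x, y => x - y
  | .mul, x, y => x * y
  | .div, x, y => x / y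
  | .mod, x, y => x % y
  | .and, x, y => x &&& y
  | .or, x, y => x ||| y
  | .xor, x, y => x ^^^ y
  | .shl, x, y => x * 2 ^ y % 2 ^ b
  | .shr, x, y => x / 2 ^ y

/-- There is neither overflow nor underflow. -/
def okOp (b : ℕ) : BinOp → ℕ → ℕ → Prop
  | .add, x, y => x + y < 2 ^ b
  | .sub, x, y => y ≤ x
  | .mul, x, y => x * y < 2 ^ b
  | _, _, _ => True

theorem apply_toNat {b : ℕ} (f : BinOp) (x y : BitVec b) (h : okOp b f x.toNat y.toNat) :
    (f.apply x y).toNat = natOp b f x.toNat y.toNat := by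
  cases f <;> simp only [BinOp.apply, natOp, okOp] at *
  · rw [BitVec.toNat_add, Nat.mod_eq_of_lt h]
  · rw [BitVec.toNat_sub_of_le (by simpa [BitVec.le_def] using h)]
  · rw [BitVec.toNat_mul, Nat.mod_eq_of_lt h]
  · simp
  · simp
  · simp
  · simp
  · simp
  · simp [Nat.shiftLeft_eq]
  · simp [Nat.shiftRight_eq_div_pow]

namespace Ex

/-- The value of an expression; on words of `b` bits it is correct if `ok` holds. -/
def eval (b : ℕ) (s : NS) : Ex → ℕ
  | var v => s.reg v
  | num n => n
  | bin f e₁ e₂ => natOp b f (e₁.eval b s) (e₂.eval b s)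

/-- All constants fit into a word, and no operation overflows or underflows. -/
def ok (b : ℕ) (s : NS) : Ex → Prop
  | var _ => True
  | num n => n < 2 ^ b
  | bin f e₁ e₂ => e₁.ok b s ∧ e₂.ok b s ∧ okOp b f (e₁.eval b s) (e₂.eval b s)

/-- The number of nodes, which is the time that evaluation takes. -/
def size : Ex → ℕ
  | var _ => 1
  | num _ => 1
  | bin _ e₁ e₂ => e₁.size + e₂.size + 1

/-- Evaluate the expression into register `k`, using the registers from `k` on. -/
def code : Ex → ℕ → Prog
  | var v, k => .op .or k v.idx v.idx
  | num n, k => .const k n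
  | bin f e₁ e₂, k => .seq (e₁.code k) (.seq (e₂.code (k + 1)) (.op f k k (k + 1)))

end Ex

/-- Comparisons of expressions. -/
inductive Cond
  | lt (e₁ e₂ : Ex)
  | le (e₁ e₂ : Ex)
  | eq (e₁ e₂ : Ex)
  | ne (e₁ e₂ : Ex)

namespace Cond

/-- The left-hand side. -/
def left : Cond → Ex
  | lt e _ | le e _ | eq e _ | ne e _ => e

/-- The right-hand side. -/
def right : Cond → Ex
  | lt _ e | le _ e | eq _ e | ne _ e => e

/-- The comparison is true. -/
def holds (b : ℕ) (s : NS) : Cond → Prop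
  | lt e₁ e₂ => e₁.eval b s < e₂.eval b s
  | le e₁ e₂ => e₁.eval b s ≤ e₂.eval b s
  | eq e₁ e₂ => e₁.eval b s = e₂.eval b s
  | ne e₁ e₂ => e₁.eval b s ≠ e₂.eval b s

/-- Both sides can be evaluated without overflow or underflow. -/
def ok (b : ℕ) (s : NS) (c : Cond) : Prop := c.left.ok b s ∧ c.right.ok b s

/-- The time for the evaluation of both sides and the comparison. -/
def cost (c : Cond) : ℕ := c.left.size + c.right.size + 1

/-- Evaluate both sides into the registers 100 and 101. -/
def code (c : Cond) : Prog := .seq (c.left.code 100) (c.right.code 101)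

/-- The machine test to be done after `code`. -/
def test : Cond → Test
  | lt _ _ => .lt 100 101
  | le _ _ => .le 100 101
  | eq _ _ => .eq 100 101
  | ne _ _ => .ne 100 101

end Cond

/-- Programs over the variables: `ld d e` loads the cell with address `e` into `d`, `st e₁ e₂`
stores `e₂` at the address `e₁`, and `trans d e i j` evaluates the transition function at the state
`i` and the symbol `j`, and assigns the new state to `d` and the output symbol to `e`. -/
inductive Cmd
  | skip
  | set (d : Var) (e : Ex)
  | ld (d : Var) (e : Ex)
  | st (e₁ e₂ : Ex)
  | trans (d e i j : Var)
  | seq (p p' : Cmd)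
  | ite (c : Cond) (p p' : Cmd)
  | loop (c : Cond) (p : Cmd)

/-- Sequential composition. -/
infixr:40 " ;; " => Cmd.seq
/-- Assignment. -/
infix:50 " ≔ " => Cmd.set

namespace Cmd

/-- The machine program. The registers from 100 on are used for intermediate results. -/
def code : Cmd → Prog
  | skip => .nop
  | set d e => .seq (e.code 100) (.op .or d.idx 100 100)
  | ld d e => .seq (e.code 100) (.load d.idx 100)
  | st e₁ e₂ => .seq (e₁.code 100) (.seq (e₂.code 101) (.store 100 101))
  | trans d e i j => .transition d.idx e.idx i.idx j.idx
  | seq p p' => .seq p.code p'.code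
  | ite c p p' => .seq c.code (.branch c.test p.code p'.code)
  | .loop c p => .seq c.code (.loop c.test (.seq p.code c.code))

/-- The variables to which a program assigns. -/
def writes : Cmd → List Var
  | skip => []
  | set d _ => [d]
  | ld d _ => [d]
  | st _ _ => []
  | trans d e _ _ => [d, e]
  | seq p p' => p.writes ++ p'.writes
  | ite _ p p' => p.writes ++ p'.writes
  | .loop _ p => p.writes

/-- Whether a program may modify the memory. -/
def stores : Cmd → Bool
  | st _ _ => true
  | seq p p' => p.stores || p'.stores
  | ite _ p p' => p.stores || p'.stores
  | .loop _ p => p.stores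
  | _ => false

end Cmd

/-- Total correctness of a loop with at most `n` tests, given the meaning `f` of the body. -/
def loopWp (b : ℕ) (c : Cond) (f : (NS → Prop) → NS → Prop) (Q : NS → Prop) : ℕ → NS → Prop
  | 0, _ => False
  | n + 1, s => c.ok b s ∧ (c.holds b s → f (loopWp b c f Q n) (s.tick c.cost)) ∧
      (¬ c.holds b s → Q (s.tick c.cost))

section wp

variable {b q σ : ℕ} (A : Transducer q σ) (cost : Fin q → Fin σ → ℕ)

variable (b) in
/-- Total correctness: started in `s`, the program halts without overflow, underflow or an
access outside of the memory, in a state satisfying `Q`. The clock counts the time. Since cells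
hold words, a loaded value may be assumed to be less than `2 ^ b`. -/
def wp : Cmd → (NS → Prop) → NS → Prop
  | .skip, Q, s => Q s
  | .set d e, Q, s => e.ok b s ∧ Q ((s.set d (e.eval b s)).tick (e.size + 1))
  | .ld d e, Q, s => e.ok b s ∧ e.eval b s < 2 ^ b ∧ (s.mem (e.eval b s) < 2 ^ b →
      Q ((s.set d (s.mem (e.eval b s))).tick (e.size + 1)))
  | .st e₁ e₂, Q, s => e₁.ok b s ∧ e₂.ok b s ∧ e₁.eval b s < 2 ^ b ∧
      Q ((s.put (e₁.eval b s) (e₂.eval b s)).tick (e₁.size + e₂.size + 1))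
  | .trans d e i j, Q, s => ∃ (v : Fin q) (x : Fin σ), s.reg i = v ∧ s.reg j = x ∧
      ((A.step v x).1 : ℕ) < 2 ^ b ∧ ((A.step v x).2 : ℕ) < 2 ^ b ∧
      Q (((s.set d (A.step v x).1).set e (A.step v x).2).tick (cost v x))
  | .seq p p', Q, s => wp p (wp p' Q) s
  | .ite c p p', Q, s => c.ok b s ∧ (c.holds b s → wp p Q (s.tick c.cost)) ∧
      (¬ c.holds b s → wp p' Q (s.tick c.cost))
  | .loop c p, Q, s => ∃ n, loopWp b c (wp p) Q n s

variable {A cost}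

theorem loopWp_mono {c : Cond} {f : (NS → Prop) → NS → Prop} {Q Q' : NS → Prop}
    (hf : ∀ {R R' : NS → Prop}, (∀ s, R s → R' s) → ∀ s, f R s → f R' s)
    (h : ∀ s, Q s → Q' s) : ∀ n s, loopWp b c f Q n s → loopWp b c f Q' n s
  | 0, _, hs => hs
  | n + 1, _, hs =>
      ⟨hs.1, fun hc => hf (loopWp_mono hf h n) _ (hs.2.1 hc), fun hc => h _ (hs.2.2 hc)⟩

theorem wp_mono {p : Cmd} : ∀ {Q Q' : NS → Prop}, (∀ s, Q s → Q' s) →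
    ∀ {s : NS}, wp b A cost p Q s → wp b A cost p Q' s := by
  induction p with
  | skip => exact fun h _ hs => h _ hs
  | set d e => exact fun h _ hs => ⟨hs.1, h _ hs.2⟩
  | ld d e => exact fun h _ hs => ⟨hs.1, hs.2.1, fun hm => h _ (hs.2.2 hm)⟩
  | st e₁ e₂ => exact fun h _ hs => ⟨hs.1, hs.2.1, hs.2.2.1, h _ hs.2.2.2⟩
  | trans d e i j =>
    rintro Q Q' h s ⟨v, x, h1, h2, h3, h4, h5⟩
    exact ⟨v, x, h1, h2, h3, h4, h _ h5⟩
  | seq p p' ih ih' => exact fun h _ hs => ih (fun _ => ih' h) hs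
  | ite c p p' ih ih' =>
    exact fun h _ hs => ⟨hs.1, fun hc => ih h (hs.2.1 hc), fun hc => ih' h (hs.2.2 hc)⟩
  | loop c p ih =>
    rintro Q Q' h s ⟨n, hn⟩
    exact ⟨n, loopWp_mono (f := wp b A cost p) (fun hR _ hs => ih hR hs) h n s hn⟩

/-- What a program leaves unchanged: the variables it does not assign to, and the memory if it
contains no store instruction. Time does not run backwards. -/
structure Frame (p : Cmd) (s s' : NS) : Prop where
  reg' : ∀ v, p.writes.contains v = false → s'.reg v = s.reg v
  mem' : p.stores = false → s'.mem = s.mem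
  time' : s.time ≤ s'.time

theorem Frame.trans' {p : Cmd} {s s' s'' : NS} (h : Frame p s s') (h' : Frame p s' s'') :
    Frame p s s'' :=
  ⟨fun v hv => (h'.reg' v hv).trans (h.reg' v hv), fun hp => (h'.mem' hp).trans (h.mem' hp),
    h.time'.trans h'.time'⟩

/-- Every specification may be extended by the frame of the program. -/
theorem wp_frame {p : Cmd} : ∀ {Q : NS → Prop} {s : NS}, wp b A cost p Q s →
    wp b A cost p (fun s' => Q s' ∧ Frame p s s') s := by
  induction p with
  | skip => exact fun h => ⟨h, fun _ _ => rfl, fun _ => rfl, le_rfl⟩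
  | set d e =>
    refine fun h => ⟨h.1, h.2, fun v hv => ?_, fun _ => rfl, by simp⟩
    have : v ≠ d := by simpa [Cmd.writes] using hv
    simp [this]
  | ld d e =>
    refine fun h => ⟨h.1, h.2.1, fun hm => ⟨h.2.2 hm, fun v hv => ?_, fun _ => rfl, by simp⟩⟩
    have : v ≠ d := by simpa [Cmd.writes] using hv
    simp [this]
  | st e₁ e₂ =>
    exact fun h => ⟨h.1, h.2.1, h.2.2.1, h.2.2.2, fun v hv => rfl, fun h =>
      by simp [Cmd.stores] at h, by simp⟩
  | trans d e i j =>
    rintro Q s ⟨v, x, h1, h2, h3, h4, h5⟩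
    refine ⟨v, x, h1, h2, h3, h4, h5, fun v hv => ?_, fun _ => rfl, by simp⟩
    have : ¬ (v = d ∨ v = e) := by simpa [Cmd.writes] using hv
    push Not at this
    simp [this]
  | seq p p' ih ih' =>
    intro Q s h
    refine wp_mono (p := p) ?_ (ih h)
    rintro s' ⟨h', hf⟩
    refine wp_mono (p := p') ?_ (ih' h')
    rintro s'' ⟨h'', hf'⟩
    refine ⟨h'', fun v hv => ?_, fun hp => ?_, hf.time'.trans hf'.time'⟩
    · have : v ∉ p.writes ∧ v ∉ p'.writes := by simpa [Cmd.writes] using hv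
      rw [hf'.reg' v (by simpa using this.2), hf.reg' v (by simpa using this.1)]
    · have : p.stores = false ∧ p'.stores = false := by simpa [Cmd.stores] using hp
      rw [hf'.mem' this.2, hf.mem' this.1]
  | ite c p p' ih ih' =>
    intro Q s h
    refine ⟨h.1, fun hc => wp_mono ?_ (ih (h.2.1 hc)), fun hc => wp_mono ?_ (ih' (h.2.2 hc))⟩ <;>
    · rintro s' ⟨h', hf⟩
      refine ⟨h', fun v hv => ?_, fun hp => ?_, (Nat.le_add_right _ _).trans hf.time'⟩
      · have : v ∉ p.writes ∧ v ∉ p'.writes := by simpa [Cmd.writes] using hv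
        exact hf.reg' v (by simp [this.1, this.2])
      · have : p.stores = false ∧ p'.stores = false := by simpa [Cmd.stores] using hp
        exact hf.mem' (by simp [this.1, this.2])
  | loop c p ih =>
    rintro Q s ⟨n, hn⟩
    have key : ∀ (n : ℕ) (s₁ : NS), Frame p s s₁ → loopWp b c (wp b A cost p) Q n s₁ →
        loopWp b c (wp b A cost p) (fun s' => Q s' ∧ Frame p s s') n s₁ := by
      intro n
      induction n with
      | zero => exact fun _ _ h => h
      | succ n ihn =>
        intro s₁ hf h
        refine ⟨h.1, fun hc => wp_mono ?_ (ih (h.2.1 hc)), fun hc => ⟨h.2.2 hc, hf.reg', hf.mem',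
          hf.time'.trans (Nat.le_add_right _ _)⟩⟩
        rintro s₂ ⟨h₂, hf₂⟩
        refine ihn s₂ (hf.trans' ⟨hf₂.reg', hf₂.mem', ?_⟩) h₂
        exact (Nat.le_add_right _ _).trans hf₂.time'
    refine ⟨n, loopWp_mono (f := wp b A cost p) (fun hR _ hs => wp_mono hR hs) ?_ n s
      (key n s ⟨fun _ _ => rfl, fun _ => rfl, le_rfl⟩ hn)⟩
    exact fun s' h => ⟨h.1, h.2.reg', h.2.mem', h.2.time'⟩

/-- Rule for loops. The invariant bounds the clock, and this ensures termination, since every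
test takes time. -/
theorem wp_while {c : Cond} {p : Cmd} {s : NS} (I : NS → Prop) (T : ℕ) (h0 : I s)
    (hT : ∀ s', I s' → s'.time ≤ T)
    (hok : ∀ s', I s' → Frame p s s' → c.ok b s')
    (hI : ∀ s', I s' → Frame p s s' → c.holds b s' → wp b A cost p I (s'.tick c.cost)) :
    wp b A cost (.loop c p)
      (fun s' => ∃ s₁, I s₁ ∧ ¬ c.holds b s₁ ∧ Frame p s s₁ ∧ s' = s₁.tick c.cost) s := by
  have key : ∀ (n : ℕ) (s' : NS), T < s'.time + n → I s' → Frame p s s' →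
      loopWp b c (wp b A cost p)
        (fun s' => ∃ s₁, I s₁ ∧ ¬ c.holds b s₁ ∧ Frame p s s₁ ∧ s' = s₁.tick c.cost) n s' := by
    intro n
    induction n with
    | zero =>
      intro s' h hI
      have := hT s' hI
      omega
    | succ n ih =>
      intro s' h hI' hf
      refine ⟨hok s' hI' hf, fun hc => ?_, fun hc => ⟨s', hI', hc, hf, rfl⟩⟩
      refine wp_mono ?_ (wp_frame (hI s' hI' hf hc))
      rintro s₂ ⟨h₂, hf₂⟩
      have ht := hf₂.time'
      have hcc : 1 ≤ c.cost := by simp [Cond.cost]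
      simp only [NS.tick_time] at ht
      refine ih s₂ (by omega) h₂ (hf.trans' ⟨hf₂.reg', hf₂.mem', ?_⟩)
      omega
  exact ⟨T + 1, key (T + 1) s (by omega) h0 ⟨fun _ _ => rfl, fun _ => rfl, le_rfl⟩⟩

end wp

/-! ### Soundness of the translation to the word RAM -/

section sound

variable {b q σ : ℕ} {A : Transducer q σ} {cost : Fin q → Fin σ → ℕ}

/-- The state `s` describes variables and memory of the machine state `st`. -/
structure Rep (st : State b) (s : NS) : Prop where
  reg : ∀ v : Var, (st.reg v.idx).toNat = s.reg v
  mem : ∀ a, a < 2 ^ b → (st.mem (BitVec.ofNat b a)).toNat = s.mem a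

theorem Rep.setReg_temp {st : State b} {s : NS} (h : Rep st s) {k : ℕ} (hk : 100 ≤ k)
    (v : BitVec b) : Rep (st.setReg k v) s := by
  refine ⟨fun w => ?_, h.mem⟩
  have := w.idx_lt
  have h2 : w.idx ≠ k := by omega
  simp [State.setReg, h2, h.reg]

theorem Rep.setReg {st : State b} {s : NS} (h : Rep st s) (d : Var) {v : BitVec b} {n : ℕ}
    (hv : v.toNat = n) : Rep (st.setReg d.idx v) (s.set d n) := by
  refine ⟨fun w => ?_, h.mem⟩
  by_cases hw : w = d
  · subst hw
    simp [State.setReg, hv]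
  · have h2 : w.idx ≠ d.idx := fun h => hw (Var.idx_injective h)
    simp [State.setReg, h2, hw, h.reg]

theorem Rep.tick {st : State b} {s : NS} (h : Rep st s) (t : ℕ) : Rep st (s.tick t) := ⟨h.1, h.2⟩

/-- The translation of an expression takes time `e.size`, and keeps the registers below its
target. -/
theorem Ex.code_exec (e : Ex) : ∀ (k : ℕ) (st : State b) (s : NS), 100 ≤ k → Rep st s →
    e.ok b s → ∃ st', Exec A cost (e.code k) st st' e.size ∧ Rep st' s ∧
      (st'.reg k).toNat = e.eval b s ∧ ∀ i < k, st'.reg i = st.reg i := by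
  induction e with
  | var v =>
    intro k st s hk h _
    refine ⟨_, .op .or k v.idx v.idx st, h.setReg_temp hk _, ?_, ?_⟩
    · simp [State.setReg, BinOp.apply, Ex.eval, h.reg]
    · intro i hi
      simp [State.setReg, hi.ne]
  | num n =>
    intro k st s hk h hn
    refine ⟨_, .const k n st, h.setReg_temp hk _, ?_, ?_⟩
    · simp only [State.setReg, Function.update_self, BitVec.toNat_ofNat, Ex.eval]
      exact Nat.mod_eq_of_lt hn
    · intro i hi
      simp [State.setReg, hi.ne]
  | bin f e₁ e₂ ih₁ ih₂ =>
    intro k st s hk h hn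
    obtain ⟨st₁, x₁, r₁, v₁, f₁⟩ := ih₁ k st s hk h hn.1
    obtain ⟨st₂, x₂, r₂, v₂, f₂⟩ := ih₂ (k + 1) st₁ s (by omega) r₁ hn.2.1
    have hx := Exec.seq x₁ (.seq x₂ (.op f k k (k + 1) st₂))
    refine ⟨st₂.setReg k (f.apply (st₂.reg k) (st₂.reg (k + 1))), ?_, r₂.setReg_temp hk _, ?_, ?_⟩
    · rw [← add_assoc] at hx
      exact hx
    · have v₁' : (st₂.reg k).toNat = e₁.eval b s := by rw [f₂ k (by omega), v₁]
      have := apply_toNat f (st₂.reg k) (st₂.reg (k + 1)) (by rw [v₁', v₂]; exact hn.2.2)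
      simp [State.setReg, this, v₁', v₂, Ex.eval]
    · intro i hi
      simp [State.setReg, hi.ne, f₂ i (by omega), f₁ i hi]

theorem Cond.code_exec (c : Cond) (st : State b) (s : NS) (h : Rep st s) (hc : c.ok b s) :
    ∃ st' t, Exec A cost c.code st st' t ∧ t + 1 = c.cost ∧ Rep st' s ∧
      (c.test.holds st' ↔ c.holds b s) := by
  obtain ⟨st₁, x₁, r₁, v₁, f₁⟩ := c.left.code_exec (A := A) (cost := cost) 100 st s le_rfl h hc.1
  obtain ⟨st₂, x₂, r₂, v₂, f₂⟩ :=
    c.right.code_exec (A := A) (cost := cost) 101 st₁ s (by omega) r₁ hc.2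
  refine ⟨st₂, _, .seq x₁ x₂, rfl, r₂, ?_⟩
  have v₁' : (st₂.reg 100).toNat = c.left.eval b s := by rw [f₂ 100 (by omega), v₁]
  cases c <;> simp [Cond.test, Test.holds, Cond.holds, v₁', v₂, Cond.left, Cond.right]

/-- Soundness: what `wp` promises holds for the translated program on the word RAM, and the clock
has advanced by exactly the running time. -/
theorem Cmd.code_exec (p : Cmd) : ∀ (Q : NS → Prop) (s : NS) (st : State b), Rep st s →
    wp b A cost p Q s → ∃ st' t s', Exec A cost p.code st st' t ∧ Rep st' s' ∧ Q s' ∧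
      s'.time = s.time + t := by
  induction p with
  | skip => exact fun Q s st h hw => ⟨st, 0, s, .nop st, h, hw, rfl⟩
  | set d e =>
    intro Q s st h hw
    obtain ⟨st₁, x₁, r₁, v₁, -⟩ := e.code_exec (A := A) (cost := cost) 100 st s le_rfl h hw.1
    refine ⟨_, _, _, .seq x₁ (.op .or d.idx 100 100 st₁), (r₁.setReg d ?_).tick _, hw.2, rfl⟩
    simp [BinOp.apply, v₁]
  | ld d e =>
    intro Q s st h hw
    obtain ⟨st₁, x₁, r₁, v₁, -⟩ := e.code_exec (A := A) (cost := cost) 100 st s le_rfl h hw.1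
    have hm : (st₁.mem (st₁.reg 100)).toNat = s.mem (e.eval b s) := by
      rw [← r₁.mem _ hw.2.1, ← v₁, BitVec.ofNat_toNat, BitVec.setWidth_eq]
    exact ⟨_, _, _, .seq x₁ (.load d.idx 100 st₁), (r₁.setReg d hm).tick _,
      hw.2.2 (hm ▸ BitVec.isLt _), rfl⟩
  | st e₁ e₂ =>
    intro Q s st h hw
    obtain ⟨st₁, x₁, r₁, v₁, -⟩ := e₁.code_exec (A := A) (cost := cost) 100 st s le_rfl h hw.1
    obtain ⟨st₂, x₂, r₂, v₂, f₂⟩ :=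
      e₂.code_exec (A := A) (cost := cost) 101 st₁ s (by omega) r₁ hw.2.1
    have v₁' : (st₂.reg 100).toNat = e₁.eval b s := by rw [f₂ 100 (by omega), v₁]
    refine ⟨_, _, _, .seq x₁ (.seq x₂ (.store 100 101 st₂)), ?_, hw.2.2.2, ?_⟩
    · refine ⟨r₂.reg, fun a ha => ?_⟩
      have : (BitVec.ofNat b a = st₂.reg 100) ↔ a = e₁.eval b s := by
        rw [← BitVec.toNat_inj, v₁', BitVec.toNat_ofNat, Nat.mod_eq_of_lt ha]
      by_cases hae : a = e₁.eval b s
      · simp only [State.setMem, NS.tick_mem, NS.put_mem, hae, Function.update_self]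
        rw [← hae, this.2 hae, Function.update_self, v₂]
      · simp only [State.setMem, NS.tick_mem, NS.put_mem]
        rw [Function.update_of_ne hae, Function.update_of_ne (fun h => hae (this.1 h)),
          r₂.mem a ha]
    · simp only [NS.tick_time, NS.put_time]
      omega
  | trans d e i j =>
    rintro Q s st h ⟨v, x, h1, h2, h3, h4, h5⟩
    refine ⟨_, _, _, .transition d.idx e.idx i.idx j.idx st v x ?_ ?_,
      ((h.setReg d ?_).setReg e ?_).tick _, h5, rfl⟩
    · rw [h.reg, h1]
    · rw [h.reg, h2]
    · rw [BitVec.toNat_ofNat, Nat.mod_eq_of_lt h3]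
    · rw [BitVec.toNat_ofNat, Nat.mod_eq_of_lt h4]
  | seq p p' ih ih' =>
    intro Q s st h hw
    obtain ⟨st₁, t₁, s₁, x₁, r₁, w₁, e₁⟩ := ih _ s st h hw
    obtain ⟨st₂, t₂, s₂, x₂, r₂, w₂, e₂⟩ := ih' _ s₁ st₁ r₁ w₁
    exact ⟨_, _, s₂, .seq x₁ x₂, r₂, w₂, by omega⟩
  | ite c p p' ih ih' =>
    intro Q s st h hw
    obtain ⟨st₁, t, x₁, ht, r₁, hh⟩ := c.code_exec (A := A) (cost := cost) st s h hw.1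
    by_cases hc : c.holds b s
    · obtain ⟨st₂, t₂, s₂, x₂, r₂, w₂, e₂⟩ := ih _ _ st₁ (r₁.tick _) (hw.2.1 hc)
      refine ⟨_, _, s₂, .seq x₁ (.branch_true (hh.2 hc) x₂), r₂, w₂, ?_⟩
      simp only [NS.tick_time] at e₂
      omega
    · obtain ⟨st₂, t₂, s₂, x₂, r₂, w₂, e₂⟩ := ih' _ _ st₁ (r₁.tick _) (hw.2.2 hc)
      refine ⟨_, _, s₂, .seq x₁ (.branch_false (fun h => hc (hh.1 h)) x₂), r₂, w₂, ?_⟩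
      simp only [NS.tick_time] at e₂
      omega
  | loop c p ih =>
    rintro Q s st h ⟨n, hw⟩
    -- `Cmd.code` evaluates the operands of the test before the loop and again at the end of its
    -- body. So the time `t'` of this evaluation is counted before the loop of the machine is
    -- entered.
    have key : ∀ (n : ℕ) (s : NS), loopWp b c (wp b A cost p) Q n s → c.ok b s ∧
        ∀ (st : State b), Rep st s → (c.test.holds st ↔ c.holds b s) →
        ∃ st' t s' t', Exec A cost (.loop c.test (.seq p.code c.code)) st st' t ∧ Rep st' s' ∧
          Q s' ∧ t' + 1 = c.cost ∧ s'.time = s.time + t' + t := by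
      intro n
      induction n with
      | zero => exact fun _ h => h.elim
      | succ n ihn =>
        intro s hw
        refine ⟨hw.1, fun st h hh => ?_⟩
        have hcost : c.cost - 1 + 1 = c.cost := by simp [Cond.cost]
        by_cases hc : c.holds b s
        · obtain ⟨st₁, t₁, s₁, x₁, r₁, w₁, e₁⟩ := ih _ _ st (h.tick _) (hw.2.1 hc)
          obtain ⟨hok, hrest⟩ := ihn s₁ w₁
          obtain ⟨st₂, t₂, x₂, ht₂, r₂, hh₂⟩ := c.code_exec (A := A) (cost := cost) st₁ s₁ r₁ hok
          obtain ⟨st₃, t₃, s₃, t', x₃, r₃, w₃, ht', e₃⟩ := hrest st₂ r₂ hh₂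
          refine ⟨_, _, s₃, c.cost - 1, .loop_true (hh.2 hc) (.seq x₁ x₂) x₃, r₃, w₃, hcost, ?_⟩
          simp only [NS.tick_time] at e₁
          omega
        · refine ⟨st, 1, s.tick c.cost, c.cost - 1, .loop_false (fun h => hc (hh.1 h)), h.tick _,
            hw.2.2 hc, hcost, ?_⟩
          simp only [NS.tick_time]
          omega
    obtain ⟨hok, hrest⟩ := key n s hw
    obtain ⟨st₂, t₂, x₂, ht₂, r₂, hh₂⟩ := c.code_exec (A := A) (cost := cost) st s h hok
    obtain ⟨st₃, t₃, s₃, t', x₃, r₃, w₃, ht', e₃⟩ := hrest st₂ r₂ hh₂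
    exact ⟨_, _, s₃, .seq x₂ x₃, r₃, w₃, by omega⟩

/-- The description of a machine state, with the clock set to zero. -/
def absState (st : State b) : NS :=
  ⟨fun v => (st.reg v.idx).toNat, fun a => (st.mem (BitVec.ofNat b a)).toNat, 0⟩

theorem rep_absState (st : State b) : Rep st (absState st) := ⟨fun _ => rfl, fun _ _ => rfl⟩

end sound

/-! ### Rules for symbolic execution -/

section rules

variable {b q σ : ℕ} {A : Transducer q σ} {cost : Fin q → Fin σ → ℕ} {s : NS} {Q : NS → Prop}

@[simp] theorem eval_var (v : Var) : (Ex.var v).eval b s = s.reg v := rfl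
@[simp] theorem eval_num (n : ℕ) : (Ex.num n).eval b s = n := rfl
@[simp] theorem eval_ofNat (n : ℕ) : (no_index (OfNat.ofNat n) : Ex).eval b s = n := rfl
@[simp] theorem eval_add (e e' : Ex) : (e + e').eval b s = e.eval b s + e'.eval b s := rfl
@[simp] theorem eval_sub (e e' : Ex) : (e - e').eval b s = e.eval b s - e'.eval b s := rfl
@[simp] theorem eval_mul (e e' : Ex) : (e * e').eval b s = e.eval b s * e'.eval b s := rfl
@[simp] theorem eval_div (e e' : Ex) : (e / e').eval b s = e.eval b s / e'.eval b s := rfl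
@[simp] theorem eval_mod (e e' : Ex) : (e % e').eval b s = e.eval b s % e'.eval b s := rfl
@[simp] theorem eval_shl (e e' : Ex) :
    (e ≪≪ e').eval b s = e.eval b s * 2 ^ e'.eval b s % 2 ^ b := rfl
@[simp] theorem eval_shr (e e' : Ex) : (e ≫≫ e').eval b s = e.eval b s / 2 ^ e'.eval b s := rfl

@[simp] theorem ok_var (v : Var) : (Ex.var v).ok b s := trivial
@[simp] theorem ok_num (n : ℕ) : (Ex.num n).ok b s ↔ n < 2 ^ b := Iff.rfl
@[simp] theorem ok_ofNat (n : ℕ) : (no_index (OfNat.ofNat n) : Ex).ok b s ↔ n < 2 ^ b := Iff.rfl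
@[simp] theorem ok_add (e e' : Ex) :
    (e + e').ok b s ↔ e.ok b s ∧ e'.ok b s ∧ e.eval b s + e'.eval b s < 2 ^ b := Iff.rfl
@[simp] theorem ok_sub (e e' : Ex) :
    (e - e').ok b s ↔ e.ok b s ∧ e'.ok b s ∧ e'.eval b s ≤ e.eval b s := Iff.rfl
@[simp] theorem ok_mul (e e' : Ex) :
    (e * e').ok b s ↔ e.ok b s ∧ e'.ok b s ∧ e.eval b s * e'.eval b s < 2 ^ b := Iff.rfl
@[simp] theorem ok_div (e e' : Ex) : (e / e').ok b s ↔ e.ok b s ∧ e'.ok b s :=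
  ⟨fun h => ⟨h.1, h.2.1⟩, fun h => ⟨h.1, h.2, trivial⟩⟩
@[simp] theorem ok_mod (e e' : Ex) : (e % e').ok b s ↔ e.ok b s ∧ e'.ok b s :=
  ⟨fun h => ⟨h.1, h.2.1⟩, fun h => ⟨h.1, h.2, trivial⟩⟩
@[simp] theorem ok_shl (e e' : Ex) : (e ≪≪ e').ok b s ↔ e.ok b s ∧ e'.ok b s :=
  ⟨fun h => ⟨h.1, h.2.1⟩, fun h => ⟨h.1, h.2, trivial⟩⟩
@[simp] theorem ok_shr (e e' : Ex) : (e ≫≫ e').ok b s ↔ e.ok b s ∧ e'.ok b s :=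
  ⟨fun h => ⟨h.1, h.2.1⟩, fun h => ⟨h.1, h.2, trivial⟩⟩

@[simp] theorem size_var (v : Var) : (Ex.var v).size = 1 := rfl
@[simp] theorem size_num (n : ℕ) : (Ex.num n).size = 1 := rfl
@[simp] theorem size_ofNat (n : ℕ) : (no_index (OfNat.ofNat n) : Ex).size = 1 := rfl
@[simp] theorem size_add (e e' : Ex) : (e + e').size = e.size + e'.size + 1 := rfl
@[simp] theorem size_sub (e e' : Ex) : (e - e').size = e.size + e'.size + 1 := rfl
@[simp] theorem size_mul (e e' : Ex) : (e * e').size = e.size + e'.size + 1 := rfl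
@[simp] theorem size_div (e e' : Ex) : (e / e').size = e.size + e'.size + 1 := rfl
@[simp] theorem size_mod (e e' : Ex) : (e % e').size = e.size + e'.size + 1 := rfl
@[simp] theorem size_shl (e e' : Ex) : (e ≪≪ e').size = e.size + e'.size + 1 := rfl
@[simp] theorem size_shr (e e' : Ex) : (e ≫≫ e').size = e.size + e'.size + 1 := rfl

@[simp] theorem holds_lt (e e' : Ex) : (Cond.lt e e').holds b s ↔ e.eval b s < e'.eval b s :=
  Iff.rfl
@[simp] theorem holds_le (e e' : Ex) : (Cond.le e e').holds b s ↔ e.eval b s ≤ e'.eval b s :=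
  Iff.rfl
@[simp] theorem holds_eq (e e' : Ex) : (Cond.eq e e').holds b s ↔ e.eval b s = e'.eval b s :=
  Iff.rfl
@[simp] theorem holds_ne (e e' : Ex) : (Cond.ne e e').holds b s ↔ e.eval b s ≠ e'.eval b s :=
  Iff.rfl
@[simp] theorem cond_ok_lt (e e' : Ex) : (Cond.lt e e').ok b s ↔ e.ok b s ∧ e'.ok b s := Iff.rfl
@[simp] theorem cond_ok_le (e e' : Ex) : (Cond.le e e').ok b s ↔ e.ok b s ∧ e'.ok b s := Iff.rfl
@[simp] theorem cond_ok_eq (e e' : Ex) : (Cond.eq e e').ok b s ↔ e.ok b s ∧ e'.ok b s := Iff.rfl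
@[simp] theorem cond_ok_ne (e e' : Ex) : (Cond.ne e e').ok b s ↔ e.ok b s ∧ e'.ok b s := Iff.rfl
@[simp] theorem cond_cost_lt (e e' : Ex) : (Cond.lt e e').cost = e.size + e'.size + 1 := rfl
@[simp] theorem cond_cost_le (e e' : Ex) : (Cond.le e e').cost = e.size + e'.size + 1 := rfl
@[simp] theorem cond_cost_eq (e e' : Ex) : (Cond.eq e e').cost = e.size + e'.size + 1 := rfl
@[simp] theorem cond_cost_ne (e e' : Ex) : (Cond.ne e e').cost = e.size + e'.size + 1 := rfl

@[simp] theorem wp_skip : wp b A cost .skip Q s ↔ Q s := Iff.rfl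
@[simp] theorem wp_set (d : Var) (e : Ex) : wp b A cost (d ≔ e) Q s ↔
    e.ok b s ∧ Q ((s.set d (e.eval b s)).tick (e.size + 1)) := Iff.rfl
@[simp] theorem wp_ld (d : Var) (e : Ex) : wp b A cost (.ld d e) Q s ↔
    e.ok b s ∧ e.eval b s < 2 ^ b ∧ (s.mem (e.eval b s) < 2 ^ b →
      Q ((s.set d (s.mem (e.eval b s))).tick (e.size + 1))) := Iff.rfl
@[simp] theorem wp_st (e e' : Ex) : wp b A cost (.st e e') Q s ↔
    e.ok b s ∧ e'.ok b s ∧ e.eval b s < 2 ^ b ∧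
      Q ((s.put (e.eval b s) (e'.eval b s)).tick (e.size + e'.size + 1)) := Iff.rfl
@[simp] theorem wp_seq (p p' : Cmd) :
    wp b A cost (p ;; p') Q = wp b A cost p (wp b A cost p' Q) := rfl
@[simp] theorem wp_ite (c : Cond) (p p' : Cmd) : wp b A cost (.ite c p p') Q s ↔
    c.ok b s ∧ (c.holds b s → wp b A cost p Q (s.tick c.cost)) ∧
      (¬ c.holds b s → wp b A cost p' Q (s.tick c.cost)) := Iff.rfl

/-- Use of a specification `h` of a program within a larger one. -/
theorem wp_use {p : Cmd} {R : NS → Prop} (h : wp b A cost p R s)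
    (hQ : ∀ s', R s' → Frame p s s' → Q s') : wp b A cost p Q s :=
  wp_mono (fun s' h => hQ s' h.1 h.2) (wp_frame h)

theorem Frame.reg {p : Cmd} {s s' : NS} (h : Frame p s s') (v : Var)
    (hv : p.writes.contains v = false := by decide) : s'.reg v = s.reg v := h.reg' v hv

theorem Frame.mem {p : Cmd} {s s' : NS} (h : Frame p s s')
    (hp : p.stores = false := by decide) : s'.mem = s.mem := h.mem' hp

end rules

/-! ### Bit strings as numbers -/

/-- The number with a given binary representation, most significant bit first. -/
def bv (l : List Bool) : ℕ := l.foldl (fun a c => 2 * a + c.toNat) 0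

theorem foldl_bv (l : List Bool) (a : ℕ) :
    l.foldl (fun a c => 2 * a + c.toNat) a = a * 2 ^ l.length + bv l := by
  induction l generalizing a with
  | nil => simp [bv]
  | cons c l ih =>
    rw [bv, List.foldl_cons, List.foldl_cons, ih, ih (2 * 0 + c.toNat), List.length_cons, pow_succ]
    ring

@[simp] theorem bv_nil : bv [] = 0 := rfl

theorem bv_append (l l' : List Bool) : bv (l ++ l') = bv l * 2 ^ l'.length + bv l' := by
  conv_lhs => rw [bv, List.foldl_append, foldl_bv]
  rfl

theorem bv_cons (c : Bool) (l : List Bool) : bv (c :: l) = c.toNat * 2 ^ l.length + bv l := by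
  rw [← List.singleton_append, bv_append]
  simp [bv]

theorem bv_lt (l : List Bool) : bv l < 2 ^ l.length := by
  induction l with
  | nil => simp
  | cons c l ih =>
    rw [bv_cons, List.length_cons, pow_succ]
    have : c.toNat ≤ 1 := by cases c <;> simp
    nlinarith

theorem bv_replicate_false (k : ℕ) : bv (List.replicate k false) = 0 := by
  induction k with
  | zero => rfl
  | succ k ih => rw [List.replicate_succ, bv_cons, ih]; simp

theorem bv_bits_reverse (x : ℕ) : bv (Nat.bits x).reverse = x := by
  induction x using Nat.binaryRec' with
  | zero => simp
  | bit c n h ih =>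
    rw [Nat.bits_append_bit n c h, List.reverse_cons, bv_append, ih]
    cases c <;> simp [bv, Nat.bit] <;> ring

theorem testBit_bv (l : List Bool) (i : ℕ) (hi : i < l.length) :
    (bv l).testBit (l.length - 1 - i) = l[i] := by
  induction l generalizing i with
  | nil => simp at hi
  | cons c l ih =>
    rw [bv_cons]
    cases i with
    | zero =>
      have := bv_lt l
      cases c
      · simp [Nat.testBit_lt_two_pow this]
      · simp only [List.length_cons, Nat.add_sub_cancel, Nat.sub_zero, Bool.toNat_true, one_mul,
          List.getElem_cons_zero]
        rw [Nat.testBit_two_pow_add_eq]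
        simp [Nat.testBit_lt_two_pow this]
    | succ i =>
      simp only [List.length_cons] at hi
      have h1 : l.length + 1 - 1 - (i + 1) = l.length - 1 - i := by omega
      rw [List.length_cons, h1, List.getElem_cons_succ, ← ih i (by omega)]
      cases c
      · simp
      · simp only [Bool.toNat_true, one_mul]
        rw [Nat.testBit_two_pow_add_gt (by omega)]

/-- At zero, both sides are zero. -/
theorem log_eq_size_sub_one (x : ℕ) : Nat.log 2 x = Nat.size x - 1 := by
  rcases Nat.eq_zero_or_pos x with rfl | hx
  · simp
  have h1 : 0 < Nat.size x := Nat.size_pos.2 hx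
  refine (Nat.log_eq_iff (Or.inr ⟨by norm_num, hx.ne'⟩)).2 ⟨Nat.lt_size.1 (by omega), ?_⟩
  rw [Nat.sub_add_cancel h1]
  exact Nat.lt_size_self x

theorem size_div_pow {y L : ℕ} (h : 2 ^ L ≤ y) : Nat.size y = Nat.size (y / 2 ^ L) + L := by
  apply le_antisymm
  · rw [Nat.size_le, pow_add, ← Nat.div_lt_iff_lt_mul (Nat.two_pow_pos L)]
    exact Nat.lt_size_self _
  · have h1 : 0 < Nat.size (y / 2 ^ L) := Nat.size_pos.2 (Nat.div_pos h (Nat.two_pow_pos L))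
    have h2 : Nat.size (y / 2 ^ L) - 1 + L < Nat.size y := by
      rw [Nat.lt_size, pow_add, ← Nat.le_div_iff_mul_le (Nat.two_pow_pos L)]
      exact Nat.lt_size.1 (by omega)
    omega

theorem two_pow_size_le {x : ℕ} (hx : 0 < x) : 2 ^ (Nat.size x - 1) ≤ x :=
  Nat.lt_size.1 (by have := Nat.size_pos.2 hx; omega)

theorem eliasGamma_eq (x : ℕ) :
    eliasGamma x = List.replicate (Nat.size x - 1) false ++ (Nat.bits x).reverse := by
  rw [eliasGamma, log_eq_size_sub_one]

theorem length_eliasGamma (x : ℕ) : (eliasGamma x).length = 2 * Nat.size x - 1 := by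
  rw [eliasGamma_eq, List.length_append, List.length_replicate, List.length_reverse,
    Nat.size_eq_bits_len]
  omega

theorem bv_eliasGamma (x : ℕ) : bv (eliasGamma x) = x := by
  rw [eliasGamma_eq, bv_append, bv_replicate_false, bv_bits_reverse]
  simp

@[simp] theorem zeroRunToken_zero : zeroRunToken 0 = [] := rfl

theorem zeroRunToken_pos {z : ℕ} (hz : z ≠ 0) : zeroRunToken z = false :: eliasGamma z := by
  simp [zeroRunToken, hz]

@[simp] theorem length_zeroRunToken (z : ℕ) : (zeroRunToken z).length = 2 * Nat.size z := by
  by_cases hz : z = 0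
  · simp [hz]
  · have := Nat.size_pos.2 (Nat.pos_of_ne_zero hz)
    rw [zeroRunToken_pos hz, List.length_cons, length_eliasGamma]
    omega

theorem length_literalToken {u : ℕ} (hu : 0 < u) : (literalToken u).length = 2 * Nat.size u := by
  have := Nat.size_pos.2 hu
  rw [literalToken, List.length_cons, length_eliasGamma]
  omega

theorem bv_zeroRunToken (z : ℕ) : bv (zeroRunToken z) = z := by
  by_cases hz : z = 0
  · simp [hz]
  · rw [zeroRunToken_pos hz, bv_cons, bv_eliasGamma]; simp

theorem bv_literalToken (u : ℕ) : bv (literalToken u) = 2 ^ (2 * Nat.size u - 1) + u := by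
  rw [literalToken, bv_cons, bv_eliasGamma, length_eliasGamma]; simp

/-! ### Token sequences -/

/-- A token: `(true, u)` is a literal `u > 0`, and `(false, x)` a run of `x > 0` zeros. -/
abbrev Tok := Bool × ℕ

/-- The encoding of a token. -/
def Tok.bits (t : Tok) : List Bool := t.1 :: eliasGamma t.2

/-- The string that a token stands for. -/
def Tok.expand (t : Tok) : List ℕ := if t.1 then [t.2] else List.replicate t.2 0

/-- The encoding of a sequence of tokens. -/
def tbits (ts : List Tok) : List Bool := ts.flatMap Tok.bits

/-- The string that a sequence of tokens stands for. -/
def texpand (ts : List Tok) : List ℕ := ts.flatMap Tok.expand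

@[simp] theorem tbits_nil : tbits [] = [] := rfl
@[simp] theorem tbits_cons (t : Tok) (ts : List Tok) : tbits (t :: ts) = t.bits ++ tbits ts := rfl
@[simp] theorem tbits_append (ts ts' : List Tok) : tbits (ts ++ ts') = tbits ts ++ tbits ts' := by
  simp [tbits]
@[simp] theorem texpand_nil : texpand [] = [] := rfl
@[simp] theorem texpand_cons (t : Tok) (ts : List Tok) :
    texpand (t :: ts) = t.expand ++ texpand ts := rfl
@[simp] theorem texpand_append (ts ts' : List Tok) :
    texpand (ts ++ ts') = texpand ts ++ texpand ts' := by
  simp [texpand]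

theorem Tok.length_bits {t : Tok} (ht : 0 < t.2) : t.bits.length = 2 * Nat.size t.2 := by
  have := Nat.size_pos.2 ht
  rw [Tok.bits, List.length_cons, length_eliasGamma]
  omega

theorem exists_tokens_aux (l : List ℕ) : ∀ z, ∃ ts : List Tok, (∀ t ∈ ts, 0 < t.2) ∧
    tbits ts = sparseEncodingAux z l ∧ texpand ts = List.replicate z 0 ++ l := by
  have h0 : ∀ z, ∃ ts : List Tok, (∀ t ∈ ts, 0 < t.2) ∧ tbits ts = zeroRunToken z ∧
      texpand ts = List.replicate z 0 := by
    intro z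
    by_cases hz : z = 0
    · exact ⟨[], by simp, by simp [hz], by simp [hz]⟩
    · exact ⟨[(false, z)], by simpa using Nat.pos_of_ne_zero hz,
        by simp [zeroRunToken_pos hz, Tok.bits], by simp [Tok.expand]⟩
  induction l with
  | nil => intro z; simpa [sparseEncodingAux] using h0 z
  | cons u l ih =>
    intro z
    cases u with
    | zero =>
      obtain ⟨ts, h1, h2, h3⟩ := ih (z + 1)
      refine ⟨ts, h1, by rw [h2, sparseEncodingAux], ?_⟩
      rw [h3, List.replicate_succ', List.append_assoc, List.singleton_append]
    | succ u =>
      obtain ⟨ts, h1, h2, h3⟩ := ih 0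
      obtain ⟨ts', h1', h2', h3'⟩ := h0 z
      refine ⟨ts' ++ (true, u + 1) :: ts, ?_, ?_, ?_⟩
      · intro t ht
        simp only [List.mem_append, List.mem_cons] at ht
        rcases ht with ht | rfl | ht
        · exact h1' t ht
        · simp
        · exact h1 t ht
      · simp [sparseEncodingAux, h2, h2', Tok.bits, literalToken]
      · simp [h3, h3', Tok.expand]

/-- Every sparse encoding is a sequence of tokens. -/
theorem exists_tokens (l : List ℕ) : ∃ ts : List Tok, (∀ t ∈ ts, 0 < t.2) ∧
    tbits ts = sparseEncoding l ∧ texpand ts = l := by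
  simpa [sparseEncoding] using exists_tokens_aux l 0

/-! ### The pending output -/

/-- Zeros at the front only extend the pending run. -/
theorem sea_zeros (z k : ℕ) (l : List ℕ) :
    sparseEncodingAux z (List.replicate k 0 ++ l) = sparseEncodingAux (z + k) l := by
  induction k generalizing z with
  | zero => simp
  | succ k ih =>
    rw [List.replicate_succ, List.cons_append, sparseEncodingAux, ih]
    congr 1
    omega

theorem sea_pos (z : ℕ) {y : ℕ} (hy : y ≠ 0) (l : List ℕ) :
    sparseEncodingAux z (y :: l) = zeroRunToken z ++ literalToken y ++ sparseEncodingAux 0 l := by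
  obtain ⟨u, rfl⟩ := Nat.exists_eq_succ_of_ne_zero hy
  rfl

/-- Summary of an output string: if `wd` is empty, then the string consists of `lead + tz` zeros.
Otherwise `lead` zeros end the pending run, `wd` is the encoding of what follows, up to the last
non-zero symbol, and `tz` zeros remain pending. -/
structure Rec where
  lead : ℕ
  wd : List Bool
  tz : ℕ

namespace Rec

/-- The summary of the empty string. -/
def empty : Rec := ⟨0, [], 0⟩

/-- The summary after one more symbol. -/
def emit (r : Rec) (y : ℕ) : Rec :=
  if y = 0 then ⟨r.lead, r.wd, r.tz + 1⟩
  else if r.wd = [] then ⟨r.lead + r.tz, literalToken y, 0⟩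
  else ⟨r.lead, r.wd ++ (zeroRunToken r.tz ++ literalToken y), 0⟩

/-- The bits that an encoder with `z` pending zeros writes for the summarized string. -/
def out (r : Rec) (z : ℕ) : List Bool :=
  if r.wd = [] then [] else zeroRunToken (z + r.lead) ++ r.wd

/-- The number of zeros that are pending afterwards. -/
def pend (r : Rec) (z : ℕ) : ℕ := if r.wd = [] then z + r.lead + r.tz else r.tz

/-- `r` summarizes the string `l`. -/
def Of (r : Rec) (l : List ℕ) : Prop :=
  ∀ z rest, sparseEncodingAux z (l ++ rest) = r.out z ++ sparseEncodingAux (r.pend z) rest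

theorem literalToken_ne_nil (y : ℕ) : literalToken y ≠ [] := by simp [literalToken]

theorem of_empty : empty.Of [] := fun z rest => by simp [empty, out, pend]

theorem Of.emit {r : Rec} {l : List ℕ} (h : r.Of l) (y : ℕ) : (r.emit y).Of (l ++ [y]) := by
  intro z rest
  rw [List.append_assoc, h z, Rec.emit]
  by_cases hy : y = 0
  · subst hy
    by_cases hW : r.wd = [] <;> simp [out, pend, hW, sparseEncodingAux, add_assoc]
  · by_cases hW : r.wd = []
    · simp [out, pend, hW, hy, sea_pos _ hy, literalToken_ne_nil, add_assoc]
    · simp [out, pend, hW, hy, sea_pos _ hy]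

theorem of_zeros (k : ℕ) : (⟨0, [], k⟩ : Rec).Of (List.replicate k 0) := by
  intro z rest
  simp [sea_zeros, out, pend]

end Rec

theorem zeroRunToken_length_mono {z z' : ℕ} (h : z ≤ z') :
    (zeroRunToken z).length ≤ (zeroRunToken z').length := by
  simp only [length_zeroRunToken]
  have := Nat.size_le_size h
  omega

theorem zeroRunToken_le_sea (z : ℕ) (l : List ℕ) :
    (zeroRunToken z).length ≤ (sparseEncodingAux z l).length := by
  induction l generalizing z with
  | nil => simp [sparseEncodingAux]
  | cons y l ih =>
    cases y with
    | zero =>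
      rw [sparseEncodingAux]
      exact (zeroRunToken_length_mono (by omega)).trans (ih (z + 1))
    | succ y => simp only [sparseEncodingAux, List.length_append]; omega

/-- An encoding with `k` bits stands for fewer than `2 ^ k` symbols. -/
theorem lt_two_pow_length_sea (z : ℕ) (l : List ℕ) :
    z + l.length < 2 ^ (sparseEncodingAux z l).length := by
  have h0 : ∀ z, z < 2 ^ (zeroRunToken z).length := by
    intro z
    rw [length_zeroRunToken]
    exact (Nat.lt_size_self z).trans_le (Nat.pow_le_pow_right (by norm_num) (by omega))
  induction l generalizing z with
  | nil => simpa [sparseEncodingAux] using h0 z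
  | cons y l ih =>
    cases y with
    | zero =>
      rw [sparseEncodingAux]
      have := ih (z + 1)
      simp only [List.length_cons]
      omega
    | succ y =>
      have h1 := ih 0
      have h2 := h0 z
      have h3 : 2 ≤ (literalToken (y + 1)).length := by
        rw [length_literalToken (Nat.succ_pos y)]
        have := Nat.size_pos.2 (Nat.succ_pos y)
        omega
      have h4 : 2 ^ 2 ≤ 2 ^ (literalToken (y + 1)).length := Nat.pow_le_pow_right (by norm_num) h3
      simp only [sparseEncodingAux, List.length_append, List.length_cons, pow_add]
      have h5 := Nat.mul_le_mul_right (2 ^ (zeroRunToken z).length) h4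
      have h6 : (z + 1) * (l.length + 1) ≤
          2 ^ (zeroRunToken z).length * 2 ^ (sparseEncodingAux 0 l).length :=
        Nat.mul_le_mul (by omega) (by omega)
      nlinarith [Nat.zero_le (z * l.length), Nat.two_pow_pos (sparseEncodingAux 0 l).length,
        Nat.mul_le_mul_right (2 ^ (sparseEncodingAux 0 l).length) h5]

/-- Bound on the length of an encoding, if all symbols are less than `2 ^ m`. -/
theorem length_sea_le (m : ℕ) (l : List ℕ) (hl : ∀ y ∈ l, y < 2 ^ m) (z : ℕ) :
    (sparseEncodingAux z l).length ≤ 2 * Nat.size z + l.length * (2 * m + 2) := by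
  induction l generalizing z with
  | nil => simp [sparseEncodingAux]
  | cons y l ih =>
    have ih' := ih (fun y hy => hl y (by simp [hy]))
    cases y with
    | zero =>
      rw [sparseEncodingAux]
      have h1 : Nat.size (z + 1) ≤ Nat.size z + 1 := by
        rw [Nat.size_le, pow_succ]
        have := Nat.lt_size_self z
        omega
      have := ih' (z + 1)
      simp only [List.length_cons, add_mul]
      omega
    | succ y =>
      have h1 : Nat.size (Nat.succ y) ≤ m := Nat.size_le.2 (hl (y + 1) (by simp))
      have := ih' 0
      simp only [sparseEncodingAux, List.length_append, length_zeroRunToken,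
        length_literalToken (Nat.succ_pos y), List.length_cons, add_mul]
      simp at this
      omega

open Var

section

variable {b q σ : ℕ} {A : Transducer q σ} {cost : Fin q → Fin σ → ℕ} {L MB : ℕ}

/-! ### Bit lengths, tokens, and the output stream -/

/-- Bounds on word length `b`, block length `L` and the address `MB` of the bit length table. -/
structure Bnd (b L MB : ℕ) : Prop where
  L1 : 1 ≤ L
  Lb : 8 * L + 8 ≤ b
  MBb : MB + 2 ^ L < 2 ^ b
  bb : 8 * b < 2 ^ b

/-- The constants of the programs are in place. -/
structure Env (b L MB : ℕ) (s : NS) : Prop where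
  hB : s.reg vB = b
  hL : s.reg vL = L
  hP : s.reg vP = 2 ^ L
  hMB : s.reg vMB = MB
  hM : ∀ v < 2 ^ L, s.mem (MB + v) = Nat.size v

theorem Env.frame {b L MB : ℕ} {s s' : NS} (h : Env b L MB s) (h1 : s'.reg vB = s.reg vB)
    (h2 : s'.reg vL = s.reg vL) (h3 : s'.reg vP = s.reg vP) (h4 : s'.reg vMB = s.reg vMB)
    (h5 : ∀ v < 2 ^ L, s'.mem (MB + v) = s.mem (MB + v)) : Env b L MB s' :=
  ⟨h1 ▸ h.hB, h2 ▸ h.hL, h3 ▸ h.hP, h4 ▸ h.hMB, fun v hv => (h5 v hv).trans (h.hM v hv)⟩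

/-- `vSz := ` bit length of `vSy`. -/
def sizeCode : Cmd :=
  vSz ≔ 0 ;;
  .loop (.le vP vSy) (vSy ≔ vSy ≫≫ vL ;; vSz ≔ vSz + vL) ;;
  .ld vT0 (vMB + vSy) ;;
  vSz ≔ vSz + vT0

/-- The bit length of a word is computed by reducing it by `L` bits at a time, and then looking it
up. Times are multiplied by `L` in the specifications, so as to avoid divisions. -/
theorem size_spec {s : NS} {y : ℕ} (hb : Bnd b L MB) (he : Env b L MB s) (hy : s.reg vSy = y)
    (hyb : Nat.size y ≤ b) :
    wp b A cost sizeCode (fun s' => s'.reg vSz = Nat.size y ∧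
      L * s'.time ≤ L * s.time + 20 * (L + Nat.size y)) s := by
  obtain ⟨hB, hL, hP, hMB, hM⟩ := he
  obtain ⟨hL1, hLb, hMBb, hbb⟩ := hb
  unfold sizeCode
  simp only [wp_seq]
  refine ⟨by simp, ?_⟩
  refine wp_use (wp_while (fun s' => Nat.size y = s'.reg vSz + Nat.size (s'.reg vSy) ∧
      L * s'.time ≤ L * s.time + 2 * L + 12 * s'.reg vSz)
      (L * s.time + 2 * L + 12 * Nat.size y) ?_ ?_ ?_ ?_) ?_
  · simp [hy]
    rw [Nat.mul_add]; omega
  · rintro s' ⟨h1, h2⟩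
    have := Nat.le_mul_of_pos_left s'.time hL1
    omega
  · simp
  · rintro s' ⟨h1, h2⟩ hf hc
    simp only [holds_le, eval_var] at hc
    have e1 := hf.reg vP
    have e2 := hf.reg vL
    simp only [NS.tick_reg, NS.set_reg, reduceCtorEq, if_false, hP, hL] at e1 e2
    rw [e1] at hc
    have h3 := size_div_pow hc
    simp [e2]
    refine ⟨by omega, by omega, ?_⟩
    simp only [Nat.mul_add]
    omega
  · rintro _ ⟨s', ⟨h1, h2⟩, hc, hf, rfl⟩ -
    have e1 := hf.reg vP
    have e2 := hf.reg vMB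
    have e3 := hf.mem
    simp only [NS.tick_reg, NS.set_reg, reduceCtorEq, if_false, hP, hMB, holds_le, eval_var,
      NS.tick_mem, NS.set_mem] at e1 e2 e3 hc
    rw [e1] at hc
    have h4 := hM (s'.reg vSy) (by omega)
    simp [e2, e3, h4]
    refine ⟨by omega, fun _ => ⟨by omega, by omega, ?_⟩⟩
    simp only [Nat.mul_add]
    omega

/-- The summary `r` is stored in the variables. -/
structure HasRec (r : Rec) (s : NS) : Prop where
  lead : s.reg vLead = r.lead
  mv : s.reg vMv = bv r.wd
  ml : s.reg vMl = r.wd.length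
  tz : s.reg vTz = r.tz

/-- Append the output symbol `vY` to the summary. -/
def emitCode : Cmd :=
  .ite (.eq vY 0) (vTz ≔ vTz + 1)
  (.ite (.eq vMl 0) (vLead ≔ vLead + vTz ;; vTz ≔ 0) .skip ;;
    vSy ≔ vTz ;; sizeCode ;;
    vMv ≔ (vMv ≪≪ (vSz + vSz)) + vTz ;; vMl ≔ vMl + (vSz + vSz) ;;
    vSy ≔ vY ;; sizeCode ;;
    vMv ≔ (vMv ≪≪ (vSz + vSz)) + ((1 ≪≪ (vSz + vSz - 1)) + vY) ;; vMl ≔ vMl + (vSz + vSz) ;;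
    vTz ≔ 0)

theorem push_lt {l : List Bool} {m b x : ℕ} (h : l.length + m ≤ b) (hx : x < 2 ^ m) :
    bv l * 2 ^ m % 2 ^ b = bv l * 2 ^ m ∧ bv l * 2 ^ m + x < 2 ^ b := by
  have h1 := bv_lt l
  have h2 : 2 ^ l.length * 2 ^ m ≤ 2 ^ b := by
    rw [← pow_add]; exact Nat.pow_le_pow_right (by norm_num) h
  have h3 : (bv l + 1) * 2 ^ m ≤ 2 ^ l.length * 2 ^ m := Nat.mul_le_mul_right _ h1
  rw [add_mul, one_mul] at h3
  exact ⟨Nat.mod_eq_of_lt (by omega), by omega⟩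

/-- The bound on the length ensures that the bits of the summary still fit into a word. -/
theorem emit_spec {s : NS} {r : Rec} {y : ℕ} (hb : Bnd b L MB) (he : Env b L MB s)
    (hr : HasRec r s) (hy : s.reg vY = y)
    (hlen : r.wd.length + 2 * Nat.size r.tz + 2 * Nat.size y ≤ b)
    (hlt : r.lead + r.tz + 1 < 2 ^ b) :
    wp b A cost emitCode (fun s' => HasRec (r.emit y) s' ∧
      L * s'.time ≤ L * s.time + 200 * (L + Nat.size r.tz + Nat.size y)) s := by
  have hbd := hb
  obtain ⟨hL1, hLb, hMBb, hbb⟩ := hb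
  obtain ⟨r1, r2, r3, r4⟩ := hr
  unfold emitCode
  rw [wp_ite]
  refine ⟨by simp, fun h0 => ?_, fun h0 => ?_⟩
  · simp only [holds_eq, eval_var, eval_ofNat, hy] at h0
    simp [r4]
    refine ⟨by omega, ⟨?_, ?_, ?_, ?_⟩, ?_⟩ <;> simp [Rec.emit, h0, r1, r2, r3]
    simp only [Nat.mul_add]
    omega
  simp only [holds_eq, eval_var, eval_ofNat, hy] at h0
  -- Before the first non-zero symbol, all zeros are at the front.
  obtain ⟨lead, tz, hlt1, hwd, hem⟩ : ∃ lead tz, (tz ≤ r.tz ∧ lead + tz = r.lead + r.tz) ∧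
      ((lead, tz) = if r.wd = [] then (r.lead + r.tz, 0) else (r.lead, r.tz)) ∧
      r.emit y = ⟨lead, r.wd ++ (zeroRunToken tz ++ literalToken y), 0⟩ := by
    by_cases hW : r.wd = []
    · exact ⟨_, _, ⟨by omega, by omega⟩, (if_pos hW).symm, by simp [Rec.emit, h0, hW]⟩
    · exact ⟨_, _, ⟨le_rfl, rfl⟩, (if_neg hW).symm, by simp [Rec.emit, h0, hW]⟩
  rw [wp_seq]
  refine wp_use (R := fun s' => s'.reg vLead = lead ∧ s'.reg vTz = tz ∧
    s'.time ≤ s.time + 20) ?_ ?_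
  · by_cases hW : r.wd = []
    · simp [hW] at hwd
      simp [r3, hW, r4, r1, hwd]
      omega
    · simp [hW] at hwd
      simp [r3, hW, r4, r1, hwd]
  rintro s₁ ⟨a1, a2, a3⟩ hf
  have f1 := hf.reg vY
  have f2 := hf.reg vMv
  have f3 := hf.reg vMl
  have he1 : Env b L MB ((s₁.set vSy tz).tick 2) :=
    he.frame (hf.reg vB) (hf.reg vL) (hf.reg vP) (hf.reg vMB) (fun v _ => by simp [hf.mem])
  have hsz : Nat.size tz ≤ Nat.size r.tz := Nat.size_le_size hlt1.1
  have hsy := Nat.size_pos.2 (Nat.pos_of_ne_zero h0)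
  simp only [NS.tick_reg, hy, r2, r3] at f1 f2 f3
  simp [a2]
  refine wp_use (size_spec hbd he1 (y := tz) (by simp) (by omega)) ?_
  rintro s₂ ⟨b1, b2⟩ hf₂
  have g1 := hf₂.reg vY
  have g2 := hf₂.reg vMv
  have g3 := hf₂.reg vMl
  have g4 := hf₂.reg vTz
  have g5 := hf₂.reg vLead
  simp [f1, f2, f3, a1, a2] at g1 g2 g3 g4 g5
  have p1 := push_lt (l := r.wd) (m := tz.size + tz.size) (b := b) (x := tz) (by omega)
    ((Nat.lt_size_self tz).trans_le (Nat.pow_le_pow_right (by norm_num) (by omega)))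
  have e1 : bv r.wd * 2 ^ (tz.size + tz.size) + tz = bv (r.wd ++ zeroRunToken tz) := by
    rw [bv_append, bv_zeroRunToken, length_zeroRunToken, two_mul]
  have e2 : r.wd.length + (tz.size + tz.size) = (r.wd ++ zeroRunToken tz).length := by
    rw [List.length_append, length_zeroRunToken, two_mul]
  simp [g1, g2, g3, g4, b1, p1.1]
  rw [e1, e2]
  have e6 : (r.wd ++ zeroRunToken tz).length < 2 ^ b := by rw [← e2]; omega
  refine ⟨⟨by omega, by omega⟩, ⟨by omega, e6⟩, ?_⟩
  have he2 : Env b L MB (((((s₂.set vMv (bv (r.wd ++ zeroRunToken tz))).tick 8).set vMl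
      (r.wd ++ zeroRunToken tz).length).tick 6).set vSy y |>.tick 2) :=
    he1.frame (hf₂.reg vB) (hf₂.reg vL) (hf₂.reg vP) (hf₂.reg vMB) (fun v _ => by simp [hf₂.mem])
  refine wp_use (size_spec hbd he2 (y := y) (by simp) (by omega)) ?_
  rintro s₃ ⟨c1, c2⟩ hf₃
  have k1 := hf₃.reg vY
  have k2 := hf₃.reg vMv
  have k3 := hf₃.reg vMl
  have k5 := hf₃.reg vLead
  simp [g1, g5] at k1 k2 k3 k5
  have q0 : 2 ^ (y.size + y.size - 1) + y < 2 ^ (y.size + y.size) := by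
    have h1 := bv_lt (literalToken y)
    rw [bv_literalToken, length_literalToken (Nat.pos_of_ne_zero h0), two_mul] at h1
    exact h1
  have q1 := push_lt (l := r.wd ++ zeroRunToken tz) (m := y.size + y.size) (b := b)
    (x := 2 ^ (y.size + y.size - 1) + y) (by rw [← e2]; omega) q0
  have q2 : 2 ^ (y.size + y.size - 1) % 2 ^ b = 2 ^ (y.size + y.size - 1) :=
    Nat.mod_eq_of_lt (by omega)
  have e3 : bv (r.wd ++ zeroRunToken tz) * 2 ^ (y.size + y.size) + (2 ^ (y.size + y.size - 1) + y)
      = bv (r.wd ++ (zeroRunToken tz ++ literalToken y)) := by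
    rw [← List.append_assoc, bv_append _ (literalToken y), bv_literalToken,
      length_literalToken (Nat.pos_of_ne_zero h0), two_mul]
  have e4 : r.wd.length + 2 * tz.size + (y.size + y.size) =
      (r.wd ++ (zeroRunToken tz ++ literalToken y)).length := by
    simp only [List.length_append, length_zeroRunToken,
      length_literalToken (Nat.pos_of_ne_zero h0)]
    omega
  simp [k1, k2, k3, c1, q1.1, q2, -List.length_append, and_assoc]
  rw [e3, e4]
  refine ⟨by omega, by omega, by omega, by omega, by omega, by omega, by omega, by omega,
    by omega, ?_, ?_⟩
  · rw [hem]
    constructor <;> simp [k5]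
  · simp [Nat.mul_add] at b2 c2 ⊢
    have := Nat.mul_le_mul_left L a3
    simp only [Nat.mul_add] at this
    omega

/-- The bits `W` have been written to the output area at address `o`, except that the last,
incomplete word is still in `vAcc`. -/
structure OutRep (b o : ℕ) (W : List Bool) (s : NS) : Prop where
  ow : s.reg vOw = o + W.length / b
  r : s.reg vR = W.length % b
  acc : s.reg vAcc = bv (W.drop (W.length / b * b)) * 2 ^ (b - W.length % b)
  full : ∀ j < W.length / b, s.mem (o + j) = bv ((W.drop (j * b)).take b)

/-- Append the last `vPl` bits of `vPv` to the output. -/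
def putCode : Cmd :=
  vPv ≔ vPv ≪≪ (vB - vPl) ;;
  vAcc ≔ vAcc + (vPv ≫≫ vR) ;;
  vR ≔ vR + vPl ;;
  .ite (.le vB vR)
    (.st vOw vAcc ;; vOw ≔ vOw + 1 ;; vR ≔ vR - vB ;; vAcc ≔ vPv ≪≪ (vPl - vR)) .skip

theorem bv_shift_lt {l : List Bool} {b : ℕ} (h : l.length ≤ b) :
    bv l * 2 ^ (b - l.length) < 2 ^ b := by
  have h1 : 2 ^ b = 2 ^ l.length * 2 ^ (b - l.length) := by rw [← pow_add]; congr 1; omega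
  rw [h1]
  exact Nat.mul_lt_mul_of_pos_right (bv_lt l) (Nat.two_pow_pos _)

/-- The string fits into the accumulator. -/
theorem put_word_lt {x l : List Bool} {b : ℕ} (h : x.length + l.length ≤ b) :
    bv x * 2 ^ (b - x.length) + bv l * 2 ^ (b - l.length) / 2 ^ x.length =
      bv (x ++ l) * 2 ^ (b - (x.length + l.length)) := by
  have h1 : 2 ^ (b - l.length) = 2 ^ (b - (x.length + l.length)) * 2 ^ x.length := by
    rw [← pow_add]; congr 1; omega
  have h2 : 2 ^ (b - x.length) = 2 ^ l.length * 2 ^ (b - (x.length + l.length)) := by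
    rw [← pow_add]; congr 1; omega
  rw [h1, ← mul_assoc, Nat.mul_div_cancel _ (Nat.two_pow_pos _), h2, bv_append]
  ring

/-- The beginning `l₁` of the string completes the word in the accumulator. -/
theorem put_word_ge {x l₁ l₂ : List Bool} {b : ℕ} (h : x.length + l₁.length = b)
    (h' : (l₁ ++ l₂).length ≤ b) :
    bv x * 2 ^ (b - x.length) + bv (l₁ ++ l₂) * 2 ^ (b - (l₁ ++ l₂).length) / 2 ^ x.length =
      bv (x ++ l₁) := by
  rw [List.length_append] at h'
  have h1 : bv (l₁ ++ l₂) * 2 ^ (b - (l₁ ++ l₂).length) =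
      bv l₁ * 2 ^ x.length + bv l₂ * 2 ^ (b - (l₁ ++ l₂).length) := by
    have : 2 ^ x.length = 2 ^ l₂.length * 2 ^ (b - (l₁ ++ l₂).length) := by
      rw [← pow_add, List.length_append]; congr 1; omega
    rw [bv_append, this]; ring
  have h2 : bv l₂ * 2 ^ (b - (l₁ ++ l₂).length) < 2 ^ x.length := by
    have : 2 ^ x.length = 2 ^ l₂.length * 2 ^ (b - (l₁ ++ l₂).length) := by
      rw [← pow_add, List.length_append]; congr 1; omega
    rw [this]
    exact Nat.mul_lt_mul_of_pos_right (bv_lt l₂) (Nat.two_pow_pos _)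
  rw [h1, mul_comm (bv l₁), Nat.mul_add_div (Nat.two_pow_pos _), Nat.div_eq_of_lt h2, bv_append]
  have : b - x.length = l₁.length := by omega
  rw [this]
  rfl

/-- The rest of the string, moved to the front of the empty accumulator. -/
theorem put_rest {l₁ l₂ : List Bool} {b : ℕ} (h' : (l₁ ++ l₂).length ≤ b) :
    bv (l₁ ++ l₂) * 2 ^ (b - (l₁ ++ l₂).length) * 2 ^ l₁.length % 2 ^ b =
      bv l₂ * 2 ^ (b - l₂.length) := by
  have h1 : bv (l₁ ++ l₂) * 2 ^ (b - (l₁ ++ l₂).length) * 2 ^ l₁.length =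
      bv l₂ * 2 ^ (b - l₂.length) + 2 ^ b * bv l₁ := by
    rw [List.length_append] at h' ⊢
    have e1 : 2 ^ b = 2 ^ l₂.length * (2 ^ (b - (l₁.length + l₂.length)) * 2 ^ l₁.length) := by
      rw [← pow_add, ← pow_add]; congr 1; omega
    have e2 : 2 ^ (b - l₂.length) = 2 ^ (b - (l₁.length + l₂.length)) * 2 ^ l₁.length := by
      rw [← pow_add]; congr 1; omega
    rw [bv_append, e1, e2]; ring
  rw [h1, Nat.add_mul_mod_self_left]
  rw [List.length_append] at h'
  exact Nat.mod_eq_of_lt (bv_shift_lt (by omega))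

/-- Up to a word of output is appended in constant time. -/
theorem put_spec {s : NS} {o : ℕ} {W l : List Bool} (hb : 0 < b) (hB : s.reg vB = b)
    (ho : OutRep b o W s) (hv : s.reg vPv = bv l) (hl : s.reg vPl = l.length) (hlb : l.length ≤ b)
    (hroom : o + (W ++ l).length / b < 2 ^ b) (hbb : 8 * b < 2 ^ b) :
    wp b A cost putCode (fun s' => OutRep b o (W ++ l) s' ∧ s'.time ≤ s.time + 60 ∧
      ∀ a, a < o ∨ o + (W ++ l).length / b ≤ a → s'.mem a = s.mem a) s := by
  obtain ⟨o1, o2, o3, o4⟩ := ho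
  unfold putCode
  set n := W.length / b with hn
  set r := W.length % b with hr
  have hrb : r < b := Nat.mod_lt _ hb
  have hW : W.length = n * b + r := by rw [hn, hr, Nat.div_add_mod']
  set x := W.drop (n * b) with hx
  have hxl : x.length = r := by rw [hx, List.length_drop]; omega
  have hdrop : (W ++ l).drop (n * b) = x ++ l := List.drop_append_of_le_length (by omega)
  have hfull : ∀ j < n, ((W ++ l).drop (j * b)).take b = (W.drop (j * b)).take b := by
    intro j hj
    have h1 : (j + 1) * b ≤ n * b := Nat.mul_le_mul_right _ hj
    rw [add_mul, one_mul] at h1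
    rw [List.drop_append_of_le_length (by omega), List.take_append_of_le_length]
    rw [List.length_drop]; omega
  have hmod : bv l * 2 ^ (b - l.length) % 2 ^ b = bv l * 2 ^ (b - l.length) :=
    Nat.mod_eq_of_lt (bv_shift_lt hlb)
  simp [hB, hv, hl, o1, o2, o3, hmod, and_assoc, -List.length_append]
  rw [← hxl]
  refine ⟨hlb, ?_, by omega, fun hc => ?_, fun hc => ?_⟩
  · by_cases hc : x.length + l.length ≤ b
    · rw [put_word_lt hc, ← List.length_append]
      exact bv_shift_lt (by simpa using hc)
    · have e : l = l.take (b - x.length) ++ l.drop (b - x.length) := by simp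
      have h1 : (l.take (b - x.length)).length = b - x.length := by
        rw [List.length_take]; omega
      conv_lhs => rw [e]
      rw [put_word_ge (by omega) (by simpa using hlb)]
      refine (bv_lt _).trans_le (Nat.pow_le_pow_right (by norm_num) ?_)
      rw [List.length_append]; omega
  · have e : l = l.take (b - x.length) ++ l.drop (b - x.length) := by simp
    set l₁ := l.take (b - x.length)
    set l₂ := l.drop (b - x.length)
    have h1 : l₁.length = b - x.length := by
      rw [List.length_take]; omega
    have h2 : l₂.length = x.length + l.length - b := by
      rw [List.length_drop]; omega
    have e1 : (W ++ l).length / b = n + 1 ∧ (W ++ l).length % b = l₂.length := by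
      have : (W ++ l).length = l₂.length + b * (n + 1) := by
        rw [List.length_append, h2, hW, mul_add, mul_comm b n]; omega
      rw [this, Nat.add_mul_div_left _ _ hb, Nat.add_mul_mod_self_left,
        Nat.div_eq_of_lt (by omega), Nat.mod_eq_of_lt (by omega)]
      omega
    have hword : bv x * 2 ^ (b - x.length) + bv l * 2 ^ (b - l.length) / 2 ^ x.length =
        bv (x ++ l₁) := by
      rw [e]; exact put_word_ge (by omega) (by rw [← e]; exact hlb)
    have hrest : bv l * 2 ^ (b - l.length) * 2 ^ (l.length - (x.length + l.length - b)) % 2 ^ b =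
        bv l₂ * 2 ^ (b - l₂.length) := by
      have : l.length - (x.length + l.length - b) = l₁.length := by omega
      rw [this, e]; exact put_rest (by rw [← e]; exact hlb)
    have hd : (W ++ l).drop ((n + 1) * b) = l₂ := by
      have : (n + 1) * b = n * b + (x.length + (b - x.length)) := by rw [add_mul]; omega
      rw [this, ← List.drop_drop, hdrop, List.drop_append]
      simp [l₂]
    rw [e1.1] at hroom ⊢
    rw [hword, hrest]
    refine ⟨by omega, by omega, by omega, hc, by omega, ⟨?_, ?_, ?_, ?_⟩, ?_⟩
    · rw [e1.1]; simp; omega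
    · rw [e1.2]; simp [h2]
    · rw [e1.1, e1.2, hd]; simp
    · rw [e1.1]
      intro j hj
      simp only [NS.tick_mem, NS.set_mem, NS.put_mem, Function.update_apply]
      by_cases hj' : j = n
      · subst hj'
        rw [if_pos rfl, hdrop, List.take_append, List.take_of_length_le (by omega)]
      · rw [if_neg (by omega), hfull j (by omega)]
        exact o4 j (by omega)
    · intro a ha
      have hn0 := Nat.zero_le n
      rw [Function.update_apply, if_neg (by rcases ha with ha | ha <;> omega)]
  · have e1 : (W ++ l).length / b = n ∧ (W ++ l).length % b = (x ++ l).length := by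
      have : (W ++ l).length = (x ++ l).length + b * n := by
        rw [List.length_append, List.length_append, hW, mul_comm b n]; omega
      rw [this, Nat.add_mul_div_left _ _ hb, Nat.add_mul_mod_self_left,
        Nat.div_eq_of_lt (by rw [List.length_append]; omega),
        Nat.mod_eq_of_lt (by rw [List.length_append]; omega)]
      omega
    refine ⟨?_, ?_, ?_, ?_⟩
    · rw [e1.1]; simp [o1]
    · rw [e1.2]; simp
    · rw [e1.1, e1.2, hdrop, List.length_append]
      simp [put_word_lt (show x.length + l.length ≤ b by omega)]
    · rw [e1.1]
      intro j hj
      simp only [NS.tick_mem, NS.set_mem]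
      rw [hfull j hj]
      exact o4 j hj

/-- Write the encoding of the summarized string, where `vZ` zeros are pending. -/
def applyCode : Cmd :=
  vZ ≔ vZ + vLead ;;
  .ite (.eq vMl 0) (vZ ≔ vZ + vTz)
    (vSy ≔ vZ ;; sizeCode ;; vPv ≔ vZ ;; vPl ≔ vSz + vSz ;; putCode ;;
      vPv ≔ vMv ;; vPl ≔ vMl ;; putCode ;; vZ ≔ vTz)

theorem OutRep.frame {o : ℕ} {W : List Bool} {s s' : NS} (h : OutRep b o W s)
    (h1 : s'.reg vOw = s.reg vOw) (h2 : s'.reg vR = s.reg vR) (h3 : s'.reg vAcc = s.reg vAcc)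
    (h4 : s'.mem = s.mem) : OutRep b o W s' :=
  ⟨h1 ▸ h.ow, h2 ▸ h.r, h3 ▸ h.acc, fun j hj => by rw [h4, h.full j hj]⟩

/-- Writing a summary takes time `O(1)`, except for the bit length of the pending run, which is
paid by the length of the output. -/
theorem apply_spec {s : NS} {o z : ℕ} {W : List Bool} {r : Rec} (hb : Bnd b L MB)
    (he : Env b L MB s) (hr : HasRec r s) (ho : OutRep b o W s) (hz : s.reg vZ = z)
    (hzb : z + r.lead + r.tz < 2 ^ b) (hzs : 2 * Nat.size (z + r.lead) ≤ b)
    (hwl : r.wd.length ≤ b) (hroom : o + (W ++ r.out z).length / b < 2 ^ b) :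
    wp b A cost applyCode (fun s' => OutRep b o (W ++ r.out z) s' ∧ s'.reg vZ = r.pend z ∧
      L * s'.time ≤ L * s.time + 300 * L + 20 * (r.out z).length ∧
      ∀ a, a < o ∨ o + (W ++ r.out z).length / b ≤ a → s'.mem a = s.mem a) s := by
  have hbd := hb
  obtain ⟨hL1, hLb, hMBb, hbb⟩ := hb
  obtain ⟨r1, r2, r3, r4⟩ := hr
  unfold applyCode
  simp [hz, r1, r3, r4]
  refine ⟨by omega, fun hW => ⟨by omega, ?_, ?_, ?_⟩, fun hW => ?_⟩
  · have : r.out z = [] := by simp [Rec.out, hW]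
    rw [this, List.append_nil]
    exact ho.frame (by simp) (by simp) (by simp) (by simp)
  · simp [Rec.pend, hW]
  · simp only [Nat.mul_add]; omega
  have hout : r.out z = zeroRunToken (z + r.lead) ++ r.wd := by simp [Rec.out, hW]
  have hpend : r.pend z = r.tz := by simp [Rec.pend, hW]
  rw [hout] at hroom ⊢
  rw [hpend]
  refine wp_use (size_spec hbd (y := z + r.lead)
    (he.frame (by simp) (by simp) (by simp) (by simp) (by simp)) (by simp) (by omega)) ?_
  rintro s₂ ⟨b1, b2⟩ hf₂
  have g1 := hf₂.reg vZ
  have g2 := hf₂.reg vMv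
  have g3 := hf₂.reg vMl
  have g4 := hf₂.reg vTz
  have g5 := hf₂.reg vB
  have gm := hf₂.mem
  simp [r2, r3, r4, he.hB] at g1 g2 g3 g4 g5 gm
  simp [g1, b1]
  have hlen : (zeroRunToken (z + r.lead)).length = (z + r.lead).size + (z + r.lead).size := by
    rw [length_zeroRunToken, two_mul]
  refine ⟨by omega, ?_⟩
  have hroom1 : o + (W ++ zeroRunToken (z + r.lead)).length / b < 2 ^ b := by
    refine lt_of_le_of_lt (Nat.add_le_add_left (Nat.div_le_div_right ?_) _) hroom
    simp
  refine wp_use (put_spec (l := zeroRunToken (z + r.lead)) (W := W) (o := o) (by omega)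
    (by simp [g5]) (ho.frame ?_ ?_ ?_ ?_) (by simp [bv_zeroRunToken])
    (by simp [two_mul]) (by omega) hroom1 hbb) ?_
  · simpa using hf₂.reg vOw
  · simpa using hf₂.reg vR
  · simpa using hf₂.reg vAcc
  · simpa using gm
  rintro s₃ ⟨c1, c2, c3⟩ hf₃
  have k2 := hf₃.reg vMv
  have k3 := hf₃.reg vMl
  have k4 := hf₃.reg vTz
  have k5 := hf₃.reg vB
  simp [g2, g3, g4, g5] at k2 k3 k4 k5
  simp [k2, k3]
  rw [← List.append_assoc] at hroom
  refine wp_use (put_spec (l := r.wd) (W := W ++ zeroRunToken (z + r.lead)) (o := o) (by omega)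
    (by simp [k5]) (c1.frame (by simp) (by simp) (by simp) (by simp)) (by simp)
    (by simp) (by omega) hroom hbb) ?_
  rintro s₄ ⟨d1, d2, d3⟩ hf₄
  have m4 := hf₄.reg vTz
  simp [k4] at m4
  rw [List.append_assoc] at d1 d3
  refine ⟨trivial, d1.frame (by simp) (by simp) (by simp) (by simp), by simp [m4], ?_,
    fun a ha => ?_⟩
  · simp [Nat.mul_add] at c2 d2 b2 ⊢
    have := Nat.mul_le_mul_left L c2
    have := Nat.mul_le_mul_left L d2
    simp only [Nat.mul_add] at *
    omega
  · simp at d3 ⊢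
    rw [d3 a (by simpa using ha), c3 a, NS.tick_mem, NS.set_mem, NS.tick_mem, NS.set_mem, gm]
    rcases ha with ha | ha
    · exact Or.inl ha
    · refine Or.inr (le_trans (Nat.add_le_add_left (Nat.div_le_div_right ?_) _) ha)
      simp

/-! ### Reading tokens -/

/-- Split the first token off the left-aligned bit string `vV`: type `vTy`, value `vU` and number
`vTl` of bits. -/
def readCode : Cmd :=
  vTy ≔ vV ≫≫ (vB - 1) ;; vV1 ≔ vV ≪≪ 1 ;; vJ ≔ vL ;;
  .loop (.eq (vV1 ≫≫ (vB - vJ)) 0) (vJ ≔ vJ + vL) ;;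
  .ld vT0 (vMB + (vV1 ≫≫ (vB - vJ))) ;;
  vK ≔ vJ - vT0 ;; vU ≔ vV1 ≫≫ (vB - (vK + vK + 1)) ;; vTl ≔ vK + vK + 2

theorem size_div_two_pow (x m : ℕ) : Nat.size (x / 2 ^ m) = Nat.size x - m := by
  by_cases h : 2 ^ m ≤ x
  · rw [size_div_pow h]; omega
  · push Not at h
    rw [Nat.div_eq_of_lt h]
    have := Nat.size_le.2 h
    simp; omega

/-- The leading zeros of the Elias-γ code are found by looking at a growing multiple of `L` bits.
Here, `k` is the number of leading zeros after the type bit. -/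
theorem read_spec {s : NS} {V V1 k : ℕ} (hb : Bnd b L MB) (he : Env b L MB s)
    (hV : s.reg vV = V) (hV1 : V * 2 % 2 ^ b = V1) (hk : Nat.size V1 + k = b)
    (hk2 : 2 * k + 2 ≤ b) (hkL : k + L ≤ b) :
    wp b A cost readCode (fun s' => s'.reg vTy = V / 2 ^ (b - 1) ∧
      s'.reg vU = V1 / 2 ^ (b - (2 * k + 1)) ∧ s'.reg vTl = 2 * k + 2 ∧ s'.reg vV1 = V1 ∧
      L * s'.time ≤ L * s.time + 100 * (L + k)) s := by
  obtain ⟨hB, hL, hP, hMB, hM⟩ := he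
  obtain ⟨hL1, hLb, hMBb, hbb⟩ := hb
  unfold readCode
  have h2 : 1 < 2 ^ b := by omega
  simp [hB, hL, hV, hV1]
  refine ⟨by omega, by omega, ?_⟩
  refine wp_use (wp_while (fun s' => L ≤ s'.reg vJ ∧ s'.reg vJ ≤ k + L ∧
      L * s'.time ≤ L * s.time + 12 * L + 20 * s'.reg vJ)
      (L * s.time + 12 * L + 20 * (k + L)) ?_ ?_ ?_ ?_) ?_
  · simp [Nat.mul_add]; omega
  · rintro s' ⟨h1, h2, h3⟩
    have := Nat.le_mul_of_pos_left s'.time hL1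
    omega
  · rintro s' ⟨h1, h2, h3⟩ hf
    have e1 := hf.reg vB
    simp [hB] at e1
    simp [e1]
    omega
  · rintro s' ⟨h1, h2, h3⟩ hf hc
    have e1 := hf.reg vB
    have e2 := hf.reg vL
    have e3 := hf.reg vV1
    simp [hB, hL] at e1 e2 e3
    simp only [holds_eq, eval_shr, eval_sub, eval_var, eval_ofNat, e1, e3] at hc
    have h4 : V1 < 2 ^ (b - s'.reg vJ) := by
      rcases (Nat.div_eq_zero_iff.1 hc) with h | h
      · exact absurd h (Nat.two_pow_pos _).ne'
      · exact h
    have h5 := Nat.size_le.2 h4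
    simp [e2]
    refine ⟨by omega, by omega, ?_⟩
    simp only [Nat.mul_add]
    omega
  · rintro _ ⟨s', ⟨h1, h2, h3⟩, hc, hf, rfl⟩ -
    have e1 := hf.reg vB
    have e2 := hf.reg vMB
    have e3 := hf.reg vV1
    have e4 := hf.mem
    have e5 := hf.reg vTy
    simp [hB, hMB] at e1 e2 e3 e4 e5
    simp only [holds_eq, eval_shr, eval_sub, eval_var, eval_ofNat, e1, e3] at hc
    have h6 : Nat.size (V1 / 2 ^ (b - s'.reg vJ)) = s'.reg vJ - k := by
      rw [size_div_two_pow]; omega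
    have h7 : V1 / 2 ^ (b - s'.reg vJ) < 2 ^ L := Nat.size_le.1 (by omega)
    have h8 : 0 < Nat.size (V1 / 2 ^ (b - s'.reg vJ)) := Nat.size_pos.2 (Nat.pos_of_ne_zero hc)
    have h9 : s'.reg vJ - (s'.reg vJ - k) = k := by omega
    simp [e1, e2, e3, e4, e5, hM _ h7, h6, h9, and_assoc, two_mul]
    generalize V1 / 2 ^ (b - s'.reg vJ) = top at *
    refine ⟨by omega, by omega, fun _ => ⟨by omega, by omega, by omega,
      by omega, by omega, by omega, by omega, ?_⟩⟩
    simp only [Nat.mul_add]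
    omega

/-- The value of a bit string that starts with a given token. -/
theorem token_parse {t : Tok} (ht : 0 < t.2) {V g : ℕ} (hlen : 2 * Nat.size t.2 ≤ b)
    (hg : g < 2 ^ (b - 2 * Nat.size t.2)) (hV : V = bv t.bits * 2 ^ (b - 2 * Nat.size t.2) + g) :
    V / 2 ^ (b - 1) = t.1.toNat ∧ Nat.size (V * 2 % 2 ^ b) + (Nat.size t.2 - 1) = b ∧
      V * 2 % 2 ^ b / 2 ^ (b - (2 * (Nat.size t.2 - 1) + 1)) = t.2 := by
  obtain ⟨c, u⟩ := t
  simp only at *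
  have hs := Nat.size_pos.2 ht
  obtain ⟨k, hk⟩ : ∃ k, Nat.size u = k + 1 := ⟨Nat.size u - 1, by omega⟩
  have hu1 := Nat.lt_size_self u
  have hu2 := two_pow_size_le ht
  rw [Tok.bits, bv_cons, bv_eliasGamma, length_eliasGamma] at hV
  rw [hk] at hV hg hlen hu1 hu2 ⊢
  have a1 : 2 * (k + 1) - 1 = 2 * k + 1 := by omega
  have a2 : b - 2 * (k + 1) + (2 * k + 1) = b - 1 := by omega
  have a3 : b - (2 * k + 1) = b - 2 * (k + 1) + 1 := by omega
  set d := b - 2 * (k + 1)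
  simp only [a1, Nat.add_sub_cancel] at hV hg hu2 ⊢
  have e1 : 2 ^ (b - 1) = 2 ^ (2 * k + 1) * 2 ^ d := by rw [← pow_add]; congr 1; omega
  have e2 : 2 ^ b = 2 * (2 ^ (2 * k + 1) * 2 ^ d) := by
    rw [← e1, ← pow_succ']; congr 1; omega
  have e0 : 2 ^ (k + 1) ≤ 2 ^ (2 * k + 1) := Nat.pow_le_pow_right (by norm_num) (by omega)
  have e3 : u * 2 ^ d + g < 2 ^ (2 * k + 1) * 2 ^ d := by
    have : (u + 1) * 2 ^ d ≤ 2 ^ (2 * k + 1) * 2 ^ d := Nat.mul_le_mul_right _ (by omega)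
    rw [add_mul, one_mul] at this
    omega
  have e4 : V = 2 ^ (b - 1) * c.toNat + (u * 2 ^ d + g) := by rw [hV, e1]; ring
  have e5 : V * 2 % 2 ^ b = u * 2 ^ (d + 1) + 2 * g := by
    have : V * 2 = u * 2 ^ (d + 1) + 2 * g + 2 ^ b * c.toNat := by rw [e4, e2, e1, pow_succ]; ring
    rw [this, Nat.add_mul_mod_self_left, Nat.mod_eq_of_lt]
    rw [e2, pow_succ]
    linarith
  have e6 : 2 * g < 2 ^ (d + 1) := by rw [pow_succ]; omega
  refine ⟨?_, ?_, ?_⟩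
  · rw [e4, Nat.mul_add_div (Nat.two_pow_pos _), Nat.div_eq_of_lt (by rw [e1]; exact e3)]
    rfl
  · rw [e5]
    have h1 : u * 2 ^ (d + 1) + 2 * g < 2 ^ (b - k) := by
      have h3 : (u + 1) * 2 ^ (d + 1) ≤ 2 ^ (k + 1) * 2 ^ (d + 1) := Nat.mul_le_mul_right _ hu1
      rw [← pow_add, add_mul, one_mul] at h3
      have : k + 1 + (d + 1) = b - k := by omega
      rw [this] at h3
      omega
    have h2 : 2 ^ (b - k - 1) ≤ u * 2 ^ (d + 1) + 2 * g := by
      have h3 : 2 ^ k * 2 ^ (d + 1) ≤ u * 2 ^ (d + 1) := Nat.mul_le_mul_right _ hu2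
      rw [← pow_add] at h3
      have : k + (d + 1) = b - k - 1 := by omega
      rw [this] at h3
      omega
    have h3 := Nat.size_le.2 h1
    have h4 := Nat.lt_size.2 h2
    omega
  · rw [e5, a3, mul_comm u, Nat.mul_add_div (Nat.two_pow_pos _), Nat.div_eq_of_lt e6]
    rfl

/-! ### The input stream -/

/-- The bit string `B` is stored at address `a`. -/
structure InRep (b a : ℕ) (B : List Bool) (s : NS) : Prop where
  adr : s.reg vA = a
  len : s.reg vLen = B.length
  bits : ∀ (i : ℕ) (hi : i < B.length), (s.mem (a + i / b)).testBit (b - 1 - i % b) = B[i]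

/-- Load a word of the input, starting at bit position `vPos`. -/
def peekCode : Cmd :=
  vT1 ≔ vPos / vB ;; vT2 ≔ vPos % vB ;; .ld vV (vA + vT1) ;; vV ≔ vV ≪≪ vT2 ;;
  .ite (.lt vT1 (vLen / vB)) (.ld vT3 (vA + vT1 + 1) ;; vV ≔ vV + (vT3 ≫≫ (vB - vT2))) .skip

/-- A word that starts at bit `r` of the word `w₀` and continues in the word `w₁`. For `r = 0`, the
shift by `b` removes `w₁` altogether. -/
theorem join_words {w₀ w₁ r b : ℕ} (hr : r < b) (h₁ : w₁ < 2 ^ b) :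
    w₀ * 2 ^ r % 2 ^ b + w₁ / 2 ^ (b - r) < 2 ^ b ∧ ∀ i < b,
      (w₀ * 2 ^ r % 2 ^ b + w₁ / 2 ^ (b - r)).testBit (b - 1 - i) =
        if r + i < b then w₀.testBit (b - 1 - (r + i)) else w₁.testBit (b - 1 - (r + i - b)) := by
  have e1 : 2 ^ b = 2 ^ (b - r) * 2 ^ r := by rw [← pow_add]; congr 1; omega
  have e2 : w₁ / 2 ^ (b - r) < 2 ^ r := by
    rw [Nat.div_lt_iff_lt_mul (Nat.two_pow_pos _), mul_comm, ← e1]; exact h₁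
  have e3 : w₀ * 2 ^ r % 2 ^ b = 2 ^ r * (w₀ % 2 ^ (b - r)) := by
    rw [e1, Nat.mul_mod_mul_right, mul_comm]
  rw [e3]
  constructor
  · have h1 : w₀ % 2 ^ (b - r) < 2 ^ (b - r) := Nat.mod_lt _ (Nat.two_pow_pos _)
    have h2 : 2 ^ r * (w₀ % 2 ^ (b - r) + 1) ≤ 2 ^ r * 2 ^ (b - r) := Nat.mul_le_mul_left _ h1
    rw [mul_add, mul_one] at h2
    rw [e1, mul_comm (2 ^ (b - r))]
    omega
  · intro i hi
    rw [Nat.testBit_two_pow_mul_add _ e2]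
    by_cases h : r + i < b
    · rw [if_neg (by omega), if_pos h, Nat.testBit_mod_two_pow]
      have : b - 1 - i - r = b - 1 - (r + i) := by omega
      rw [this]
      simp
      omega
    · rw [if_pos (by omega), if_neg h, Nat.testBit_div_two_pow]
      congr 1
      omega

theorem top_bits_eq {V b m : ℕ} (hV : V < 2 ^ b) (l : List Bool) (hl : l.length = m) (hm : m ≤ b)
    (h : ∀ (i : ℕ) (hi : i < l.length), V.testBit (b - 1 - i) = l[i]) :
    V / 2 ^ (b - m) = bv l := by
  apply Nat.eq_of_testBit_eq
  intro j
  rw [Nat.testBit_div_two_pow]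
  by_cases hj : j < m
  · have h1 := h (m - 1 - j) (by omega)
    have h2 := testBit_bv l (m - 1 - j) (by omega)
    have e1 : b - 1 - (m - 1 - j) = j + (b - m) := by omega
    have e2 : l.length - 1 - (m - 1 - j) = j := by omega
    rw [e1] at h1
    rw [e2] at h2
    rw [h1, h2]
  · rw [Nat.testBit_lt_two_pow (hV.trans_le (Nat.pow_le_pow_right (by norm_num) (by omega))),
      Nat.testBit_lt_two_pow ((bv_lt l).trans_le (Nat.pow_le_pow_right (by norm_num) (by omega)))]

/-- The bits of `vV` after the end of the input are arbitrary, so only the first `m` bits are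
specified, for every `m` such that they are part of the input. -/
theorem peek_spec {s : NS} {a p : ℕ} {B : List Bool} (hb : 0 < b)
    (hB : s.reg vB = b) (hi : InRep b a B s)
    (hp : s.reg vPos = p) (hpB : p ≤ B.length) (hroom : a + B.length / b + 1 ≤ 2 ^ b) :
    wp b A cost peekCode (fun s' => s'.reg vV < 2 ^ b ∧ (∀ m ≤ b, p + m ≤ B.length →
      s'.reg vV / 2 ^ (b - m) = bv ((B.drop p).take m)) ∧ s'.time ≤ s.time + 60) s := by
  obtain ⟨h1, h2, h3⟩ := hi
  unfold peekCode
  have hr : p % b < b := Nat.mod_lt _ hb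
  have hn : p / b ≤ B.length / b := Nat.div_le_div_right hpB
  have hpd := Nat.div_add_mod p b
  have key : ∀ w₁, w₁ < 2 ^ b → (p / b < B.length / b → w₁ = s.mem (a + p / b + 1)) →
      ∀ m ≤ b, p + m ≤ B.length →
      (s.mem (a + p / b) * 2 ^ (p % b) % 2 ^ b + w₁ / 2 ^ (b - p % b)) / 2 ^ (b - m) =
        bv ((B.drop p).take m) := by
    intro w₁ hw hw1 m hm hpm
    obtain ⟨j1, j2⟩ := join_words (w₀ := s.mem (a + p / b)) hr hw
    apply top_bits_eq j1 _ (by simp; omega) hm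
    intro i hi
    have hi' : i < m := by simp at hi; omega
    rw [j2 i (by omega)]
    simp only [List.getElem_take, List.getElem_drop]
    have h4 := h3 (p + i) (by omega)
    rw [← h4]
    by_cases hc : p % b + i < b
    · have e1 : (p + i) / b = p / b ∧ (p + i) % b = p % b + i := by
        have : p + i = (p % b + i) + b * (p / b) := by omega
        rw [this, Nat.add_mul_div_left _ _ hb, Nat.add_mul_mod_self_left, Nat.div_eq_of_lt hc,
          Nat.mod_eq_of_lt hc]
        simp
      rw [if_pos hc, e1.1, e1.2]
    · have e1 : (p + i) / b = p / b + 1 ∧ (p + i) % b = p % b + i - b := by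
        have : p + i = (p % b + i - b) + b * (p / b + 1) := by rw [mul_add]; omega
        rw [this, Nat.add_mul_div_left _ _ hb, Nat.add_mul_mod_self_left,
          Nat.div_eq_of_lt (by omega), Nat.mod_eq_of_lt (by omega)]
        simp
      have h5 : (p + i) / b ≤ B.length / b := Nat.div_le_div_right (by omega)
      rw [if_neg hc, e1.1, e1.2, hw1 (by omega), add_assoc]
  have hpb : 0 < 2 ^ b := Nat.two_pow_pos b
  simp [hB, hp, h1, h2]
  refine ⟨by omega, fun hm₀ => ⟨fun hc => ?_, fun hc => ?_⟩⟩
  · refine ⟨⟨by omega, by omega⟩, by omega, fun hm₁ => ⟨⟨by omega, ?_⟩, ?_, ?_⟩⟩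
    · exact (join_words hr hm₁).1
    · exact (join_words hr hm₁).1
    · exact key _ hm₁ (fun _ => rfl)
  · refine ⟨Nat.mod_lt _ hpb, fun m hm hpm => ?_⟩
    simpa using key 0 hpb (by intro h; omega) m hm hpm

/-! ### Runs of the transducer -/

/-- The state after reading a string. -/
def run (A : Transducer q σ) (v : Fin q) : List (Fin σ) → Fin q
  | [] => v
  | u :: l => run A (A.step v u).1 l

/-- The output symbols as natural numbers. -/
def outs (A : Transducer q σ) (v : Fin q) (l : List (Fin σ)) : List ℕ :=
  (A.outputFrom v l).map Fin.val

@[simp] theorem run_nil (v : Fin q) : run A v [] = v := rfl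
@[simp] theorem outs_nil (v : Fin q) : outs A v [] = [] := rfl
theorem run_cons (v : Fin q) (u : Fin σ) (l : List (Fin σ)) :
    run A v (u :: l) = run A (A.step v u).1 l := rfl
theorem outs_cons (v : Fin q) (u : Fin σ) (l : List (Fin σ)) :
    outs A v (u :: l) = ((A.step v u).2 : ℕ) :: outs A (A.step v u).1 l := rfl

theorem run_append (v : Fin q) (l l' : List (Fin σ)) :
    run A v (l ++ l') = run A (run A v l) l' := by
  induction l generalizing v with
  | nil => rfl
  | cons u l ih => simp [run_cons, ih]

theorem outs_append (v : Fin q) (l l' : List (Fin σ)) :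
    outs A v (l ++ l') = outs A v l ++ outs A (run A v l) l' := by
  induction l generalizing v with
  | nil => rfl
  | cons u l ih => simp [run_cons, outs_cons, ih]

theorem length_outs (v : Fin q) (l : List (Fin σ)) : (outs A v l).length = l.length := by
  induction l generalizing v with
  | nil => rfl
  | cons u l ih => simp [outs_cons, ih]

/-! ### Runs of zeros -/

/-- The successor of a state under the input symbol `z₀` (zero), where states with a non-zero
output on this symbol are made fixed points. -/
def skipStep (A : Transducer q σ) (z₀ : Fin σ) (v : Fin q) : Fin q :=
  if ((A.step v z₀).2 : ℕ) = 0 then (A.step v z₀).1 else v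

/-- A decomposition of the functional graph of `g` into in-trees: every cycle has been cut at one
vertex, the root; `dep` is the depth of a vertex in its tree. -/
structure Forest (g : Fin q → Fin q) (dep : Fin q → ℕ) (root : Fin q → Fin q) : Prop where
  root_of_zero : ∀ v, dep v = 0 → root v = v
  dep_succ : ∀ v, dep v ≠ 0 → dep (g v) + 1 = dep v
  root_succ : ∀ v, root (g v) = root v

namespace Forest

variable {g : Fin q → Fin q} {dep : Fin q → ℕ} {root : Fin q → Fin q}

theorem dep_iterate (h : Forest g dep root) : ∀ (d : ℕ) (v : Fin q), d ≤ dep v →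
    dep (g^[d] v) = dep v - d := by
  intro d
  induction d with
  | zero => simp
  | succ d ih =>
    intro v hd
    have h1 := h.dep_succ v (by omega)
    rw [Function.iterate_succ_apply, ih _ (by omega)]
    omega

theorem root_iterate (h : Forest g dep root) (d : ℕ) (v : Fin q) :
    root (g^[d] v) = root v := by
  induction d generalizing v with
  | zero => rfl
  | succ d ih => rw [Function.iterate_succ_apply, ih, h.root_succ]

theorem iterate_dep (h : Forest g dep root) (v : Fin q) : g^[dep v] v = root v := by
  rw [← h.root_iterate (dep v) v, h.root_of_zero]
  rw [h.dep_iterate _ _ le_rfl]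
  omega

/-- If the cycle of a root is entered, then the walk is periodic. -/
theorem iterate_period (h : Forest g dep root) {r : Fin q} (hr : root r = r) (y : ℕ) :
    g^[y] (g r) = g^[y % (dep (g r) + 1)] (g r) := by
  have : Function.IsPeriodicPt g (dep (g r) + 1) (g r) := by
    rw [Function.IsPeriodicPt, Function.IsFixedPt, Function.iterate_succ_apply', h.iterate_dep,
      h.root_succ, hr]
  exact (this.iterate_mod_apply y).symm

variable {z₀ : Fin σ}

theorem out_eq_zero_of_dep (h : Forest (skipStep A z₀) dep root) {v : Fin q} (hv : dep v ≠ 0) :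
    ((A.step v z₀).2 : ℕ) = 0 := by
  by_contra h0
  have := h.dep_succ v hv
  simp [skipStep, h0] at this

theorem out_eq_zero_of_root (h : Forest (skipStep A z₀) dep root) {v : Fin q}
    (hv : ((A.step (root v) z₀).2 : ℕ) = 0) : ((A.step v z₀).2 : ℕ) = 0 := by
  by_cases h0 : dep v = 0
  · rwa [h.root_of_zero v h0] at hv
  · exact h.out_eq_zero_of_dep h0

/-- On a run of zeros, the transducer follows `skipStep` as long as the output is zero: either the
run ends at the root or before, or the output at the root is zero as well, in which case all states
of the tree have output zero. -/
theorem run_zeros (h : Forest (skipStep A z₀) dep root) : ∀ (x : ℕ) (v : Fin q),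
    (x ≤ dep v ∨ ((A.step (root v) z₀).2 : ℕ) = 0) →
    run A v (List.replicate x z₀) = (skipStep A z₀)^[x] v ∧
      outs A v (List.replicate x z₀) = List.replicate x 0 := by
  intro x
  induction x with
  | zero => simp
  | succ x ih =>
    intro v hv
    have h0 : ((A.step v z₀).2 : ℕ) = 0 := by
      rcases hv with hv | hv
      · exact h.out_eq_zero_of_dep (by omega)
      · exact h.out_eq_zero_of_root hv
    have h1 : skipStep A z₀ v = (A.step v z₀).1 := by simp [skipStep, h0]
    have h2 := ih (skipStep A z₀ v) (by
      rw [h.root_succ]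
      rcases hv with hv | hv
      · have := h.dep_succ v (by omega)
        left; omega
      · exact Or.inr hv)
    rw [List.replicate_succ, run_cons, outs_cons, Function.iterate_succ_apply, List.replicate_succ,
      h0, ← h1, h2.1, h2.2]
    simp

end Forest

/-- The first `L` bits of a bit string, padded with zeros, as a number. -/
def block (L : ℕ) (l : List Bool) : ℕ := bv (l.take L) * 2 ^ (L - (l.take L).length)

/-- The fields `F` describe what happens from state `v` on, for the index `i`. An index
`i < 2 ^ L` is a block of input bits, of which `F 0` bits are processed, and the index `2 ^ L + d`
stands for `d` zeros. In both cases, `F 1` zeros remain to be processed. Processing stops when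
`L` bits of output have been produced, before an output symbol that is at least `2 ^ L`, and before
a token that is not contained in the block. -/
def EntryOK (A : Transducer q σ) (z₀ : Fin σ) (b L : ℕ) (v : Fin q) (i : ℕ) (F : ℕ → ℕ) : Prop :=
  ∃ (l : List (Fin σ)) (r : Rec), F 6 = (run A v l : ℕ) ∧ F 2 = r.lead ∧ F 3 = bv r.wd ∧
    F 4 = r.wd.length ∧ F 5 = r.tz ∧ r.Of (outs A v l) ∧ r.wd.length ≤ b ∧
    r.lead + r.tz ≤ l.length ∧
    (∀ d, i = 2 ^ L + d → F 1 ≤ d ∧ l = List.replicate (d - F 1) z₀ ∧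
      (L ≤ r.wd.length ∨ F 1 = 0 ∨ 2 ^ L ≤ ((A.step (run A v l) z₀).2 : ℕ))) ∧
    (i < 2 ^ L → ∀ ts : List Tok, (∀ t ∈ ts, 0 < t.2 ∧ (t.1 = true → t.2 < σ)) →
      block L (tbits ts) = i → F 1 ≤ 2 ^ L ∧ ∃ ts₁ ts₂, ts = ts₁ ++ ts₂ ∧
        texpand ts₁ = l.map Fin.val ++ List.replicate (F 1) 0 ∧
        F 0 = (tbits ts₁).length ∧
        (L ≤ r.wd.length ∨ (0 < F 1 ∧ 2 ^ L ≤ ((A.step (run A v l) z₀).2 : ℕ)) ∨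
          (F 1 = 0 ∧ (ts₂ = [] ∨ ∃ t ts₃, ts₂ = t :: ts₃ ∧ (L < F 0 + 2 * Nat.size t.2 ∨
            (t.1 = true ∧ ∃ u : Fin σ, (u : ℕ) = t.2 ∧
              2 ^ L ≤ ((A.step (run A v l) u).2 : ℕ)))))))

/-- The data structure. The record of state `v` consists of the cells `10 + 9 * v + f`, for `f < 9`:
successor and output under the symbol zero, depth and root in the forest, address of its ladder and
position on its path. The other three cells are only used during the preprocessing. A ladder
consists of its length and the states on it, from the bottom `bot` upwards. It is at least
`2 ^ L + 1` times as long as the part of its path up to any of its states. By `growth`, after `d`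
steps upwards the position on the path is at least `d`, because paths begin at deepest states. -/
structure DS (A : Transducer q σ) (z₀ : Fin σ) (b L MB GB D : ℕ) (dep : Fin q → ℕ)
    (root : Fin q → Fin q) (base idx : Fin q → ℕ) (m : ℕ → ℕ) : Prop where
  hD : 4 * D < 2 ^ b
  h0 : m 0 = b
  h1 : m 1 = L
  h2 : m 2 = 2 ^ L
  h3 : m 3 = MB
  h4 : m 4 = GB
  h5 : m 5 = (A.init : ℕ)
  hMB : MB + 2 ^ L ≤ D
  hM : ∀ v < 2 ^ L, m (MB + v) = Nat.size v
  nodes : 10 + 9 * q ≤ D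
  node0 : ∀ v : Fin q, m (10 + 9 * v) = (skipStep A z₀ v : ℕ)
  node1 : ∀ v : Fin q, m (11 + 9 * v) = ((A.step v z₀).2 : ℕ)
  node2 : ∀ v : Fin q, m (12 + 9 * v) = dep v
  node3 : ∀ v : Fin q, m (13 + 9 * v) = (root v : ℕ)
  node4 : ∀ v : Fin q, m (14 + 9 * v) = base v
  node5 : ∀ v : Fin q, m (15 + 9 * v) = idx v
  forest : Forest (skipStep A z₀) dep root
  dep_lt : ∀ v, dep v < q
  ladder : ∀ v, ∃ bot : Fin q, (skipStep A z₀)^[idx v] bot = v ∧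
    base v + 1 + m (base v) ≤ D ∧ (idx v + 1) * (2 ^ L + 1) ≤ m (base v) ∧
    ∀ j < m (base v), m (base v + 1 + j) = ((skipStep A z₀)^[j] bot : ℕ)
  growth : ∀ v d, d ≤ dep v → d ≤ idx ((skipStep A z₀)^[d] v)
  hGB : GB + 8 * (q * (2 * 2 ^ L + 1)) ≤ D
  entry : ∀ (v : Fin q) (i : ℕ), i ≤ 2 * 2 ^ L →
    EntryOK A z₀ b L v i (fun f => m (GB + 8 * (v * (2 * 2 ^ L + 1) + i) + f))

/-! ### Jumping along ladders -/

/-- Move `vX` steps from `vS` towards the root. -/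
def climbCode : Cmd :=
  .loop (.lt 0 vX) (
    .ld vBase (14 + 9 * vS) ;; .ld vIdx (15 + 9 * vS) ;; .ld vCnt vBase ;;
    .ite (.lt (vIdx + vX) vCnt)
      (.ld vS (vBase + 1 + (vIdx + vX)) ;; vX ≔ 0)
      (.ld vS (vBase + vCnt) ;; vX ≔ vX - (vCnt - 1 - vIdx)))

variable {z₀ : Fin σ} {GB D : ℕ} {dep : Fin q → ℕ} {root : Fin q → Fin q} {base idx : Fin q → ℕ}
  {m : ℕ → ℕ}

/-- After `k` jumps to the top of a ladder, the position on the path is at least `2 ^ (L * k) - 1`,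
and the last jump alone has skipped at least `2 ^ (L * k)` states. Hence, there are at most
`log x / L` jumps. -/
theorem climb_spec {s : NS} {v : Fin q} {x : ℕ} (hL : 1 ≤ L)
    (ds : DS A z₀ b L MB GB D dep root base idx m) (hm : ∀ a < D, s.mem a = m a)
    (hv : s.reg vS = v) (hx : s.reg vX = x) (hxd : x ≤ dep v) :
    wp b A cost climbCode (fun s' => s'.reg vS = ((skipStep A z₀)^[x] v : Fin q) ∧
      s'.reg vX = 0 ∧ L * s'.time ≤ L * s.time + 100 * (L + Nat.size x)) s := by
  unfold climbCode
  have hD := ds.hD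
  have hnodes := ds.nodes
  set g := skipStep A z₀
  -- After `k` jumps, `x'` steps are left from the state `u`.
  refine wp_use (wp_while (fun s' => ∃ (u : Fin q) (x' k : ℕ), s'.reg vS = u ∧ s'.reg vX = x' ∧
      x' ≤ x ∧ g^[x'] u = g^[x] v ∧ x' ≤ dep u ∧ (x' = 0 ∨ (2 ^ L) ^ k ≤ idx u + 1) ∧
      L * k ≤ Nat.size x ∧
      L * s'.time ≤ L * s.time + 60 * (L * k) + (if x' = 0 then 60 * L else 0))
      (L * s.time + 60 * Nat.size x + 60 * L) ?_ ?_ ?_ ?_) ?_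
  · exact ⟨v, x, 0, hv, hx, le_rfl, rfl, hxd, by simp, by simp, by simp⟩
  · rintro s' ⟨u, x', k, -, -, -, -, -, -, h1, h2⟩
    have := Nat.le_mul_of_pos_left s'.time hL
    split_ifs at h2 <;> omega
  · intro s' _ _
    simp
  · rintro s' ⟨u, x', k, c1, c2, c3, c4, c5, c6, c7, c8⟩ hf hc
    simp only [holds_lt, eval_ofNat, eval_var, c2] at hc
    have hm' : s'.mem = s.mem := hf.mem
    have e1 : s.mem (14 + 9 * u) = base u := by rw [hm _ (by omega), ds.node4]
    have e2 : s.mem (15 + 9 * u) = idx u := by rw [hm _ (by omega), ds.node5]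
    obtain ⟨bot, l1, l2, l3, l4⟩ := ds.ladder u
    have e3 : s.mem (base u) = m (base u) := hm _ (by omega)
    have hxu : x' < q := lt_of_le_of_lt c5 (ds.dep_lt u)
    set n := m (base u)
    have hn' : idx u + 1 + 2 ^ L * (idx u + 1) ≤ n := by linarith
    simp [c1, c2, hm', e1, e2, e3, and_assoc]
    rw [if_neg (by omega)] at c8
    have hb0 : b ≠ 0 := by
      rintro rfl
      simp at hD
      omega
    have c6' : (2 ^ L) ^ k ≤ idx u + 1 := c6.resolve_left (by omega)
    refine ⟨by omega, by omega, by omega, by omega, fun _ => ⟨by omega, by omega, by omega,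
      by omega, fun _ => ⟨by omega, fun _ => ⟨by omega, fun hlt => ⟨by omega, by omega, by omega,
        by omega, fun _ => ?_⟩, fun hge => ⟨by omega, fun _ => ⟨by omega, by omega, by omega,
        by omega, ?_⟩⟩⟩⟩⟩⟩
    · -- The target is on the ladder.
      have e4 : s.mem (base u + 1 + (idx u + x')) = (g^[x] v : Fin q) := by
        rw [hm _ (by omega), l4 _ hlt, add_comm (idx u), Function.iterate_add_apply, l1, c4]
      refine ⟨e4, k, c7, ?_⟩
      simp only [Nat.mul_add]
      omega
    · -- Continue at the top of the ladder, which is `d` steps above `u`.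
      have hd : n - 1 - idx u ≤ x' := by omega
      set d := n - 1 - idx u
      have e4 : s.mem (base u + n) = (g^[d] u : Fin q) := by
        have : base u + n = base u + 1 + (n - 1) := by omega
        rw [this, hm _ (by omega), l4 _ (by omega)]
        have : n - 1 = d + idx u := by omega
        rw [this, Function.iterate_add_apply, l1]
      have h1 : d ≤ idx (g^[d] u) := ds.growth u d (by omega)
      have h2 : (2 ^ L) ^ (k + 1) ≤ d := by
        have h3 : (2 ^ L) ^ (k + 1) ≤ 2 ^ L * (idx u + 1) := by
          rw [pow_succ, mul_comm]; exact Nat.mul_le_mul_left _ c6'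
        omega
      have h4 : L * (k + 1) < Nat.size x := by
        rw [Nat.lt_size, pow_mul]
        omega
      refine ⟨g^[d] u, e4, by omega, ?_, ?_, k + 1, Or.inr (by omega), by omega, ?_⟩
      · rw [← c4, ← Function.iterate_add_apply]
        congr 2
        omega
      · rw [ds.forest.dep_iterate _ _ (by omega)]
        omega
      · simp only [Nat.mul_add]
        split_ifs <;> omega
  · rintro _ ⟨s', ⟨u, x', k, c1, c2, c3, c4, c5, c6, c7, c8⟩, hc, hf, rfl⟩ -
    simp only [holds_lt, eval_ofNat, eval_var, c2] at hc
    have hx0 : x' = 0 := by omega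
    subst hx0
    simp at c4 c8
    simp [c1, c2, c4, Nat.mul_add]
    omega

/-! ### Configurations of a query -/

variable {m₁ m₂ : ℕ → ℕ} {M cc a o n : ℕ} {B Wf : List Bool}

/-- The setting of a query: input `B` at address `a`, output `Wf` at address `o`, initial memory
contents `m₂`, and data structure `m₁`. The number `n` bounds the length of the input string, and
symbols and `n` are at most `2 ^ M`. -/
structure QC (A : Transducer q σ) (cost : Fin q → Fin σ → ℕ) (z₀ : Fin σ) (b L MB GB D : ℕ)
    (dep : Fin q → ℕ) (root : Fin q → Fin q) (base idx : Fin q → ℕ) (m₁ m₂ : ℕ → ℕ)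
    (M cc a o n : ℕ) (B Wf : List Bool) : Prop where
  bnd : Bnd b L MB
  ds : DS A z₀ b L MB GB D dep root base idx m₁
  hz : (z₀ : ℕ) = 0
  hMb : 8 * M + 8 * L + 16 ≤ b
  hσ : σ ≤ 2 ^ M
  hn : n ≤ 2 ^ M
  hcost : ∀ v u, L * cost v u ≤ cc * (L + Nat.size u)
  Do : D ≤ o
  ra : a + B.length / b + 1 ≤ 2 ^ b
  ro : o + Wf.length / b + 1 ≤ 2 ^ b
  disj : a + B.length / b + 1 ≤ o ∨ o + Wf.length / b + 1 ≤ a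
  bits : ∀ (i : ℕ) (hi : i < B.length), (m₂ (a + i / b)).testBit (b - 1 - i % b) = B[i]
  data : ∀ x < D, m₂ x = m₁ x
  lens : 4 * B.length + 4 * Wf.length < 2 ^ b

/-- During a query, `W` has been written, `z` zeros are pending in the output, the transducer is in
state `v`, and it has still to read `rem`. The constants are in place, and only the output area has
been changed. -/
structure Core (A : Transducer q σ) (b L MB GB a o n : ℕ) (B Wf : List Bool) (m₂ : ℕ → ℕ)
    (v : Fin q) (z : ℕ) (W : List Bool) (rem : List (Fin σ)) (s : NS) : Prop where
  hB : s.reg vB = b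
  hL : s.reg vL = L
  hP : s.reg vP = 2 ^ L
  hMB : s.reg vMB = MB
  hGB : s.reg vGB = GB
  hA : s.reg vA = a
  hO : s.reg vO = o
  hLen : s.reg vLen = B.length
  hZ : s.reg vZ = z
  out : OutRep b o W s
  mem : ∀ x, x < o ∨ o + Wf.length / b + 1 ≤ x → s.mem x = m₂ x
  fin : Wf = W ++ sparseEncodingAux z (outs A v rem)
  cnt : z + rem.length ≤ n

/-- The potential of the remaining output: all its bits are counted twice, except that the token for
the `z` zeros already pending is subtracted, and so counted once. It does not increase when the
pending run grows, and when the run ends, it pays for writing its token. -/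
def outPot (A : Transducer q σ) (v : Fin q) (z : ℕ) (rem : List (Fin σ)) : ℕ :=
  2 * (sparseEncodingAux z (outs A v rem)).length - (zeroRunToken z).length

theorem Core.env {v : Fin q} {z : ℕ} {W : List Bool} {rem : List (Fin σ)} {s : NS}
    (hq : QC A cost z₀ b L MB GB D dep root base idx m₁ m₂ M cc a o n B Wf)
    (h : Core A b L MB GB a o n B Wf m₂ v z W rem s) : Env b L MB s := by
  refine ⟨h.hB, h.hL, h.hP, h.hMB, fun x hx => ?_⟩
  have h1 := hq.ds.hMB
  have h2 := hq.Do
  rw [h.mem _ (Or.inl (by omega)), hq.data _ (by omega), hq.ds.hM x hx]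

theorem Core.congr {v : Fin q} {z : ℕ} {W : List Bool} {rem : List (Fin σ)} {s s' : NS}
    (h : Core A b L MB GB a o n B Wf m₂ v z W rem s) (h1 : s'.reg vB = s.reg vB)
    (h2 : s'.reg vL = s.reg vL) (h3 : s'.reg vP = s.reg vP) (h4 : s'.reg vMB = s.reg vMB)
    (h5 : s'.reg vGB = s.reg vGB) (h6 : s'.reg vA = s.reg vA) (h7 : s'.reg vO = s.reg vO)
    (h8 : s'.reg vLen = s.reg vLen) (h9 : s'.reg vZ = s.reg vZ) (h10 : s'.reg vOw = s.reg vOw)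
    (h11 : s'.reg vR = s.reg vR) (h12 : s'.reg vAcc = s.reg vAcc) (h13 : s'.mem = s.mem) :
    Core A b L MB GB a o n B Wf m₂ v z W rem s' :=
  ⟨h1 ▸ h.hB, h2 ▸ h.hL, h3 ▸ h.hP, h4 ▸ h.hMB, h5 ▸ h.hGB, h6 ▸ h.hA, h7 ▸ h.hO, h8 ▸ h.hLen,
    h9 ▸ h.hZ, h.out.frame h10 h11 h12 h13, h13 ▸ h.mem, h.fin, h.cnt⟩

/-- Writing output decreases the potential at least by its length. -/
theorem outPot_advance {v : Fin q} {z : ℕ} {l rem : List (Fin σ)} {r : Rec}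
    (hr : r.Of (outs A v l)) :
    outPot A (run A v l) (r.pend z) rem + (r.out z).length ≤ outPot A v z (l ++ rem) := by
  have h1 := hr z (outs A (run A v l) rem)
  have h2 := zeroRunToken_le_sea (r.pend z) (outs A (run A v l) rem)
  have h3 : (zeroRunToken z).length ≤ (r.out z).length + (zeroRunToken (r.pend z)).length := by
    by_cases hW : r.wd = []
    · have := zeroRunToken_length_mono (z := z) (z' := r.pend z) (by simp [Rec.pend, hW]; omega)
      omega
    · have := zeroRunToken_length_mono (z := z) (z' := z + r.lead) (by omega)
      simp only [Rec.out, hW, if_false, List.length_append]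
      omega
  rw [outPot, outPot, outs_append, h1, List.length_append]
  omega

/-- Writing the output summary of the next part `l` of the input. -/
theorem core_apply {s : NS} {v : Fin q} {z : ℕ} {W : List Bool} {l rem : List (Fin σ)} {r : Rec}
    (hq : QC A cost z₀ b L MB GB D dep root base idx m₁ m₂ M cc a o n B Wf)
    (h : Core A b L MB GB a o n B Wf m₂ v z W (l ++ rem) s) (hs : HasRec r s)
    (hr : r.Of (outs A v l)) (hlt : r.lead + r.tz ≤ l.length) (hwl : r.wd.length ≤ b) :
    wp b A cost applyCode (fun s' =>
      Core A b L MB GB a o n B Wf m₂ (run A v l) (r.pend z) (W ++ r.out z) rem s' ∧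
      L * s'.time + 20 * outPot A (run A v l) (r.pend z) rem ≤
        L * s.time + 20 * outPot A v z (l ++ rem) + 300 * L) s := by
  have hc := h.cnt
  have hn := hq.hn
  have hMb := hq.hMb
  have hfin : Wf = W ++ r.out z ++ sparseEncodingAux (r.pend z) (outs A (run A v l) rem) := by
    rw [h.fin, outs_append, hr z, List.append_assoc]
  -- The words written so far lie within the output area.
  have hlen : (W ++ r.out z).length / b ≤ Wf.length / b := by
    apply Nat.div_le_div_right
    have := congrArg List.length hfin
    simp only [List.length_append] at this ⊢
    omega
  have hM2 : 2 ^ M < 2 ^ b := Nat.pow_lt_pow_right (by norm_num) (by omega)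
  rw [List.length_append] at hc
  have hro := hq.ro
  have hzs : Nat.size (z + r.lead) ≤ M + 1 := by
    rw [Nat.size_le, pow_succ]
    have := Nat.two_pow_pos M
    omega
  refine wp_use (apply_spec hq.bnd (h.env hq) hs h.out h.hZ (by omega) (by omega) hwl
    (by omega)) ?_
  rintro s' ⟨h1, h2, h3, h4⟩ hf
  have hpot := outPot_advance (z := z) (rem := rem) hr
  refine ⟨⟨?_, ?_, ?_, ?_, ?_, ?_, ?_, ?_, h2, h1, ?_, hfin, ?_⟩, by omega⟩
  · rw [hf.reg vB, h.hB]
  · rw [hf.reg vL, h.hL]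
  · rw [hf.reg vP, h.hP]
  · rw [hf.reg vMB, h.hMB]
  · rw [hf.reg vGB, h.hGB]
  · rw [hf.reg vA, h.hA]
  · rw [hf.reg vO, h.hO]
  · rw [hf.reg vLen, h.hLen]
  · intro x hx
    rw [h4 x (by omega), h.mem x hx]
  · rw [Rec.pend]
    split_ifs <;> omega

/-! ### One entry of the table, or one symbol -/

/-- Look up the entry for the state `vS` and the index `vI`, and write its output. -/
def lookupCode : Cmd :=
  vE ≔ vGB + 8 * (vS * (2 * vP + 1) + vI) ;;
  .ld vCb vE ;; .ld vX1 (vE + 1) ;; .ld vLead (vE + 2) ;; .ld vMv (vE + 3) ;;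
  .ld vMl (vE + 4) ;; .ld vTz (vE + 5) ;; .ld vS (vE + 6) ;; applyCode

theorem entry_addr {v i W q : ℕ} (hv : v < q) (hi : i < W) : v * W + i + 1 ≤ q * W := by
  have : (v + 1) * W ≤ q * W := Nat.mul_le_mul_right _ hv
  rw [add_mul, one_mul] at this
  omega

/-- A lookup takes constant time, up to a part that is paid by the potential of the output. -/
theorem lookup_spec {s : NS} {v : Fin q} {z i : ℕ} {W : List Bool} {l rem : List (Fin σ)} {r : Rec}
    {F : ℕ → ℕ}
    (hq : QC A cost z₀ b L MB GB D dep root base idx m₁ m₂ M cc a o n B Wf)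
    (h : Core A b L MB GB a o n B Wf m₂ v z W (l ++ rem) s) (hv : s.reg vS = v)
    (hi : s.reg vI = i) (hiP : i ≤ 2 * 2 ^ L)
    (hF : F = fun f => m₁ (GB + 8 * (v * (2 * 2 ^ L + 1) + i) + f))
    (h6 : F 6 = (run A v l : ℕ)) (h2 : F 2 = r.lead) (h3 : F 3 = bv r.wd) (h4 : F 4 = r.wd.length)
    (h5 : F 5 = r.tz)
    (hr : r.Of (outs A v l)) (hlt : r.lead + r.tz ≤ l.length) (hwl : r.wd.length ≤ b) :
    wp b A cost lookupCode (fun s' => s'.reg vCb = F 0 ∧ s'.reg vX1 = F 1 ∧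
      s'.reg vS = (run A v l : ℕ) ∧
      Core A b L MB GB a o n B Wf m₂ (run A v l) (r.pend z) (W ++ r.out z) rem s' ∧
      L * s'.time + 20 * outPot A (run A v l) (r.pend z) rem ≤
        L * s.time + 20 * outPot A v z (l ++ rem) + 400 * L) s := by
  have hD := hq.ds.hD
  have hGBD := hq.ds.hGB
  have hDo := hq.Do
  have ha : (v : ℕ) * (2 * 2 ^ L + 1) + i + 1 ≤ q * (2 * 2 ^ L + 1) :=
    entry_addr v.2 (by omega)
  set e := (v : ℕ) * (2 * 2 ^ L + 1) + i with he
  have hmem : ∀ f < 7, s.mem (GB + 8 * e + f) = F f := by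
    intro f hf
    rw [h.mem _ (Or.inl (by omega)), hq.data _ (by omega), hF]
  have e0 := hmem 0 (by omega)
  have e1 := hmem 1 (by omega)
  have e2 := hmem 2 (by omega)
  have e3 := hmem 3 (by omega)
  have e4 := hmem 4 (by omega)
  have e5 := hmem 5 (by omega)
  have e6 := hmem 6 (by omega)
  rw [h2] at e2
  rw [h3] at e3
  rw [h4] at e4
  rw [h5] at e5
  rw [h6] at e6
  rw [add_zero] at e0
  have hwW : (v : ℕ) * (2 * 2 ^ L + 1) ≤ e := by omega
  have h2L : 2 * 2 ^ L + 1 ≤ q * (2 * 2 ^ L + 1) := Nat.le_mul_of_pos_left _ v.pos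
  have hLL := Nat.two_pow_pos L
  have hMb := hq.hMb
  unfold lookupCode
  simp [h.hGB, h.hP, hv, hi, ← he, e0, e1, e2, e3, e4, e5, e6, and_assoc]
  repeat' first | refine ⟨by omega, ?_⟩ | intro _
  refine wp_use (core_apply (v := v) (z := z) (W := W) (l := l) (rem := rem) (r := r) hq
    (h.congr ?_ ?_ ?_ ?_ ?_ ?_ ?_ ?_ ?_ ?_ ?_ ?_ ?_)
    ⟨by simp, by simp, by simp, by simp⟩ hr hlt hwl) ?_
  any_goals simp
  intro s' c1 c2 hf
  have f1 := hf.reg vCb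
  have f2 := hf.reg vX1
  have f3 := hf.reg vS
  simp at f1 f2 f3
  refine ⟨f1, f2, f3, c1, ?_⟩
  simp only [Nat.mul_add] at c2 ⊢
  omega

/-- Feed the input symbol `vY` to the transducer and write its output. -/
def stepCode : Cmd :=
  vLead ≔ 0 ;; vMv ≔ 0 ;; vMl ≔ 0 ;; vTz ≔ 0 ;; .trans vS vY vS vY ;; emitCode ;; applyCode

/-- The potential pays for the bit length of the output symbol, which dominates the cost of a step
if the output symbol is large. -/
theorem step_spec {s : NS} {v : Fin q} {u : Fin σ} {z : ℕ} {W : List Bool} {rem : List (Fin σ)}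
    (hq : QC A cost z₀ b L MB GB D dep root base idx m₁ m₂ M cc a o n B Wf)
    (h : Core A b L MB GB a o n B Wf m₂ v z W (u :: rem) s) (hv : s.reg vS = v)
    (hu : s.reg vY = u) :
    wp b A cost stepCode (fun s' => s'.reg vS = ((A.step v u).1 : ℕ) ∧ ∃ z' W',
      Core A b L MB GB a o n B Wf m₂ (A.step v u).1 z' W' rem s' ∧
      outPot A (A.step v u).1 z' rem + 2 * Nat.size (A.step v u).2 ≤ outPot A v z (u :: rem) ∧
      L * s'.time + 120 * outPot A (A.step v u).1 z' rem ≤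
        L * s.time + 120 * outPot A v z (u :: rem) + 600 * L + cc * (L + Nat.size u)) s := by
  have hb := hq.bnd
  have hMb := hq.hMb
  set y := (A.step v u).2 with hy
  have hM2 : 2 ^ M < 2 ^ b := Nat.pow_lt_pow_right (by norm_num) (by omega)
  have hq2 : q < 2 ^ b := by
    have := hq.ds.nodes
    have := hq.ds.hD
    omega
  have hσ := hq.hσ
  have hys : Nat.size y ≤ M := Nat.size_le.2 (y.2.trans_le hσ)
  have hrec := Rec.of_empty.emit (y : ℕ)
  have houts : outs A v [u] = [] ++ [(y : ℕ)] := rfl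
  rw [← houts] at hrec
  have hrun : run A v [u] = (A.step v u).1 := rfl
  have hle : (Rec.empty.emit y).lead + (Rec.empty.emit y).tz ≤ 1 ∧
      (Rec.empty.emit y).wd.length = 2 * Nat.size y ∧
      2 * Nat.size y ≤ ((Rec.empty.emit y).out z).length := by
    by_cases h0 : (y : ℕ) = 0
    · simp [Rec.emit, Rec.empty, h0]
    · have := length_literalToken (Nat.pos_of_ne_zero h0)
      simp [Rec.emit, Rec.empty, Rec.out, h0, Rec.literalToken_ne_nil, this]
  obtain ⟨hle1, hle2, hle3⟩ := hle
  unfold stepCode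
  simp
  refine ⟨v, u, by simp [hv], by simp [hu], by omega, by rw [← hy]; have := y.2; omega, ?_⟩
  rw [← hy]
  refine wp_use (emit_spec (r := Rec.empty) (y := y) hb ((h.env hq).frame ?_ ?_ ?_ ?_ ?_)
    ⟨?_, ?_, ?_, ?_⟩ ?_ ?_ ?_) ?_
  any_goals simp [Rec.empty]
  · omega
  · omega
  intro s₁ c1 c2 hf
  refine wp_use (core_apply (v := v) (z := z) (W := W) (l := [u]) (rem := rem)
    (r := Rec.empty.emit y) hq (h.congr ?_ ?_ ?_ ?_ ?_ ?_ ?_ ?_ ?_ ?_ ?_ ?_ ?_) c1 hrec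
    (by simpa using hle1) (by omega)) ?_
  · simpa using hf.reg vB
  · simpa using hf.reg vL
  · simpa using hf.reg vP
  · simpa using hf.reg vMB
  · simpa using hf.reg vGB
  · simpa using hf.reg vA
  · simpa using hf.reg vO
  · simpa using hf.reg vLen
  · simpa using hf.reg vZ
  · simpa using hf.reg vOw
  · simpa using hf.reg vR
  · simpa using hf.reg vAcc
  · simpa using hf.mem
  rintro s₂ ⟨d1, d2⟩ hf₂
  rw [hrun] at d1 d2
  have g1 := hf.reg vS
  have g2 := hf₂.reg vS
  simp at g1
  have hpot := outPot_advance (z := z) (rem := rem) hrec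
  rw [hrun] at hpot
  simp only [List.singleton_append] at d2 hpot
  have hcost := hq.hcost v u
  refine ⟨by rw [g2, g1], _, ⟨_, d1⟩, by omega, ?_⟩
  simp only [Nat.mul_add] at c2 d2 hcost ⊢
  omega

/-- The configuration between two phases of a query: in addition to what `Core` says, `x` zeros
have been read but not processed, `p` input bits have been read, and the tokens `ts`, which stand
for `rem`, have not been read. -/
structure Cfg (A : Transducer q σ) (z₀ : Fin σ) (b L MB GB a o n : ℕ) (B Wf : List Bool)
    (m₂ : ℕ → ℕ) (v : Fin q) (x p z : ℕ) (rem : List (Fin σ)) (ts : List Tok) (s : NS) : Prop where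
  core : ∃ W, Core A b L MB GB a o n B Wf m₂ v z W (List.replicate x z₀ ++ rem) s
  hS : s.reg vS = v
  hX : s.reg vX = x
  hPos : s.reg vPos = p
  hp : p ≤ B.length
  pos : ∀ t ∈ ts, 0 < t.2
  bits : tbits ts = B.drop p
  exp : rem.map Fin.val = texpand ts

/-- It suffices to consider an abstract postcondition. This keeps the terms small while a program
is executed symbolically. -/
theorem wp_abs {p : Cmd} {Q : NS → Prop} {s : NS}
    (h : ∀ R : NS → Prop, (∀ s', Q s' → R s') → wp b A cost p R s) : wp b A cost p Q s :=
  h Q fun _ h => h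

theorem Core.dmem {v : Fin q} {z : ℕ} {W : List Bool} {rem : List (Fin σ)} {s : NS}
    (hq : QC A cost z₀ b L MB GB D dep root base idx m₁ m₂ M cc a o n B Wf)
    (h : Core A b L MB GB a o n B Wf m₂ v z W rem s) : ∀ x < D, s.mem x = m₁ x := by
  intro x hx
  have := hq.Do
  rw [h.mem _ (Or.inl (by omega)), hq.data _ hx]

theorem QC.nlt (hq : QC A cost z₀ b L MB GB D dep root base idx m₁ m₂ M cc a o n B Wf) :
    64 * n < 2 ^ b := by
  have h1 := hq.hMb
  have h2 := hq.hn
  have h3 : 2 ^ (M + 7) ≤ 2 ^ b := Nat.pow_le_pow_right (by norm_num) (by omega)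
  have h4 := Nat.two_pow_pos M
  rw [pow_add] at h3
  omega

theorem Core.skip {v : Fin q} {z k : ℕ} {W : List Bool} {rem : List (Fin σ)} {s s' : NS}
    (h : Core A b L MB GB a o n B Wf m₂ v z W (List.replicate k z₀ ++ rem) s)
    (ho : outs A v (List.replicate k z₀) = List.replicate k 0) (h1 : s'.reg vB = s.reg vB)
    (h2 : s'.reg vL = s.reg vL) (h3 : s'.reg vP = s.reg vP) (h4 : s'.reg vMB = s.reg vMB)
    (h5 : s'.reg vGB = s.reg vGB) (h6 : s'.reg vA = s.reg vA) (h7 : s'.reg vO = s.reg vO)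
    (h8 : s'.reg vLen = s.reg vLen) (h9 : s'.reg vZ = z + k) (h10 : s'.reg vOw = s.reg vOw)
    (h11 : s'.reg vR = s.reg vR) (h12 : s'.reg vAcc = s.reg vAcc) (h13 : s'.mem = s.mem) :
    Core A b L MB GB a o n B Wf m₂ (run A v (List.replicate k z₀)) (z + k) W rem s' := by
  refine ⟨h1 ▸ h.hB, h2 ▸ h.hL, h3 ▸ h.hP, h4 ▸ h.hMB, h5 ▸ h.hGB, h6 ▸ h.hA, h7 ▸ h.hO,
    h8 ▸ h.hLen, h9, h.out.frame h10 h11 h12 h13, h13 ▸ h.mem, ?_, ?_⟩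
  · rw [h.fin, outs_append, ho, sea_zeros]
  · have := h.cnt
    rw [List.length_append, List.length_replicate] at this
    omega

/-- Zeros of output that extend the pending run do not increase the potential. -/
theorem outPot_skip {v : Fin q} {z k : ℕ} {rem : List (Fin σ)}
    (ho : outs A v (List.replicate k z₀) = List.replicate k 0) :
    outPot A (run A v (List.replicate k z₀)) (z + k) rem ≤
      outPot A v z (List.replicate k z₀ ++ rem) := by
  have h1 := Rec.of_zeros k
  rw [← ho] at h1
  have h2 := outPot_advance (z := z) (rem := rem) h1
  simp [Rec.pend, Rec.out] at h2
  exact h2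

/-! ### Skipping zeros -/

/-- Process pending zeros as long as the output consists of zeros. -/
def skipCode : Cmd :=
  .ite (.lt 0 vX)
    (.ld vD (12 + 9 * vS) ;; .ld vRt (13 + 9 * vS) ;; .ld vO0 (11 + 9 * vRt) ;;
      .ite (.eq vO0 0) (vDd ≔ vX) (vDd ≔ vD) ;;
      .ite (.lt vDd vX) (vZ ≔ vZ + vD ;; vX ≔ vX - vD ;; vS ≔ vRt)
        (vZ ≔ vZ + vX ;;
          .ite (.lt vD vX)
            (vX ≔ vX - (vD + 1) ;; .ld vS (10 + 9 * vRt) ;; .ld vD (12 + 9 * vS) ;;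
              vX ≔ vX % (vD + 1)) .skip ;;
          climbCode)) .skip

/-- Either all pending zeros are skipped, in time `O(1 + log x / L)`, or skipping takes constant
time and ends at a state with a non-zero output. -/
theorem skip_spec {s : NS} {v : Fin q} {x p z : ℕ} {rem : List (Fin σ)} {ts : List Tok}
    (hq : QC A cost z₀ b L MB GB D dep root base idx m₁ m₂ M cc a o n B Wf)
    (h : Cfg A z₀ b L MB GB a o n B Wf m₂ v x p z rem ts s) :
    wp b A cost skipCode (fun s' => ∃ v' x' z',
      Cfg A z₀ b L MB GB a o n B Wf m₂ v' x' p z' rem ts s' ∧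
      outPot A v' z' (List.replicate x' z₀ ++ rem) ≤ outPot A v z (List.replicate x z₀ ++ rem) ∧
      ((x = 0 ∧ x' = 0 ∧ L * s'.time ≤ L * s.time + 20 * L) ∨
       (0 < x ∧ x' = 0 ∧ L * s'.time ≤ L * s.time + 200 * (L + Nat.size x)) ∨
       (0 < x' ∧ x' ≤ x ∧ ((A.step v' z₀).2 : ℕ) ≠ 0 ∧ L * s'.time ≤ L * s.time + 200 * L))) s := by
  obtain ⟨⟨W, hc⟩, hS, hX, hPos, hp, hpos, hbits, hexp⟩ := h
  have hnlt := hq.nlt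
  have hD := hq.ds.hD
  have hnodes := hq.ds.nodes
  have hcnt := hc.cnt
  have hL1 := hq.bnd.L1
  have hF := hq.ds.forest
  set g := skipStep A z₀
  have hm := hc.dmem hq
  have hbb := hq.bnd.bb
  rw [List.length_append, List.length_replicate] at hcnt
  refine wp_abs fun R hR => ?_
  by_cases hx0 : x = 0
  · subst hx0
    unfold skipCode
    simp [hX]
    refine hR _ ⟨v, 0, z, ⟨⟨W, hc.congr ?_ ?_ ?_ ?_ ?_ ?_ ?_ ?_ ?_ ?_ ?_ ?_ ?_⟩, by simpa,
      by simpa, by simpa, hp, hpos, hbits, hexp⟩, le_rfl, Or.inl ⟨rfl, rfl, ?_⟩⟩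
    any_goals simp
    simp only [Nat.mul_add]
    omega
  have e1 : s.mem (12 + 9 * v) = dep v := by rw [hm _ (by omega), hq.ds.node2]
  have e2 : s.mem (13 + 9 * v) = root v := by rw [hm _ (by omega), hq.ds.node3]
  have e3 : s.mem (11 + 9 * (root v : ℕ)) = ((A.step (root v) z₀).2 : ℕ) := by
    rw [hm _ (by omega), hq.ds.node1]
  have e4 : s.mem (10 + 9 * (root v : ℕ)) = (g (root v) : ℕ) := by
    rw [hm _ (by omega), hq.ds.node0]
  have e5 : s.mem (12 + 9 * (g (root v) : ℕ)) = dep (g (root v)) := by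
    rw [hm _ (by omega), hq.ds.node2]
  have hdl' := hq.ds.dep_lt (g (root v))
  have hrr : root (root v) = root v := by
    conv_lhs => rw [← hF.iterate_dep v]
    rw [hF.root_iterate]
  -- The effect of `x` zeros is that of `y` steps from `u`.
  have key : ∀ (s' : NS) (u : Fin q) (y : ℕ), s'.reg vS = u → s'.reg vX = y → y ≤ dep u → y ≤ x →
      g^[y] u = g^[x] v → (x ≤ dep v ∨ ((A.step (root v) z₀).2 : ℕ) = 0) →
      s'.reg vZ = z + x → s'.reg vB = s.reg vB → s'.reg vL = s.reg vL →
      s'.reg vP = s.reg vP → s'.reg vMB = s.reg vMB → s'.reg vGB = s.reg vGB →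
      s'.reg vA = s.reg vA → s'.reg vO = s.reg vO → s'.reg vLen = s.reg vLen →
      s'.reg vOw = s.reg vOw → s'.reg vR = s.reg vR → s'.reg vAcc = s.reg vAcc →
      s'.reg vPos = s.reg vPos → s'.mem = s.mem → s'.time ≤ s.time + 100 →
      wp b A cost climbCode R s' := by
    intro s' u y i1 i2 i3 i4 i5 i6 i7 j1 j2 j3 j4 j5 j6 j7 j8 j9 j10 j11 j12 j13 j14
    obtain ⟨k1, k2⟩ := hF.run_zeros x v i6
    refine wp_use (climb_spec (s := s') hL1 hq.ds (by rw [j13]; exact hm) i1 i2 i3) ?_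
    rintro s'' ⟨l1, l2, l3⟩ hf
    refine hR _ ⟨_, 0, z + x, ⟨⟨W, hc.skip k2 ?_ ?_ ?_ ?_ ?_ ?_ ?_ ?_ ?_ ?_ ?_ ?_ ?_⟩, ?_, l2, ?_,
      hp,
      hpos, hbits, hexp⟩, ?_, ?_⟩
    · rw [hf.reg vB, j1]
    · rw [hf.reg vL, j2]
    · rw [hf.reg vP, j3]
    · rw [hf.reg vMB, j4]
    · rw [hf.reg vGB, j5]
    · rw [hf.reg vA, j6]
    · rw [hf.reg vO, j7]
    · rw [hf.reg vLen, j8]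
    · rw [hf.reg vZ, i7]
    · rw [hf.reg vOw, j9]
    · rw [hf.reg vR, j10]
    · rw [hf.reg vAcc, j11]
    · rw [hf.mem, j13]
    · rw [l1, i5, k1]
    · rw [hf.reg vPos, j12, hPos]
    · exact outPot_skip k2
    · right; left
      have h1 := Nat.size_le_size i4
      have h2 : L * s'.time ≤ L * (s.time + 100) := Nat.mul_le_mul_left _ j14
      rw [Nat.mul_add] at h2
      exact ⟨by omega, rfl, by omega⟩
  unfold skipCode
  have hLb := hq.bnd.Lb
  simp [hX, hS, e1, e2, e3, e4, e5, hc.hZ, and_assoc]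
  refine ⟨fun _ => ?_, fun h => absurd h hx0⟩
  repeat' first | refine ⟨by omega, ?_⟩ | intro _
  constructor
  · intro h0
    refine ⟨by omega, fun hlt => ?_, fun hle => ?_⟩
    · -- The walk goes beyond the root. Afterwards, the number of steps is reduced modulo the length
      -- of the cycle, so that they stay within one tree.
      refine ⟨by omega, by omega, by omega, by omega, by omega, by omega, by omega, fun _ =>
        ⟨by omega, by omega, by omega, by omega, fun _ => ⟨by omega, by omega, ?_⟩⟩⟩
      have hmod : (x - (dep v + 1)) % (dep (g (root v)) + 1) < dep (g (root v)) + 1 :=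
        Nat.mod_lt _ (by omega)
      have hmod' := Nat.mod_le (x - (dep v + 1)) (dep (g (root v)) + 1)
      refine key _ (g (root v)) ((x - (dep v + 1)) % (dep (g (root v)) + 1)) ?_ ?_ ?_ ?_ ?_
        (Or.inr h0) ?_ ?_ ?_ ?_ ?_ ?_ ?_ ?_ ?_ ?_ ?_ ?_ ?_ ?_ ?_
      any_goals simp
      · omega
      · omega
      · have : x = (x - (dep v + 1)) + 1 + dep v := by omega
        conv_rhs => rw [this, Function.iterate_add_apply, hF.iterate_dep,
          Function.iterate_add_apply, Function.iterate_one]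
        exact (hF.iterate_period hrr _).symm
    · refine key _ v x ?_ ?_ hle le_rfl rfl (Or.inl hle) ?_ ?_ ?_ ?_ ?_ ?_ ?_ ?_ ?_ ?_
        ?_ ?_ ?_ ?_ ?_
      any_goals simp [hS, hX]
  · intro h0
    refine ⟨fun hlt => ⟨by omega, by omega, ?_⟩, fun hle => ⟨by omega,
      fun hlt => absurd hlt (by omega), fun _ => ?_⟩⟩
    · -- The output at the root is not zero, and the run of zeros is long enough to reach it.
      obtain ⟨k1, k2⟩ := hF.run_zeros (dep v) v (Or.inl le_rfl)
      rw [hF.iterate_dep] at k1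
      have hrep : List.replicate x z₀ ++ rem =
          List.replicate (dep v) z₀ ++ (List.replicate (x - dep v) z₀ ++ rem) := by
        rw [← List.append_assoc, List.replicate_append_replicate]
        congr 2
        omega
      rw [hrep] at hc hR
      refine hR _ ⟨root v, x - dep v, z + dep v, ⟨⟨W, ?_⟩, ?_, ?_, ?_, hp, hpos, hbits, hexp⟩, ?_,
        Or.inr (Or.inr ⟨by omega, by omega, h0, ?_⟩)⟩
      · rw [← k1]
        refine hc.skip k2 ?_ ?_ ?_ ?_ ?_ ?_ ?_ ?_ ?_ ?_ ?_ ?_ ?_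
        any_goals simp
      · simp
      · simp
      · simpa using hPos
      · have := outPot_skip (z := z) (rem := List.replicate (x - dep v) z₀ ++ rem) k2
        rwa [k1] at this
      · simp only [NS.set_time, NS.tick_time, Nat.mul_add]
        omega
    · refine key _ v x ?_ ?_ hle le_rfl rfl (Or.inl hle) ?_ ?_ ?_ ?_ ?_ ?_ ?_ ?_ ?_ ?_
        ?_ ?_ ?_ ?_ ?_
      any_goals simp [hS, hX]

/-- Process one pending zero by evaluating the transition function. -/
def zeroStepCode : Cmd := vX ≔ vX - 1 ;; vY ≔ 0 ;; stepCode

theorem zeroStep_spec {s : NS} {v : Fin q} {x p z : ℕ} {rem : List (Fin σ)} {ts : List Tok}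
    (hq : QC A cost z₀ b L MB GB D dep root base idx m₁ m₂ M cc a o n B Wf)
    (h : Cfg A z₀ b L MB GB a o n B Wf m₂ v (x + 1) p z rem ts s) :
    wp b A cost zeroStepCode (fun s' => ∃ v' z',
      Cfg A z₀ b L MB GB a o n B Wf m₂ v' x p z' rem ts s' ∧
      outPot A v' z' (List.replicate x z₀ ++ rem) + 2 * Nat.size (A.step v z₀).2 ≤
        outPot A v z (List.replicate (x + 1) z₀ ++ rem) ∧
      L * s'.time + 120 * outPot A v' z' (List.replicate x z₀ ++ rem) ≤
        L * s.time + 120 * outPot A v z (List.replicate (x + 1) z₀ ++ rem) + (700 + cc) * L) s := by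
  obtain ⟨⟨W, hc⟩, hS, hX, hPos, hp, hpos, hbits, hexp⟩ := h
  refine wp_abs fun R hR => ?_
  have hbL := hq.bnd.Lb
  have hL1 := hq.bnd.L1
  rw [List.replicate_succ, List.cons_append] at *
  unfold zeroStepCode
  simp [hX]
  refine ⟨by omega, ?_⟩
  refine wp_use (step_spec (v := v) (u := z₀) hq (hc.congr (s' := _) ?_ ?_ ?_ ?_ ?_ ?_ ?_ ?_ ?_ ?_
    ?_ ?_ ?_) ?_ ?_) ?_
  any_goals simp [hS, hq.hz]
  intro s' c1 z' W' c2 c3 c4 hf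
  have f1 := hf.reg vX
  have f2 := hf.reg vPos
  simp at f1 f2
  refine hR _ ⟨_, z', ⟨⟨W', c2⟩, c1, f1, f2.trans hPos, hp, hpos, hbits, hexp⟩, c3, ?_⟩
  simp only [Nat.mul_add, add_mul] at c4 ⊢
  omega

/-! ### One token -/

/-- Read a token; process a literal, and make a run of zeros the pending zeros. -/
def tokenCode : Cmd :=
  peekCode ;; readCode ;; vPos ≔ vPos + vTl ;;
    .ite (.eq vTy 1) (vY ≔ vU ;; stepCode) (vX ≔ vU)

theorem map_val_eq_zeros {z₀ : Fin σ} (hz : (z₀ : ℕ) = 0) {k : ℕ} {rem : List (Fin σ)} {w : List ℕ}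
    (h : rem.map Fin.val = List.replicate k 0 ++ w) :
    ∃ rem', rem = List.replicate k z₀ ++ rem' ∧ rem'.map Fin.val = w := by
  induction k generalizing rem with
  | zero => exact ⟨rem, rfl, by simpa using h⟩
  | succ k ih =>
    cases rem with
    | nil => simp [List.replicate_succ] at h
    | cons u rem =>
      rw [List.replicate_succ, List.map_cons, List.cons_append, List.cons.injEq] at h
      obtain ⟨rem', h1, h2⟩ := ih h.2
      have : u = z₀ := Fin.ext (h.1.trans hz.symm)
      exact ⟨rem', by rw [this, h1]; rfl, h2⟩

theorem lit_lt {rem : List (Fin σ)} {ts : List Tok} (h : rem.map Fin.val = texpand ts) :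
    ∀ t ∈ ts, t.1 = true → t.2 < σ := by
  intro t ht h1
  have : t.2 ∈ texpand ts := List.mem_flatMap.2 ⟨t, ht, by simp [Tok.expand, h1]⟩
  rw [← h, List.mem_map] at this
  obtain ⟨u, -, hu⟩ := this
  rw [← hu]
  exact u.2

/-- A token is read and processed in time proportional to its length, divided by `L`. The fourth
clause states that a large output symbol is paid by the potential. -/
theorem token_spec {s : NS} {v : Fin q} {p z : ℕ} {rem : List (Fin σ)} {t : Tok} {ts : List Tok}
    (hq : QC A cost z₀ b L MB GB D dep root base idx m₁ m₂ M cc a o n B Wf)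
    (h : Cfg A z₀ b L MB GB a o n B Wf m₂ v 0 p z rem (t :: ts) s) :
    wp b A cost tokenCode (fun s' => ∃ v' x' z' rem',
      Cfg A z₀ b L MB GB a o n B Wf m₂ v' x' (p + 2 * Nat.size t.2) z' rem' ts s' ∧
      x' ≤ t.2 ∧
      outPot A v' z' (List.replicate x' z₀ ++ rem') ≤ outPot A v z rem ∧
      (∀ u : Fin σ, t.1 = true → u = t.2 → outPot A v' z' (List.replicate x' z₀ ++ rem') +
        2 * Nat.size (A.step v u).2 ≤ outPot A v z rem) ∧
      L * s'.time + 120 * outPot A v' z' (List.replicate x' z₀ ++ rem') ≤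
        L * s.time + 120 * outPot A v z rem + (900 + cc) * (L + Nat.size t.2)) s := by
  obtain ⟨⟨W, hc⟩, hS, hX, hPos, hp, hpos, hbits, hexp⟩ := h
  rw [List.replicate_zero, List.nil_append] at hc
  have hb := hq.bnd.bb
  have hbL := hq.bnd.Lb
  have hL1 := hq.bnd.L1
  have hMb := hq.hMb
  have hlens := hq.lens
  have hmem := hc.mem
  have ht : 0 < t.2 := hpos t (by simp)
  have hs1 := Nat.size_pos.2 ht
  have hlen : p + 2 * Nat.size t.2 ≤ B.length ∧ t.bits = (B.drop p).take (2 * Nat.size t.2) ∧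
      tbits ts = B.drop (p + 2 * Nat.size t.2) := by
    have h1 := congrArg List.length hbits
    rw [tbits_cons, List.length_append, Tok.length_bits ht, List.length_drop] at h1
    rw [← List.drop_drop, ← hbits, tbits_cons, ← Tok.length_bits ht]
    refine ⟨?_, by simp, by simp⟩
    rw [Tok.length_bits ht]
    omega
  -- A token is short because neither the string nor its symbols are too large.
  have hsize : Nat.size t.2 ≤ M + 1 := by
    obtain ⟨c, u⟩ := t
    cases c
    · have h1 := congrArg List.length hexp
      simp [Tok.expand] at h1
      have h2 := hc.cnt
      have h3 := hq.hn
      rw [Nat.size_le, pow_succ]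
      have := Nat.two_pow_pos M
      simp only at *
      omega
    · have h1 := lit_lt hexp (true, u) (by simp) rfl
      have h3 := hq.hσ
      have : Nat.size u ≤ M := Nat.size_le.2 (by simp only at h1; omega)
      simp only
      omega
  have hin : InRep b a B s := by
    refine ⟨hc.hA, hc.hLen, fun i hi => ?_⟩
    have h1 : i / b ≤ B.length / b := Nat.div_le_div_right hi.le
    have h2 := hq.disj
    have h4 : a + i / b < o ∨ o + Wf.length / b + 1 ≤ a + i / b := by
      generalize i / b = x at *
      omega
    rw [hmem _ h4]
    exact hq.bits i hi
  refine wp_abs fun R hR => ?_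
  unfold tokenCode
  simp only [wp_seq]
  refine wp_use (peek_spec (by omega) hc.hB hin hPos hp hq.ra) ?_
  rintro s₁ ⟨c1, c2, c3⟩ hf₁
  have c4 := c2 (2 * Nat.size t.2) (by omega) hlen.1
  rw [← hlen.2.1] at c4
  obtain ⟨p1, p2, p3⟩ := token_parse (b := b) ht (V := s₁.reg vV)
    (g := s₁.reg vV % 2 ^ (b - 2 * Nat.size t.2)) (by omega) (Nat.mod_lt _ (Nat.two_pow_pos _))
    (by rw [← c4, Nat.div_add_mod'])
  have hc₁ : Core A b L MB GB a o n B Wf m₂ v z W rem s₁ :=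
    hc.congr (hf₁.reg vB) (hf₁.reg vL) (hf₁.reg vP) (hf₁.reg vMB) (hf₁.reg vGB) (hf₁.reg vA)
      (hf₁.reg vO) (hf₁.reg vLen) (hf₁.reg vZ) (hf₁.reg vOw) (hf₁.reg vR) (hf₁.reg vAcc) hf₁.mem
  refine wp_use (read_spec hq.bnd (hc₁.env hq) rfl rfl p2 (by omega) (by omega)) ?_
  rintro s₂ ⟨d1, d2, d3, -, d4⟩ hf₂
  rw [p1] at d1
  rw [p3] at d2
  have hc₂ : Core A b L MB GB a o n B Wf m₂ v z W rem s₂ :=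
    hc₁.congr (hf₂.reg vB) (hf₂.reg vL) (hf₂.reg vP) (hf₂.reg vMB) (hf₂.reg vGB) (hf₂.reg vA)
      (hf₂.reg vO) (hf₂.reg vLen) (hf₂.reg vZ) (hf₂.reg vOw) (hf₂.reg vR) (hf₂.reg vAcc) hf₂.mem
  have g1 : s₂.reg vPos = p := by rw [hf₂.reg vPos, hf₁.reg vPos, hPos]
  have g2 : s₂.reg vS = v := by rw [hf₂.reg vS, hf₁.reg vS, hS]
  have g3 : s₂.reg vX = 0 := by rw [hf₂.reg vX, hf₁.reg vX, hX]
  have g4 : p + s₂.reg vTl = p + 2 * Nat.size t.2 := by omega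
  have htm : L * s₂.time ≤ L * s.time + 160 * L + 100 * Nat.size t.2 := by
    have := Nat.mul_le_mul_left L c3
    simp only [Nat.mul_add] at this d4
    omega
  obtain ⟨ty, u⟩ := t
  simp only at *
  simp [g1, g4, d1, d2]
  refine ⟨by omega, by omega, ?_, ?_⟩
  · rintro rfl
    cases rem with
    | nil => simp [Tok.expand] at hexp
    | cons w rem =>
      simp [Tok.expand] at hexp
      refine wp_use (step_spec (v := v) (u := w) hq (hc₂.congr (s' := _) ?_ ?_ ?_ ?_ ?_ ?_ ?_ ?_ ?_
        ?_ ?_ ?_ ?_) ?_ ?_) ?_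
      any_goals simp [g2, hexp.1]
      intro s' e1 z' W' e2 e3 e4 hf
      have f1 := hf.reg vX
      have f2 := hf.reg vPos
      simp at f1 f2
      refine hR _ ⟨_, 0, z', rem, ⟨⟨W', e2⟩, e1, f1.trans g3, f2, hlen.1,
        fun t ht => hpos t (by simp [ht]), hlen.2.2, hexp.2⟩, by omega, ?_, ?_, ?_⟩
      · simp only [List.replicate_zero, List.nil_append]
        omega
      · intro u' _ hu
        have : u' = w := Fin.ext (hu.trans hexp.1.symm)
        rw [this]
        exact e3
      · simp only [List.replicate_zero, List.nil_append]
        simp only [Nat.mul_add, add_mul] at e4 ⊢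
        omega
  · rintro rfl
    simp [Tok.expand] at hexp
    obtain ⟨rem', rfl, h2⟩ := map_val_eq_zeros hq.hz hexp
    refine hR _ ⟨v, u, z, rem', ⟨⟨W, hc₂.congr ?_ ?_ ?_ ?_ ?_ ?_ ?_ ?_ ?_ ?_ ?_ ?_ ?_⟩, ?_, ?_, ?_,
      hlen.1, fun t ht => hpos t (by simp [ht]), hlen.2.2, h2⟩, le_rfl, le_rfl, ?_, ?_⟩
    any_goals simp [g2]
    simp only [Nat.mul_add, add_mul]
    omega

/-! ### Chunks of zeros and of input bits -/

/-- Process a chunk of at most `2 ^ L` pending zeros. -/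
def zerosChunkCode : Cmd :=
  .ite (.lt vX vP) (vDd ≔ vX) (vDd ≔ vP) ;; vI ≔ vP + vDd ;; lookupCode ;;
    vX ≔ vX - vDd ;; vX ≔ vX + vX1

/-- The output of a block of zeros that starts with a non-zero symbol is long. -/
theorem outPot_zeros {v : Fin q} {z k : ℕ} {rem : List (Fin σ)} {r : Rec} {l : List (Fin σ)}
    {u : Fin σ} (hr : r.Of (outs A v (u :: l))) (hv : ((A.step v u).2 : ℕ) ≠ 0)
    (hk : 2 ^ k ≤ (u :: l).length) :
    outPot A (run A v (u :: l)) (r.pend z) rem + k ≤ outPot A v z (u :: l ++ rem) := by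
  have h0 := hr 0 []
  rw [List.append_nil] at h0
  have h1 := lt_two_pow_length_sea 0 (outs A v (u :: l))
  rw [length_outs, zero_add] at h1
  -- An encoding of fewer bits stands for fewer symbols.
  have h2 : k < (sparseEncodingAux 0 (outs A v (u :: l))).length := by
    by_contra hlt
    have := Nat.pow_le_pow_right (n := 2) (by norm_num) (not_lt.1 hlt)
    omega
  -- The summary has no zeros at the front, since otherwise its encoding would start with a token
  -- for a run of zeros instead of a literal.
  have h3 : r.wd ≠ [] ∧ r.lead = 0 := by
    rw [outs_cons, sea_pos _ hv] at h0
    constructor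
    · intro hW
      simp only [Rec.out, Rec.pend, hW, if_true, sparseEncodingAux] at h0
      by_cases h : 0 + r.lead + r.tz = 0
      · rw [h] at h0
        simp [literalToken] at h0
      · rw [zeroRunToken_pos h] at h0
        simp [literalToken] at h0
    · by_contra h
      simp only [Rec.out] at h0
      split_ifs at h0 with hW
      · simp only [Rec.pend, hW, if_true, sparseEncodingAux] at h0
        rw [zeroRunToken_pos (z := 0 + r.lead + r.tz) (by omega)] at h0
        simp [literalToken] at h0
      · rw [zeroRunToken_pos (z := 0 + r.lead) (by omega)] at h0
        simp [literalToken] at h0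
  have h4 := hr z (outs A (run A v (u :: l)) rem)
  have h5 := zeroRunToken_le_sea (r.pend z) (outs A (run A v (u :: l)) rem)
  rw [outPot, outPot, outs_append, h4]
  rw [h0] at h2
  simp only [Rec.out, Rec.pend, h3.1, h3.2, if_false, add_zero, zeroRunToken_zero,
    List.nil_append, List.length_append, sparseEncodingAux] at h2 h5 ⊢
  omega

/-- Complete output of `k` bits decreases the potential by `k`. -/
theorem outPot_wd {v : Fin q} {z k : ℕ} {l rem : List (Fin σ)} {r : Rec}
    (hr : r.Of (outs A v l)) (hk : k ≤ r.wd.length) (hk0 : 0 < k) :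
    outPot A (run A v l) (r.pend z) rem + k ≤ outPot A v z (l ++ rem) := by
  have := outPot_advance (z := z) (rem := rem) hr
  have h1 : k ≤ (r.out z).length := by
    have : r.wd ≠ [] := by
      intro h
      rw [h] at hk
      simp at hk
      omega
    simp only [Rec.out, this, if_false, List.length_append]
    omega
  omega

/-- A chunk of zeros that begins with a non-zero output either is the last one, or decreases the
potential of the output by `L`, or the next output symbol is large. If the chunk consists of
`2 ^ L` zeros, then the potential decreases since the output of so many symbols is long. -/
theorem zerosChunk_spec {s : NS} {v : Fin q} {x p z : ℕ} {rem : List (Fin σ)} {ts : List Tok}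
    (hq : QC A cost z₀ b L MB GB D dep root base idx m₁ m₂ M cc a o n B Wf)
    (h : Cfg A z₀ b L MB GB a o n B Wf m₂ v x p z rem ts s)
    (hv : ((A.step v z₀).2 : ℕ) ≠ 0) :
    wp b A cost zerosChunkCode (fun s' => ∃ v' x' z',
      Cfg A z₀ b L MB GB a o n B Wf m₂ v' x' p z' rem ts s' ∧ x' ≤ x ∧
      L * s'.time + 20 * outPot A v' z' (List.replicate x' z₀ ++ rem) ≤
        L * s.time + 20 * outPot A v z (List.replicate x z₀ ++ rem) + 500 * L ∧
      outPot A v' z' (List.replicate x' z₀ ++ rem) ≤ outPot A v z (List.replicate x z₀ ++ rem) ∧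
      (x' = 0 ∨ outPot A v' z' (List.replicate x' z₀ ++ rem) + L ≤
        outPot A v z (List.replicate x z₀ ++ rem) ∨ 2 ^ L ≤ ((A.step v' z₀).2 : ℕ))) s := by
  obtain ⟨⟨W, hc⟩, hS, hX, hPos, hp, hpos, hbits, hexp⟩ := h
  have hb := hq.bnd.bb
  have hbL := hq.bnd.Lb
  have hL1 := hq.bnd.L1
  have hnlt := hq.nlt
  have hcnt := hc.cnt
  rw [List.length_append, List.length_replicate] at hcnt
  refine wp_abs fun R hR => ?_
  -- The length of the chunk.
  obtain ⟨dd, hdd⟩ : ∃ dd, dd = min x (2 ^ L) := ⟨_, rfl⟩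
  have hPb : 2 * 2 ^ L + 1 < 2 ^ b := by
    have : 2 ^ (L + 2) < 2 ^ b := Nat.pow_lt_pow_right (by norm_num) (by omega)
    rw [pow_add] at this
    have := Nat.two_pow_pos L
    omega
  have key : ∀ s₁ : NS, s₁.reg vDd = dd → s₁.mem = s.mem → (∀ v, v ≠ vDd → s₁.reg v = s.reg v) →
      s₁.time ≤ s.time + 10 →
      wp b A cost (vI ≔ vP + vDd ;; lookupCode ;; vX ≔ vX - vDd ;; vX ≔ vX + vX1) R s₁ := by
    intro s₁ i1 i2 i3 i4
    have hent := hq.ds.entry v (2 ^ L + dd) (by omega)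
    obtain ⟨F, hF⟩ : ∃ F : ℕ → ℕ, F = fun f =>
      m₁ (GB + 8 * (v * (2 * 2 ^ L + 1) + (2 ^ L + dd)) + f) := ⟨_, rfl⟩
    rw [← hF] at hent
    obtain ⟨l, r, f6, f2, f3, f4, f5, f7, f8, f9, f10, -⟩ := hent
    obtain ⟨g1, g2, g3⟩ := f10 dd rfl
    have hsplit : List.replicate x z₀ ++ rem = l ++ (List.replicate (x - dd + F 1) z₀ ++ rem) := by
      rw [g2, ← List.append_assoc, List.replicate_append_replicate]
      congr 2
      omega
    rw [hsplit] at hc hR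
    simp only [wp_seq, wp_set]
    have e1 := i3 vP (by decide)
    rw [hc.hP] at e1
    simp [e1, i1]
    refine ⟨by omega, ?_⟩
    refine wp_use (lookup_spec (v := v) (i := 2 ^ L + dd) hq (hc.congr
      (s' := _) ?_ ?_ ?_ ?_ ?_ ?_ ?_
      ?_ ?_ ?_ ?_ ?_ ?_) ?_ ?_ (by omega) hF f6 f2 f3 f4 f5 f7 f9 f8) ?_
    any_goals simp [i3, i2, hS]
    intro s' c1 c2 c3 c4 c5 hf
    have k1 := hf.reg vX
    have k2 := hf.reg vPos
    have k3 := hf.reg vDd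
    simp [i3, i1, hX] at k1 k2 k3
    rw [k1, k3, c2]
    have := hsplit
    have := congrArg List.length this
    simp at this
    refine ⟨by omega, by omega, hR _ ⟨_, _, _, ⟨⟨_, c4.congr ?_ ?_ ?_ ?_ ?_ ?_ ?_ ?_ ?_ ?_ ?_ ?_
      ?_⟩, ?_, ?_, ?_, hp, hpos, hbits, hexp⟩, ?_, ?_, ?_, ?_⟩⟩
    any_goals simp [c3, k2, hPos]
    · omega
    · have := Nat.mul_le_mul_left L i4
      simp only [Nat.mul_add] at this c5 ⊢
      omega
    · have := outPot_advance (z := z) (rem := (List.replicate (x - dd + F 1) z₀ ++ rem)) f7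
      omega
    · rcases g3 with g3 | g3 | g3
      · right; left
        exact outPot_wd f7 g3 (by omega)
      · -- All zeros of the chunk have been processed.
        by_cases hxd : x ≤ 2 ^ L
        · left
          omega
        · right; left
          rw [g3] at g2 ⊢
          have hl : l = z₀ :: List.replicate (dd - 1) z₀ := by
            rw [g2, ← List.replicate_succ]
            congr 1
            have := Nat.two_pow_pos L
            omega
          rw [hl] at f7 ⊢
          refine outPot_zeros f7 hv ?_
          rw [← hl, g2]
          simp
          omega
      · right; right
        exact g3
  unfold zerosChunkCode
  simp only [wp_seq, wp_ite]
  refine ⟨?_, fun h => ?_, fun h => ?_⟩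
  · simp
  · simp [hX, hc.hP] at h
    simp only [wp_set]
    refine ⟨by simp, key _ ?_ ?_ ?_ ?_⟩
    any_goals simp [hX]
    · omega
    · intro v hv
      simp [hv]
  · simp [hX, hc.hP] at h
    simp only [wp_set]
    refine ⟨by simp, key _ ?_ ?_ ?_ ?_⟩
    any_goals simp [hc.hP]
    · omega
    · intro v hv
      simp [hv]

/-- Process a block of at most `L` bits of the input. -/
def bitsChunkCode : Cmd :=
  peekCode ;; vDd ≔ vLen - vPos ;; .ite (.lt vL vDd) (vDd ≔ vL) .skip ;;
    vI ≔ (vV ≫≫ (vB - vDd)) ≪≪ (vL - vDd) ;; lookupCode ;;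
    vPos ≔ vPos + vCb ;; vX ≔ vX1

/-- A block of the input either decreases the potential of the output by `L`, or the output symbol
for the next pending zero is large, or no zeros are pending. In the last case, the input has ended,
or more than `L` input bits will have been read after the next token, or the next token is a literal
with a large output symbol. -/
theorem bitsChunk_spec {s : NS} {v : Fin q} {p z : ℕ} {rem : List (Fin σ)} {ts : List Tok}
    (hq : QC A cost z₀ b L MB GB D dep root base idx m₁ m₂ M cc a o n B Wf)
    (h : Cfg A z₀ b L MB GB a o n B Wf m₂ v 0 p z rem ts s) :
    wp b A cost bitsChunkCode (fun s' => ∃ v' x' p' z' rem' ts',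
      Cfg A z₀ b L MB GB a o n B Wf m₂ v' x' p' z' rem' ts' s' ∧ p ≤ p' ∧ x' ≤ 2 ^ L ∧
      L * s'.time + 20 * outPot A v' z' (List.replicate x' z₀ ++ rem') ≤
        L * s.time + 20 * outPot A v z rem + 600 * L ∧
      outPot A v' z' (List.replicate x' z₀ ++ rem') ≤ outPot A v z rem ∧
      (outPot A v' z' (List.replicate x' z₀ ++ rem') + L ≤ outPot A v z rem ∨
        (0 < x' ∧ 2 ^ L ≤ ((A.step v' z₀).2 : ℕ)) ∨
        (x' = 0 ∧ (ts' = [] ∨ ∃ t ts₃, ts' = t :: ts₃ ∧ (L < p' - p + 2 * Nat.size t.2 ∨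
          (t.1 = true ∧ ∃ u : Fin σ, (u : ℕ) = t.2 ∧
            2 ^ L ≤ ((A.step v' u).2 : ℕ))))))) s := by
  obtain ⟨⟨W, hc⟩, hS, hX, hPos, hp, hpos, hbits, hexp⟩ := h
  rw [List.replicate_zero, List.nil_append] at hc
  have hbL := hq.bnd.Lb
  have hL1 := hq.bnd.L1
  have hMb := hq.hMb
  have hlens := hq.lens
  have hmem := hc.mem
  have hin : InRep b a B s := by
    refine ⟨hc.hA, hc.hLen, fun i hi => ?_⟩
    have h1 : i / b ≤ B.length / b := Nat.div_le_div_right hi.le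
    have h2 := hq.disj
    have h4 : a + i / b < o ∨ o + Wf.length / b + 1 ≤ a + i / b := by
      generalize i / b = x at *
      omega
    rw [hmem _ h4]
    exact hq.bits i hi
  refine wp_abs fun R hR => ?_
  unfold bitsChunkCode
  rw [wp_seq]
  refine wp_use (peek_spec (by omega) hc.hB hin hPos hp hq.ra) ?_
  rintro s₁ ⟨c1, c2, c3⟩ hf₁
  have hc₁ : Core A b L MB GB a o n B Wf m₂ v z W rem s₁ :=
    hc.congr (hf₁.reg vB) (hf₁.reg vL) (hf₁.reg vP) (hf₁.reg vMB) (hf₁.reg vGB) (hf₁.reg vA)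
      (hf₁.reg vO) (hf₁.reg vLen) (hf₁.reg vZ) (hf₁.reg vOw) (hf₁.reg vR) (hf₁.reg vAcc) hf₁.mem
  have g1 : s₁.reg vPos = p := by rw [hf₁.reg vPos, hPos]
  have g2 : s₁.reg vS = v := by rw [hf₁.reg vS, hS]
  -- The number of bits that are left in the block.
  obtain ⟨m, hm⟩ : ∃ m, m = min L (B.length - p) := ⟨_, rfl⟩
  have hblock : s₁.reg vV / 2 ^ (b - m) * 2 ^ (L - m) % 2 ^ b = block L (B.drop p) ∧
      block L (B.drop p) < 2 ^ L := by
    have h1 := c2 m (by omega) (by omega)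
    have h2 : (B.drop p).take L = (B.drop p).take m := by
      rw [hm]
      rcases Nat.le_total L (B.length - p) with h | h
      · rw [min_eq_left h]
      · rw [min_eq_right h, List.take_of_length_le (by simpa using h),
          List.take_of_length_le (by simp)]
    have h3 : ((B.drop p).take m).length = m := by simp; omega
    have h4 := bv_lt ((B.drop p).take m)
    rw [h3] at h4
    rw [h1, block, h2, h3]
    have h5 : bv ((B.drop p).take m) * 2 ^ (L - m) < 2 ^ m * 2 ^ (L - m) :=
      Nat.mul_lt_mul_of_pos_right h4 (Nat.two_pow_pos _)
    rw [← pow_add, Nat.add_sub_cancel' (by omega)] at h5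
    have h6 : 2 ^ L ≤ 2 ^ b := Nat.pow_le_pow_right (by norm_num) (by omega)
    exact ⟨Nat.mod_eq_of_lt (by omega), h5⟩
  obtain ⟨i, hi⟩ : ∃ i, i = block L (B.drop p) := ⟨_, rfl⟩
  rw [← hi] at hblock
  have key : ∀ s₂ : NS, s₂.reg vDd = m → s₂.mem = s₁.mem → (∀ v, v ≠ vDd → s₂.reg v = s₁.reg v) →
      s₂.time ≤ s₁.time + 20 →
      wp b A cost (vI ≔ (vV ≫≫ (vB - vDd)) ≪≪ (vL - vDd) ;; lookupCode ;;
        vPos ≔ vPos + vCb ;; vX ≔ vX1) R s₂ := by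
    intro s₂ i1 i2 i3 i4
    have hent := hq.ds.entry v i (by omega)
    obtain ⟨F, hF⟩ : ∃ F : ℕ → ℕ, F = fun f =>
      m₁ (GB + 8 * (v * (2 * 2 ^ L + 1) + i) + f) := ⟨_, rfl⟩
    rw [← hF] at hent
    obtain ⟨l, r, f6, f2, f3, f4, f5, f7, f8, f9, -, f10⟩ := hent
    obtain ⟨g4, ts₁, ts₂, t1, t2, t3, t4⟩ := f10 hblock.2 ts
      (fun t ht => ⟨hpos t ht, lit_lt hexp t ht⟩) (by rw [hbits, hi])
    have hsplit : ∃ rem', rem = l ++ (List.replicate (F 1) z₀ ++ rem') ∧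
        rem'.map Fin.val = texpand ts₂ := by
      rw [t1, texpand_append, t2, List.append_assoc] at hexp
      obtain ⟨l₁, l₂, rfl, h1, h2⟩ := List.map_eq_append_iff.1 hexp
      obtain ⟨rem', h3, h4⟩ := map_val_eq_zeros hq.hz h2
      have : l₁ = l := List.map_injective_iff.2 Fin.val_injective h1
      exact ⟨rem', by rw [this, h3], h4⟩
    obtain ⟨rem', rfl, h2⟩ := hsplit
    have e1 := i3 vB (by decide)
    have e2 := i3 vL (by decide)
    have e3 := i3 vV (by decide)
    rw [hc₁.hB] at e1
    rw [hc₁.hL] at e2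
    have hpp : p + F 0 ≤ B.length ∧ tbits ts₂ = B.drop (p + F 0) := by
      rw [t1, tbits_append] at hbits
      have h1 := congrArg List.length hbits
      rw [List.length_append, List.length_drop, ← t3] at h1
      rw [← List.drop_drop, ← hbits, t3]
      refine ⟨by omega, by simp⟩
    simp only [wp_seq, wp_set]
    simp [e1, e2, e3, i1, hblock.1]
    refine ⟨by omega, ?_⟩
    refine wp_use (lookup_spec (v := v) (i := i) hq (hc₁.congr (s' := _) ?_ ?_ ?_ ?_ ?_ ?_ ?_
      ?_ ?_ ?_ ?_ ?_ ?_) ?_ ?_ (by omega) hF f6 f2 f3 f4 f5 f7 f9 f8) ?_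
    any_goals simp [i3, i2, g2, hc₁.hB, hc₁.hL]
    intro s' d1 d2 d3 d4 d5 hf
    have k2 := hf.reg vPos
    simp [i3, g1] at k2
    rw [k2, d1, d2]
    have hpot := outPot_advance (z := z) (rem := List.replicate (F 1) z₀ ++ rem') f7
    refine ⟨by omega, hR _ ⟨_, F 1, p + F 0, _, rem', ts₂, ⟨⟨_, d4.congr ?_ ?_ ?_ ?_ ?_ ?_ ?_ ?_ ?_
      ?_ ?_ ?_ ?_⟩, ?_, ?_, ?_, hpp.1, fun t ht => hpos t (by rw [t1]; simp [ht]), hpp.2, h2⟩,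
      by omega, g4, ?_, ?_, ?_⟩⟩
    any_goals simp [d3]
    · have h5 := Nat.mul_le_mul_left L c3
      have h6 := Nat.mul_le_mul_left L i4
      simp only [Nat.mul_add] at h5 h6 d5 ⊢
      omega
    · omega
    · rcases t4 with t4 | t4 | t4
      · left
        exact outPot_wd f7 t4 (by omega)
      · right; left
        exact t4
      · right; right
        simpa using t4
  rw [wp_seq, wp_set, wp_seq, wp_ite]
  refine ⟨by simpa [g1, hc₁.hLen] using hp, by simp, fun h => ?_, fun h => ?_⟩
  · simp [g1, hc₁.hLen, hc₁.hL] at h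
    rw [wp_set]
    refine ⟨by simp, key _ ?_ ?_ ?_ ?_⟩
    any_goals simp [hc₁.hL]
    · omega
    · intro v hv
      simp [hv]
  · simp [g1, hc₁.hLen, hc₁.hL] at h
    rw [wp_skip]
    refine key _ ?_ ?_ ?_ ?_
    any_goals simp [g1, hc₁.hLen]
    · omega
    · intro v hv
      simp [hv]

theorem Cfg.tick {v : Fin q} {x p z : ℕ} {rem : List (Fin σ)} {ts : List Tok} {s : NS}
    (h : Cfg A z₀ b L MB GB a o n B Wf m₂ v x p z rem ts s) (t : ℕ) :
    Cfg A z₀ b L MB GB a o n B Wf m₂ v x p z rem ts (s.tick t) := by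
  obtain ⟨⟨W, hc⟩, hS, hX, hPos, hp, hpos, hbits, hexp⟩ := h
  exact ⟨⟨W, hc.congr rfl rfl rfl rfl rfl rfl rfl rfl rfl rfl rfl rfl rfl⟩, hS, hX, hPos, hp, hpos,
    hbits, hexp⟩

/-! ### The potential argument -/

/-- Process pending zeros, then a chunk by means of the table, then a symbol or a token without
the table. -/
def iterCode : Cmd :=
  skipCode ;; .ite (.lt 0 vX)
    (zerosChunkCode ;; .ite (.lt 0 vX) zeroStepCode .skip)
    (bitsChunkCode ;; .ite (.lt 0 vX) zeroStepCode (.ite (.lt vPos vLen) tokenCode .skip))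

/-- The credit for skipping `x` pending zeros. It is put aside when the run of zeros is read. -/
def credit (L x : ℕ) : ℕ := if x = 0 then 0 else L + Nat.size x

/-- The time, multiplied by `L`, plus the potential of the remaining input (`len - p` bits), of the
remaining output, and the credit. -/
def pot (A : Transducer q σ) (z₀ : Fin σ) (L k len : ℕ) (v : Fin q) (x p z : ℕ)
    (rem : List (Fin σ)) (t : ℕ) : ℕ :=
  L * t + 25 * (k * (len - p)) + 25 * (k * outPot A v z (List.replicate x z₀ ++ rem)) +
    5 * (k * credit L x)

theorem credit_mono {x y : ℕ} (h : x ≤ y) : credit L x ≤ credit L y := by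
  have := Nat.size_le_size h
  unfold credit
  split_ifs <;> omega

theorem credit_le {x : ℕ} : credit L x ≤ L + Nat.size x := by
  unfold credit
  split_ifs <;> omega

/-- A time bound with the potential `120 * O` implies one with `25 * k * O`, where a decrease of `O`
by `δ` leaves `24 * k * δ` for other expenses. -/
theorem scale_le {T T' O O' E k δ : ℕ} (hk : 120 ≤ k) (h : T' + 120 * O' ≤ T + 120 * O + E)
    (hδ : O' + δ ≤ O) : T' + 25 * (k * O') + 24 * (k * δ) ≤ T + 25 * (k * O) + E := by
  obtain ⟨e, rfl⟩ := Nat.exists_eq_add_of_le hk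
  obtain ⟨f, rfl⟩ := Nat.exists_eq_add_of_le hδ
  nlinarith [Nat.zero_le (e * f), Nat.zero_le (e * δ)]

/-- In every iteration but the last one, the sum of time and potential decreases by at least
`k * L`. -/
theorem iter_spec {s : NS} {v : Fin q} {x p z : ℕ} {rem : List (Fin σ)} {ts : List Tok} {k : ℕ}
    (hk : k = 1000 + cc)
    (hq : QC A cost z₀ b L MB GB D dep root base idx m₁ m₂ M cc a o n B Wf)
    (h : Cfg A z₀ b L MB GB a o n B Wf m₂ v x p z rem ts s) :
    wp b A cost iterCode (fun s' => ∃ v' x' p' z' rem' ts',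
      Cfg A z₀ b L MB GB a o n B Wf m₂ v' x' p' z' rem' ts' s' ∧
      (pot A z₀ L k B.length v' x' p' z' rem' s'.time + k * L ≤
        pot A z₀ L k B.length v x p z rem s.time ∨
      (x' = 0 ∧ p' = B.length ∧ pot A z₀ L k B.length v' x' p' z' rem' s'.time ≤
        pot A z₀ L k B.length v x p z rem s.time + 10 * (k * L)))) s := by
  have hL1 := hq.bnd.L1
  have hkL : 1000 * L + cc * L = k * L := by rw [hk]; ring
  refine wp_abs fun R hR => ?_
  unfold iterCode
  rw [wp_seq]
  refine wp_use (skip_spec hq h) ?_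
  rintro s₁ ⟨v₁, x₁, z₁, h₁, o₁, c₁⟩ -
  have o₁' := Nat.mul_le_mul_left k o₁
  rw [wp_ite]
  refine ⟨by simp, fun hx => ?_, fun hx => ?_⟩
  · simp [h₁.hX] at hx
    -- Zeros are still pending, so the output at the current state is not zero.
    obtain ⟨-, hx1, hv, -⟩ := (c₁.resolve_left (by omega)).resolve_left (by omega)
    rw [wp_seq]
    refine wp_use (zerosChunk_spec hq (h₁.tick _) hv) ?_
    rintro s₂ ⟨v₂, x₂, z₂, h₂, hx2, t₂, o₂, c₂⟩ -
    have hcr : credit L x = L + Nat.size x := by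
      rw [credit, if_neg (by omega)]
    rw [wp_ite]
    simp only [NS.tick_time, Nat.mul_add] at t₂
    simp at t₂
    refine ⟨by simp, fun hx' => ?_, fun hx' => ?_⟩
    · simp [h₂.hX] at hx'
      obtain ⟨y, rfl⟩ : ∃ y, x₂ = y + 1 := ⟨x₂ - 1, by omega⟩
      refine wp_use (zeroStep_spec hq (h₂.tick _)) ?_
      rintro s₃ ⟨v₃, z₃, h₃, o₃, t₃⟩ -
      have hcy := Nat.mul_le_mul_left k (credit_mono (L := L) (show y ≤ x by omega))
      -- The chunk or the step has produced `L` bits of output.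
      have hδ : outPot A v₃ z₃ (List.replicate y z₀ ++ rem) + L ≤
          outPot A v₁ z₁ (List.replicate x₁ z₀ ++ rem) := by
        rcases c₂ with c₂ | c₂ | c₂
        · omega
        · omega
        · have := Nat.lt_size.2 c₂
          omega
      simp only [NS.tick_time, Nat.mul_add, add_mul] at t₃
      simp at t₃
      have hs := scale_le (k := k) (T := L * s.time) (T' := L * s₃.time) (E := 2000 * L + cc * L)
        (by omega) (by omega) hδ
      refine hR _ ⟨v₃, y, p, z₃, rem, ts, h₃, Or.inl ?_⟩
      unfold pot
      omega
    · -- No zeros are left, so the credit of the run pays.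
      simp [h₂.hX] at hx'
      subst hx'
      have hs := scale_le (k := k) (T := L * s.time) (T' := L * s₂.time) (E := 1000 * L) (δ := 0)
        (O' := outPot A v₂ z₂ (List.replicate 0 z₀ ++ rem))
        (O := outPot A v₁ z₁ (List.replicate x₁ z₀ ++ rem)) (by omega) (by omega) (by omega)
      simp only [List.replicate_zero, List.nil_append] at hs
      rw [wp_skip]
      refine hR _ ⟨v₂, 0, p, z₂, rem, ts, h₂.tick _, Or.inl ?_⟩
      unfold pot
      rw [hcr]
      simp only [NS.tick_time, Nat.mul_add, credit, if_true]
      simp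
      omega
  · simp [h₁.hX] at hx
    subst hx
    -- All pending zeros have been skipped, which is paid by the credit.
    have ht1 : L * s₁.time ≤ L * s.time + 5 * (k * credit L x) + 20 * L := by
      rcases c₁ with c₁ | c₁ | c₁
      · omega
      · rw [credit, if_neg (by omega)]
        have : (200 : ℕ) * (L + Nat.size x) ≤ k * (L + Nat.size x) :=
          Nat.mul_le_mul_right _ (by omega)
        omega
      · omega
    rw [wp_seq]
    refine wp_use (bitsChunk_spec hq (h₁.tick _)) ?_
    rintro s₂ ⟨v₂, x₂, p₂, z₂, rem₂, ts₂, h₂, hp2, hx2, t₂, o₂, c₂⟩ -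
    simp only [List.replicate_zero, List.nil_append] at o₁ o₁'
    simp only [NS.tick_time, Nat.mul_add] at t₂
    simp at t₂
    have hp2' := h₂.hp
    rw [wp_ite]
    refine ⟨by simp, fun hx' => ?_, fun hx' => ?_⟩
    · simp [h₂.hX] at hx'
      obtain ⟨y, rfl⟩ : ∃ y, x₂ = y + 1 := ⟨x₂ - 1, by omega⟩
      refine wp_use (zeroStep_spec hq (h₂.tick _)) ?_
      rintro s₃ ⟨v₃, z₃, h₃, o₃, t₃⟩ -
      -- The output pays for the new credit, because the run that the block leaves is short.
      have hcy : credit L y ≤ 3 * L := by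
        have h1 : Nat.size y ≤ L := Nat.size_le.2 (by omega)
        have := credit_le (L := L) (x := y)
        omega
      have hcy := Nat.mul_le_mul_left k hcy
      have hδ : outPot A v₃ z₃ (List.replicate y z₀ ++ rem₂) + L ≤ outPot A v₁ z₁ rem := by
        rcases c₂ with c₂ | c₂ | c₂
        · omega
        · have := Nat.lt_size.2 c₂.2
          omega
        · omega
      simp only [NS.tick_time, Nat.mul_add, add_mul] at t₃
      simp at t₃
      have hs := scale_le (k := k) (T := L * s₁.time) (T' := L * s₃.time) (E := 2000 * L + cc * L)
        (by omega) (by omega) hδ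
      have hpp : k * (B.length - p₂) ≤ k * (B.length - p) := Nat.mul_le_mul_left _ (by omega)
      refine hR _ ⟨v₃, y, p₂, z₃, rem₂, ts₂, h₃, Or.inl ?_⟩
      unfold pot
      rw [Nat.mul_left_comm] at hcy
      omega
    · simp [h₂.hX] at hx'
      subst hx'
      have h2pos := h₂.hPos
      obtain ⟨W₂, hc₂⟩ := h₂.core
      rw [wp_ite]
      refine ⟨by simp, fun hlt => ?_, fun hge => ?_⟩
      · simp [h2pos, hc₂.hLen] at hlt
        obtain ⟨t, ts₃, rfl⟩ : ∃ t ts₃, ts₂ = t :: ts₃ := by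
          cases ts₂ with
          | nil =>
            have := congrArg List.length h₂.bits
            simp at this
            omega
          | cons t ts₃ => exact ⟨_, _, rfl⟩
        refine wp_use (token_spec hq ((h₂.tick _).tick _)) ?_
        rintro s₃ ⟨v₃, x₃, z₃, rem₃, h₃, hx3, o₃, o₃', t₃⟩ -
        simp only [NS.tick_time, Nat.mul_add, add_mul] at t₃
        simp at t₃ o₂
        have hp3 := h₃.hp
        -- The length of the token pays for the new credit, except for `L`.
        have hcy : credit L x₃ ≤ L + Nat.size t.2 := by
          have h1 := Nat.size_le_size hx3
          have := credit_le (L := L) (x := x₃)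
          omega
        have hcy := Nat.mul_le_mul_left k hcy
        have hks : 1000 * Nat.size t.2 + cc * Nat.size t.2 = k * Nat.size t.2 := by rw [hk]; ring
        have hpp : k * (B.length - (p₂ + 2 * Nat.size t.2)) + k * (p₂ - p + 2 * Nat.size t.2) =
            k * (B.length - p) := by
          rw [← mul_add]
          congr 1
          omega
        rw [mul_add k] at hcy
        have hpp1 : 2 * (k * Nat.size t.2) ≤ k * (p₂ - p + 2 * Nat.size t.2) := by
          rw [Nat.mul_left_comm]
          exact Nat.mul_le_mul_left _ (by omega)
        refine hR _ ⟨v₃, x₃, p₂ + 2 * Nat.size t.2, z₃, rem₃, ts₃, h₃, Or.inl ?_⟩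
        unfold pot
        simp only [List.replicate_zero, List.nil_append] at *
        by_cases hδ : outPot A v₃ z₃ (List.replicate x₃ z₀ ++ rem₃) + L ≤ outPot A v₁ z₁ rem
        · have hs := scale_le (k := k) (T := L * s₁.time) (T' := L * s₃.time)
            (E := 2000 * L + cc * L + 900 * Nat.size t.2 + cc * Nat.size t.2)
            (by omega) (by omega) hδ
          omega
        · have hs := scale_le (k := k) (T := L * s₁.time) (T' := L * s₃.time)
            (E := 2000 * L + cc * L + 900 * Nat.size t.2 + cc * Nat.size t.2) (δ := 0)
            (O' := outPot A v₃ z₃ (List.replicate x₃ z₀ ++ rem₃)) (O := outPot A v₁ z₁ rem)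
            (by omega) (by omega) (by omega)
          -- If not the output, then block and token of the input contain `L` bits.
          have hpp2 : k * L ≤ k * (p₂ - p + 2 * Nat.size t.2) := by
            apply Nat.mul_le_mul_left
            rcases c₂ with c₂ | c₂ | c₂
            · omega
            · omega
            · obtain ⟨-, c₂ | ⟨t', ts', e, c₂⟩⟩ := c₂
              · simp at c₂
              · obtain ⟨rfl, rfl⟩ := List.cons.inj e
                rcases c₂ with c₂ | ⟨c1, u, c2, c3⟩
                · omega
                · have := o₃' u c1 c2
                  have := Nat.lt_size.2 c3
                  omega
          omega
      · -- The input has ended.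
        simp [h2pos, hc₂.hLen] at hge
        rw [wp_skip]
        have hpB : p₂ = B.length := by omega
        have hs := scale_le (k := k) (T := L * s₁.time) (T' := L * s₂.time) (E := 1000 * L) (δ := 0)
          (O' := outPot A v₂ z₂ (List.replicate 0 z₀ ++ rem₂)) (O := outPot A v₁ z₁ rem)
          (by omega) (by omega) (by omega)
        have hpp : k * (B.length - p₂) ≤ k * (B.length - p) := Nat.mul_le_mul_left _ (by omega)
        refine hR _ ⟨v₂, 0, p₂, z₂, rem₂, ts₂, (h₂.tick _).tick _, Or.inr ⟨rfl, hpB, ?_⟩⟩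
        unfold pot
        simp only [NS.tick_time, Nat.mul_add, credit, if_true, List.replicate_zero,
          List.nil_append] at *
        simp at *
        omega

/-! ### The end of a query -/

/-- Write the pending zeros and the last, incomplete word. -/
def flushCode : Cmd :=
  vSy ≔ vZ ;; sizeCode ;; vPv ≔ vZ ;; vPl ≔ vSz + vSz ;; putCode ;; .st vOw vAcc ;;
    vR0 ≔ (vOw - vO) * vB + vR

/-- The bit string `W` is stored at address `o`. -/
def BitsAt (b o : ℕ) (W : List Bool) (m : ℕ → ℕ) : Prop :=
  ∀ (i : ℕ) (hi : i < W.length), (m (o + i / b)).testBit (b - 1 - i % b) = W[i]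

theorem testBit_word {l : List Bool} {i m : ℕ} (hm : l.length = m) (hl : m ≤ b)
    (hi : i < l.length) : (bv l * 2 ^ (b - m)).testBit (b - 1 - i) = l[i] := by
  subst hm
  rw [mul_comm, Nat.testBit_two_pow_mul, ← testBit_bv l i hi]
  have : b - 1 - i - (b - l.length) = l.length - 1 - i := by omega
  rw [this]
  simp
  intro h
  omega

theorem bitsAt_of_outRep {s : NS} {W : List Bool} (hb : 0 < b) (h : OutRep b o W s) :
    BitsAt b o W (Function.update s.mem (o + W.length / b) (s.reg vAcc)) := by
  intro i hi
  have hm : i % b < b := Nat.mod_lt _ hb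
  have hd := Nat.div_add_mod' i b
  have hdW := Nat.div_add_mod' W.length b
  have hle : i / b ≤ W.length / b := Nat.div_le_div_right hi.le
  rcases hle.lt_or_eq with hlt | heq
  · have h1 : (i / b + 1) * b ≤ W.length / b * b := Nat.mul_le_mul_right _ hlt
    rw [add_mul, one_mul] at h1
    rw [Function.update_of_ne (by omega), h.full _ hlt]
    have h2 : ((W.drop (i / b * b)).take b).length = b := by simp; omega
    have h3 := testBit_word (b := b) (l := (W.drop (i / b * b)).take b) (i := i % b) h2 le_rfl
      (by omega)
    rw [Nat.sub_self, pow_zero, mul_one] at h3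
    rw [h3]
    simp [hd]
  · rw [heq, Function.update_self, h.acc]
    have h2 : (W.drop (W.length / b * b)).length = W.length % b := by simp; omega
    have h3 := testBit_word (b := b) (l := W.drop (W.length / b * b)) (i := i % b)
      h2 (Nat.mod_lt _ hb).le (by rw [h2]; rw [heq] at hd; omega)
    rw [h3]
    simp [← heq, hd]

theorem flush_spec {s : NS} {v : Fin q} {z : ℕ} {W : List Bool}
    (hq : QC A cost z₀ b L MB GB D dep root base idx m₁ m₂ M cc a o n B Wf)
    (h : Core A b L MB GB a o n B Wf m₂ v z W [] s) :
    wp b A cost flushCode (fun s' => BitsAt b o Wf s'.mem ∧ s'.reg vR0 = Wf.length ∧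
      (∀ x, x < o ∨ o + Wf.length / b + 1 ≤ x → s'.mem x = m₂ x) ∧
      L * s'.time ≤ L * s.time + 200 * L + 20 * Wf.length) s := by
  have hb := hq.bnd.bb
  have hL1 := hq.bnd.L1
  have hMb := hq.hMb
  have hro := hq.ro
  have hlens := hq.lens
  have hcnt := h.cnt
  have hn := hq.hn
  have hfin := h.fin
  simp only [outs_nil, sparseEncodingAux] at hfin
  have hzs : Nat.size z ≤ M + 1 := by
    rw [Nat.size_le, pow_succ]
    have := Nat.two_pow_pos M
    omega
  have hzl : 2 * Nat.size z ≤ Wf.length := by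
    have := congrArg List.length hfin
    rw [List.length_append, length_zeroRunToken] at this
    omega
  refine wp_abs fun R hR => ?_
  unfold flushCode
  simp only [wp_seq]
  rw [wp_set]
  refine ⟨by simp, ?_⟩
  refine wp_use (size_spec (y := z) hq.bnd ((h.env hq).frame ?_ ?_ ?_ ?_ ?_) ?_ (by omega)) ?_
  any_goals simp
  · exact h.hZ
  intro s₁ c1 c2 hf
  have e1 := hf.reg vZ
  have e2 := hf.reg vB
  have e3 := hf.reg vOw
  have e4 := hf.reg vR
  have e5 := hf.reg vAcc
  have e6 := hf.mem
  have e7 := hf.reg vO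
  simp [h.hZ, h.hB, h.hO] at e1 e2 e3 e4 e5 e6 e7
  rw [e1, c1]
  refine ⟨by omega, ?_⟩
  refine wp_use (put_spec (o := o) (W := W) (l := zeroRunToken z) (by omega) ?_
    (h.out.frame ?_ ?_ ?_ ?_) ?_ ?_ ?_ ?_ hb) ?_
  any_goals simp [e2, e3, e4, e5, e6, bv_zeroRunToken]
  · omega
  · omega
  · have := congrArg List.length hfin
    rw [List.length_append, length_zeroRunToken] at this
    rw [← this]
    omega
  rw [← hfin]
  intro s₂ d1 d2 d3 hf₂
  have g1 := hf₂.reg vO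
  have g2 := hf₂.reg vB
  simp [e7, e2] at g1 g2
  have g3 := Nat.div_add_mod' Wf.length b
  have g4 := bitsAt_of_outRep (by omega) d1
  have g5 := d1.ow
  have g8 : o ≤ s₂.reg vOw := by rw [g5]; exact Nat.le_add_right _ _
  have g6 : s₂.reg vOw - o = Wf.length / b := by omega
  rw [d1.r, g1, g2, g6, g3]
  refine ⟨by omega, ⟨⟨by omega, by omega⟩, by omega⟩, hR _ ⟨?_, ?_, ?_, ?_⟩⟩
  · rw [g5]
    simpa using g4
  · simp
  · intro x hx
    simp only [NS.put_mem, NS.tick_mem, NS.set_mem]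
    rw [g5, Function.update_of_ne (by omega), ← h.mem x hx]
    refine d3 x ?_
    have := congrArg List.length hfin
    rw [List.length_append, length_zeroRunToken] at this
    rw [← this]
    omega
  · have h1 := Nat.mul_le_mul_left L d2
    simp only [NS.put_time, NS.tick_time, NS.set_time, Nat.mul_add] at h1 c2 ⊢
    omega

/-! ### The whole query -/

/-- The program that processes queries. -/
def queryCode : Cmd :=
  .ite (.eq vR1 0) (vR0 ≔ 0)
    (vA ≔ vR0 ;; vLen ≔ vR1 ;; vO ≔ vR2 ;;
      .ld vB 0 ;; .ld vL 1 ;; .ld vP 2 ;; .ld vMB 3 ;; .ld vGB 4 ;; .ld vS 5 ;;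
      vX ≔ 0 ;; vZ ≔ 0 ;; vPos ≔ 0 ;; vR ≔ 0 ;; vAcc ≔ 0 ;; vOw ≔ vO ;;
      .loop (.lt vPos (vLen + vX)) iterCode ;; flushCode)

/-- The initial potential is proportional to the length of input and output, and it bounds the
time of all iterations. -/
theorem query_spec {s : NS} {S : List (Fin σ)}
    (hq : QC A cost z₀ b L MB GB D dep root base idx m₁ m₂ M cc a o n B Wf)
    (hB : B = sparseEncoding (S.map Fin.val)) (hW : Wf = sparseEncoding (outs A A.init S))
    (hn : S.length ≤ n) (h0 : s.reg vR0 = a) (h1 : s.reg vR1 = B.length) (h2 : s.reg vR2 = o)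
    (hm : s.mem = m₂) (hB0 : B ≠ []) :
    wp b A cost queryCode (fun s' => BitsAt b o Wf s'.mem ∧ s'.reg vR0 = Wf.length ∧
      (∀ x, x < o ∨ o + Wf.length / b + 1 ≤ x → s'.mem x = m₂ x) ∧
      L * s'.time ≤ L * s.time + 100 * ((1000 + cc) * (L + B.length + Wf.length))) s := by
  have hb := hq.bnd.bb
  have hbL := hq.bnd.Lb
  have hL1 := hq.bnd.L1
  have hlens := hq.lens
  have hD := hq.ds.hD
  have hnodes := hq.ds.nodes
  obtain ⟨ts, t1, t2, t3⟩ := exists_tokens (S.map Fin.val)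
  obtain ⟨k, hk⟩ : ∃ k, k = 1000 + cc := ⟨_, rfl⟩
  have e : ∀ x < 6, s.mem x = m₁ x := fun x hx => by rw [hm, hq.data _ (by omega)]
  have e0 := e 0 (by omega)
  have e1 := e 1 (by omega)
  have e2 := e 2 (by omega)
  have e3 := e 3 (by omega)
  have e4 := e 4 (by omega)
  have e5 := e 5 (by omega)
  rw [hq.ds.h0] at e0
  rw [hq.ds.h1] at e1
  rw [hq.ds.h2] at e2
  rw [hq.ds.h3] at e3
  rw [hq.ds.h4] at e4
  rw [hq.ds.h5] at e5
  refine wp_abs fun R hR => ?_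
  unfold queryCode
  rw [wp_ite]
  refine ⟨by simp, fun h => ?_, fun _ => ?_⟩
  · simp [h1] at h
    exact absurd h hB0
  simp only [wp_seq, wp_set, wp_ld]
  simp [h0, h1, h2, e0, e1, e2, e3, e4, e5]
  intro _
  refine ⟨by omega, fun _ => ⟨by omega, fun _ => ⟨by omega, fun _ => ⟨by omega, fun _ => ⟨by omega,
    fun _ => ?_⟩⟩⟩⟩⟩
  -- The initial potential.
  have hP0 : 25 * (k * B.length) + 25 * (k * outPot A A.init 0 S) ≤
      25 * (k * (B.length + 2 * Wf.length)) := by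
    rw [← mul_add, ← mul_add]
    refine Nat.mul_le_mul_left _ (Nat.mul_le_mul_left _ ?_)
    rw [outPot, hW, sparseEncoding]
    omega
  -- The second alternative holds after the last iteration.
  refine wp_use (wp_while (fun s' => ∃ v x p z rem ts,
      Cfg A z₀ b L MB GB a o n B Wf m₂ v x p z rem ts s' ∧
      (pot A z₀ L k B.length v x p z rem s'.time ≤
          L * (s.time + 40) + 25 * (k * (B.length + 2 * Wf.length)) ∨
        (x = 0 ∧ p = B.length ∧ pot A z₀ L k B.length v x p z rem s'.time ≤
          L * (s.time + 40) + 25 * (k * (B.length + 2 * Wf.length)) + 11 * (k * L))))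
    (L * (s.time + 40) + 25 * (k * (B.length + 2 * Wf.length)) + 11 * (k * L)) ?_ ?_ ?_ ?_) ?_
  · refine ⟨A.init, 0, 0, 0, S, ts, ⟨⟨[], ?_⟩, ?_, ?_, ?_, Nat.zero_le _, t1, ?_, t3.symm⟩,
      Or.inl ?_⟩
    · rw [List.replicate_zero, List.nil_append]
      refine ⟨?_, ?_, ?_, ?_, ?_, ?_, ?_, ?_, ?_, ⟨?_, ?_, ?_, ?_⟩, ?_, ?_, ?_⟩
      any_goals simp
      · intro x _
        rw [hm]
      · exact hW
      · exact hn
    · simp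
    · simp
    · simp
    · rw [t2, hB, List.drop_zero]
    · simp only [pot, NS.tick_time, NS.set_time, Nat.mul_add, List.replicate_zero, List.nil_append,
        credit, Nat.sub_zero, if_true] at hP0 ⊢
      omega
  · rintro s' ⟨v, x, p, z, rem, ts, -, h⟩
    have h1 : L * s'.time ≤ pot A z₀ L k B.length v x p z rem s'.time := by
      unfold pot
      omega
    have := Nat.le_mul_of_pos_left s'.time hL1
    omega
  · rintro s' ⟨v, x, p, z, rem, ts, h, -⟩ -
    obtain ⟨W, hc⟩ := h.core
    have h1 := hc.cnt
    have h2 := hq.nlt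
    rw [List.length_append, List.length_replicate] at h1
    simp [hc.hLen, h.hX]
    omega
  · rintro s' ⟨v, x, p, z, rem, ts, h, hp⟩ - hc
    obtain ⟨W, hco⟩ := h.core
    simp [h.hPos, hco.hLen, h.hX] at hc
    have hp := hp.resolve_right (by omega)
    refine wp_use (iter_spec hk hq (h.tick _)) ?_
    rintro s'' ⟨v', x', p', z', rem', ts', h', hp'⟩ -
    have hkL : 1000 * L ≤ k * L := Nat.mul_le_mul_right _ (by omega)
    refine ⟨v', x', p', z', rem', ts', h', ?_⟩
    have h3 : ∀ t, pot A z₀ L k B.length v x p z rem (s'.time + t) =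
        pot A z₀ L k B.length v x p z rem s'.time + L * t := by
      intro t
      unfold pot
      rw [Nat.mul_add]
      omega
    rw [NS.tick_time, h3] at hp'
    simp at hp'
    omega
  · rintro _ ⟨s', ⟨v, x, p, z, rem, ts, h, hp⟩, hc, hf, rfl⟩ -
    obtain ⟨W, hco⟩ := h.core
    simp [h.hPos, hco.hLen, h.hX] at hc
    have hpB := h.hp
    have hts : ts = [] := by
      cases ts with
      | nil => rfl
      | cons t ts =>
        have h1 := congrArg List.length h.bits
        rw [tbits_cons, List.length_append, Tok.length_bits (h.pos t (by simp)),
          List.length_drop] at h1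
        have := Nat.size_pos.2 (h.pos t (by simp))
        omega
    have hx : x = 0 := by omega
    have hrem : rem = [] := by
      have := h.exp
      rw [hts] at this
      simpa using this
    subst hx hrem
    refine wp_use (flush_spec (v := v) (z := z) (W := W) hq (hco.congr ?_ ?_ ?_ ?_ ?_ ?_ ?_ ?_ ?_ ?_
      ?_ ?_ ?_)) ?_
    any_goals simp
    intro s'' f1 f2 f3 f4 _
    refine hR _ ⟨f1, f2, f3, ?_⟩
    have h1 : L * s'.time ≤ pot A z₀ L k B.length v 0 p z [] s'.time := by
      unfold pot
      omega
    have hkL : 1000 * L ≤ k * L := Nat.mul_le_mul_right _ (by omega)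
    have hkW : 1000 * Wf.length ≤ k * Wf.length := Nat.mul_le_mul_right _ (by omega)
    rw [← hk]
    simp only [Nat.mul_add, Nat.mul_left_comm k 2] at f4 hp ⊢
    omega

end

section

variable {b q σ : ℕ} {A : Transducer q σ} {cost : Fin q → Fin σ → ℕ} {L MB GB LB D N : ℕ}

variable {z₀ : Fin σ} {cc : ℕ}

/-! ### Preprocessing: parameters -/

/-- The layout of the data structure: ten header cells, the records of the states, a table of bit
lengths at `MB`, the table of chunks at `GB`, and the ladders from `LB` on. -/
structure Lay (b L q σ MB GB LB D : ℕ) : Prop where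
  bnd : Bnd b L MB
  hMB : MB = 10 + 9 * q
  hGB : GB = MB + 2 ^ L
  hLB : LB = GB + 8 * (q * (2 * 2 ^ L + 1))
  hD : D = LB + (2 ^ L + 2) * q
  hDb : 4 * D < 2 ^ b
  hq : 0 < q
  hσ : 0 < σ
  hσb : σ < 2 ^ b

/-- The registers that hold the parameters. -/
structure PRegs (A : Transducer q σ) (b L MB GB LB : ℕ) (s : NS) : Prop where
  rB : s.reg vB = b
  rQ : s.reg vQ = q
  rSig : s.reg vSig = σ
  rL : s.reg vL = L
  rP : s.reg vP = 2 ^ L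
  rMB : s.reg vMB = MB
  rGB : s.reg vGB = GB
  rLB : s.reg vLB = LB

theorem PRegs.congr {s s' : NS} (h : PRegs A b L MB GB LB s) (h1 : s'.reg vB = s.reg vB)
    (h2 : s'.reg vQ = s.reg vQ) (h3 : s'.reg vSig = s.reg vSig) (h4 : s'.reg vL = s.reg vL)
    (h5 : s'.reg vP = s.reg vP) (h6 : s'.reg vMB = s.reg vMB) (h7 : s'.reg vGB = s.reg vGB)
    (h8 : s'.reg vLB = s.reg vLB) : PRegs A b L MB GB LB s' :=
  ⟨h1 ▸ h.rB, h2 ▸ h.rQ, h3 ▸ h.rSig, h4 ▸ h.rL, h5 ▸ h.rP, h6 ▸ h.rMB, h7 ▸ h.rGB, h8 ▸ h.rLB⟩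

/-- Choose the chunk length, and store the header. -/
def paramCode : Cmd :=
  vB ≔ vR0 ;; vN ≔ vR1 ;; vQ ≔ vR2 ;; vSig ≔ vR3 ;; vS0 ≔ vR4 ;; vL ≔ 1 ;; vP ≔ 2 ;;
  .loop (.lt (vP * vP) vN) (vP ≔ vP + vP ;; vL ≔ vL + 1) ;;
  vMB ≔ 10 + 9 * vQ ;; vGB ≔ vMB + vP ;; vLB ≔ vGB + 8 * (vQ * (2 * vP + 1)) ;;
  .st 0 vB ;; .st 1 vL ;; .st 2 vP ;; .st 3 vMB ;; .st 4 vGB ;; .st 5 vS0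

theorem param_spec {s : NS} (hN : 2 ≤ N) (hNb : 8 * N < 2 ^ b)
    (hlay : ∀ L, 1 ≤ L → 4 ^ L < 4 * N → ∃ MB GB LB D, Lay b L q σ MB GB LB D)
    (h0 : s.reg vR0 = b) (h1 : s.reg vR1 = N) (h2 : s.reg vR2 = q) (h3 : s.reg vR3 = σ)
    (h4 : s.reg vR4 = A.init) :
    wp b A cost paramCode (fun s' => ∃ L MB GB LB D, Lay b L q σ MB GB LB D ∧ N ≤ 4 ^ L ∧
      4 ^ L < 4 * N ∧ PRegs A b L MB GB LB s' ∧ s'.mem 0 = b ∧ s'.mem 1 = L ∧ s'.mem 2 = 2 ^ L ∧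
      s'.mem 3 = MB ∧ s'.mem 4 = GB ∧ s'.mem 5 = A.init ∧ (∀ x, 6 ≤ x → s'.mem x = s.mem x) ∧
      s'.time ≤ s.time + 80 + 20 * L) s := by
  have hb0 : b ≠ 0 := by
    rintro rfl
    simp at hNb
    omega
  refine wp_abs fun R hR => ?_
  unfold paramCode
  simp only [wp_seq, wp_set, ok_var]
  simp [h0, h1, h2, h3, h4]
  refine ⟨by omega, by omega, ?_⟩
  refine wp_use (wp_while (fun s' => ∃ L, 1 ≤ L ∧ 4 ^ L < 4 * N ∧ s'.reg vL = L ∧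
    s'.reg vP = 2 ^ L ∧ s'.time ≤ s.time + 14 + 20 * L) (s.time + 14 + 20 * (4 * N)) ?_ ?_ ?_ ?_) ?_
  · exact ⟨1, le_rfl, by omega, by simp, by simp, by simp⟩
  · rintro s' ⟨L, -, h1, -, -, h2⟩
    have : L < 4 ^ L := Nat.lt_pow_self (by norm_num)
    omega
  · rintro s' ⟨L, -, c1, -, c2, -⟩ hf
    have e : 2 ^ L * 2 ^ L = 4 ^ L := by rw [← mul_pow]; rfl
    simp [c2, e]
    omega
  · rintro s' ⟨L, c0, c1, c2, c3, c4⟩ hf hc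
    have e : 2 ^ L * 2 ^ L = 4 ^ L := by rw [← mul_pow]; rfl
    have hLL : 2 ^ L ≤ 4 ^ L := Nat.pow_le_pow_left (by norm_num) L
    have hL4 : L < 4 ^ L := Nat.lt_pow_self (by norm_num)
    have hrn := hf.reg vN
    simp at hrn
    simp [c3, hrn, e] at hc
    simp [c2, c3]
    refine ⟨by omega, by omega, by rw [pow_succ]; omega, by rw [pow_succ]; omega, by omega⟩
  · rintro _ ⟨s', ⟨L, c0, c1, c2, c3, c4⟩, hc, hf, rfl⟩ -
    have e : 2 ^ L * 2 ^ L = 4 ^ L := by rw [← mul_pow]; rfl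
    obtain ⟨MB, GB, LB, D, lay⟩ := hlay L c0 c1
    obtain ⟨⟨b1, b2, b3, b4⟩, l1, l2, l3, l4, l5, l6, l7, l8⟩ := lay
    have e1 := hf.reg vB
    have e2 := hf.reg vN
    have e3 := hf.reg vQ
    have e4 := hf.reg vSig
    have e5 := hf.reg vS0
    have e6 := hf.mem
    simp at e1 e2 e3 e4 e5 e6
    simp [c3, e, e2] at hc
    have hqP : 2 * 2 ^ L + 1 ≤ q * (2 * 2 ^ L + 1) := Nat.le_mul_of_pos_left _ l6
    simp [e1, e3, e5, c2, c3]
    rw [← l1, ← l2, ← l3]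
    repeat refine ⟨by omega, ?_⟩
    refine hR _ ⟨L, MB, GB, LB, D, ⟨⟨b1, b2, b3, b4⟩, l1, l2, l3, l4, l5, l6, l7, l8⟩,
        by omega, c1, ⟨?_, ?_, ?_, ?_, ?_, ?_, ?_, ?_⟩, ?_⟩
    any_goals simp [e1, e3, e4, e6, c2, c3]
    refine ⟨fun x hx => ?_, by omega⟩
    simp only [Function.update_apply]
    rw [if_neg (by omega), if_neg (by omega), if_neg (by omega), if_neg (by omega),
      if_neg (by omega), if_neg (by omega)]

theorem PRegs.frame {p : Cmd} {s s' : NS} (h : PRegs A b L MB GB LB s) (hf : Frame p s s')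
    (hw : ∀ v ∈ [vB, vQ, vSig, vL, vP, vMB, vGB, vLB], p.writes.contains v = false := by decide) :
    PRegs A b L MB GB LB s' :=
  h.congr (hf.reg vB (hw vB (by simp))) (hf.reg vQ (hw vQ (by simp)))
    (hf.reg vSig (hw vSig (by simp)))
    (hf.reg vL (hw vL (by simp))) (hf.reg vP (hw vP (by simp))) (hf.reg vMB (hw vMB (by simp)))
    (hf.reg vGB (hw vGB (by simp))) (hf.reg vLB (hw vLB (by simp)))

/-- Store the bit lengths of the numbers less than `2 ^ L`. -/
def lenTableCode : Cmd :=
  .st vMB 0 ;; vC ≔ 1 ;;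
  .loop (.lt vC vP) (.ld vT0 (vMB + vC / 2) ;; .st (vMB + vC) (vT0 + 1) ;; vC ≔ vC + 1)

theorem size_eq_succ_size_half {v : ℕ} (hv : 0 < v) : Nat.size v = Nat.size (v / 2) + 1 := by
  have h := size_div_two_pow v 1
  have := Nat.size_pos.2 hv
  rw [pow_one] at h
  omega

/-- Every bit length is computed from that of half the number, in constant time. -/
theorem lenTable_spec {s : NS} (lay : Lay b L q σ MB GB LB D) (h : PRegs A b L MB GB LB s) :
    wp b A cost lenTableCode (fun s' => (∀ v < 2 ^ L, s'.mem (MB + v) = Nat.size v) ∧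
      (∀ x, x < MB ∨ MB + 2 ^ L ≤ x → s'.mem x = s.mem x) ∧
      s'.time ≤ s.time + 20 + 30 * 2 ^ L) s := by
  obtain ⟨⟨b1, b2, b3, b4⟩, l1, l2, l3, l4, l5, l6, l7, l8⟩ := lay
  obtain ⟨rB, rQ, rSig, rL, rP, rMB, rGB, rLB⟩ := h
  have hP : 2 ≤ 2 ^ L := by
    calc 2 = 2 ^ 1 := rfl
      _ ≤ 2 ^ L := Nat.pow_le_pow_right (by norm_num) b1
  have hb : 2 < 2 ^ b := by omega
  refine wp_abs fun R hR => ?_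
  unfold lenTableCode
  simp [rMB]
  refine ⟨by omega, by omega, ?_⟩
  refine wp_use (wp_while (fun s' => ∃ c, s'.reg vC = c ∧ 1 ≤ c ∧ c ≤ 2 ^ L ∧
    (∀ v < c, s'.mem (MB + v) = Nat.size v) ∧
    (∀ x, x < MB ∨ MB + 2 ^ L ≤ x → s'.mem x = s.mem x) ∧ s'.time ≤ s.time + 10 + 30 * c)
    (s.time + 10 + 30 * 2 ^ L) ?_ ?_ ?_ ?_) ?_
  · refine ⟨1, by simp, le_rfl, by omega, fun v hv => ?_, fun x hx => ?_, ?_⟩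
    · have : v = 0 := by omega
      subst this
      simp
    · simp [Function.update_apply]
      omega
    · simp
  · rintro s' ⟨c, -, -, h1, -, -, h2⟩
    omega
  · intro s' _ _
    simp
  · rintro s' ⟨c, c1, c2, c3, c4, c5, c6⟩ hf hc
    have e1 := hf.reg vMB
    have e2 := hf.reg vP
    simp [rMB, rP] at e1 e2
    simp [c1, e2] at hc
    have e3 := c4 (c / 2) (by omega)
    simp [c1, e1, e3]
    rw [← size_eq_succ_size_half c2]
    have hs : Nat.size (c / 2) ≤ L := Nat.size_le.2 (by omega)
    have hcs := size_eq_succ_size_half c2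
    refine ⟨by omega, by omega, fun _ => ⟨by omega, by omega, by omega, by omega, by omega,
      fun v hv => ?_, fun x hx => ?_, by omega⟩⟩
    · rw [Function.update_apply]
      split_ifs with h
      · congr 1
        omega
      · exact c4 v (by omega)
    · rw [Function.update_of_ne (by omega), c5 x hx]
  · rintro _ ⟨s', ⟨c, c1, c2, c3, c4, c5, c6⟩, hc, hf, rfl⟩ -
    have e2 := hf.reg vP
    simp [rP] at e2
    simp [c1, e2] at hc
    refine hR _ ⟨fun v hv => c4 v (by omega), c5, ?_⟩
    simp
    omega

theorem wp_trans {d e i j : Var} {Q : NS → Prop} {s : NS} :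
    wp b A cost (.trans d e i j) Q s ↔ ∃ (v : Fin q) (x : Fin σ), s.reg i = v ∧ s.reg j = x ∧
      ((A.step v x).1 : ℕ) < 2 ^ b ∧ ((A.step v x).2 : ℕ) < 2 ^ b ∧
      Q (((s.set d (A.step v x).1).set e (A.step v x).2).tick (cost v x)) := Iff.rfl

/-- Initialize the records of the states: the map `skipStep`, and the output on the symbol zero.
Zeros are written to the cells that will hold addresses of ladders, heads of lists, and marks. -/
def nodeCode : Cmd :=
  vC ≔ 0 ;;
  .loop (.lt vC vQ)
    (vT0 ≔ vC ;; vY ≔ 0 ;; .trans vT0 vY vT0 vY ;; .ite (.eq vY 0) .skip (vT0 ≔ vC) ;;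
      .st (10 + 9 * vC) vT0 ;; .st (11 + 9 * vC) vY ;; .st (14 + 9 * vC) 0 ;;
      .st (16 + 9 * vC) 0 ;; .st (18 + 9 * vC) 0 ;; vC ≔ vC + 1)

theorem node_spec {s : NS} (lay : Lay b L q σ MB GB LB D) (h : PRegs A b L MB GB LB s)
    (hz : (z₀ : ℕ) = 0) (hcost : ∀ v, cost v z₀ ≤ cc) :
    wp b A cost nodeCode (fun s' =>
      (∀ v : Fin q, s'.mem (10 + 9 * v) = skipStep A z₀ v ∧
        s'.mem (11 + 9 * v) = (A.step v z₀).2 ∧ s'.mem (14 + 9 * v) = 0 ∧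
        s'.mem (16 + 9 * v) = 0 ∧ s'.mem (18 + 9 * v) = 0) ∧
      (∀ x, x < 10 ∨ 10 + 9 * q ≤ x → s'.mem x = s.mem x) ∧
      s'.time ≤ s.time + 20 + (100 + cc) * q) s := by
  obtain ⟨⟨b1, b2, b3, b4⟩, l1, l2, l3, l4, l5, l6, l7, l8⟩ := lay
  obtain ⟨rB, rQ, rSig, rL, rP, rMB, rGB, rLB⟩ := h
  refine wp_abs fun R hR => ?_
  unfold nodeCode
  simp
  refine wp_use (wp_while (fun s' => ∃ c, s'.reg vC = c ∧ c ≤ q ∧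
    (∀ v : Fin q, v < c → s'.mem (10 + 9 * v) = skipStep A z₀ v ∧
        s'.mem (11 + 9 * v) = (A.step v z₀).2 ∧ s'.mem (14 + 9 * v) = 0 ∧
        s'.mem (16 + 9 * v) = 0 ∧ s'.mem (18 + 9 * v) = 0) ∧
    (∀ x, x < 10 ∨ 10 + 9 * q ≤ x → s'.mem x = s.mem x) ∧
    s'.time ≤ s.time + 10 + (100 + cc) * c)
    (s.time + 10 + (100 + cc) * q) ?_ ?_ ?_ ?_) ?_
  · exact ⟨0, by simp, by omega, by simp, by simp, by simp⟩
  · rintro s' ⟨c, -, h1, -, -, h2⟩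
    have := Nat.mul_le_mul_left (100 + cc) h1
    omega
  · intro s' _ _
    simp
  · rintro s' ⟨c, c1, c2, c3, c4, c5⟩ hf hc
    have e1 := hf.reg vQ
    simp [rQ] at e1
    simp [c1, e1] at hc
    have hco := hcost ⟨c, hc⟩
    have hnxt := (A.step ⟨c, hc⟩ z₀).1.2
    have hout := (A.step ⟨c, hc⟩ z₀).2.2
    have hg : ((A.step ⟨c, hc⟩ z₀).2 : ℕ) = 0 → skipStep A z₀ ⟨c, hc⟩ = (A.step ⟨c, hc⟩ z₀).1 :=
      fun h => by simp [skipStep, h]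
    have hg' : ((A.step ⟨c, hc⟩ z₀).2 : ℕ) ≠ 0 → skipStep A z₀ ⟨c, hc⟩ = ⟨c, hc⟩ :=
      fun h => by simp [skipStep, h]
    refine wp_abs fun R' hR' => ?_
    have key : ∀ s₁ : NS, s₁.reg vT0 = skipStep A z₀ ⟨c, hc⟩ →
        s₁.reg vY = (A.step ⟨c, hc⟩ z₀).2 → s₁.reg vC = c → s₁.mem = s'.mem →
        s₁.time ≤ s'.time + cc + 30 → wp b A cost (.st (10 + 9 * vC) vT0 ;; .st (11 + 9 * vC) vY ;;
          .st (14 + 9 * vC) 0 ;; .st (16 + 9 * vC) 0 ;; .st (18 + 9 * vC) 0 ;; vC ≔ vC + 1)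
          R' s₁ := by
      intro s₁ i1 i2 i3 i4 i5
      simp [i1, i2, i3, and_assoc]
      repeat refine ⟨by omega, ?_⟩
      refine hR' _ ⟨c + 1, by simp, hc, ?_, ?_, ?_⟩
      · simp only [NS.tick_mem, NS.put_mem, NS.set_mem, i4]
        intro v hv
        rcases Nat.lt_succ_iff_lt_or_eq.1 hv with hv | hv
        · refine ⟨?_, ?_, ?_, ?_, ?_⟩ <;> rw [Function.update_of_ne (by omega),
            Function.update_of_ne (by omega), Function.update_of_ne (by omega),
            Function.update_of_ne (by omega), Function.update_of_ne (by omega)]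
          exacts [(c3 v hv).1, (c3 v hv).2.1, (c3 v hv).2.2.1, (c3 v hv).2.2.2.1, (c3 v hv).2.2.2.2]
        · have : v = ⟨c, hc⟩ := Fin.ext hv
          subst this
          simp
      · simp only [NS.tick_mem, NS.put_mem, NS.set_mem, i4]
        intro x hx
        rw [Function.update_of_ne (by omega), Function.update_of_ne (by omega),
          Function.update_of_ne (by omega), Function.update_of_ne (by omega),
          Function.update_of_ne (by omega), c4 x hx]
      · simp only [NS.tick_time, NS.put_time, NS.set_time]
        rw [mul_add]
        omega
    rw [wp_seq, wp_set, wp_seq, wp_set, wp_seq, wp_trans, wp_seq]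
    refine ⟨by simp, by simp, ⟨c, hc⟩, z₀, by simp [c1], by simp [hz], by omega, by omega, ?_⟩
    rw [wp_ite]
    refine ⟨by simp, fun h => ?_, fun h => ?_⟩
    · simp at h
      rw [wp_skip]
      refine key _ ?_ ?_ ?_ ?_ ?_
      any_goals simp [c1, hg h]
      omega
    · simp at h
      rw [wp_set]
      refine ⟨by simp, key _ ?_ ?_ ?_ ?_ ?_⟩
      any_goals simp [c1, hg' h]
      omega
  · rintro _ ⟨s', ⟨c, c1, c2, c3, c4, c5⟩, hc, hf, rfl⟩ -
    have e2 := hf.reg vQ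
    simp [rQ] at e2
    simp [c1, e2] at hc
    have : c = q := by omega
    subst this
    refine hR _ ⟨fun v => c3 v v.2, c4, ?_⟩
    simp
    omega

/-! ### Preprocessing: the forest -/

/-- Mark unvisited states, beginning with `vU`; count them in `vCnt`, and keep the last one in
`vLast`. -/
def markCode : Cmd :=
  .loop (.eq vF 0)
    (.st (18 + 9 * vU) (vC + 1) ;; vLast ≔ vU ;; .ld vU (10 + 9 * vU) ;; vCnt ≔ vCnt + 1 ;;
      .ld vF (18 + 9 * vU))

/-- The first `n` states on the walk of `g` from `v` are distinct and not in `V`. -/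
structure Fresh (g : Fin q → Fin q) (v : Fin q) (V : Finset (Fin q)) (n : ℕ) : Prop where
  notMem : ∀ i < n, g^[i] v ∉ V
  ne : ∀ i j, i < j → j < n → g^[i] v ≠ g^[j] v

theorem Fresh.card {g : Fin q → Fin q} {v : Fin q} {V : Finset (Fin q)} {n : ℕ}
    (h : Fresh g v V n) :
    (V ∪ (Finset.range n).image (fun i => g^[i] v)).card = V.card + n := by
  rw [Finset.card_union_of_disjoint, Finset.card_image_of_injOn, Finset.card_range]
  · intro i hi j hj hij
    simp only [Finset.coe_range, Set.mem_Iio] at hi hj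
    rcases lt_trichotomy i j with hlt | rfl | hlt
    · exact absurd hij (h.ne i j hlt hj)
    · rfl
    · exact absurd hij.symm (h.ne j i hlt hi)
  · rw [Finset.disjoint_right]
    intro w hw
    obtain ⟨i, hi, rfl⟩ := Finset.mem_image.1 hw
    exact h.notMem i (Finset.mem_range.1 hi)

theorem Fresh.card_le {g : Fin q → Fin q} {v : Fin q} {V : Finset (Fin q)} {n : ℕ}
    (h : Fresh g v V n) : V.card + n ≤ q := by
  rw [← h.card]
  simpa using Finset.card_le_univ (V ∪ (Finset.range n).image (fun i => g^[i] v))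

/-- The walk from `v` is marked with `c + 1` until it reaches a marked state, in time proportional
to the number `n` of states that have been marked. -/
theorem mark_spec {s : NS} {c : ℕ} {v : Fin q} {V : Finset (Fin q)} {g : Fin q → Fin q}
    (hb : 4 * (10 + 9 * q) < 2 ^ b) (hc : s.reg vC = c) (hcq : c < q) (hu : s.reg vU = v)
    (hn : s.reg vCnt = 0)
    (hF : s.reg vF = s.mem (18 + 9 * v)) (hg : ∀ w : Fin q, s.mem (10 + 9 * w) = g w)
    (hV : ∀ w : Fin q, w ∈ V ↔ s.mem (18 + 9 * w) ≠ 0) :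
    wp b A cost markCode (fun s' => ∃ n, Fresh g v V n ∧ s'.reg vU = g^[n] v ∧ s'.reg vCnt = n ∧
      s'.reg vF = s'.mem (18 + 9 * (g^[n] v : Fin q)) ∧ s'.reg vF ≠ 0 ∧
      (0 < n → s'.reg vLast = g^[n - 1] v) ∧
      (∀ i < n, s'.mem (18 + 9 * (g^[i] v : Fin q)) = c + 1) ∧
      (∀ x : ℕ, (∀ i < n, x ≠ 18 + 9 * (g^[i] v : Fin q)) → s'.mem x = s.mem x) ∧
      s'.time ≤ s.time + 10 + 40 * n) s := by
  have hb0 : b ≠ 0 := by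
    rintro rfl
    simp at hb
  refine wp_abs fun R hR => ?_
  unfold markCode
  refine wp_use (wp_while (fun s' => ∃ n, Fresh g v V n ∧ s'.reg vU = g^[n] v ∧ s'.reg vCnt = n ∧
      s'.reg vF = s'.mem (18 + 9 * (g^[n] v : Fin q)) ∧
      (0 < n → s'.reg vLast = g^[n - 1] v) ∧
      (∀ i < n, s'.mem (18 + 9 * (g^[i] v : Fin q)) = c + 1) ∧
      (∀ x : ℕ, (∀ i < n, x ≠ 18 + 9 * (g^[i] v : Fin q)) → s'.mem x = s.mem x) ∧
      s'.time ≤ s.time + 40 * n) (s.time + 40 * q) ?_ ?_ ?_ ?_) ?_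
  · exact ⟨0, ⟨by simp, by simp⟩, by simpa using hu, hn, by simpa using hF, by simp, by simp,
      by simp, by simp⟩
  · rintro s' ⟨n, h, -, -, -, -, -, -, ht⟩
    have := h.card_le
    omega
  · intro s' _ _
    simp
  · rintro s' ⟨n, h, c1, c2, c3, c4, c5, c6, c7⟩ hf hcond
    simp at hcond
    have hrC := hf.reg vC
    rw [hc] at hrC
    set u := g^[n] v with hu'
    have huq := u.2
    have hgu := (g u).2
    have huV : u ∉ V := by
      intro hm
      have h1 := (hV u).1 hm
      rw [← c6 (18 + 9 * u) ?_] at h1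
      · omega
      · intro i hi heq
        have : u = g^[i] v := Fin.ext (by omega)
        exact h.notMem i hi (this ▸ hm)
    have hune : ∀ i < n, u ≠ g^[i] v := by
      intro i hi heq
      have := c5 i hi
      rw [← heq] at this
      omega
    have hfr : Fresh g v V (n + 1) := by
      refine ⟨fun i hi => ?_, fun i j hij hj => ?_⟩
      · rcases Nat.lt_succ_iff_lt_or_eq.1 hi with hi | rfl
        · exact h.notMem i hi
        · exact huV
      · rcases Nat.lt_succ_iff_lt_or_eq.1 hj with hj | rfl
        · exact h.ne i j hij hj
        · exact (hune i hij).symm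
    have hle := hfr.card_le
    have e1 : s'.mem (10 + 9 * u) = g u := by
      rw [c6 _ (fun i hi => by omega), hg]
    have hgu' : g^[n + 1] v = g u := Function.iterate_succ_apply' g n v
    simp only [wp_seq]
    have hgu2 : g^[n] (g v) = g u := by rw [← Function.iterate_succ_apply, hgu']
    simp [c1, c2, hrC, e1, hgu2, ← hu', and_assoc]
    repeat refine ⟨by omega, ?_⟩
    intro _
    repeat refine ⟨by omega, ?_⟩
    intro _
    refine ⟨hfr, ?_, ?_, by omega⟩
    · intro i hi
      rcases Nat.lt_succ_iff_lt_or_eq.1 (Nat.lt_succ_iff.2 hi) with hi | rfl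
      · rw [Function.update_apply]
        split_ifs
        · rfl
        · exact c5 i hi
      · rw [← hu', Function.update_self]
    · intro x hx
      rw [Function.update_of_ne (by have := hx n le_rfl; rwa [← hu'] at this)]
      exact c6 x fun i hi => hx i hi.le
  · rintro _ ⟨s', ⟨n, h, c1, c2, c3, c4, c5, c6, c7⟩, hcond, hf, rfl⟩ -
    simp at hcond
    refine hR _ ⟨n, h, c1, c2, c3, hcond, c4, c5, c6, ?_⟩
    simp
    omega

/-- Store depths and roots along the marked walk. -/
def depthCode : Cmd :=
  .loop (.lt 0 vCnt)
    (vCnt ≔ vCnt - 1 ;; .st (12 + 9 * vU) (vBase + vCnt) ;; .st (13 + 9 * vU) vRt ;;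
      .ld vU (10 + 9 * vU))

/-- The `i`-th state of the walk from `v` gets the depth `B + (n - 1 - i)`. Thus, `B` is the depth
of the last one. -/
theorem depth_spec {s : NS} {v : Fin q} {V : Finset (Fin q)} {g : Fin q → Fin q} {n B r : ℕ}
    (hb : 4 * (10 + 9 * q) < 2 ^ b) (hfr : Fresh g v V n) (hu : s.reg vU = v)
    (hn : s.reg vCnt = n) (hB : s.reg vBase = B) (hr : s.reg vRt = r) (hBn : B + n ≤ q)
    (hg : ∀ w : Fin q, s.mem (10 + 9 * w) = g w) :
    wp b A cost depthCode (fun s' =>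
      (∀ i < n, s'.mem (12 + 9 * (g^[i] v : Fin q)) = B + (n - 1 - i) ∧
        s'.mem (13 + 9 * (g^[i] v : Fin q)) = r) ∧
      (∀ x : ℕ, (∀ i < n, x ≠ 12 + 9 * (g^[i] v : Fin q) ∧ x ≠ 13 + 9 * (g^[i] v : Fin q)) →
        s'.mem x = s.mem x) ∧
      s'.time ≤ s.time + 10 + 40 * n) s := by
  have hb0 : b ≠ 0 := by
    rintro rfl
    simp at hb
  refine wp_abs fun R hR => ?_
  unfold depthCode
  refine wp_use (wp_while (fun s' => ∃ k ≤ n, s'.reg vU = g^[k] v ∧ s'.reg vCnt = n - k ∧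
      (∀ i < k, s'.mem (12 + 9 * (g^[i] v : Fin q)) = B + (n - 1 - i) ∧
        s'.mem (13 + 9 * (g^[i] v : Fin q)) = r) ∧
      (∀ x : ℕ, (∀ i < k, x ≠ 12 + 9 * (g^[i] v : Fin q) ∧ x ≠ 13 + 9 * (g^[i] v : Fin q)) →
        s'.mem x = s.mem x) ∧
      s'.time ≤ s.time + 40 * k) (s.time + 40 * n) ?_ ?_ ?_ ?_) ?_
  · exact ⟨0, by omega, by simpa using hu, by simpa using hn, by simp, by simp, by simp⟩
  · rintro s' ⟨k, h, -, -, -, -, ht⟩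
    omega
  · intro s' _ _
    simp
  · rintro s' ⟨k, h, c1, c2, c3, c4, c5⟩ hf hcond
    simp [c2] at hcond
    have hrB := hf.reg vBase
    have hrR := hf.reg vRt
    rw [hB] at hrB
    rw [hr] at hrR
    have hne : ∀ i < k, (g^[i] v : ℕ) ≠ (g^[k] v : Fin q) := fun i hi he =>
      hfr.ne i k hi (by omega) (Fin.ext he)
    have e1 : s'.mem (10 + 9 * (g^[k] v : Fin q)) = (g^[k + 1] v : Fin q) := by
      rw [c4 _ (fun i hi => by omega), hg, Function.iterate_succ_apply']
    have hlt := (g^[k + 1] v).2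
    set u := g^[k] v with hu'
    have huq := u.2
    refine wp_abs fun R' hR' => ?_
    simp only [wp_seq, wp_set, wp_st, wp_ld]
    simp [c1, c2, hrB, hrR, and_assoc]
    repeat refine ⟨by omega, ?_⟩
    intro _
    refine hR' _ ⟨k + 1, by omega, ?_, ?_, ?_, ?_, ?_⟩
    · simp [e1]
    · simp
      omega
    · simp only [NS.tick_mem, NS.put_mem, NS.set_mem]
      intro i hi
      rcases Nat.lt_succ_iff_lt_or_eq.1 hi with hi | rfl
      · have := hne i hi
        rw [Function.update_of_ne (by omega), Function.update_of_ne (by omega),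
          Function.update_of_ne (by omega), Function.update_of_ne (by omega)]
        exact c3 i hi
      · rw [Function.update_of_ne (by omega), ← hu', Function.update_self, Function.update_self]
        exact ⟨by omega, rfl⟩
    · simp only [NS.tick_mem, NS.put_mem, NS.set_mem]
      intro x hx
      have := hx k (by omega)
      rw [← hu'] at this
      rw [Function.update_of_ne this.2, Function.update_of_ne this.1]
      exact c4 x fun i hi => hx i (by omega)
    · simp
      omega
  · rintro _ ⟨s', ⟨k, h, c1, c2, c3, c4, c5⟩, hcond, hf, rfl⟩ -
    simp [c2] at hcond
    have : k = n := by omega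
    subst this
    refine hR _ ⟨c3, c4, ?_⟩
    simp
    omega

/-- The cells of the memory `m` describe depths and roots on the set `V` of marked states. -/
structure Marked (g : Fin q → Fin q) (V : Finset (Fin q)) (m : ℕ → ℕ) : Prop where
  mem : ∀ w : Fin q, w ∈ V ↔ m (18 + 9 * w) ≠ 0
  step : ∀ w ∈ V, g w ∈ V
  dep_lt : ∀ w ∈ V, m (12 + 9 * w) < V.card
  root_lt : ∀ w ∈ V, m (13 + 9 * w) < q
  root_of_zero : ∀ w ∈ V, m (12 + 9 * w) = 0 → m (13 + 9 * w) = w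
  dep_succ : ∀ w ∈ V, m (12 + 9 * w) ≠ 0 → m (12 + 9 * g w) + 1 = m (12 + 9 * w)
  root_succ : ∀ w ∈ V, m (13 + 9 * g w) = m (13 + 9 * w)

/-- A walk can be added to the marked states if it ends at a marked state, which continues the old
tree, or at one of its own states, in which case its last state `g^[n - 1] v` is made a root. -/
theorem Marked.extend {g : Fin q → Fin q} {V : Finset (Fin q)} {m m' : ℕ → ℕ} {v : Fin q}
    {n B r : ℕ} (h : Marked g V m) (hfr : Fresh g v V n)
    (hB : (g^[n] v ∈ V ∧ B = m (12 + 9 * (g^[n] v : Fin q)) + 1 ∧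
        r = m (13 + 9 * (g^[n] v : Fin q))) ∨
      ((∃ j < n, g^[n] v = g^[j] v) ∧ B = 0 ∧ r = (g^[n - 1] v : Fin q)))
    (h8 : ∀ i < n, m' (18 + 9 * (g^[i] v : Fin q)) ≠ 0)
    (h2 : ∀ i < n, m' (12 + 9 * (g^[i] v : Fin q)) = B + (n - 1 - i))
    (h3 : ∀ i < n, m' (13 + 9 * (g^[i] v : Fin q)) = r)
    (hm : ∀ w : Fin q, (∀ i < n, w ≠ g^[i] v) → m' (12 + 9 * w) = m (12 + 9 * w) ∧
      m' (13 + 9 * w) = m (13 + 9 * w) ∧ m' (18 + 9 * w) = m (18 + 9 * w)) :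
    Marked g (V ∪ (Finset.range n).image (fun i => g^[i] v)) m' := by
  have hV : ∀ w ∈ V, m' (12 + 9 * w) = m (12 + 9 * w) ∧
      m' (13 + 9 * w) = m (13 + 9 * w) ∧ m' (18 + 9 * w) = m (18 + 9 * w) := by
    refine fun w hw => hm w fun i hi he => ?_
    exact hfr.notMem i hi (he ▸ hw)
  have hcard := hfr.card
  have hrq : 0 < n → r < q := by
    rcases hB with ⟨c1, c2, c3⟩ | ⟨c1, c2, c3⟩
    · intro _
      rw [c3]; exact h.root_lt _ c1
    · intro _
      rw [c3]; exact Fin.isLt _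
  have hBV : B ≤ V.card := by
    rcases hB with ⟨c1, c2, c3⟩ | ⟨c1, c2, c3⟩
    · have := h.dep_lt _ c1
      omega
    · omega
  have key : ∀ i < n, (g (g^[i] v) = g^[i + 1] v) := fun i _ =>
    (Function.iterate_succ_apply' g i v).symm
  set V' := V ∪ (Finset.range n).image (fun i => g^[i] v)
  have split : ∀ w ∈ V', w ∈ V ∨ ∃ i < n, w = g^[i] v := by
    intro w hw
    rcases Finset.mem_union.1 hw with hw | hw
    · exact Or.inl hw
    · obtain ⟨i, hi, rfl⟩ := Finset.mem_image.1 hw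
      exact Or.inr ⟨i, Finset.mem_range.1 hi, rfl⟩
  have memV : ∀ w ∈ V, w ∈ V' := fun w hw => Finset.mem_union_left _ hw
  have memI : ∀ i < n, g^[i] v ∈ V' := fun i hi =>
    Finset.mem_union_right _ (Finset.mem_image.2 ⟨i, Finset.mem_range.2 hi, rfl⟩)
  -- The state at which the walk ends has been marked.
  have last : g^[n] v ∈ V' := by
    rcases hB with ⟨c1, c2, c3⟩ | ⟨⟨j, hj, e⟩, c2, c3⟩
    · exact memV _ c1
    · rw [e]; exact memI j hj
  have lastr : 0 < n → m' (13 + 9 * (g^[n] v : Fin q)) = r := by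
    intro _
    rcases hB with ⟨c1, c2, c3⟩ | ⟨⟨j, hj, e⟩, c2, c3⟩
    · rw [(hV _ c1).2.1, c3]
    · rw [e]; exact h3 j hj
  refine ⟨fun w => ⟨fun hw => ?_, fun hw => ?_⟩, fun w hw => ?_, fun w hw => ?_, fun w hw => ?_,
    fun w hw hd => ?_, fun w hw hd => ?_, fun w hw => ?_⟩
  · rcases split w hw with hw | ⟨i, hi, rfl⟩
    · rw [(hV w hw).2.2]; exact (h.mem w).1 hw
    · exact h8 i hi
  · by_cases hi : ∀ i < n, w ≠ g^[i] v
    · rw [(hm w hi).2.2] at hw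
      exact memV _ ((h.mem w).2 hw)
    · push Not at hi
      obtain ⟨i, hi, rfl⟩ := hi
      exact memI i hi
  · rcases split w hw with hw | ⟨i, hi, rfl⟩
    · exact memV _ (h.step w hw)
    · rw [key i hi]
      rcases Nat.lt_or_ge (i + 1) n with hi' | hi'
      · exact memI _ hi'
      · have : i + 1 = n := by omega
        rw [this]; exact last
  · rcases split w hw with hw | ⟨i, hi, rfl⟩
    · rw [(hV w hw).1]
      have := h.dep_lt w hw
      omega
    · rw [h2 i hi]
      omega
  · rcases split w hw with hw | ⟨i, hi, rfl⟩
    · rw [(hV w hw).2.1]; exact h.root_lt w hw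
    · rw [h3 i hi]; exact hrq (by omega)
  · rcases split w hw with hw | ⟨i, hi, rfl⟩
    · rw [(hV w hw).1] at hd
      rw [(hV w hw).2.1]; exact h.root_of_zero w hw hd
    · rw [h2 i hi] at hd
      rw [h3 i hi]
      rcases hB with ⟨c1, c2, c3⟩ | ⟨c1, c2, c3⟩
      · omega
      · rw [c3]
        congr
        omega
  · rcases split w hw with hw | ⟨i, hi, rfl⟩
    · rw [(hV w hw).1] at hd ⊢
      rw [(hV _ (h.step w hw)).1]; exact h.dep_succ w hw hd
    · rw [h2 i hi] at hd ⊢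
      rw [key i hi]
      rcases Nat.lt_or_ge (i + 1) n with hi' | hi'
      · rw [h2 _ hi']
        omega
      · have : i + 1 = n := by omega
        rw [this]
        rcases hB with ⟨c1, c2, c3⟩ | ⟨c1, c2, c3⟩
        · rw [(hV _ c1).1]
          omega
        · omega
  · rcases split w hw with hw | ⟨i, hi, rfl⟩
    · rw [(hV w hw).2.1, (hV _ (h.step w hw)).2.1]; exact h.root_succ w hw
    · rw [h3 i hi, key i hi]
      rcases Nat.lt_or_ge (i + 1) n with hi' | hi'
      · exact h3 _ hi'
      · have : i + 1 = n := by omega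
        rw [this]; exact lastr (by omega)

/-- Compute depths and roots: every walk from an unmarked state stops at a marked one, either from
an earlier walk or from the same one, in which case the cycle is cut before this state. -/
def forestCode : Cmd :=
  vC ≔ 0 ;;
  .loop (.lt vC vQ)
    (vU ≔ vC ;; vCnt ≔ 0 ;; .ld vF (18 + 9 * vU) ;; markCode ;;
      .ite (.eq vF (vC + 1)) (vRt ≔ vLast ;; vBase ≔ 0)
        (.ld vRt (13 + 9 * vU) ;; .ld vBase (12 + 9 * vU) ;; vBase ≔ vBase + 1) ;;
      vU ≔ vC ;; depthCode ;; vC ≔ vC + 1)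

/-- The forest is computed in linear time, because every state is marked only once. -/
theorem forest_spec {s : NS} {g : Fin q → Fin q} (hb : 4 * (10 + 9 * q) < 2 ^ b)
    (hQ : s.reg vQ = q) (hg : ∀ w : Fin q, s.mem (10 + 9 * w) = g w)
    (h8 : ∀ w : Fin q, s.mem (18 + 9 * w) = 0) :
    wp b A cost forestCode (fun s' => ∃ (dep : Fin q → ℕ) (root : Fin q → Fin q),
      Forest g dep root ∧ (∀ v, dep v < q) ∧ (∀ v : Fin q, s'.mem (12 + 9 * v) = dep v) ∧
      (∀ v : Fin q, s'.mem (13 + 9 * v) = root v) ∧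
      (∀ x : ℕ, (∀ w : Fin q, x ≠ 12 + 9 * w ∧ x ≠ 13 + 9 * w ∧ x ≠ 18 + 9 * w) →
        s'.mem x = s.mem x) ∧
      s'.time ≤ s.time + 20 + 200 * q) s := by
  have hb0 : b ≠ 0 := by
    rintro rfl
    simp at hb
  refine wp_abs fun R hR => ?_
  unfold forestCode
  rw [wp_seq, wp_set]
  refine ⟨by simp, ?_⟩
  -- The states less than `c` have been considered; `V` is the set of marked states. All marks are
  -- at most `c`, so that the mark `c + 1` shows that a walk has met itself.
  refine wp_use (wp_while (fun s' => ∃ (c : ℕ) (V : Finset (Fin q)), s'.reg vC = c ∧ c ≤ q ∧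
      Marked g V s'.mem ∧ (∀ w : Fin q, w < c → w ∈ V) ∧ (∀ w : Fin q, s'.mem (18 + 9 * w) ≤ c) ∧
      (∀ x : ℕ, (∀ w : Fin q, x ≠ 12 + 9 * w ∧ x ≠ 13 + 9 * w ∧ x ≠ 18 + 9 * w) →
        s'.mem x = s.mem x) ∧
      s'.time ≤ s.time + 10 + 100 * c + 100 * V.card) (s.time + 10 + 200 * q) ?_ ?_ ?_ ?_) ?_
  · refine ⟨0, ∅, by simp, by omega, ⟨?_, ?_, ?_, ?_, ?_, ?_, ?_⟩, ?_⟩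
    any_goals simp [h8]
  · rintro s' ⟨c, V, -, h1, -, -, -, -, h2⟩
    have : V.card ≤ q := by simpa using Finset.card_le_univ V
    omega
  · intro s' _ _
    simp
  · rintro s' ⟨c, V, c1, c2, c3, c4, c5, c6, c7⟩ hf hcond
    have e1 := hf.reg vQ
    simp [hQ] at e1
    simp [c1, e1] at hcond
    have hg' : ∀ w : Fin q, s'.mem (10 + 9 * w) = g w := by
      intro w
      rw [c6 _ (fun w' => by omega), hg]
    refine wp_abs fun R' hR' => ?_
    rw [wp_seq, wp_set, wp_seq, wp_set, wp_seq, wp_ld, wp_seq]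
    refine ⟨by simp, by simp, ?_⟩
    simp [c1]
    repeat refine ⟨by omega, ?_⟩
    intro _
    refine wp_use (mark_spec (v := ⟨c, hcond⟩) (c := c) (V := V) (g := g) hb (by simp [c1]) hcond
      (by simp) (by simp) (by simp) (by simpa using hg') (by simpa using c3.mem)) ?_
    rintro s₁ ⟨n, hfr, m1, m2, m3, m4, m5, m6, m7, m8⟩ hf₁
    have f1 := hf₁.reg vC
    have f2 := hf₁.reg vQ
    simp at f1 f2 m7 m8
    rw [c1] at f1
    rw [e1] at f2
    set v : Fin q := ⟨c, hcond⟩ with hv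
    set u := g^[n] v with hu
    have huq := u.2
    have hcle := hfr.card_le
    have hg₁ : ∀ w : Fin q, s₁.mem (10 + 9 * w) = g w := by
      intro w
      rw [m7 _ (fun i hi => by omega), hg']
    have key : ∀ (s₂ : NS) (B r : ℕ), s₂.reg vC = c → s₂.reg vCnt = n → s₂.reg vBase = B →
        s₂.reg vRt = r → s₂.mem = s₁.mem → s₂.time ≤ s₁.time + 30 →
        ((u ∈ V ∧ B = s'.mem (12 + 9 * u) + 1 ∧ r = s'.mem (13 + 9 * u)) ∨
          ((∃ j < n, u = g^[j] v) ∧ B = 0 ∧ r = (g^[n - 1] v : Fin q))) →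
        wp b A cost (vU ≔ vC ;; depthCode ;; vC ≔ vC + 1) R' s₂ := by
      intro s₂ B r k1 k2 k3 k4 k5 k6 k7
      have hBn : B + n ≤ q := by
        rcases k7 with ⟨a1, a2, a3⟩ | ⟨a1, a2, a3⟩
        · have := c3.dep_lt _ a1
          omega
        · omega
      rw [wp_seq, wp_set, wp_seq]
      refine ⟨by simp, ?_⟩
      refine wp_use (depth_spec (v := v) (V := V) (g := g) (n := n) (B := B) (r := r) hb hfr
        (by simp [k1, hv]) (by simp [k2]) (by simp [k3]) (by simp [k4]) hBn
        (by simpa [k5] using hg₁)) ?_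
      rintro s₃ ⟨d1, d2, d3⟩ hf₃
      have g1 := hf₃.reg vC
      simp [k1] at g1
      simp [k5] at d2 d3
      rw [wp_set]
      refine ⟨by simp [g1, hb0]; omega, hR' _ ⟨c + 1, V ∪ (Finset.range n).image (fun i => g^[i] v),
        by simp [g1], by omega, ?_, ?_, ?_, ?_, ?_⟩⟩
      · refine c3.extend hfr k7 (fun i hi => ?_) (fun i hi => ?_) (fun i hi => ?_)
          (fun w hw => ?_)
        · simp
          rw [d2 _ (fun j hj => by omega), m6 i hi]
          omega
        · simpa using (d1 i hi).1
        · simpa using (d1 i hi).2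
        · have hw' : ∀ i < n, (w : ℕ) ≠ (g^[i] v : Fin q) := fun i hi he => hw i hi (Fin.ext he)
          simp
          refine ⟨?_, ?_, ?_⟩
          all_goals
            rw [d2 _ (fun j hj => by have := hw' j hj; omega),
              m7 _ (fun j hj => by have := hw' j hj; omega)]
      · intro w hw
        rcases Nat.lt_succ_iff_lt_or_eq.1 hw with hw | hw
        · exact Finset.mem_union_left _ (c4 w hw)
        · have : w = v := Fin.ext hw
          subst this
          rcases Nat.eq_zero_or_pos n with h0 | h0
          · subst h0
            refine Finset.mem_union_left _ ?_
            rw [c3.mem]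
            simp at hu
            rw [m3, hu] at m4
            rwa [m7 _ (by simp)] at m4
          · exact Finset.mem_union_right _ (Finset.mem_image.2 ⟨0, Finset.mem_range.2 h0, rfl⟩)
      · intro w
        simp
        rw [d2 _ (fun j hj => by omega)]
        by_cases hw : ∀ i < n, 18 + 9 * (w : ℕ) ≠ 18 + 9 * (g^[i] v : Fin q)
        · rw [m7 _ hw]
          have := c5 w
          omega
        · push Not at hw
          obtain ⟨i, hi, he⟩ := hw
          rw [he, m6 i hi]
      · intro x hx
        simp
        rw [d2 _ (fun i hi => ⟨(hx _).1, (hx _).2.1⟩), m7 _ (fun i hi => (hx _).2.2), c6 x hx]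
      · rw [hfr.card]
        simp
        omega
    rw [wp_ite]
    refine ⟨by simp [f1, hb0]; omega, fun h => ?_, fun h => ?_⟩
    · simp [f1] at h
      -- The walk has met itself.
      have hj : ∃ j < n, u = g^[j] v := by
        by_contra hno
        push Not at hno
        rw [m3, m7 _ (fun i hi he => hno i hi (Fin.ext (by omega)))] at h
        have := c5 u
        omega
      have hn : 0 < n := by
        obtain ⟨j, hj, -⟩ := hj
        omega
      have m5' := m5 hn
      rw [wp_seq, wp_set, wp_set]
      refine ⟨by simp, by simp, key _ 0 (g^[n - 1] v : Fin q) ?_ ?_ ?_ ?_ ?_ ?_ (Or.inr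
        ⟨hj, rfl, rfl⟩)⟩
      any_goals simp [f1, m2, m5']
    · simp [f1] at h
      -- The walk has met an earlier one.
      have hno : ∀ i < n, 18 + 9 * (u : ℕ) ≠ 18 + 9 * (g^[i] v : Fin q) := by
        intro i hi he
        rw [m3, he, m6 i hi] at h
        exact h rfl
      have huV : u ∈ V := by
        rw [c3.mem]
        rwa [m3, m7 _ hno] at m4
      have e2 : s₁.mem (12 + 9 * u) = s'.mem (12 + 9 * u) := m7 _ (fun i hi => by omega)
      have e3 : s₁.mem (13 + 9 * u) = s'.mem (13 + 9 * u) := m7 _ (fun i hi => by omega)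
      have hd := c3.dep_lt _ huV
      refine wp_abs fun R'' hR'' => ?_
      simp [m1, e2, e3]
      repeat refine ⟨by omega, ?_⟩
      intro _
      repeat refine ⟨by omega, ?_⟩
      intro _
      repeat refine ⟨by omega, ?_⟩
      refine hR'' _ (key _ _ _ ?_ ?_ rfl rfl ?_ ?_ (Or.inl ⟨huV, ?_, ?_⟩))
      any_goals simp [f1, m2]
  · rintro _ ⟨s', ⟨c, V, c1, c2, c3, c4, c5, c6, c7⟩, hcond, hf, rfl⟩ -
    have e1 := hf.reg vQ
    simp [hQ] at e1
    simp [c1, e1] at hcond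
    have hall : ∀ w, w ∈ V := fun w => c4 w (by omega)
    have hcard : V.card ≤ q := by simpa using Finset.card_le_univ V
    refine hR _ ⟨fun v => s'.mem (12 + 9 * v), fun v => ⟨s'.mem (13 + 9 * v),
      c3.root_lt v (hall v)⟩,
      ⟨fun v h => Fin.ext (c3.root_of_zero v (hall v) h), fun v h => c3.dep_succ v (hall v) h,
        fun v => Fin.ext (c3.root_succ v (hall v))⟩, fun v => ?_, fun v => rfl, fun v => rfl,
        c6, ?_⟩
    · exact lt_of_lt_of_le (c3.dep_lt v (hall v)) hcard
    · simp
      omega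

/-! ### Preprocessing: states sorted by depth -/

/-- The linked list of states that starts with the pointer `h`, where zero ends the list and
`v + 1` points to the state `v`. -/
def Chain (m : ℕ → ℕ) : ℕ → List (Fin q) → Prop
  | h, [] => h = 0
  | h, v :: l => h = v + 1 ∧ Chain m (m (17 + 9 * v)) l

theorem Chain.congr {m m' : ℕ → ℕ} : ∀ {l : List (Fin q)} {h : ℕ}, Chain m h l →
    (∀ v ∈ l, m' (17 + 9 * v) = m (17 + 9 * v)) → Chain m' h l
  | [], _, h, _ => h
  | v :: l, _, h, hm => ⟨h.1, by
      rw [hm v (by simp)]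
      exact Chain.congr h.2 fun w hw => hm w (by simp [hw])⟩

/-- Sort the states into lists by depth. -/
def bucketCode : Cmd :=
  vC ≔ 0 ;;
  .loop (.lt vC vQ)
    (.ld vDd (12 + 9 * vC) ;; .ld vCnt (16 + 9 * vDd) ;; .st (17 + 9 * vC) vCnt ;;
      .st (16 + 9 * vDd) (vC + 1) ;; vC ≔ vC + 1)

/-- The head of the list for the depth `d` is kept in the record of the state `d`. -/
theorem bucket_spec {s : NS} {dep : Fin q → ℕ} (hb : 4 * (10 + 9 * q) < 2 ^ b)
    (hQ : s.reg vQ = q) (hdep : ∀ v : Fin q, s.mem (12 + 9 * v) = dep v) (hlt : ∀ v, dep v < q)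
    (h6 : ∀ w : Fin q, s.mem (16 + 9 * w) = 0) :
    wp b A cost bucketCode (fun s' =>
      (∀ d < q, ∃ l : List (Fin q), Chain s'.mem (s'.mem (16 + 9 * d)) l ∧ l.Nodup ∧
        ∀ v, v ∈ l ↔ dep v = d) ∧
      (∀ x : ℕ, (∀ w : Fin q, x ≠ 16 + 9 * w ∧ x ≠ 17 + 9 * w) → s'.mem x = s.mem x) ∧
      s'.time ≤ s.time + 20 + 60 * q) s := by
  have hb0 : b ≠ 0 := by
    rintro rfl
    simp at hb
  refine wp_abs fun R hR => ?_
  unfold bucketCode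
  rw [wp_seq, wp_set]
  refine ⟨by simp, ?_⟩
  refine wp_use (wp_while (fun s' => ∃ c ≤ q, s'.reg vC = c ∧
      (∀ d < q, ∃ l : List (Fin q), Chain s'.mem (s'.mem (16 + 9 * d)) l ∧ l.Nodup ∧
        ∀ v : Fin q, v ∈ l ↔ v < c ∧ dep v = d) ∧
      (∀ x : ℕ, (∀ w : Fin q, x ≠ 16 + 9 * w ∧ x ≠ 17 + 9 * w) → s'.mem x = s.mem x) ∧
      s'.time ≤ s.time + 10 + 60 * c) (s.time + 10 + 60 * q) ?_ ?_ ?_ ?_) ?_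
  · refine ⟨0, by omega, by simp, fun d hd => ⟨[], ?_, by simp, by simp⟩, by simp, by simp⟩
    exact h6 ⟨d, hd⟩
  · rintro s' ⟨c, h1, -, -, -, h2⟩
    omega
  · intro s' _ _
    simp
  · rintro s' ⟨c, c1, c2, c3, c4, c5⟩ hf hcond
    have e1 := hf.reg vQ
    simp [hQ] at e1
    simp [c2, e1] at hcond
    set v : Fin q := ⟨c, hcond⟩
    have hvc : (v : ℕ) = c := rfl
    have e2 : s'.mem (12 + 9 * c) = dep v := by
      rw [c4 _ (fun w => by omega), ← hdep]
    have hd := hlt v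
    refine wp_abs fun R' hR' => ?_
    simp [c2, e2, and_assoc]
    repeat refine ⟨by omega, ?_⟩
    intro _
    repeat refine ⟨by omega, ?_⟩
    intro hlt2
    repeat refine ⟨by omega, ?_⟩
    refine hR' _ ⟨c + 1, by omega, by simp, fun d hdq => ?_, fun x hx => ?_, by simp; omega⟩
    · obtain ⟨l, l1, l2, l3⟩ := c3 d hdq
      have hcongr : Chain (Function.update (Function.update s'.mem (17 + 9 * c)
          (s'.mem (16 + 9 * dep v))) (16 + 9 * dep v) (c + 1)) (s'.mem (16 + 9 * d)) l := by
        refine l1.congr fun w hw => ?_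
        have := (l3 w).1 hw
        rw [Function.update_of_ne (by omega), Function.update_of_ne (by omega)]
      simp only [NS.tick_mem, NS.put_mem, NS.set_mem]
      by_cases hdv : dep v = d
      · subst hdv
        refine ⟨v :: l, ⟨?_, ?_⟩, ?_, fun w => ?_⟩
        · rw [Function.update_self]
        · have : Function.update (Function.update s'.mem (17 + 9 * c)
              (s'.mem (16 + 9 * dep v))) (16 + 9 * dep v) (c + 1) (17 + 9 * c) =
              s'.mem (16 + 9 * dep v) := by
            rw [Function.update_of_ne (by omega), Function.update_self]
          rw [hvc, this]
          exact hcongr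
        · refine List.nodup_cons.2 ⟨fun h => ?_, l2⟩
          have := (l3 v).1 h
          omega
        · rw [List.mem_cons, l3]
          constructor
          · rintro (rfl | ⟨h1, h2⟩)
            · exact ⟨by omega, rfl⟩
            · exact ⟨by omega, h2⟩
          · rintro ⟨h1, h2⟩
            rcases Nat.lt_succ_iff_lt_or_eq.1 h1 with h1 | h1
            · exact Or.inr ⟨h1, h2⟩
            · exact Or.inl (Fin.ext h1)
      · refine ⟨l, ?_, l2, fun w => ?_⟩
        · have : Function.update (Function.update s'.mem (17 + 9 * c)
              (s'.mem (16 + 9 * dep v))) (16 + 9 * dep v) (c + 1) (16 + 9 * d) =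
              s'.mem (16 + 9 * d) := by
            rw [Function.update_of_ne (by omega), Function.update_of_ne (by omega)]
          rw [this]
          exact hcongr
        · rw [l3]
          constructor
          · rintro ⟨h1, h2⟩
            exact ⟨by omega, h2⟩
          · rintro ⟨h1, h2⟩
            refine ⟨lt_of_le_of_ne (Nat.lt_succ_iff.1 h1) fun h => hdv ?_, h2⟩
            rw [← h2]
            exact congrArg dep (Fin.ext h.symm)
    · simp only [NS.tick_mem, NS.put_mem, NS.set_mem]
      have h1 := (hx v).2
      have h2 := (hx ⟨dep v, hd⟩).1
      rw [Function.update_of_ne h2, Function.update_of_ne h1, c4 x hx]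
  · rintro _ ⟨s', ⟨c, c1, c2, c3, c4, c5⟩, hcond, hf, rfl⟩ -
    have e1 := hf.reg vQ
    simp [hQ] at e1
    simp [c2, e1] at hcond
    have : c = q := by omega
    subst this
    refine hR _ ⟨fun d hd => ?_, c4, by simp; omega⟩
    obtain ⟨l, l1, l2, l3⟩ := c3 d hd
    exact ⟨l, l1, l2, fun v => by simp [l3]⟩

/-! ### Preprocessing: ladders -/

/-- Follow a path upwards from the state `vU` to a root or to a state on another path, and record
its address `vAl` and the positions on it. The number of states is computed in `vCnt`. -/
def pathCode : Cmd :=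
  vCnt ≔ 0 ;; vGo ≔ 1 ;;
  .loop (.ne vGo 0)
    (.st (14 + 9 * vU) vAl ;; .st (15 + 9 * vU) vCnt ;; vCnt ≔ vCnt + 1 ;;
      .ld vT0 (12 + 9 * vU) ;;
      .ite (.eq vT0 0) (vGo ≔ 0)
        (.ld vU (10 + 9 * vU) ;; .ld vT0 (14 + 9 * vU) ;; .ite (.eq vT0 0) .skip (vGo ≔ 0)))

/-- The path consists of the `n` states from `v` upwards before the first one in `V`, the set of
states that are already on paths. -/
theorem path_spec {s : NS} {g : Fin q → Fin q} {dep : Fin q → ℕ} {root : Fin q → Fin q}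
    {v : Fin q} {V : Finset (Fin q)} {al : ℕ} (hb : 4 * (10 + 9 * q) < 2 ^ b)
    (F : Forest g dep root) (hlt : ∀ v, dep v < q) (hu : s.reg vU = v) (hal : s.reg vAl = al)
    (hg : ∀ w : Fin q, s.mem (10 + 9 * w) = g w) (hdep : ∀ v : Fin q, s.mem (12 + 9 * v) = dep v)
    (hV : ∀ w : Fin q, w ∈ V ↔ s.mem (14 + 9 * w) ≠ 0) (hv : v ∉ V) :
    wp b A cost pathCode (fun s' => ∃ n, s'.reg vCnt = n ∧ 1 ≤ n ∧ n ≤ dep v + 1 ∧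
      (∀ i < n, g^[i] v ∉ V) ∧ (n = dep v + 1 ∨ g^[n] v ∈ V) ∧
      (∀ i < n, s'.mem (14 + 9 * (g^[i] v : Fin q)) = al ∧
        s'.mem (15 + 9 * (g^[i] v : Fin q)) = i) ∧
      (∀ x : ℕ, (∀ i < n, x ≠ 14 + 9 * (g^[i] v : Fin q) ∧ x ≠ 15 + 9 * (g^[i] v : Fin q)) →
        s'.mem x = s.mem x) ∧
      s'.time ≤ s.time + 20 + 60 * n) s := by
  have hb0 : b ≠ 0 := by
    rintro rfl
    simp at hb
  have hdv := hlt v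
  refine wp_abs fun R hR => ?_
  unfold pathCode
  rw [wp_seq, wp_set, wp_seq, wp_set]
  refine ⟨by simp, by simpa using hb0, ?_⟩
  refine wp_use (wp_while (fun s' => ∃ n, s'.reg vCnt = n ∧ n ≤ dep v + 1 ∧
      (∀ i < n, g^[i] v ∉ V) ∧
      ((s'.reg vGo ≠ 0 ∧ n ≤ dep v ∧ g^[n] v ∉ V ∧ s'.reg vU = (g^[n] v : Fin q)) ∨
        (s'.reg vGo = 0 ∧ 1 ≤ n ∧ (n = dep v + 1 ∨ g^[n] v ∈ V))) ∧
      (∀ i < n, s'.mem (14 + 9 * (g^[i] v : Fin q)) = al ∧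
        s'.mem (15 + 9 * (g^[i] v : Fin q)) = i) ∧
      (∀ x : ℕ, (∀ i < n, x ≠ 14 + 9 * (g^[i] v : Fin q) ∧ x ≠ 15 + 9 * (g^[i] v : Fin q)) →
        s'.mem x = s.mem x) ∧
      s'.time ≤ s.time + 10 + 60 * n) (s.time + 10 + 60 * (dep v + 1)) ?_ ?_ ?_ ?_) ?_
  · refine ⟨0, by simp, by omega, by simp, Or.inl ⟨by simp, by omega, hv, by simpa using hu⟩,
      by simp, by simp, by simp⟩
  · rintro s' ⟨n, -, h1, -, -, -, -, h2⟩
    omega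
  · intro s' _ _
    simp
  · rintro s' ⟨n, c1, c2, c3, c4, c5, c6, c7⟩ hf hcond
    simp at hcond
    obtain ⟨-, a1, a2, a3⟩ := c4.resolve_right fun h => hcond h.1
    have hr := hf.reg vAl
    simp [hal] at hr
    have hdu := F.dep_iterate n v a1
    have hgu : g (g^[n] v) = g^[n + 1] v := (Function.iterate_succ_apply' g n v).symm
    have hne : ∀ i < n, (g^[i] v : ℕ) ≠ (g^[n] v : Fin q) := by
      intro i hi he
      have := F.dep_iterate i v (by omega)
      rw [Fin.ext he, hdu] at this
      omega
    have e1 : s'.mem (10 + 9 * (g^[n] v : Fin q)) = (g^[n + 1] v : Fin q) := by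
      rw [c6 _ (fun i hi => by omega), hg, hgu]
    have e2 : s'.mem (12 + 9 * (g^[n] v : Fin q)) = dep v - n := by
      rw [c6 _ (fun i hi => by omega), hdep, hdu]
    set u := g^[n] v with hu'
    set u₁ := g^[n + 1] v with hu1
    have huq := u.2
    have huq₁ := u₁.2
    have hmem : ∀ x : ℕ, (∀ i < n + 1, x ≠ 14 + 9 * (g^[i] v : Fin q) ∧
        x ≠ 15 + 9 * (g^[i] v : Fin q)) →
        Function.update (Function.update s'.mem (14 + 9 * (u : ℕ)) al) (15 + 9 * (u : ℕ)) n x =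
          s.mem x := by
      intro x hx
      have := hx n (by omega)
      rw [← hu'] at this
      rw [Function.update_of_ne this.2, Function.update_of_ne this.1]
      exact c6 x fun i hi => hx i (by omega)
    have hmem2 : ∀ i < n + 1,
        Function.update (Function.update s'.mem (14 + 9 * (u : ℕ)) al) (15 + 9 * (u : ℕ)) n
          (14 + 9 * (g^[i] v : Fin q)) = al ∧
        Function.update (Function.update s'.mem (14 + 9 * (u : ℕ)) al) (15 + 9 * (u : ℕ)) n
          (15 + 9 * (g^[i] v : Fin q)) = i := by
      intro i hi
      rcases Nat.lt_succ_iff_lt_or_eq.1 hi with hi | rfl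
      · have := hne i hi
        rw [Function.update_of_ne (by omega), Function.update_of_ne (by omega),
          Function.update_of_ne (by omega), Function.update_of_ne (by omega)]
        exact c5 i hi
      · rw [← hu', Function.update_self, Function.update_of_ne (by omega), Function.update_self]
        exact ⟨rfl, rfl⟩
    have hV' : ∀ i < n + 1, g^[i] v ∉ V := by
      intro i hi
      rcases Nat.lt_succ_iff_lt_or_eq.1 hi with hi | rfl
      · exact c3 i hi
      · exact a2
    set m₁ := Function.update (Function.update s'.mem (14 + 9 * (u : ℕ)) al) (15 + 9 * (u : ℕ)) n
      with hm₁
    refine wp_abs fun R' hR' => ?_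
    rw [wp_seq, wp_st, wp_seq, wp_st, wp_seq, wp_set, wp_seq, wp_ld]
    simp [c1, a3, hr, and_assoc]
    rw [← hm₁, e1, e2]
    repeat refine ⟨by omega, ?_⟩
    intro _
    refine ⟨fun h0 => ?_, fun h0 => ?_⟩
    · refine hR' _ ⟨n + 1, by simp, by omega, hV', Or.inr ⟨by simp, by omega, Or.inl (by omega)⟩,
        ?_, ?_, ?_⟩
      · simpa [hm₁] using hmem2
      · simpa [hm₁] using hmem
      · simp
        omega
    · repeat refine ⟨by omega, ?_⟩
      intro _
      repeat refine ⟨by omega, ?_⟩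
      intro _
      have hdu₁ : dep u₁ + 1 = dep v - n := by
        rw [← hgu, F.dep_succ u (by omega), hdu]
      have hu₁V : u₁ ∈ V ↔ m₁ (14 + 9 * (u₁ : ℕ)) ≠ 0 := by
        have : m₁ (14 + 9 * (u₁ : ℕ)) = s.mem (14 + 9 * (u₁ : ℕ)) := by
          refine hmem _ fun i hi => ⟨fun he => ?_, by omega⟩
          have h1 := F.dep_iterate i v (by omega)
          have h2 : g^[i] v = u₁ := Fin.ext (by omega)
          rw [h2] at h1
          omega
        rw [hV, this]
      refine ⟨fun h1 => ?_, fun h1 => ?_⟩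
      · refine hR' _ ⟨n + 1, by simp, by omega, hV', Or.inl ⟨?_, by omega, ?_, ?_⟩, ?_, ?_, ?_⟩
        · simpa using hcond
        · rw [← hu1, hu₁V]
          simp [h1]
        · simp [hu1]
        · simpa [hm₁] using hmem2
        · simpa [hm₁] using hmem
        · simp
          omega
      · refine hR' _ ⟨n + 1, by simp, by omega, hV', Or.inr ⟨?_, by omega, Or.inr ?_⟩, ?_, ?_, ?_⟩
        · simp
        · rw [← hu1, hu₁V]
          exact h1
        · simpa [hm₁] using hmem2
        · simpa [hm₁] using hmem
        · simp
          omega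
  · rintro _ ⟨s', ⟨n, c1, c2, c3, c4, c5, c6, c7⟩, hcond, hf, rfl⟩ -
    simp at hcond
    obtain ⟨-, a1, a2⟩ := c4.resolve_left fun h => h.1 hcond
    refine hR _ ⟨n, c1, a1, c2, c3, a2, c5, c6, ?_⟩
    simp
    omega

/-- Store the ladder of the path with `vCnt` states that starts at `vU`. The ladder has
`(2 ^ L + 1) * vCnt` states, and is stored at the address `vAl`, which is advanced. -/
def ladderCode : Cmd :=
  vCnt ≔ vCnt * (vP + 1) ;; .st vAl vCnt ;; vAl ≔ vAl + 1 ;;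
  .loop (.lt 0 vCnt)
    (.st vAl vU ;; vAl ≔ vAl + 1 ;; .ld vU (10 + 9 * vU) ;; vCnt ≔ vCnt - 1)

theorem ladder_spec {s : NS} {g : Fin q → Fin q} {v : Fin q} {al n P : ℕ} (h1 : 10 + 9 * q ≤ al)
    (h2 : 4 * (al + 1 + n * (P + 1)) < 2 ^ b) (hu : s.reg vU = v) (hal : s.reg vAl = al)
    (hn : s.reg vCnt = n) (hP : s.reg vP = P) (hPb : P + 1 < 2 ^ b)
    (hg : ∀ w : Fin q, s.mem (10 + 9 * w) = g w) :
    wp b A cost ladderCode (fun s' => s'.reg vAl = al + 1 + n * (P + 1) ∧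
      s'.mem al = n * (P + 1) ∧
      (∀ j < n * (P + 1), s'.mem (al + 1 + j) = (g^[j] v : Fin q)) ∧
      (∀ x, x < al → s'.mem x = s.mem x) ∧
      (∀ x, al + 1 + n * (P + 1) ≤ x → s'.mem x = s.mem x) ∧
      s'.time ≤ s.time + 20 + 40 * (n * (P + 1))) s := by
  have hb0 : b ≠ 0 := by
    rintro rfl
    simp at h2
  refine wp_abs fun R hR => ?_
  unfold ladderCode
  set sz := n * (P + 1) with hsz
  rw [wp_seq, wp_set, wp_seq, wp_st, wp_seq, wp_set]
  simp [hn, hP, hal, ← hsz, and_assoc]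
  refine ⟨by omega, by omega, by omega, by omega, by omega, by omega, ?_⟩
  refine wp_use (wp_while (fun s' => ∃ k ≤ sz, s'.reg vCnt = sz - k ∧ s'.reg vAl = al + 1 + k ∧
      s'.reg vU = (g^[k] v : Fin q) ∧ s'.mem al = sz ∧
      (∀ j < k, s'.mem (al + 1 + j) = (g^[j] v : Fin q)) ∧
      (∀ x, x < al → s'.mem x = s.mem x) ∧ (∀ x, al + 1 + k ≤ x → s'.mem x = s.mem x) ∧
      s'.time ≤ s.time + 15 + 40 * k) (s.time + 15 + 40 * sz) ?_ ?_ ?_ ?_) ?_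
  · refine ⟨0, by omega, by simp, by simp, by simpa using hu, by simp, by simp, fun x hx => ?_,
      fun x hx => ?_, by simp⟩
    · simp
      rw [Function.update_of_ne (by omega)]
    · simp
      rw [Function.update_of_ne (by omega)]
  · rintro s' ⟨k, c1, -, -, -, -, -, -, -, c2⟩
    omega
  · intro s' _ _
    simp
  · rintro s' ⟨k, c1, c2, c3, c4, c5, c6, c7, c8, c9⟩ hf hcond
    simp [c2] at hcond
    set u := g^[k] v with hu'
    have huq := u.2
    have hgq := (g u).2
    have e1 : s'.mem (10 + 9 * (u : ℕ)) = g u := by rw [c7 _ (by omega), hg]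
    refine wp_abs fun R' hR' => ?_
    simp [c2, c3, c4, and_assoc]
    rw [Function.update_of_ne (by omega), e1]
    repeat refine ⟨by omega, ?_⟩
    intro _
    repeat refine ⟨by omega, ?_⟩
    refine hR' _ ⟨k + 1, by omega, by simp; omega, by simp; omega, ?_, ?_, ?_, ?_, ?_, ?_⟩
    · simp [hu', ← Function.iterate_succ_apply' g k v, Function.iterate_succ_apply]
    · simp
      rw [Function.update_of_ne (by omega), c5]
    · intro j hj
      simp
      rcases Nat.lt_succ_iff_lt_or_eq.1 hj with hj | rfl
      · rw [Function.update_of_ne (by omega), c6 j hj]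
      · rw [Function.update_self]
    · intro x hx
      simp
      rw [Function.update_of_ne (by omega), c7 x hx]
    · intro x hx
      simp
      rw [Function.update_of_ne (by omega), c8 x (by omega)]
    · simp
      omega
  · rintro _ ⟨s', ⟨k, c1, c2, c3, c4, c5, c6, c7, c8, c9⟩, hcond, hf, rfl⟩ -
    simp [c2] at hcond
    have : k = sz := by omega
    subst this
    refine hR _ ⟨c3, c5, c6, c7, c8, ?_⟩
    simp
    omega

/-- The ladders of the states in `V`: the state `w` has the address `m (14 + 9 * w)` of its ladder
and its position `m (15 + 9 * w)` on the path. The states in `V` are on paths whose lowest states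
have depth at least `d`, and these paths end at roots or at other paths. The next free address is
`al`, and `al_le` bounds the memory that is used. -/
structure Laddered (g : Fin q → Fin q) (dep : Fin q → ℕ) (P LB : ℕ) (V : Finset (Fin q))
    (d al : ℕ) (m : ℕ → ℕ) : Prop where
  mem : ∀ w : Fin q, w ∈ V ↔ m (14 + 9 * w) ≠ 0
  ladder : ∀ w ∈ V, ∃ bot : Fin q, g^[m (15 + 9 * w)] bot = w ∧ LB ≤ m (14 + 9 * w) ∧
    m (14 + 9 * w) + 1 + m (m (14 + 9 * w)) ≤ al ∧
    (m (15 + 9 * w) + 1) * (P + 1) ≤ m (m (14 + 9 * w)) ∧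
    ∀ j < m (m (14 + 9 * w)), m (m (14 + 9 * w) + 1 + j) = (g^[j] bot : Fin q)
  high : ∀ w ∈ V, d ≤ m (15 + 9 * w) + dep w
  step : ∀ w ∈ V, dep w ≠ 0 → g w ∈ V ∧ m (15 + 9 * w) + 1 ≤ m (15 + 9 * g w)
  le_al : LB ≤ al
  al_le : al ≤ LB + (P + 2) * V.card

/-- Adding a path that begins at a state of depth `d`. It may end at an old path because positions
do not decrease there: the old path begins at least as deep as the new one. -/
theorem Laddered.extend {g : Fin q → Fin q} {dep : Fin q → ℕ} {root : Fin q → Fin q}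
    {P LB al n : ℕ} {V : Finset (Fin q)} {v : Fin q} {m m' : ℕ → ℕ} (F : Forest g dep root)
    (h : Laddered g dep P LB V (dep v) al m) (hLB : 10 + 9 * q ≤ LB) (h1 : 1 ≤ n)
    (h2 : n ≤ dep v + 1) (h3 : ∀ i < n, g^[i] v ∉ V) (h4 : n = dep v + 1 ∨ g^[n] v ∈ V)
    (h5 : ∀ i < n, m' (14 + 9 * (g^[i] v : Fin q)) = al ∧ m' (15 + 9 * (g^[i] v : Fin q)) = i)
    (h6 : m' al = n * (P + 1)) (h7 : ∀ j < n * (P + 1), m' (al + 1 + j) = (g^[j] v : Fin q))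
    (h8 : ∀ w : Fin q, (∀ i < n, w ≠ g^[i] v) → m' (14 + 9 * w) = m (14 + 9 * w) ∧
      m' (15 + 9 * w) = m (15 + 9 * w))
    (h9 : ∀ x, LB ≤ x → x < al → m' x = m x) :
    ∃ V' : Finset (Fin q), Laddered g dep P LB V' (dep v) (al + 1 + n * (P + 1)) m' ∧
      V'.card = V.card + n ∧ v ∈ V' ∧ V ⊆ V' := by
  have hfr : Fresh g v V n := by
    refine ⟨h3, fun i j hij hj he => ?_⟩
    have e1 := F.dep_iterate i v (by omega)
    have e2 := F.dep_iterate j v (by omega)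
    rw [he] at e1
    omega
  have hcard := hfr.card
  set V' := V ∪ (Finset.range n).image (fun i => g^[i] v)
  have split : ∀ w ∈ V', w ∈ V ∨ ∃ i < n, w = g^[i] v := by
    intro w hw
    rcases Finset.mem_union.1 hw with hw | hw
    · exact Or.inl hw
    · obtain ⟨i, hi, rfl⟩ := Finset.mem_image.1 hw
      exact Or.inr ⟨i, Finset.mem_range.1 hi, rfl⟩
  have memV : ∀ w ∈ V, w ∈ V' := fun w hw => Finset.mem_union_left _ hw
  have memI : ∀ i < n, g^[i] v ∈ V' := fun i hi =>
    Finset.mem_union_right _ (Finset.mem_image.2 ⟨i, Finset.mem_range.2 hi, rfl⟩)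
  have hV : ∀ w ∈ V, m' (14 + 9 * w) = m (14 + 9 * w) ∧ m' (15 + 9 * w) = m (15 + 9 * w) :=
    fun w hw => h8 w fun i hi he => h3 i hi (he ▸ hw)
  have hal := h.le_al
  refine ⟨V', ⟨fun w => ⟨fun hw => ?_, fun hw => ?_⟩, fun w hw => ?_, fun w hw => ?_,
    fun w hw hd => ?_, by omega, ?_⟩, hcard, memI 0 (by omega), fun w => memV w⟩
  · rcases split w hw with hw | ⟨i, hi, rfl⟩
    · rw [(hV w hw).1]; exact (h.mem w).1 hw
    · rw [(h5 i hi).1]; omega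
  · by_cases hi : ∀ i < n, w ≠ g^[i] v
    · rw [(h8 w hi).1] at hw
      exact memV _ ((h.mem w).2 hw)
    · push Not at hi
      obtain ⟨i, hi, rfl⟩ := hi
      exact memI i hi
  · rcases split w hw with hw | ⟨i, hi, rfl⟩
    · obtain ⟨bot, b1, b2, b3, b4, b5⟩ := h.ladder w hw
      rw [(hV w hw).1, (hV w hw).2]
      have e : m' (m (14 + 9 * w)) = m (m (14 + 9 * w)) := h9 _ b2 (by omega)
      rw [e]
      refine ⟨bot, b1, b2, by omega, b4, fun j hj => ?_⟩
      rw [h9 _ (by omega) (by omega), b5 j hj]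
    · rw [(h5 i hi).1, (h5 i hi).2, h6]
      exact ⟨v, rfl, hal, le_rfl, Nat.mul_le_mul_right _ hi, h7⟩
  · rcases split w hw with hw | ⟨i, hi, rfl⟩
    · rw [(hV w hw).2]; exact h.high w hw
    · rw [(h5 i hi).2, F.dep_iterate i v (by omega)]
      omega
  · rcases split w hw with hw | ⟨i, hi, rfl⟩
    · obtain ⟨s1, s2⟩ := h.step w hw hd
      rw [(hV w hw).2, (hV _ s1).2]
      exact ⟨memV _ s1, s2⟩
    · have e : g (g^[i] v) = g^[i + 1] v := (Function.iterate_succ_apply' g i v).symm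
      rw [F.dep_iterate i v (by omega)] at hd
      rw [e, (h5 i hi).2]
      rcases Nat.lt_or_ge (i + 1) n with hi' | hi'
      · rw [(h5 _ hi').2]
        exact ⟨memI _ hi', le_rfl⟩
      · have hin : i + 1 = n := by omega
        rw [hin]
        rcases h4 with h4 | h4
        · omega
        · rw [(hV _ h4).2]
          -- The old path reaches as deep as the new one.
          have := h.high _ h4
          rw [F.dep_iterate n v (by omega)] at this
          exact ⟨memV _ h4, by omega⟩
  · rw [hcard]
    have := h.al_le
    have e : (P + 2) * (V.card + n) = (P + 2) * V.card + n * (P + 1) + n := by ring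
    omega

/-- After `d` steps upwards, the position on the path is at least `d`. -/
theorem Laddered.growth {g : Fin q → Fin q} {dep : Fin q → ℕ} {root : Fin q → Fin q}
    {P LB al c : ℕ} {V : Finset (Fin q)} {m : ℕ → ℕ} (F : Forest g dep root)
    (h : Laddered g dep P LB V c al m) {v : Fin q} (hv : v ∈ V) :
    ∀ d, d ≤ dep v → g^[d] v ∈ V ∧ d ≤ m (15 + 9 * (g^[d] v : Fin q)) := by
  intro d
  induction d with
  | zero => exact fun _ => ⟨hv, by simp⟩
  | succ d ih =>
    intro hd
    obtain ⟨i1, i2⟩ := ih (by omega)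
    obtain ⟨s1, s2⟩ := h.step _ i1 (by rw [F.dep_iterate d v (by omega)]; omega)
    rw [Function.iterate_succ_apply']
    exact ⟨s1, by omega⟩

theorem Laddered.mono {g : Fin q → Fin q} {dep : Fin q → ℕ}
    {P LB al d d' : ℕ} {V : Finset (Fin q)} {m : ℕ → ℕ}
    (h : Laddered g dep P LB V d al m) (hd : d' ≤ d) : Laddered g dep P LB V d' al m :=
  ⟨h.mem, h.ladder, fun w hw => hd.trans (h.high w hw), h.step, h.le_al, h.al_le⟩

/-- Decompose the forest into paths, each of them beginning at a deepest state that is left, and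
store the ladders. -/
def pathsCode : Cmd :=
  vAl ≔ vLB ;; vC ≔ vQ ;;
  .loop (.lt 0 vC)
    (vC ≔ vC - 1 ;; .ld vLast (16 + 9 * vC) ;;
      .loop (.lt 0 vLast)
        (vU ≔ vLast - 1 ;; .ld vLast (17 + 9 * vU) ;; .ld vBase (14 + 9 * vU) ;;
          .ite (.eq vBase 0) (vS ≔ vU ;; pathCode ;; vU ≔ vS ;; ladderCode) .skip))

/-- Cells that are not changed when the ladders are built. -/
def OffPaths (q LB D x : ℕ) : Prop :=
  (x < LB ∨ D ≤ x) ∧ ∀ w : Fin q, x ≠ 14 + 9 * w ∧ x ≠ 15 + 9 * w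

/-- All states of depth `d` are put on paths, provided that the old paths begin at depth at least
`d`. The time is counted per state of the list and per state on a path. -/
theorem bucketPaths_spec {s : NS} {g : Fin q → Fin q} {dep : Fin q → ℕ} {root : Fin q → Fin q}
    {P d al T : ℕ} {V : Finset (Fin q)} {l : List (Fin q)} (F : Forest g dep root)
    (hlt : ∀ v, dep v < q)
    (hLB : 10 + 9 * q ≤ LB) (hD : D = LB + (P + 2) * q) (hDb : 4 * D < 2 ^ b) (hq : 0 < q)
    (hP : s.reg vP = P) (hal : s.reg vAl = al) (hg : ∀ w : Fin q, s.mem (10 + 9 * w) = g w)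
    (hdep : ∀ v : Fin q, s.mem (12 + 9 * v) = dep v) (hl : Chain s.mem (s.reg vLast) l)
    (hld : ∀ v ∈ l, dep v = d) (h : Laddered g dep P LB V d al s.mem)
    (hT : s.time ≤ T + (100 + 40 * (P + 1)) * V.card) :
    wp b A cost (.loop (.lt 0 vLast)
        (vU ≔ vLast - 1 ;; .ld vLast (17 + 9 * vU) ;; .ld vBase (14 + 9 * vU) ;;
          .ite (.eq vBase 0) (vS ≔ vU ;; pathCode ;; vU ≔ vS ;; ladderCode) .skip))
      (fun s' => ∃ al' V', s'.reg vAl = al' ∧ Laddered g dep P LB V' d al' s'.mem ∧ V ⊆ V' ∧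
        (∀ v ∈ l, v ∈ V') ∧ (∀ x, OffPaths q LB D x → s'.mem x = s.mem x) ∧
        s'.time ≤ T + 10 + 100 * l.length + (100 + 40 * (P + 1)) * V'.card) s := by
  have hb0 : b ≠ 0 := by
    rintro rfl
    simp at hDb
    have := Nat.le_mul_of_pos_right (P + 2) hq
    omega
  have hPq : P + 2 ≤ (P + 2) * q := Nat.le_mul_of_pos_right _ hq
  have offN : ∀ (w : Fin q) (f : ℕ), f < 4 ∨ 6 ≤ f → f < 9 → OffPaths q LB D (10 + f + 9 * w) :=
    fun w f _ _ => ⟨Or.inl (by omega), fun w' => by omega⟩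
  refine wp_abs fun R hR => ?_
  -- The states in `l₁` have been considered.
  refine wp_use (wp_while (fun s' => ∃ (l₁ l₂ : List (Fin q)) (al' : ℕ) (V' : Finset (Fin q)),
      l = l₁ ++ l₂ ∧ Chain s.mem (s'.reg vLast) l₂ ∧
      s'.reg vAl = al' ∧ Laddered g dep P LB V' d al' s'.mem ∧ V ⊆ V' ∧
        (∀ v ∈ l₁, v ∈ V') ∧ (∀ x, OffPaths q LB D x → s'.mem x = s.mem x) ∧
        s'.time ≤ T + 100 * l₁.length + (100 + 40 * (P + 1)) * V'.card)
      (T + 100 * l.length + (100 + 40 * (P + 1)) * q) ?_ ?_ ?_ ?_) ?_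
  · exact ⟨[], l, al, V, rfl, hl, hal, h, subset_rfl, by simp, by simp, by simpa using hT⟩
  · rintro s' ⟨l₁, l₂, al', V', rfl, -, -, -, -, -, -, c1⟩
    have h1 : V'.card ≤ q := by simpa using Finset.card_le_univ V'
    have h2 := Nat.mul_le_mul_left (100 + 40 * (P + 1)) h1
    simp
    omega
  · intro s' _ _
    simp
  · rintro s' ⟨l₁, l₂, al', V', c1, c2, c3, c4, c5, c6, c7, c8⟩ hf hcond
    simp at hcond
    match l₂, c2 with
    | [], c2 =>
      simp only [Chain] at c2
      omega
    | v :: l₂, ⟨c2, c2'⟩ =>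
    have hdv : dep v = d := hld v (by simp [c1])
    have e1 : s'.mem (17 + 9 * v) = s.mem (17 + 9 * v) :=
      c7 _ (offN v 7 (by omega) (by omega))
    have e2 := hf.reg vP
    rw [hP] at e2
    have hg' : ∀ w : Fin q, s'.mem (10 + 9 * w) = g w := fun w => by
      rw [c7 _ (offN w 0 (by omega) (by omega)), hg]
    have hdep' : ∀ w : Fin q, s'.mem (12 + 9 * w) = dep w := fun w => by
      rw [c7 _ (offN w 2 (by omega) (by omega)), hdep]
    refine wp_abs fun R' hR' => ?_
    rw [wp_seq, wp_set, wp_seq, wp_ld, wp_seq, wp_ld, wp_ite]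
    refine ⟨by simp [hb0]; omega, by simp [c2]; omega, by simp [c2]; omega, fun _ =>
      ⟨by simp [c2]; omega,
      by simp [c2]; omega, fun _ => ⟨by simp, fun h0 => ?_, fun h0 => ?_⟩⟩⟩
    · simp [c2] at h0
      have hv : v ∉ V' := by
        rw [c4.mem]
        simp [h0]
      rw [wp_seq, wp_set, wp_seq]
      refine ⟨by simp, ?_⟩
      refine wp_use (path_spec (v := v) (V := V') (al := al') (g := g) (by omega) F hlt
        (by simp [c2]) (by simp [c3]) (by simpa using hg') (by simpa using hdep')
        (by simpa using c4.mem) hv) ?_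
      rintro s₁ ⟨n, m1, m2, m3, m4, m5, m6, m7, m8⟩ hf₁
      have f1 := hf₁.reg vAl
      have f2 := hf₁.reg vP
      have f3 := hf₁.reg vLast
      have f4 := hf₁.reg vS
      simp [c2, c3, e1, e2] at f1 f2 f3 f4
      simp [c2] at m7 m8
      have hg₁ : ∀ w : Fin q, s₁.mem (10 + 9 * w) = g w := fun w => by
        rw [m7 _ fun i hi => by omega, hg']
      have hcard : V'.card + n ≤ q := by
        refine Fresh.card_le (g := g) (v := v) ⟨m4, fun i j hij hj he => ?_⟩
        have e1 := F.dep_iterate i v (by omega)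
        have e2 := F.dep_iterate j v (by omega)
        rw [he] at e1
        omega
      have hle := c4.al_le
      have hge := c4.le_al
      have hmul := Nat.mul_le_mul_left (P + 2) hcard
      have hexp : (P + 2) * (V'.card + n) = (P + 2) * V'.card + n * (P + 1) + n := by ring
      rw [wp_seq, wp_set]
      refine ⟨by simp, ?_⟩
      refine wp_use (ladder_spec (v := v) (al := al') (n := n) (P := P) (g := g) (by omega)
        (by omega) (by simp [f4]) (by simp [f1]) (by simp [m1]) (by simp [f2]) (by omega)
        (by simpa using hg₁)) ?_
      rintro s₂ ⟨n1, n2, n3, n4, n5, n6⟩ hf₂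
      have g3 := hf₂.reg vLast
      simp [f3] at g3
      simp at n4 n5 n6
      rw [← hdv] at c4
      have hnode : ∀ (w : Fin q) (f : ℕ), f < 9 →
          s₂.mem (10 + f + 9 * w) = s₁.mem (10 + f + 9 * w) :=
        fun w f hf => n4 _ (by omega)
      obtain ⟨V₂, v1, v2, v3, v4⟩ := c4.extend (m' := s₂.mem) F hLB m2 m3 m4 m5
        (fun i hi => by rw [hnode _ 4 (by omega), hnode _ 5 (by omega)]; exact m6 i hi)
        n2 n3 (fun w hw => by
          have hw' : ∀ i < n, (w : ℕ) ≠ (g^[i] v : Fin q) := fun i hi he => hw i hi (Fin.ext he)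
          rw [hnode _ 4 (by omega), hnode _ 5 (by omega),
            m7 _ (fun i hi => by have := hw' i hi; omega),
            m7 _ (fun i hi => by have := hw' i hi; omega)]
          exact ⟨rfl, rfl⟩)
        (fun x h1 h2 => by rw [n4 x h2, m7 x fun i hi => by omega])
      rw [hdv] at v1
      refine hR' _ ⟨l₁ ++ [v], l₂, _, V₂, by simp [c1], ?_, n1, v1, c5.trans v4, ?_, ?_, ?_⟩
      · rw [g3]
        exact c2'
      · intro w hw
        rcases List.mem_append.1 hw with hw | hw
        · exact v4 (c6 w hw)
        · rw [List.mem_singleton.1 hw]; exact v3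
      · intro x hx
        have h1 : s₂.mem x = s₁.mem x := by
          rcases hx.1 with h1 | h1
          · exact n4 x (by omega)
          · exact n5 x (by omega)
        rw [h1, m7 x (fun i hi => hx.2 _), c7 x hx]
      · rw [v2]
        have : (100 + 40 * (P + 1)) * (V'.card + n) =
          (100 + 40 * (P + 1)) * V'.card + 100 * n + 40 * (n * (P + 1)) := by ring
        simp
        omega
    · simp [c2] at h0
      rw [wp_skip]
      refine hR' _ ⟨l₁ ++ [v], l₂, al', V', by simp [c1], ?_, by simp [c3], by simpa using c4, c5,
        ?_, by simpa using c7, ?_⟩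
      · simp [c2, e1]
        exact c2'
      · intro w hw
        rcases List.mem_append.1 hw with hw | hw
        · exact c6 w hw
        · rw [List.mem_singleton.1 hw, c4.mem]; exact h0
      · simp
        omega
  · rintro _ ⟨s', ⟨l₁, l₂, al', V', c1, c2, c3, c4, c5, c6, c7, c8⟩, hcond, hf, rfl⟩ -
    simp at hcond
    have hl₂ : l₂ = [] := by
      cases l₂ with
      | nil => rfl
      | cons v l₂ =>
        have := c2.1
        omega
    subst hl₂
    rw [List.append_nil] at c1
    subst c1
    refine hR _ ⟨al', V', by simpa using c3, by simpa using c4, c5, c6, by simpa using c7, ?_⟩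
    simp
    omega

/-- All states are put on paths. Depths are treated in decreasing order, so that every path begins
at a deepest state that is left. The time is linear in the total length of the ladders. -/
theorem paths_spec {s : NS} {g : Fin q → Fin q} {dep : Fin q → ℕ} {root : Fin q → Fin q}
    {P : ℕ} (F : Forest g dep root) (hlt : ∀ v, dep v < q)
    (hLB : 10 + 9 * q ≤ LB) (hD : D = LB + (P + 2) * q) (hDb : 4 * D < 2 ^ b) (hq : 0 < q)
    (hP : s.reg vP = P) (hQ : s.reg vQ = q) (hrLB : s.reg vLB = LB)
    (hg : ∀ w : Fin q, s.mem (10 + 9 * w) = g w)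
    (hdep : ∀ v : Fin q, s.mem (12 + 9 * v) = dep v)
    (h4 : ∀ v : Fin q, s.mem (14 + 9 * v) = 0)
    (hl : ∀ d < q, ∃ l : List (Fin q), Chain s.mem (s.mem (16 + 9 * d)) l ∧ l.Nodup ∧
        ∀ v, v ∈ l ↔ dep v = d) :
    wp b A cost pathsCode (fun s' => ∃ al V, Laddered g dep P LB V 0 al s'.mem ∧ (∀ v, v ∈ V) ∧
        (∀ x, OffPaths q LB D x → s'.mem x = s.mem x) ∧
        s'.time ≤ s.time + 30 + (300 + 40 * (P + 1)) * q) s := by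
  have hPq : P + 2 ≤ (P + 2) * q := Nat.le_mul_of_pos_right _ hq
  have hb0 : b ≠ 0 := by
    rintro rfl
    simp at hDb
    omega
  have offN : ∀ (w : Fin q) (f : ℕ), f < 4 ∨ 6 ≤ f → f < 9 → OffPaths q LB D (10 + f + 9 * w) :=
    fun w f _ _ => ⟨Or.inl (by omega), fun w' => by omega⟩
  refine wp_abs fun R hR => ?_
  unfold pathsCode
  rw [wp_seq, wp_set, wp_seq, wp_set]
  refine ⟨by simp, by simp, ?_⟩
  -- The states of depth at least `d` are on paths.
  refine wp_use (wp_while (fun s' => ∃ (d al : ℕ) (V : Finset (Fin q)), d ≤ q ∧ s'.reg vC = d ∧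
      s'.reg vAl = al ∧ Laddered g dep P LB V d al s'.mem ∧ (∀ v, d ≤ dep v → v ∈ V) ∧
      (∀ x, OffPaths q LB D x → s'.mem x = s.mem x) ∧
      s'.time + 100 * d ≤ s.time + 10 + 100 * q +
        100 * (Finset.univ.filter (fun v => d ≤ dep v)).card + (100 + 40 * (P + 1)) * V.card)
      (s.time + 10 + 200 * q + (100 + 40 * (P + 1)) * q) ?_ ?_ ?_ ?_) ?_
  · refine ⟨q, LB, ∅, le_rfl, by simp [hQ], by simp [hrLB], ⟨?_, ?_, ?_, ?_, ?_, ?_⟩,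
      fun v hv => absurd (hlt v) (by omega), by simp, ?_⟩
    any_goals simp [h4]
    omega
  · rintro s' ⟨d, al, V, -, -, -, -, -, -, c1⟩
    have h1 : V.card ≤ q := by simpa using Finset.card_le_univ V
    have h2 := Nat.mul_le_mul_left (100 + 40 * (P + 1)) h1
    have h3 : (Finset.univ.filter (fun v => d ≤ dep v)).card ≤ q := by
      simpa using Finset.card_le_univ (Finset.univ.filter (fun v => d ≤ dep v))
    omega
  · intro s' _ _
    simp
  · rintro s' ⟨d, al, V, c0, c1, c2, c3, c4, c5, c6⟩ hf hcond
    simp [c1] at hcond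
    have e1 := hf.reg vP
    simp [hP] at e1
    obtain ⟨l, l1, l2, l3⟩ := hl (d - 1) (by omega)
    have hhead : s'.mem (16 + 9 * (d - 1)) = s.mem (16 + 9 * (d - 1)) :=
      c5 _ (offN ⟨d - 1, by omega⟩ 6 (by omega) (by omega))
    refine wp_abs fun R' hR' => ?_
    rw [wp_seq, wp_set, wp_seq, wp_ld]
    refine ⟨by simp [c1, hb0]; omega, by simp [c1]; omega, by simp [c1]; omega, fun _ => ?_⟩
    refine wp_use (bucketPaths_spec (D := D) (P := P) (al := al) (V := V) (l := l)
      (d := d - 1) F hlt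
      hLB hD hDb hq (T := s'.time + 20 - (100 + 40 * (P + 1)) * V.card)
      (by simp [e1]) (by simp [c2]) (fun w => ?_) (fun w => ?_) ?_ (fun v hv => (l3 v).1 hv)
      (by simpa using c3.mono (by omega)) (by simp; omega)) ?_
    · simp
      rw [c5 _ (offN w 0 (by omega) (by omega)), hg]
    · simp
      rw [c5 _ (offN w 2 (by omega) (by omega)), hdep]
    · simp [c1, hhead]
      exact l1.congr fun v _ => c5 _ (offN v 7 (by omega) (by omega))
    rintro s₁ ⟨al', V', m1, m2, m3, m4, m5, m6⟩ hf₁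
    have f1 := hf₁.reg vC
    simp [c1] at f1
    simp at m5
    have hfilter : (Finset.univ.filter (fun v => d - 1 ≤ dep v)).card =
        (Finset.univ.filter (fun v => d ≤ dep v)).card + l.length := by
      have : Finset.univ.filter (fun v => d - 1 ≤ dep v) =
          Finset.univ.filter (fun v => d ≤ dep v) ∪ l.toFinset := by
        ext v
        simp [l3]
        omega
      rw [this, Finset.card_union_of_disjoint, List.toFinset_card_of_nodup l2]
      rw [Finset.disjoint_right]
      intro v hv
      simp [l3] at hv
      simp
      omega
    refine hR' _ ⟨d - 1, al', V', by omega, f1, m1, m2, fun v hv => ?_, fun x hx => ?_, ?_⟩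
    · rcases Nat.lt_or_ge (dep v) d with h | h
      · exact m4 v ((l3 v).2 (by omega))
      · exact m3 (c4 v h)
    · rw [m5 x hx, c5 x hx]
    · rw [hfilter]
      omega
  · rintro _ ⟨s', ⟨d, al, V, c0, c1, c2, c3, c4, c5, c6⟩, hcond, hf, rfl⟩ -
    simp [c1] at hcond
    subst hcond
    refine hR _ ⟨al, V, by simpa using c3, fun v => c4 v (by omega), by simpa using c5, ?_⟩
    have h1 : V.card ≤ q := by simpa using Finset.card_le_univ V
    have h2 := Nat.mul_le_mul_left (100 + 40 * (P + 1)) h1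
    have h3 : (Finset.univ.filter (fun v => 0 ≤ dep v)).card ≤ q := by simp
    have h4 : (300 + 40 * (P + 1)) * q = 200 * q + (100 + 40 * (P + 1)) * q := by ring
    simp
    omega

/-! ### Blocks of input bits -/

theorem block_lt (n : ℕ) (l : List Bool) : block n l < 2 ^ n := by
  have h1 := bv_lt (l.take n)
  have h2 : (l.take n).length ≤ n := List.length_take_le _ _
  have h3 : 2 ^ n = 2 ^ (l.take n).length * 2 ^ (n - (l.take n).length) := by
    rw [← pow_add]; congr 1; omega
  rw [block, h3]
  exact (Nat.mul_lt_mul_right (Nat.two_pow_pos _)).2 h1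

@[simp] theorem block_nil (n : ℕ) : block n [] = 0 := by simp [block]

theorem block_append {n : ℕ} {l : List Bool} (h : l.length ≤ n) (l' : List Bool) :
    block n (l ++ l') = bv l * 2 ^ (n - l.length) + block (n - l.length) l' := by
  have e1 : (l ++ l').take n = l ++ l'.take (n - l.length) := by
    rw [List.take_append, List.take_of_length_le h]
  have h2 : (l'.take (n - l.length)).length ≤ n - l.length := List.length_take_le _ _
  rw [block, block, e1, bv_append, List.length_append, add_mul, mul_assoc, ← pow_add]
  congr 3 <;> [congr 1; skip] <;> omega

theorem block_append_of_le {n : ℕ} {l : List Bool} (h : n ≤ l.length) (l' : List Bool) :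
    block n (l ++ l') = bv l / 2 ^ (l.length - n) := by
  have e1 : (l ++ l').take n = l.take n := List.take_append_of_le_length h
  have e2 : (l.take n).length = n := List.length_take_of_le h
  have h3 := bv_append (l.take n) (l.drop n)
  rw [List.take_append_drop, List.length_drop] at h3
  have h4 := bv_lt (l.drop n)
  rw [List.length_drop] at h4
  rw [block, e1, e2, Nat.sub_self, pow_zero, mul_one, h3, mul_comm,
    Nat.mul_add_div (Nat.two_pow_pos _), Nat.div_eq_of_lt h4, add_zero]

theorem size_mul_two_pow {x : ℕ} (hx : 0 < x) (j : ℕ) : Nat.size (x * 2 ^ j) = Nat.size x + j := by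
  rw [← Nat.shiftLeft_eq, Nat.size_shiftLeft hx.ne']

/-- The block after its first bit has been shifted out of a word of `b` bits. -/
theorem mul_two_mod {a n b : ℕ} (h1 : 1 ≤ n) (h2 : n ≤ b) :
    a * 2 ^ (b - n) * 2 % 2 ^ b = a % 2 ^ (n - 1) * 2 ^ (b - n + 1) := by
  have e1 : a * 2 ^ (b - n) * 2 = a * 2 ^ (b - n + 1) := by rw [pow_succ]; ring
  have e2 : 2 ^ b = 2 ^ (n - 1) * 2 ^ (b - n + 1) := by rw [← pow_add]; congr 1; omega
  rw [e1, e2, Nat.mul_mod_mul_right]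

/-- If a block starts with a token that is too long for it, then the length of this token is
either not contained in the block, or it is still read correctly. -/
theorem long_token {t : Tok} (ht : 0 < t.2) {n b : ℕ} (h1 : 1 ≤ n) (h2 : n ≤ b)
    (h3 : n < 2 * Nat.size t.2) (l : List Bool) :
    block n (t.bits ++ l) * 2 ^ (b - n) * 2 % 2 ^ b = 0 ∨
      Nat.size (block n (t.bits ++ l) * 2 ^ (b - n) * 2 % 2 ^ b) + (Nat.size t.2 - 1) = b := by
  have hl := Tok.length_bits ht
  have hg := length_eliasGamma t.2
  set s := Nat.size t.2
  rw [mul_two_mod h1 h2, block_append_of_le (by omega), hl, Tok.bits, bv_cons, bv_eliasGamma, hg]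
  have e1 : 2 * s - 1 = (n - 1) + (2 * s - n) := by omega
  have e2 : (t.1.toNat * 2 ^ (2 * s - 1) + t.2) / 2 ^ (2 * s - n) =
      2 ^ (n - 1) * t.1.toNat + t.2 / 2 ^ (2 * s - n) := by
    rw [e1, pow_add]
    have : t.1.toNat * (2 ^ (n - 1) * 2 ^ (2 * s - n)) =
        2 ^ (2 * s - n) * (2 ^ (n - 1) * t.1.toNat) := by ring
    rw [this, Nat.mul_add_div (Nat.two_pow_pos _)]
  have e3 : t.2 / 2 ^ (2 * s - n) < 2 ^ (n - 1) := by
    rw [Nat.div_lt_iff_lt_mul (Nat.two_pow_pos _), ← pow_add, ← e1]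
    exact (Nat.lt_size_self _).trans_le (Nat.pow_le_pow_right (by norm_num) (by omega))
  rw [e2, Nat.mul_add_mod, Nat.mod_eq_of_lt e3]
  rcases Nat.eq_zero_or_pos (t.2 / 2 ^ (2 * s - n)) with h0 | h0
  · left
    rw [h0, zero_mul]
  · right
    have h4 := size_div_two_pow t.2 (2 * s - n)
    have h5 := Nat.size_pos.2 h0
    rw [size_mul_two_pow h0, h4]
    omega

/-- The tokens `ts` satisfy the bounds for input symbols. -/
def Valid (σ : ℕ) (ts : List Tok) : Prop := ∀ t ∈ ts, 0 < t.2 ∧ (t.1 = true → t.2 < σ)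

/-- If a block starts with a token that is contained in it, then the token is read correctly. -/
theorem short_token {t : Tok} (ht : 0 < t.2) {n b : ℕ} (h2 : n ≤ b) (h3 : 2 * Nat.size t.2 ≤ n)
    (l : List Bool) :
    block n (t.bits ++ l) * 2 ^ (b - n) / 2 ^ (b - 1) = t.1.toNat ∧
      Nat.size (block n (t.bits ++ l) * 2 ^ (b - n) * 2 % 2 ^ b) + (Nat.size t.2 - 1) = b ∧
      block n (t.bits ++ l) * 2 ^ (b - n) * 2 % 2 ^ b / 2 ^ (b - (2 * (Nat.size t.2 - 1) + 1)) =
        t.2 ∧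
      block n (t.bits ++ l) % 2 ^ (n - 2 * Nat.size t.2) = block (n - 2 * Nat.size t.2) l := by
  have hl := Tok.length_bits ht
  have e1 := block_append (n := n) (l := t.bits) (by omega) l
  rw [hl] at e1
  have h4 := block_lt (n - 2 * Nat.size t.2) l
  set g := block (n - 2 * Nat.size t.2) l
  have e2 : 2 ^ (b - 2 * Nat.size t.2) = 2 ^ (n - 2 * Nat.size t.2) * 2 ^ (b - n) := by
    rw [← pow_add]; congr 1; omega
  have h5 := token_parse (b := b) (V := block n (t.bits ++ l) * 2 ^ (b - n)) ht
    (by omega) (g := g * 2 ^ (b - n)) (by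
      rw [e2]
      exact (Nat.mul_lt_mul_right (Nat.two_pow_pos _)).2 h4) (by
      rw [e1, e2]
      ring)
  refine ⟨h5.1, h5.2.1, h5.2.2, ?_⟩
  rw [e1, Nat.mul_add_mod_self_right, Nat.mod_eq_of_lt h4]

/-- If no complete token can be read from the block, then it does not contain one. -/
theorem no_token {ts : List Tok} (hv : Valid σ ts) {n b V1 : ℕ} (h2 : n ≤ b)
    (hV : block n (tbits ts) * 2 ^ (b - n) * 2 % 2 ^ b = V1)
    (h : V1 = 0 ∨ n < 2 * (b - Nat.size V1) + 2) :
    ts = [] ∨ ∃ t ts', ts = t :: ts' ∧ n < 2 * Nat.size t.2 := by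
  cases ts with
  | nil => exact Or.inl rfl
  | cons t ts =>
    refine Or.inr ⟨t, ts, rfl, ?_⟩
    by_contra h3
    push Not at h3
    have ht := (hv t (by simp)).1
    have hs := Nat.size_pos.2 ht
    obtain ⟨-, h5, -, -⟩ := short_token ht h2 h3 (tbits ts)
    rw [tbits_cons] at hV
    rw [hV] at h5
    rcases h with h | h
    · rw [h] at h5
      simp at h5
      omega
    · omega

/-- If a complete token can be read from the block, then it is the first one. -/
theorem some_token {ts : List Tok} (hv : Valid σ ts) {n b V1 k : ℕ} (h2 : n ≤ b)
    (hV : block n (tbits ts) * 2 ^ (b - n) * 2 % 2 ^ b = V1)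
    (h : V1 ≠ 0) (hk : Nat.size V1 + k = b) (hkn : 2 * k + 2 ≤ n) :
    ∃ t ts', ts = t :: ts' ∧ 2 * Nat.size t.2 = 2 * k + 2 ∧
      t.1.toNat = block n (tbits ts) * 2 ^ (b - n) / 2 ^ (b - 1) ∧
      t.2 = V1 / 2 ^ (b - (2 * k + 1)) ∧
      block n (tbits ts) % 2 ^ (n - (2 * k + 2)) = block (n - (2 * k + 2)) (tbits ts') := by
  cases ts with
  | nil =>
    simp at hV
    omega
  | cons t ts =>
    have ht := (hv t (by simp)).1
    have hs := Nat.size_pos.2 ht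
    rw [tbits_cons] at hV ⊢
    have hlen : 2 * Nat.size t.2 ≤ n := by
      by_contra h3
      push Not at h3
      rcases long_token ht (by omega) h2 h3 (tbits ts) with h4 | h4
      · omega
      · rw [hV] at h4
        omega
    obtain ⟨h4, h5, h6, h7⟩ := short_token ht h2 hlen (tbits ts)
    rw [hV] at h5 h6
    have e1 : Nat.size t.2 - 1 = k := by omega
    have e2 : 2 * Nat.size t.2 = 2 * k + 2 := by omega
    rw [e1] at h6
    rw [e2] at h7
    exact ⟨t, ts, rfl, e2, h4.symm, h6.symm, h7⟩

namespace Rec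

theorem length_emit_le (r : Rec) (y : ℕ) :
    (r.emit y).wd.length ≤ r.wd.length + 2 * Nat.size r.tz + 2 * Nat.size y := by
  unfold emit
  split_ifs with h1 h2
  · simp only
    omega
  · simp only [length_literalToken (Nat.pos_of_ne_zero h1)]
    omega
  · simp only [List.length_append, length_zeroRunToken, length_literalToken (Nat.pos_of_ne_zero h1)]
    omega

theorem lead_add_tz_emit_le (r : Rec) (y : ℕ) :
    (r.emit y).lead + (r.emit y).tz ≤ r.lead + r.tz + 1 := by
  unfold emit
  split_ifs <;> simp only <;> omega

end Rec

/-! ### Preprocessing: the table of chunks -/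

/-- The state of the computation of an entry: the string `l` with the output summary `r` has been
processed, and `x` zeros are pending. Of a block of bits, `cb` bits have been read, and the others
have the value `a`. The bound `meas` limits the number of zeros, because a token of `2 * k + 2` bits
stands for a run of fewer than `2 ^ (k + 1)` zeros. -/
structure Build (A : Transducer q σ) (z₀ : Fin σ) (b L : ℕ) (v : Fin q) (i : ℕ)
    (l : List (Fin σ)) (r : Rec) (x cb a : ℕ) : Prop where
  rOf : r.Of (outs A v l)
  wd_le : r.wd.length ≤ b
  lead_le : r.lead + r.tz ≤ l.length
  zeros : ∀ d, i = 2 ^ L + d → x ≤ d ∧ l = List.replicate (d - x) z₀ ∧ a = 0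
  cb_le : cb ≤ L
  a_lt : a < 2 ^ (L - cb)
  meas : l.length + x + 2 ^ (L - cb) ≤ 2 ^ L + (i - 2 ^ L)
  blk : i < 2 ^ L → ∀ ts, Valid σ ts → block L (tbits ts) = i → ∃ ts₁ ts₂, ts = ts₁ ++ ts₂ ∧
    texpand ts₁ = l.map Fin.val ++ List.replicate x 0 ∧ cb = (tbits ts₁).length ∧
    block (L - cb) (tbits ts₂) = a

/-- At the start, for the block of bits `i`. -/
theorem build_block {v : Fin q} {i : ℕ} (hi : i < 2 ^ L) : Build A z₀ b L v i [] .empty 0 0 i where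
  rOf := Rec.of_empty
  wd_le := by simp [Rec.empty]
  lead_le := by simp [Rec.empty]
  zeros d hd := by omega
  cb_le := by omega
  a_lt := by simpa using hi
  meas := by simp
  blk _ ts _ h := ⟨[], ts, by simpa using h⟩

/-- At the start, for a run of `d` zeros. -/
theorem build_zeros {v : Fin q} (d : ℕ) : Build A z₀ b L v (2 ^ L + d) [] .empty d 0 0 where
  rOf := Rec.of_empty
  wd_le := by simp [Rec.empty]
  lead_le := by simp [Rec.empty]
  zeros d' hd := by
    have : d' = d := by omega
    simp [this]
  cb_le := by omega
  a_lt := by simp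
  meas := by simp; omega
  blk h := by omega

theorem outs_concat (v : Fin q) (l : List (Fin σ)) (u : Fin σ) :
    outs A v (l ++ [u]) = outs A v l ++ [((A.step (run A v l) u).2 : ℕ)] := by
  rw [outs_append]
  rfl

theorem run_concat (v : Fin q) (l : List (Fin σ)) (u : Fin σ) :
    run A v (l ++ [u]) = (A.step (run A v l) u).1 := by
  rw [run_append]
  rfl

namespace Build

variable {v : Fin q} {i x cb a : ℕ} {l : List (Fin σ)} {r : Rec}

/-- One pending zero is processed. -/
theorem zero (h : Build A z₀ b L v i l r (x + 1) cb a) (hz : (z₀ : ℕ) = 0)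
    (hb : (r.emit (A.step (run A v l) z₀).2).wd.length ≤ b) :
    Build A z₀ b L v i (l ++ [z₀]) (r.emit (A.step (run A v l) z₀).2) x cb a where
  rOf := by
    rw [outs_concat]
    exact h.rOf.emit _
  wd_le := hb
  lead_le := by
    have h1 := r.lead_add_tz_emit_le (A.step (run A v l) z₀).2
    have h2 := h.lead_le
    rw [List.length_append, List.length_singleton]
    omega
  zeros d hd := by
    obtain ⟨h1, h2, h3⟩ := h.zeros d hd
    refine ⟨by omega, ?_, h3⟩
    have : d - x = d - (x + 1) + 1 := by omega
    rw [this, List.replicate_succ', h2]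
  cb_le := h.cb_le
  a_lt := h.a_lt
  meas := by
    have := h.meas
    simp
    omega
  blk hi ts hv hts := by
    obtain ⟨ts₁, ts₂, h1, h2, h3⟩ := h.blk hi ts hv hts
    exact ⟨ts₁, ts₂, h1, by rw [h2]; simp [hz, List.replicate_succ], h3⟩

/-- The measure `meas` does not increase when a token of `2 * k + 2` bits is replaced by `X`
symbols. -/
theorem consume_meas {X k : ℕ} (h : Build A z₀ b L v i l r 0 cb a) (hk : cb + (2 * k + 2) ≤ L)
    (hX : X < 2 ^ (k + 1)) :
    l.length + X + 2 ^ (L - (cb + (2 * k + 2))) ≤ 2 ^ L + (i - 2 ^ L) := by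
  have h1 := h.meas
  have e1 : 2 ^ (L - cb) = 2 ^ (k + 1) * (2 ^ (k + 1) * 2 ^ (L - (cb + (2 * k + 2)))) := by
    rw [← pow_add, ← pow_add]; congr 1; omega
  have h2 : 2 ≤ 2 ^ (k + 1) := by rw [pow_succ]; have := Nat.two_pow_pos k; omega
  have h3 := Nat.two_pow_pos (L - (cb + (2 * k + 2)))
  have h4 : 2 ^ (k + 1) * 1 ≤ 2 ^ (k + 1) * 2 ^ (L - (cb + (2 * k + 2))) :=
    Nat.mul_le_mul_left _ h3
  have h5 : 1 * 2 ^ (L - (cb + (2 * k + 2))) ≤ 2 ^ (k + 1) * 2 ^ (L - (cb + (2 * k + 2))) :=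
    Nat.mul_le_mul_right _ (by omega)
  have h6 := Nat.mul_le_mul_right (2 ^ (k + 1) * 2 ^ (L - (cb + (2 * k + 2)))) h2
  omega

/-- A token for a run of zeros is read. -/
theorem runToken {V1 k : ℕ} (h : Build A z₀ b L v i l r 0 cb a) (hLb : L ≤ b)
    (hi : i < 2 ^ L)
    (hV : a * 2 ^ (b - (L - cb)) * 2 % 2 ^ b = V1) (h0 : V1 ≠ 0) (hk : Nat.size V1 + k = b)
    (hkL : cb + (2 * k + 2) ≤ L) (hX : V1 / 2 ^ (b - (2 * k + 1)) < 2 ^ (k + 1))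
    (ht : a * 2 ^ (b - (L - cb)) / 2 ^ (b - 1) = 0) :
    Build A z₀ b L v i l r (V1 / 2 ^ (b - (2 * k + 1))) (cb + (2 * k + 2))
      (a % 2 ^ (L - (cb + (2 * k + 2)))) where
  rOf := h.rOf
  wd_le := h.wd_le
  lead_le := h.lead_le
  zeros d hd := by omega
  cb_le := hkL
  a_lt := Nat.mod_lt _ (Nat.two_pow_pos _)
  meas := h.consume_meas hkL hX
  blk _ ts hv hts := by
    obtain ⟨ts₁, ts₂, h1, h2, h3, h4⟩ := h.blk hi ts hv hts
    have hv₂ : Valid σ ts₂ := fun t ht => hv t (by simp [h1, ht])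
    rw [← h4] at hV
    obtain ⟨t, ts₃, k1, k2, k3, k4, k5⟩ := some_token hv₂ (by omega) hV h0 hk (by omega)
    rw [h4, ht] at k3
    rw [h4, Nat.sub_sub] at k5
    have ht1 : t.1 = false := by
      rw [Bool.toNat_eq_zero] at k3
      exact k3
    refine ⟨ts₁ ++ [t], ts₃, by simp [h1, k1], ?_, ?_, k5.symm⟩
    · simp [h2, Tok.expand, ht1, k4]
    · have := Tok.length_bits (hv₂ t (by simp [k1])).1
      simp [h3]
      omega

/-- A literal is read and processed. -/
theorem literal {V1 k : ℕ} {u : Fin σ} (h : Build A z₀ b L v i l r 0 cb a) (hLb : L ≤ b)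
    (hi : i < 2 ^ L)
    (hV : a * 2 ^ (b - (L - cb)) * 2 % 2 ^ b = V1) (h0 : V1 ≠ 0) (hk : Nat.size V1 + k = b)
    (hkL : cb + (2 * k + 2) ≤ L) (hu : V1 / 2 ^ (b - (2 * k + 1)) = u)
    (ht : a * 2 ^ (b - (L - cb)) / 2 ^ (b - 1) ≠ 0)
    (hb : (r.emit (A.step (run A v l) u).2).wd.length ≤ b) :
    Build A z₀ b L v i (l ++ [u]) (r.emit (A.step (run A v l) u).2) 0 (cb + (2 * k + 2))
      (a % 2 ^ (L - (cb + (2 * k + 2)))) where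
  rOf := by
    rw [outs_concat]
    exact h.rOf.emit _
  wd_le := hb
  lead_le := by
    have h1 := r.lead_add_tz_emit_le (A.step (run A v l) u).2
    have h2 := h.lead_le
    rw [List.length_append, List.length_singleton]
    omega
  zeros d hd := by omega
  cb_le := hkL
  a_lt := Nat.mod_lt _ (Nat.two_pow_pos _)
  meas := by
    have := h.consume_meas (X := 1) hkL (Nat.one_lt_two_pow (by omega))
    simp
    omega
  blk _ ts hv hts := by
    obtain ⟨ts₁, ts₂, h1, h2, h3, h4⟩ := h.blk hi ts hv hts
    have hv₂ : Valid σ ts₂ := fun t ht => hv t (by simp [h1, ht])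
    rw [← h4] at hV
    obtain ⟨t, ts₃, k1, k2, k3, k4, k5⟩ := some_token hv₂ (by omega) hV h0 hk (by omega)
    rw [h4] at k3
    rw [h4, Nat.sub_sub] at k5
    have ht1 : t.1 = true := by
      by_contra hc
      simp at hc
      rw [hc] at k3
      exact ht k3.symm
    refine ⟨ts₁ ++ [t], ts₃, by simp [h1, k1], ?_, ?_, k5.symm⟩
    · simp [h2, Tok.expand, ht1, k4, hu]
    · have := Tok.length_bits (hv₂ t (by simp [k1])).1
      simp [h3]
      omega

/-- The reasons for which the computation of an entry stops: enough output, a large output symbol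
for a pending zero, the block contains no further complete token, or a large output symbol for a
literal. The last condition is void for a literal outside of the alphabet, which does not occur in
the encoding of a string. -/
inductive Stop (A : Transducer q σ) (z₀ : Fin σ) (b L : ℕ) (v : Fin q) (l : List (Fin σ)) (r : Rec)
    (x cb a : ℕ) : Prop where
  | full (h : L ≤ r.wd.length)
  | zero (h : 0 < x) (h' : 2 ^ L ≤ ((A.step (run A v l) z₀).2 : ℕ))
  | noToken (hx : x = 0) (V1 : ℕ) (hV : a * 2 ^ (b - (L - cb)) * 2 % 2 ^ b = V1)
      (h : V1 = 0 ∨ L < cb + (2 * (b - Nat.size V1) + 2))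
  | literal (hx : x = 0) (V1 k : ℕ) (hV : a * 2 ^ (b - (L - cb)) * 2 % 2 ^ b = V1) (h0 : V1 ≠ 0)
      (hk : Nat.size V1 + k = b) (hkL : cb + (2 * k + 2) ≤ L)
      (ht : a * 2 ^ (b - (L - cb)) / 2 ^ (b - 1) ≠ 0)
      (h : ∀ u : Fin σ, (u : ℕ) = V1 / 2 ^ (b - (2 * k + 1)) →
        2 ^ L ≤ ((A.step (run A v l) u).2 : ℕ))

/-- When the computation stops, the fields of the entry are correct. -/
theorem entryOK (h : Build A z₀ b L v i l r x cb a) (hs : Stop A z₀ b L v l r x cb a)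
    (hLb : L ≤ b) {F : ℕ → ℕ} (h0 : F 0 = cb) (h1 : F 1 = x) (h2 : F 2 = r.lead)
    (h3 : F 3 = bv r.wd) (h4 : F 4 = r.wd.length) (h5 : F 5 = r.tz) (h6 : F 6 = (run A v l : ℕ)) :
    EntryOK A z₀ b L v i F := by
  refine ⟨l, r, h6, h2, h3, h4, h5, h.rOf, h.wd_le, h.lead_le, fun d hd => ?_, fun hi ts hv hts =>
    ?_⟩
  · rw [h1]
    obtain ⟨z1, z2, z3⟩ := h.zeros d hd
    refine ⟨z1, z2, ?_⟩
    rcases hs with hs | ⟨-, hs⟩ | ⟨hx, V1, -, -⟩ | ⟨hx, V1, k, -, -, -, -, -⟩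
    · exact Or.inl hs
    · exact Or.inr (Or.inr hs)
    · exact Or.inr (Or.inl hx)
    · exact Or.inr (Or.inl hx)
  · rw [h1, h0]
    have hm := h.meas
    have hcb := h.cb_le
    have hpos := Nat.two_pow_pos (L - cb)
    obtain ⟨ts₁, ts₂, t1, t2, t3, t4⟩ := h.blk hi ts hv hts
    have hv₂ : Valid σ ts₂ := fun t ht => hv t (by simp [t1, ht])
    refine ⟨by omega, ts₁, ts₂, t1, t2, t3, ?_⟩
    rcases hs with hs | ⟨hx, hs⟩ | ⟨hx, V1, hV, hs⟩ | ⟨hx, V1, k, hV, hV0, hk, hkL, ht, hs⟩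
    · exact Or.inl hs
    · exact Or.inr (Or.inl ⟨hx, hs⟩)
    · refine Or.inr (Or.inr ⟨hx, ?_⟩)
      rw [← t4] at hV
      rcases no_token hv₂ (by omega) hV (hs.imp_right fun h => by omega) with h | ⟨t, ts₃, h, h'⟩
      · exact Or.inl h
      · exact Or.inr ⟨t, ts₃, h, Or.inl (by omega)⟩
    · refine Or.inr (Or.inr ⟨hx, Or.inr ?_⟩)
      rw [← t4] at hV
      obtain ⟨t, ts₃, k1, k2, k3, k4, k5⟩ := some_token hv₂ (by omega) hV hV0 hk (by omega)
      rw [t4] at k3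
      have ht1 : t.1 = true := by
        by_contra hc
        simp at hc
        rw [hc] at k3
        exact ht k3.symm
      have hlt := (hv₂ t (by simp [k1])).2 ht1
      exact ⟨t, ts₃, k1, Or.inr ⟨ht1, ⟨t.2, hlt⟩, rfl, hs _ k4⟩⟩

end Build

/-- Process one pending zero, unless its output symbol is at least `2 ^ L`. -/
def buildZeroCode : Cmd :=
  .trans vDd vY vSt vZero ;;
  .ite (.le vP vY) (vGo ≔ 0) (vSt ≔ vDd ;; vX ≔ vX - 1 ;; emitCode)

/-- Process a literal that has been read, unless its output symbol is at least `2 ^ L`, or it is not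
a symbol of the alphabet. -/
def buildLiteralCode : Cmd :=
  .ite (.le vSig vU) (vGo ≔ 0)
    (.trans vDd vY vSt vU ;;
      .ite (.le vP vY) (vGo ≔ 0)
        (vSt ≔ vDd ;; vCb ≔ vCb + vTl ;; vV ≔ vV ≪≪ vTl ;; emitCode))

/-- Process a token of the block. -/
def buildTokenCode : Cmd :=
  vV1 ≔ vV ≪≪ 1 ;;
  .ite (.eq vV1 0) (vGo ≔ 0)
    (readCode ;;
      .ite (.lt vL (vCb + vTl)) (vGo ≔ 0)
        (.ite (.eq vTy 0) (vX ≔ vU ;; vCb ≔ vCb + vTl ;; vV ≔ vV ≪≪ vTl) buildLiteralCode))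

/-- Compute an entry of the table of chunks, for the state `vSt`, a run of `vX` zeros and the
left-aligned block `vV`. -/
def buildCode : Cmd :=
  vCb ≔ 0 ;; vLead ≔ 0 ;; vMv ≔ 0 ;; vMl ≔ 0 ;; vTz ≔ 0 ;; vZero ≔ 0 ;; vGo ≔ 1 ;;
  .loop (.ne vGo 0)
    (.ite (.le vL vMl) (vGo ≔ 0) (.ite (.lt 0 vX) buildZeroCode buildTokenCode))

/-- The variables describe the state of the computation of an entry. -/
structure HasBuild (A : Transducer q σ) (z₀ : Fin σ) (b L : ℕ) (v : Fin q) (i : ℕ)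
    (l : List (Fin σ)) (r : Rec) (x cb a : ℕ) (s : NS) : Prop where
  build : Build A z₀ b L v i l r x cb a
  hrec : HasRec r s
  st : s.reg vSt = (run A v l : ℕ)
  rx : s.reg vX = x
  rcb : s.reg vCb = cb
  rv : s.reg vV = a * 2 ^ (b - (L - cb))

/-- Either the computation of an entry continues in the next state, or it stops. The value `p` is
the progress before, that is, the number of symbols processed and bits read; the time is at most `T
+ K`. -/
def Next (A : Transducer q σ) (z₀ : Fin σ) (b L : ℕ) (v : Fin q) (i : ℕ) (p T K : ℕ)
    (s : NS) : Prop :=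
  ∃ l r x cb a, HasBuild A z₀ b L v i l r x cb a s ∧
    ((s.reg vGo ≠ 0 ∧ p < l.length + cb ∧ s.time ≤ T + K) ∨
      (s.reg vGo = 0 ∧ p ≤ l.length + cb ∧ s.time ≤ T + K ∧ Build.Stop A z₀ b L v l r x cb a))

/-- Conditions for the construction of the table. -/
structure BuildEnv (b L q σ MB cc : ℕ) (cost : Fin q → Fin σ → ℕ) (z₀ : Fin σ) : Prop where
  bnd : Bnd b L MB
  hz : (z₀ : ℕ) = 0
  hq : q < 2 ^ b
  hσ : σ < 2 ^ b
  cost_le : ∀ (v : Fin q) (u : Fin σ), (u : ℕ) < 2 ^ L → cost v u ≤ cc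

/-- The numbers of zeros in the summary are `O(2 ^ L)`. -/
theorem size_run_lt {v : Fin q} {i x cb a : ℕ} {l : List (Fin σ)} {r : Rec}
    (h : Build A z₀ b L v i l r x cb a) (hi : i ≤ 2 * 2 ^ L) :
    Nat.size r.tz ≤ L + 2 ∧ r.lead + r.tz ≤ 2 * 2 ^ L := by
  have h1 := h.lead_le
  have h2 := h.meas
  have h3 := Nat.two_pow_pos (L - cb)
  refine ⟨Nat.size_le.2 ?_, by omega⟩
  have := Nat.two_pow_pos L
  rw [pow_add]
  omega

variable {v : Fin q} {i x cb a : ℕ} {l : List (Fin σ)} {r : Rec} {s : NS}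

/-- As long as the output has fewer than `L` bits and the next symbol is less than `2 ^ L`, output
is appended in constant time, and still fits into a word. -/
theorem buildEmit_spec {y : ℕ} (hb : Bnd b L MB) (he : Env b L MB s) (hr : HasRec r s)
    (hy : s.reg vY = y) (hyL : y < 2 ^ L) (hw : r.wd.length < L) (ht : Nat.size r.tz ≤ L + 2)
    (hl : r.lead + r.tz ≤ 2 * 2 ^ L) :
    (r.emit y).wd.length ≤ b ∧
    wp b A cost emitCode (fun s' => HasRec (r.emit y) s' ∧ s'.time ≤ s.time + 1000) s := by
  have hbb := hb
  obtain ⟨b1, b2, b3, b4⟩ := hb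
  have hys : Nat.size y ≤ L := Nat.size_le.2 hyL
  have hlt : 2 * 2 ^ L + 1 < 2 ^ b := by
    have h1 : 2 ^ (L + 2) ≤ 2 ^ b := Nat.pow_le_pow_right (by norm_num) (by omega)
    rw [pow_add] at h1
    have := Nat.two_pow_pos L
    omega
  refine ⟨(r.length_emit_le y).trans (by omega), wp_mono ?_ (emit_spec hbb he hr hy (by omega)
    (by omega))⟩
  rintro s' ⟨h1, h2⟩
  refine ⟨h1, ?_⟩
  have : L * s'.time ≤ L * (s.time + 1000) := by
    rw [mul_add]
    omega
  exact Nat.le_of_mul_le_mul_left this b1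

theorem buildZero_spec (E : BuildEnv b L q σ MB cc cost z₀) (he : Env b L MB s)
    (hi : i ≤ 2 * 2 ^ L)
    (h : HasBuild A z₀ b L v i l r (x + 1) cb a s) (hw : r.wd.length < L)
    (hZ : s.reg vZero = 0) (hGo : s.reg vGo ≠ 0) :
    wp b A cost buildZeroCode (Next A z₀ b L v i (l.length + cb) s.time (cc + 1100)) s := by
  obtain ⟨hbd, hz, hqb, hσb, hcost⟩ := E
  obtain ⟨h1, h2, h3, h4, h5, h6⟩ := h
  obtain ⟨w1, w2⟩ := size_run_lt h1 hi
  have hco := hcost (run A v l) z₀ (by rw [hz]; exact Nat.two_pow_pos L)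
  have hst := (A.step (run A v l) z₀).1.2
  have hout := (A.step (run A v l) z₀).2.2
  unfold buildZeroCode
  rw [wp_seq, wp_trans]
  refine ⟨run A v l, z₀, h3, by rw [hZ, hz], by omega, by omega, ?_⟩
  rw [wp_ite]
  refine ⟨by simp, fun hc => ?_, fun hc => ?_⟩
  · simp [he.hP] at hc
    rw [wp_set]
    refine ⟨by simp, l, r, x + 1, cb, a, ⟨h1, ⟨?_, ?_, ?_, ?_⟩, ?_, ?_, ?_, ?_⟩,
      Or.inr ⟨by simp, le_rfl, ?_, .zero (by omega) hc⟩⟩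
    any_goals simp [h2.lead, h2.mv, h2.ml, h2.tz, h3, h4, h5, h6]
    omega
  · simp [he.hP] at hc
    rw [wp_seq, wp_set, wp_seq, wp_set]
    refine ⟨by simp, by simp [h4]; have := hbd.bb; have := hbd.Lb; omega, ?_⟩
    obtain ⟨g1, g2⟩ := buildEmit_spec (A := A) (cost := cost) (r := r)
      (y := (A.step (run A v l) z₀).2)
      (s := ((((((s.set vDd (A.step (run A v l) z₀).1).set vY (A.step (run A v l) z₀).2).tick
        (cost (run A v l) z₀)).tick 3).set vSt (A.step (run A v l) z₀).1).tick 2 |>.set vX x).tick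
        4)
      hbd (he.frame (by simp) (by simp) (by simp) (by simp) (by simp))
      ⟨by simp [h2.lead], by simp [h2.mv], by simp [h2.ml], by simp [h2.tz]⟩ (by simp) hc hw w1 w2
    simp [h4]
    refine wp_use g2 ?_
    rintro s' ⟨k1, k2⟩ hf
    have f1 := hf.reg vSt
    have f2 := hf.reg vX
    have f3 := hf.reg vCb
    have f4 := hf.reg vV
    have f5 := hf.reg vGo
    simp [h5, h6] at f1 f2 f3 f4 f5
    refine ⟨l ++ [z₀], _, x, cb, a, ⟨h1.zero hz g1, k1, ?_, f2, f3, f4⟩, Or.inl ⟨?_, ?_, ?_⟩⟩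
    · rw [f1, run_concat]
    · rw [f5]; exact hGo
    · simp
    · simp only [NS.tick_time, NS.set_time] at k2
      linarith

theorem shift_block {n t : ℕ} (h1 : n ≤ b) (h2 : t ≤ n) :
    a * 2 ^ (b - n) * 2 ^ t % 2 ^ b = a % 2 ^ (n - t) * 2 ^ (b - (n - t)) := by
  have e1 : a * 2 ^ (b - n) * 2 ^ t = a * 2 ^ (b - (n - t)) := by
    rw [mul_assoc, ← pow_add]; congr 2; omega
  have e2 : 2 ^ b = 2 ^ (n - t) * 2 ^ (b - (n - t)) := by rw [← pow_add]; congr 1; omega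
  rw [e1, e2, Nat.mul_mod_mul_right]

theorem buildLiteral_spec (E : BuildEnv b L q σ MB cc cost z₀) (he : Env b L MB s)
    (hi : i < 2 ^ L) (hSig : s.reg vSig = σ) {V1 k : ℕ}
    (h : HasBuild A z₀ b L v i l r 0 cb a s) (hw : r.wd.length < L)
    (hV : a * 2 ^ (b - (L - cb)) * 2 % 2 ^ b = V1) (h0 : V1 ≠ 0) (hk : Nat.size V1 + k = b)
    (hkL : cb + (2 * k + 2) ≤ L) (hX : V1 / 2 ^ (b - (2 * k + 1)) < 2 ^ (k + 1))
    (ht : a * 2 ^ (b - (L - cb)) / 2 ^ (b - 1) ≠ 0)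
    (hU : s.reg vU = V1 / 2 ^ (b - (2 * k + 1))) (hTl : s.reg vTl = 2 * k + 2)
    (hGo : s.reg vGo ≠ 0) :
    wp b A cost buildLiteralCode (Next A z₀ b L v i (l.length + cb) s.time (cc + 1100)) s := by
  obtain ⟨hbd, hz, hqb, hσb, hcost⟩ := E
  obtain ⟨h1, h2, h3, h4, h5, h6⟩ := h
  obtain ⟨w1, w2⟩ := size_run_lt h1 (by omega)
  obtain ⟨b1, b2, b3, b4⟩ := hbd
  have hbd : Bnd b L MB := ⟨b1, b2, b3, b4⟩
  have hXL : V1 / 2 ^ (b - (2 * k + 1)) < 2 ^ L :=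
    hX.trans_le (Nat.pow_le_pow_right (by norm_num) (by omega))
  unfold buildLiteralCode
  set u := V1 / 2 ^ (b - (2 * k + 1))
  rw [wp_ite]
  refine ⟨by simp, fun hc => ?_, fun hc => ?_⟩
  · simp [hSig, hU] at hc
    rw [wp_set]
    refine ⟨by simp, l, r, 0, cb, a, ⟨h1, ⟨?_, ?_, ?_, ?_⟩, ?_, ?_, ?_, ?_⟩,
      Or.inr ⟨by simp, le_rfl, ?_, .literal rfl V1 k hV h0 hk hkL ht fun u' hu' =>
        absurd u'.2 (by omega)⟩⟩
    any_goals simp [h2.lead, h2.mv, h2.ml, h2.tz, h3, h4, h5, h6]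
    linarith
  simp [hSig, hU] at hc
  set u' : Fin σ := ⟨u, hc⟩ with hu'
  have hco := hcost (run A v l) u' hXL
  have hst := (A.step (run A v l) u').1.2
  have hout := (A.step (run A v l) u').2.2
  rw [wp_seq, wp_trans]
  refine ⟨run A v l, u', by simp [h3], by simp [hU, hu'], by omega, by omega, ?_⟩
  rw [wp_ite]
  refine ⟨by simp, fun hc => ?_, fun hc => ?_⟩
  · simp [he.hP] at hc
    rw [wp_set]
    refine ⟨by simp, l, r, 0, cb, a, ⟨h1, ⟨?_, ?_, ?_, ?_⟩, ?_, ?_, ?_, ?_⟩,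
      Or.inr ⟨by simp, le_rfl, ?_, .literal rfl V1 k hV h0 hk hkL ht fun u'' hu'' => ?_⟩⟩
    any_goals simp [h2.lead, h2.mv, h2.ml, h2.tz, h3, h4, h5, h6]
    · omega
    · have : u'' = u' := Fin.ext hu''
      rw [this]
      exact hc
  · simp [he.hP] at hc
    have hsh := shift_block (a := a) (n := L - cb) (t := 2 * k + 2) (b := b) (by omega) (by omega)
    rw [Nat.sub_sub] at hsh
    obtain ⟨g1, g2⟩ := buildEmit_spec (A := A) (cost := cost) (r := r)
      (y := (A.step (run A v l) u').2)
      (s := ((((((((s.tick 3).set vDd (A.step (run A v l) u').1).set vY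
        (A.step (run A v l) u').2).tick
        (cost (run A v l) u')).tick 3).set vSt (A.step (run A v l) u').1).tick 2 |>.set vCb
          (cb + (2 * k + 2))).tick 4 |>.set vV (a % 2 ^ (L - (cb + (2 * k + 2))) *
            2 ^ (b - (L - (cb + (2 * k + 2)))))).tick 4)
      hbd (he.frame (by simp) (by simp) (by simp) (by simp) (by simp))
      ⟨by simp [h2.lead], by simp [h2.mv], by simp [h2.ml], by simp [h2.tz]⟩ (by simp) hc hw w1 w2
    refine wp_abs fun R hR => ?_
    rw [wp_seq, wp_set, wp_seq, wp_set, wp_seq, wp_set]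
    simp [h5, h6, hTl, hsh]
    refine ⟨by omega, wp_use g2 ?_⟩
    rintro s' ⟨k1, k2⟩ hf
    have f1 := hf.reg vSt
    have f2 := hf.reg vX
    have f3 := hf.reg vCb
    have f4 := hf.reg vV
    have f5 := hf.reg vGo
    simp [h4] at f1 f2 f3 f4 f5
    refine hR _ ⟨l ++ [u'], _, 0, _, _, ⟨h1.literal (by omega) hi hV h0 hk hkL rfl ht g1, k1, ?_,
      f2,
      f3, f4⟩, Or.inl ⟨?_, ?_, ?_⟩⟩
    · rw [f1, run_concat]
    · rw [f5]; exact hGo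
    · simp
      omega
    · simp only [NS.tick_time, NS.set_time] at k2
      linarith

theorem buildToken_spec (E : BuildEnv b L q σ MB cc cost z₀) (he : Env b L MB s)
    (hSig : s.reg vSig = σ)
    (h : HasBuild A z₀ b L v i l r 0 cb a s) (hw : r.wd.length < L) (hGo : s.reg vGo ≠ 0) :
    wp b A cost buildTokenCode (Next A z₀ b L v i (l.length + cb) s.time (cc + 1400)) s := by
  have hE := E
  obtain ⟨hbd, hz, hqb, hσb, hcost⟩ := E
  have hh := h
  obtain ⟨h1, h2, h3, h4, h5, h6⟩ := h
  obtain ⟨b1, b2, b3, b4⟩ := hbd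
  have hbd : Bnd b L MB := ⟨b1, b2, b3, b4⟩
  have hcb := h1.cb_le
  obtain ⟨V1, hV⟩ : ∃ V1, a * 2 ^ (b - (L - cb)) * 2 % 2 ^ b = V1 := ⟨_, rfl⟩
  unfold buildTokenCode
  rw [wp_seq, wp_set, wp_ite]
  have hb0 : b ≠ 0 := by omega
  refine ⟨by simpa using hb0, by simp, fun hc => ?_, fun hc => ?_⟩
  · simp [h6, hV] at hc
    rw [wp_set]
    refine ⟨by simp, l, r, 0, cb, a, ⟨h1, ⟨?_, ?_, ?_, ?_⟩, ?_, ?_, ?_, ?_⟩,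
      Or.inr ⟨by simp, le_rfl, ?_, .noToken rfl V1 hV (Or.inl hc)⟩⟩
    any_goals simp [h2.lead, h2.mv, h2.ml, h2.tz, h3, h4, h5, h6]
    linarith
  simp [h6, hV] at hc
  have ha : a ≠ 0 := by
    rintro rfl
    simp at hV
    omega
  have hi : i < 2 ^ L := by
    by_contra hcon
    obtain ⟨d, hd⟩ := Nat.exists_eq_add_of_le (Nat.le_of_not_lt hcon)
    exact ha (h1.zeros d hd).2.2
  have hn : 1 ≤ L - cb := by
    by_contra hcon
    have : L - cb = 0 := by omega
    have := h1.a_lt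
    rw [‹L - cb = 0›] at this
    omega
  obtain ⟨k, hk⟩ : ∃ k, Nat.size V1 + k = b := by
    have : Nat.size V1 ≤ b := by
      rw [Nat.size_le, ← hV]
      exact Nat.mod_lt _ (Nat.two_pow_pos _)
    exact ⟨b - Nat.size V1, by omega⟩
  -- The low bits of the word are zero, so that its first bit one is among the high bits.
  have hkn : k + 2 ≤ L - cb + 1 := by
    have e := hV
    rw [mul_two_mod hn (by omega)] at e
    have ha' : 0 < a % 2 ^ (L - cb - 1) := by
      rcases Nat.eq_zero_or_pos (a % 2 ^ (L - cb - 1)) with h | h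
      · rw [h] at e
        omega
      · exact h
    have h8 := size_mul_two_pow ha' (b - (L - cb) + 1)
    have h9 := Nat.size_pos.2 ha'
    rw [e] at h8
    omega
  rw [wp_seq]
  refine wp_use (read_spec (V := a * 2 ^ (b - (L - cb))) (V1 := V1) (k := k) hbd
    (he.frame (by simp) (by simp) (by simp) (by simp) (by simp)) (by simp [h6]) hV hk (by omega)
    (by omega)) ?_
  rintro s₁ ⟨r1, r2, r3, r4, r5⟩ hf
  have f1 := hf.reg vCb
  have f2 := hf.reg vL
  have f3 := hf.reg vSt
  have f4 := hf.reg vX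
  have f5 := hf.reg vV
  have f6 := hf.reg vGo
  have f7 := hf.reg vLead
  have f8 := hf.reg vMv
  have f9 := hf.reg vMl
  have f10 := hf.reg vTz
  have f11 := hf.reg vSig
  have f12 := hf.mem
  simp [h3, h4, h5, h6, he.hL, h2.lead, h2.mv, h2.ml] at f1 f2 f3 f4 f5 f7 f8 f9
  simp [hSig, h2.tz] at f10 f11 f12
  simp at f6
  have htime : s₁.time ≤ s.time + 250 := by
    have : L * s₁.time ≤ L * (s.time + 250) := by
      simp [Nat.mul_add] at r5 ⊢
      omega
    exact Nat.le_of_mul_le_mul_left this b1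
  have he₁ : Env b L MB s₁ :=
    he.frame (hf.reg vB) (hf.reg vL) (hf.reg vP) (hf.reg vMB) (fun w _ => by rw [f12])
  rw [wp_ite]
  refine ⟨by simp [f1, r3]; omega, fun hc' => ?_, fun hc' => ?_⟩
  · simp [f1, f2, r3] at hc'
    rw [wp_set]
    refine ⟨by simp, l, r, 0, cb, a, ⟨h1, ⟨?_, ?_, ?_, ?_⟩, ?_, ?_, ?_, ?_⟩,
      Or.inr ⟨by simp, le_rfl, ?_, .noToken rfl V1 hV (Or.inr (by omega))⟩⟩
    any_goals simp [f1, f3, f4, f5, f7, f8, f9, f10]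
    omega
  simp [f1, f2, r3] at hc'
  have hX : V1 / 2 ^ (b - (2 * k + 1)) < 2 ^ (k + 1) := by
    rw [Nat.div_lt_iff_lt_mul (Nat.two_pow_pos _), ← pow_add]
    have e : k + 1 + (b - (2 * k + 1)) = Nat.size V1 := by omega
    rw [e]
    exact Nat.lt_size_self _
  rw [wp_ite]
  refine ⟨by simp, fun ht => ?_, fun ht => ?_⟩
  · simp [r1] at ht
    have hsh := shift_block (a := a) (n := L - cb) (t := 2 * k + 2) (b := b) (by omega) (by omega)
    rw [Nat.sub_sub] at hsh
    have ht' : a * 2 ^ (b - (L - cb)) / 2 ^ (b - 1) = 0 := by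
      rw [Nat.div_eq_of_lt]
      omega
    rw [wp_seq, wp_set, wp_seq, wp_set, wp_set]
    refine ⟨by simp, by simp [f1, r3]; omega, by simp, l, r, _, _, _,
      ⟨h1.runToken (by omega) hi hV hc hk (by omega) hX ht', ⟨?_, ?_, ?_, ?_⟩, ?_, ?_, ?_, ?_⟩,
      Or.inl ⟨?_, ?_, ?_⟩⟩
    any_goals simp [f1, f3, f5, f7, f8, f9, f10, f6, hGo, r2, r3, hsh]
    omega
  · simp [r1] at ht
    have ht' : a * 2 ^ (b - (L - cb)) / 2 ^ (b - 1) ≠ 0 :=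
      (Nat.div_pos ht (Nat.two_pow_pos _)).ne'
    refine wp_mono ?_ (buildLiteral_spec hE (s := (s₁.tick 5).tick 3) (V1 := V1) (k := k)
      (he₁.frame (by simp) (by simp) (by simp) (by simp) (by simp)) hi (by simp [f11])
      ⟨h1, ⟨by simp [f7], by simp [f8], by simp [f9], by simp [f10]⟩, by simp [f3], by simp [f4],
        by simp [f1], by simp [f5]⟩ hw hV hc hk (by omega) hX ht' (by simp [r2]) (by simp [r3])
      (by simp [f6, hGo]))
    rintro s₂ ⟨l', r', x', cb', a', g1, g2⟩
    refine ⟨l', r', x', cb', a', g1, g2.imp (fun ⟨c1, c2, c3⟩ => ⟨c1, c2, ?_⟩)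
      (fun ⟨c1, c2, c3, c4⟩ => ⟨c1, c2, ?_, c4⟩)⟩
    all_goals
      simp only [NS.tick_time] at c3
      linarith

/-- An entry is computed in time `O(2 ^ L)`: every round but the last one processes a symbol or
reads a token, and their number is bounded by `Build.meas`. -/
theorem build_spec (E : BuildEnv b L q σ MB cc cost z₀) (he : Env b L MB s)
    (hSig : s.reg vSig = σ) (hi : i ≤ 2 * 2 ^ L) (hSt : s.reg vSt = v) (hX : s.reg vX = x)
    (hV : s.reg vV = a * 2 ^ (b - L)) (hB : Build A z₀ b L v i [] .empty x 0 a) :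
    wp b A cost buildCode (fun s' => ∃ l r x cb a, HasBuild A z₀ b L v i l r x cb a s' ∧
      Build.Stop A z₀ b L v l r x cb a ∧ s'.time ≤ s.time + (cc + 1500) * (4 * 2 ^ L)) s := by
  have hbd := E.bnd
  obtain ⟨b1, b2, b3, b4⟩ := hbd
  have hb0 : b ≠ 0 := by omega
  have hL2 : L < 2 ^ L := Nat.lt_two_pow_self
  refine wp_abs fun R hR => ?_
  unfold buildCode
  simp only [wp_seq, wp_set]
  refine ⟨by simp, by simp, by simp, by simp, by simp, by simp, by simpa using hb0, ?_⟩
  refine wp_use (wp_while (fun s' => ∃ l r x cb a, HasBuild A z₀ b L v i l r x cb a s' ∧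
      ((s'.reg vGo ≠ 0 ∧ s'.time ≤ s.time + 20 + (cc + 1420) * (l.length + cb)) ∨
        (s'.reg vGo = 0 ∧ Build.Stop A z₀ b L v l r x cb a ∧
          s'.time ≤ s.time + 20 + (cc + 1420) * (l.length + cb + 1))))
      (s.time + 20 + (cc + 1420) * (4 * 2 ^ L)) ?_ ?_ ?_ ?_) ?_
  · refine ⟨[], .empty, x, 0, a, ⟨hB, ⟨?_, ?_, ?_, ?_⟩, ?_, ?_, ?_, ?_⟩, Or.inl ⟨?_, ?_⟩⟩
    any_goals simp [Rec.empty, hSt, hX, hV]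
  · rintro s' ⟨l, r, x, cb, a, h, h'⟩
    have h1 := h.build.meas
    have h2 := h.build.cb_le
    have hpos := Nat.two_pow_pos (L - cb)
    have h3 := Nat.mul_le_mul_left (cc + 1420) (show l.length + cb + 1 ≤ 4 * 2 ^ L by omega)
    have h4 := Nat.mul_le_mul_left (cc + 1420) (show l.length + cb ≤ l.length + cb + 1 by omega)
    rcases h' with ⟨-, h'⟩ | ⟨-, -, h'⟩ <;> omega
  · intro s' _ _
    simp
  · rintro s' ⟨l, r, x, cb, a, h, h'⟩ hf hcond
    simp at hcond
    obtain ⟨-, ht⟩ := h'.resolve_right fun h => hcond h.1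
    have he' : Env b L MB s' := he.frame (hf.reg vB) (hf.reg vL) (hf.reg vP) (hf.reg vMB)
      (fun w _ => by have := hf.mem; simp [this])
    have f1 := hf.reg vSig
    have f2 := hf.reg vZero
    simp [hSig] at f1 f2
    -- A round that makes progress is paid.
    have next : ∀ s₂, Next A z₀ b L v i (l.length + cb) (s'.time + 10) (cc + 1400) s₂ →
        ∃ l r x cb a, HasBuild A z₀ b L v i l r x cb a s₂ ∧
      ((s₂.reg vGo ≠ 0 ∧ s₂.time ≤ s.time + 20 + (cc + 1420) * (l.length + cb)) ∨
        (s₂.reg vGo = 0 ∧ Build.Stop A z₀ b L v l r x cb a ∧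
          s₂.time ≤ s.time + 20 + (cc + 1420) * (l.length + cb + 1))) := by
      rintro s₂ ⟨l', r', x', cb', a', g1, g2⟩
      refine ⟨l', r', x', cb', a', g1, g2.imp (fun ⟨c1, c2, c3⟩ => ⟨c1, ?_⟩)
        (fun ⟨c1, c2, c3, c4⟩ => ⟨c1, c4, ?_⟩)⟩
      · have := Nat.mul_le_mul_left (cc + 1420) (show l.length + cb + 1 ≤ l'.length + cb' by omega)
        rw [mul_add] at this
        linarith
      · have := Nat.mul_le_mul_left (cc + 1420)
          (show l.length + cb + 1 ≤ l'.length + cb' + 1 by omega)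
        rw [mul_add] at this
        linarith
    obtain ⟨h1, h2, h3, h4, h5, h6⟩ := h
    rw [wp_ite]
    refine ⟨by simp, fun hc => ?_, fun hc => ?_⟩
    · simp [he'.hL, h2.ml] at hc
      rw [wp_set]
      refine ⟨by simp, next _ ⟨l, r, x, cb, a, ⟨h1, ⟨?_, ?_, ?_, ?_⟩, ?_, ?_, ?_, ?_⟩,
        Or.inr ⟨by simp, le_rfl, ?_, .full hc⟩⟩⟩
      any_goals simp [h2.lead, h2.mv, h2.ml, h2.tz, h3, h4, h5, h6]
      linarith
    simp [he'.hL, h2.ml] at hc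
    rw [wp_ite]
    refine ⟨by simp, fun hx => ?_, fun hx => ?_⟩
    · simp [h4] at hx
      obtain ⟨x, rfl⟩ : ∃ y, x = y + 1 := ⟨x - 1, by omega⟩
      refine wp_mono (fun s₂ h => next s₂ ?_) (buildZero_spec E (s := ((s'.tick 3).tick 3).tick 3)
        (he'.frame (by simp) (by simp) (by simp) (by simp) (by simp)) hi
        ⟨h1, ⟨by simp [h2.lead], by simp [h2.mv], by simp [h2.ml], by simp [h2.tz]⟩, by simp [h3],
          by simp [h4], by simp [h5], by simp [h6]⟩ hc (by simp [f2]) (by simpa using hcond))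
      obtain ⟨l', r', x', cb', a', g1, g2⟩ := h
      refine ⟨l', r', x', cb', a', g1, g2.imp (fun ⟨c1, c2, c3⟩ => ⟨c1, c2, ?_⟩)
        (fun ⟨c1, c2, c3, c4⟩ => ⟨c1, c2, ?_, c4⟩)⟩
      all_goals
        simp only [NS.tick_time] at c3
        linarith
    · simp [h4] at hx
      subst hx
      refine wp_mono (fun s₂ h => next s₂ ?_) (buildToken_spec E (s := ((s'.tick 3).tick 3).tick 3)
        (he'.frame (by simp) (by simp) (by simp) (by simp) (by simp)) (by simp [f1])
        ⟨h1, ⟨by simp [h2.lead], by simp [h2.mv], by simp [h2.ml], by simp [h2.tz]⟩, by simp [h3],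
          by simp [h4], by simp [h5], by simp [h6]⟩ hc (by simpa using hcond))
      obtain ⟨l', r', x', cb', a', g1, g2⟩ := h
      refine ⟨l', r', x', cb', a', g1, g2.imp (fun ⟨c1, c2, c3⟩ => ⟨c1, c2, ?_⟩)
        (fun ⟨c1, c2, c3, c4⟩ => ⟨c1, c2, ?_, c4⟩)⟩
      all_goals
        simp only [NS.tick_time] at c3
        linarith
  · rintro _ ⟨s', ⟨l, r, x, cb, a, h, h'⟩, hcond, hf, rfl⟩ -
    simp at hcond
    obtain ⟨-, hs, ht⟩ := h'.resolve_left fun h => h.1 hcond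
    obtain ⟨h1, h2, h3, h4, h5, h6⟩ := h
    refine hR _ ⟨l, r, x, cb, a, ⟨h1, ⟨?_, ?_, ?_, ?_⟩, ?_, ?_, ?_, ?_⟩, hs, ?_⟩
    any_goals simp [h2.lead, h2.mv, h2.ml, h2.tz, h3, h4, h5, h6]
    have hm := h1.meas
    have hcb := h1.cb_le
    have hpos := Nat.two_pow_pos (L - cb)
    have h7 := Nat.mul_le_mul_left (cc + 1420) (show l.length + cb + 1 ≤ 4 * 2 ^ L by omega)
    have h8 : (cc + 1500) * (4 * 2 ^ L) = (cc + 1420) * (4 * 2 ^ L) + 320 * 2 ^ L := by ring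
    omega

/-- Compute the entry with index `vI` for the state `vC`, and store it at the address `vPos`. -/
def entryCode : Cmd :=
  vSt ≔ vC ;;
  .ite (.lt vI vP) (vX ≔ 0 ;; vV ≔ vI ≪≪ (vB - vL)) (vX ≔ vI - vP ;; vV ≔ 0) ;;
  buildCode ;;
  .st vPos vCb ;; .st (vPos + 1) vX ;; .st (vPos + 2) vLead ;; .st (vPos + 3) vMv ;;
  .st (vPos + 4) vMl ;; .st (vPos + 5) vTz ;; .st (vPos + 6) vSt

theorem EntryOK.congr {v : Fin q} {i : ℕ} {F F' : ℕ → ℕ} (h : EntryOK A z₀ b L v i F)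
    (hF : ∀ f < 7, F' f = F f) : EntryOK A z₀ b L v i F' := by
  unfold EntryOK at h ⊢
  rw [hF 0 (by norm_num), hF 1 (by norm_num), hF 2 (by norm_num), hF 3 (by norm_num),
    hF 4 (by norm_num), hF 5 (by norm_num), hF 6 (by norm_num)]
  exact h

theorem entry_spec {s : NS} {v : Fin q} {i adr : ℕ} (E : BuildEnv b L q σ MB cc cost z₀)
    (he : Env b L MB s) (hSig : s.reg vSig = σ) (hi : i ≤ 2 * 2 ^ L) (hC : s.reg vC = v)
    (hI : s.reg vI = i) (hpos : s.reg vPos = adr) (hadr : adr + 8 < 2 ^ b) :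
    wp b A cost entryCode (fun s' => EntryOK A z₀ b L v i (fun f => s'.mem (adr + f)) ∧
      (∀ x, x < adr ∨ adr + 8 ≤ x → s'.mem x = s.mem x) ∧
      s'.time ≤ s.time + 100 + (cc + 1500) * (4 * 2 ^ L)) s := by
  have hbd := E.bnd
  obtain ⟨b1, b2, b3, b4⟩ := hbd
  have hb0 : b ≠ 0 := by omega
  refine wp_abs fun R hR => ?_
  unfold entryCode
  have key : ∀ (s₁ : NS) (x a : ℕ), Build A z₀ b L v i [] .empty x 0 a → s₁.reg vSt = v →
      s₁.reg vX = x → s₁.reg vV = a * 2 ^ (b - L) → s₁.mem = s.mem → Env b L MB s₁ →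
      s₁.reg vSig = σ → s₁.reg vPos = adr → s₁.time ≤ s.time + 30 →
      wp b A cost (buildCode ;;
        .st vPos vCb ;; .st (vPos + 1) vX ;; .st (vPos + 2) vLead ;; .st (vPos + 3) vMv ;;
        .st (vPos + 4) vMl ;; .st (vPos + 5) vTz ;; .st (vPos + 6) vSt) R s₁ := by
    intro s₁ x a hB k1 k2 k3 k4 k5 k6 k7 k8
    rw [wp_seq]
    refine wp_use (build_spec E k5 k6 hi k1 k2 k3 hB) ?_
    rintro s₂ ⟨l, r, x', cb, a', h, hs, ht⟩ hf
    have f1 := hf.reg vPos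
    have f2 := hf.mem
    rw [k7] at f1
    rw [k4] at f2
    obtain ⟨h1, h2, h3, h4, h5, h6⟩ := h
    simp [f1, h5, h4, h2.lead, h2.mv, h2.ml, h2.tz, h3, and_assoc]
    repeat refine ⟨by omega, ?_⟩
    refine hR _ ⟨h1.entryOK hs (by omega) ?_ ?_ ?_ ?_ ?_ ?_ ?_, ?_, ?_⟩
    any_goals simp [f2]
    · intro x hx
      rw [Function.update_of_ne (by omega), Function.update_of_ne (by omega),
        Function.update_of_ne (by omega), Function.update_of_ne (by omega),
        Function.update_of_ne (by omega), Function.update_of_ne (by omega),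
        Function.update_of_ne (by omega)]
    · linarith
  rw [wp_seq, wp_set, wp_seq, wp_ite]
  refine ⟨by simp, by simp, fun hc => ?_, fun hc => ?_⟩
  · simp [hI, he.hP] at hc
    have hm : i * 2 ^ (b - L) % 2 ^ b = i * 2 ^ (b - L) := by
      refine Nat.mod_eq_of_lt ?_
      have e : 2 ^ b = 2 ^ L * 2 ^ (b - L) := by rw [← pow_add]; congr 1; omega
      rw [e]
      exact (Nat.mul_lt_mul_right (Nat.two_pow_pos _)).2 hc
    rw [wp_seq, wp_set, wp_set]
    refine ⟨by simp, by simp [he.hB, he.hL]; omega, key _ 0 i (build_block hc) ?_ ?_ ?_ ?_ ?_ ?_ ?_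
      ?_⟩
    any_goals simp [hC, hI, he.hB, he.hL, hm, hSig, hpos]
    exact he.frame (by simp) (by simp) (by simp) (by simp) (by simp)
  · simp [hI, he.hP] at hc
    obtain ⟨d, rfl⟩ := Nat.exists_eq_add_of_le hc
    rw [wp_seq, wp_set, wp_set]
    refine ⟨by simp [hI, he.hP], by simp, key _ d 0 (build_zeros d) ?_ ?_ ?_ ?_ ?_ ?_ ?_ ?_⟩
    any_goals simp [hC, hI, he.hP, hSig, hpos]
    exact he.frame (by simp) (by simp) (by simp) (by simp) (by simp)

/-- Compute the table of chunks. -/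
def tableCode : Cmd :=
  vC ≔ 0 ;; vPos ≔ vGB ;;
  .loop (.lt vC vQ)
    (vI ≔ 0 ;;
      .loop (.lt vI (vP + vP + 1)) (entryCode ;; vPos ≔ vPos + 8 ;; vI ≔ vI + 1) ;;
      vC ≔ vC + 1)

/-- The first `e` entries of the table have been computed. -/
def TableOK (A : Transducer q σ) (z₀ : Fin σ) (b L GB e : ℕ) (m : ℕ → ℕ) : Prop :=
  ∀ (v : Fin q) (i : ℕ), i ≤ 2 * 2 ^ L → v * (2 * 2 ^ L + 1) + i < e →
    EntryOK A z₀ b L v i (fun f => m (GB + 8 * (v * (2 * 2 ^ L + 1) + i) + f))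

/-- The entries of one state. -/
theorem tableRow_spec {s : NS} {v : Fin q} (lay : Lay b L q σ MB GB LB D)
    (E : BuildEnv b L q σ MB cc cost z₀)
    (he : Env b L MB s) (hSig : s.reg vSig = σ) (hC : s.reg vC = v) (hI : s.reg vI = 0)
    (hpos : s.reg vPos = GB + 8 * (v * (2 * 2 ^ L + 1)))
    (hT : TableOK A z₀ b L GB (v * (2 * 2 ^ L + 1)) s.mem) :
    wp b A cost (.loop (.lt vI (vP + vP + 1)) (entryCode ;; vPos ≔ vPos + 8 ;; vI ≔ vI + 1))
      (fun s' => s'.reg vPos = GB + 8 * ((v + 1) * (2 * 2 ^ L + 1)) ∧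
      TableOK A z₀ b L GB ((v + 1) * (2 * 2 ^ L + 1)) s'.mem ∧
      (∀ x, x < GB ∨ LB ≤ x → s'.mem x = s.mem x) ∧
      s'.time ≤ s.time + 10 + (120 + (cc + 1500) * (4 * 2 ^ L)) * (2 * 2 ^ L + 1)) s := by
  obtain ⟨⟨b1, b2, b3, b4⟩, l1, l2, l3, l4, l5, l6, l7, l8⟩ := lay
  have hb0 : b ≠ 0 := by omega
  have hv := v.2
  set W := 2 * 2 ^ L + 1 with hW
  have hvW : (v + 1 : ℕ) * W ≤ q * W := Nat.mul_le_mul_right _ hv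
  have hexp : (v + 1 : ℕ) * W = v * W + W := by ring
  refine wp_abs fun R hR => ?_
  refine wp_use (wp_while (fun s' => ∃ i ≤ W, s'.reg vI = i ∧ s'.reg vPos = GB + 8 * (v * W + i) ∧
      TableOK A z₀ b L GB (v * W + i) s'.mem ∧
      (∀ x, x < GB ∨ LB ≤ x → s'.mem x = s.mem x) ∧
      s'.time ≤ s.time + (120 + (cc + 1500) * (4 * 2 ^ L)) * i)
      (s.time + (120 + (cc + 1500) * (4 * 2 ^ L)) * W) ?_ ?_ ?_ ?_) ?_
  · exact ⟨0, by omega, hI, by simpa using hpos, by simpa using hT, by simp, by simp⟩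
  · rintro s' ⟨i, h1, -, -, -, -, h2⟩
    have := Nat.mul_le_mul_left (120 + (cc + 1500) * (4 * 2 ^ L)) h1
    omega
  · rintro s' - hf
    have := hf.reg vP
    rw [he.hP] at this
    simp [this]
    omega
  · rintro s' ⟨i, c1, c2, c3, c4, c5, c6⟩ hf hcond
    have e1 := hf.reg vP
    have e2 := hf.reg vSig
    have e3 := hf.reg vC
    rw [he.hP] at e1
    rw [hSig] at e2
    rw [hC] at e3
    simp [c2, e1] at hcond
    have he' : Env b L MB s' := he.frame (hf.reg vB) (hf.reg vL) (hf.reg vP) (hf.reg vMB)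
      (fun w hw => c5 _ (Or.inl (by omega)))
    refine wp_abs fun R' hR' => ?_
    rw [wp_seq]
    refine wp_use (entry_spec (v := v) (i := i) (s := s'.tick (Cond.lt (Ex.var vI)
      (vP + vP + 1)).cost)
      (adr := GB + 8 * (v * W + i)) E
      (he'.frame (by simp) (by simp) (by simp) (by simp) (by simp)) (by simp [e2]) (by omega)
      (by simp [e3]) (by simp [c2]) (by simp [c3]) (by omega)) ?_
    rintro s₂ ⟨g1, g2, g3⟩ hf₂
    have f1 := hf₂.reg vPos
    have f2 := hf₂.reg vI
    simp [c2, c3] at f1 f2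
    simp at g2 g3
    simp [f1, f2, and_assoc]
    repeat refine ⟨by omega, ?_⟩
    refine hR' _ ⟨i + 1, by omega, by simp, by simp; ring, ?_, ?_, ?_⟩
    · intro v' i' hi' hlt
      by_cases hvi : (v' : ℕ) = v ∧ i' = i
      · obtain ⟨h1, rfl⟩ := hvi
        have : v' = v := Fin.ext h1
        subst this
        simpa using g1
      · have hne : (v' : ℕ) * W + i' ≠ v * W + i := by
          intro h
          rw [← hW] at hlt
          have hi1 : i' < W := by omega
          have hi2 : i < W := by omega
          have h1 := congrArg (· / W) h
          have h2 := congrArg (· % W) h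
          simp only [mul_comm _ W, Nat.mul_add_div (show 0 < W by omega), Nat.mul_add_mod,
            Nat.div_eq_of_lt hi1, Nat.div_eq_of_lt hi2, Nat.mod_eq_of_lt hi1,
            Nat.mod_eq_of_lt hi2] at h1 h2
          exact hvi ⟨by omega, h2⟩
        rw [← hW] at hlt
        refine (c4 v' i' hi' (by rw [← hW]; omega)).congr fun f hf => ?_
        rw [← hW]
        simp only [NS.tick_mem, NS.set_mem]
        exact g2 _ (by omega)
    · intro x hx
      simp only [NS.tick_mem, NS.set_mem]
      rw [g2 x (by omega), c5 x hx]
    · simp only [NS.tick_time, NS.set_time]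
      linarith
  · rintro _ ⟨s', ⟨i, c1, c2, c3, c4, c5, c6⟩, hcond, hf, rfl⟩ -
    have e1 := hf.reg vP
    rw [he.hP] at e1
    simp [c2, e1] at hcond
    have : i = W := by omega
    subst this
    rw [← hexp] at c3 c4
    refine hR _ ⟨c3, c4, c5, ?_⟩
    simp
    omega

theorem table_spec {s : NS} (lay : Lay b L q σ MB GB LB D)
    (E : BuildEnv b L q σ MB cc cost z₀) (h : PRegs A b L MB GB LB s)
    (hM : ∀ v < 2 ^ L, s.mem (MB + v) = Nat.size v) :
    wp b A cost tableCode (fun s' => TableOK A z₀ b L GB (q * (2 * 2 ^ L + 1)) s'.mem ∧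
      (∀ x, x < GB ∨ LB ≤ x → s'.mem x = s.mem x) ∧
      s'.time ≤ s.time + 20 +
        q * (30 + (120 + (cc + 1500) * (4 * 2 ^ L)) * (2 * 2 ^ L + 1))) s := by
  have lay' := lay
  obtain ⟨⟨b1, b2, b3, b4⟩, l1, l2, l3, l4, l5, l6, l7, l8⟩ := lay
  obtain ⟨rB, rQ, rSig, rL, rP, rMB, rGB, rLB⟩ := h
  have hb0 : b ≠ 0 := by omega
  refine wp_abs fun R hR => ?_
  unfold tableCode
  rw [wp_seq, wp_set, wp_seq, wp_set]
  refine ⟨by simp, by simp, ?_⟩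
  set K := 30 + (120 + (cc + 1500) * (4 * 2 ^ L)) * (2 * 2 ^ L + 1) with hK
  refine wp_use (wp_while (fun s' => ∃ c ≤ q, s'.reg vC = c ∧
      s'.reg vPos = GB + 8 * (c * (2 * 2 ^ L + 1)) ∧
      TableOK A z₀ b L GB (c * (2 * 2 ^ L + 1)) s'.mem ∧
      (∀ x, x < GB ∨ LB ≤ x → s'.mem x = s.mem x) ∧
      s'.time ≤ s.time + 10 + c * K) (s.time + 10 + q * K) ?_ ?_ ?_ ?_) ?_
  · exact ⟨0, by omega, by simp, by simp [rGB], fun v i _ h => by omega, by simp, by simp⟩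
  · rintro s' ⟨c, h1, -, -, -, -, h2⟩
    have := Nat.mul_le_mul_right K h1
    omega
  · intro s' _ _
    simp
  · rintro s' ⟨c, c1, c2, c3, c4, c5, c6⟩ hf hcond
    have e1 := hf.reg vP
    have e2 := hf.reg vSig
    have e3 := hf.reg vQ
    have e4 := hf.reg vB
    have e5 := hf.reg vL
    have e6 := hf.reg vMB
    simp [rP, rSig, rQ, rB, rL, rMB] at e1 e2 e3 e4 e5 e6
    simp [c2, e3] at hcond
    have he' : Env b L MB ((((s'.tick 3).set vI 0).tick 2)) :=
      ⟨by simp [e4], by simp [e5], by simp [e1], by simp [e6], fun w hw => by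
        simp
        rw [c5 _ (Or.inl (by omega)), hM w hw]⟩
    refine wp_abs fun R' hR' => ?_
    rw [wp_seq, wp_set, wp_seq]
    refine ⟨by simp, ?_⟩
    refine wp_use (tableRow_spec (v := ⟨c, hcond⟩) lay' E he' (by simp [e2]) (by simp [c2])
      (by simp) (by simp [c3]) (by simpa using c4)) ?_
    rintro s₂ ⟨g1, g2, g3, g4⟩ hf₂
    have f1 := hf₂.reg vC
    simp [c2] at f1 g1 g3 g4
    rw [wp_set]
    refine ⟨by simp [f1, hb0]; omega, hR' _ ⟨c + 1, hcond, by simp [f1], by simp [g1], g2, ?_, ?_⟩⟩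
    · intro x hx
      simp only [NS.tick_mem, NS.set_mem]
      rw [g3 x hx, c5 x hx]
    · simp only [NS.tick_time, NS.set_time, size_add, size_var, size_ofNat]
      rw [add_mul, one_mul]
      linarith
  · rintro _ ⟨s', ⟨c, c1, c2, c3, c4, c5, c6⟩, hcond, hf, rfl⟩ -
    have e3 := hf.reg vQ
    simp [rQ] at e3
    simp [c2, e3] at hcond
    have : c = q := by omega
    subst this
    refine hR _ ⟨c4, c5, ?_⟩
    simp
    omega

/-- The preprocessing for a non-empty alphabet. -/
def structureCode : Cmd :=
  paramCode ;; lenTableCode ;; nodeCode ;; forestCode ;; bucketCode ;; pathsCode ;; tableCode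

/-- The table of chunks dominates the time. -/
theorem pre_time_le {L q cc t : ℕ} (hL : 1 ≤ L) (hq : 0 < q)
    (ht : t ≤ 80 + 20 * L + (20 + 30 * 2 ^ L) + (20 + (100 + cc) * q) + (20 + 200 * q) +
      (20 + 60 * q) + (30 + (300 + 40 * (2 ^ L + 1)) * q) +
      (20 + q * (30 + (120 + (cc + 1500) * (4 * 2 ^ L)) * (2 * 2 ^ L + 1)))) :
    t ≤ 20 * ((cc + 1500) * (q * 4 ^ L)) := by
  have hP : 2 ≤ 2 ^ L := by
    calc 2 = 2 ^ 1 := rfl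
      _ ≤ 2 ^ L := Nat.pow_le_pow_right (by norm_num) hL
  have hLP : L < 2 ^ L := Nat.lt_two_pow_self
  have h4 : 4 ^ L = 2 ^ L * 2 ^ L := by rw [← mul_pow]; rfl
  rw [h4]
  generalize 2 ^ L = P at *
  have h1 : 2 * P ≤ P * P := Nat.mul_le_mul_right _ hP
  have h2 : P * P ≤ q * (P * P) := Nat.le_mul_of_pos_left _ hq
  have h3 : 2 * (q * P) ≤ q * (P * P) := by
    have := Nat.mul_le_mul_left q h1
    linarith
  have h5 : 2 * q ≤ q * P := by
    have := Nat.mul_le_mul_left q hP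
    linarith
  have h6 : cc * q ≤ cc * (q * (P * P)) := Nat.mul_le_mul_left _ (by omega)
  have h7 : cc * (q * P) ≤ cc * (q * (P * P)) := Nat.mul_le_mul_left _ (by omega)
  have e : q * (30 + (120 + (cc + 1500) * (4 * P)) * (2 * P + 1)) =
      30 * q + 240 * (q * P) + 120 * q + 8 * (cc * (q * (P * P))) + 4 * (cc * (q * P)) +
        12000 * (q * (P * P)) + 6000 * (q * P) := by ring
  have e2 : 20 * ((cc + 1500) * (q * (P * P))) = 20 * (cc * (q * (P * P))) +
      30000 * (q * (P * P)) := by ring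
  have e3 : (300 + 40 * (P + 1)) * q = 340 * q + 40 * (q * P) := by ring
  have e4 : (100 + cc) * q = 100 * q + cc * q := by ring
  rw [e2]
  rw [e, e3, e4] at ht
  clear e e2 e3 e4
  generalize cc * (q * (P * P)) = a₁ at *
  generalize cc * (q * P) = a₂ at *
  generalize cc * q = a₃ at *
  generalize q * (P * P) = a₄ at *
  generalize q * P = a₅ at *
  generalize P * P = a₆ at *
  omega

/-- The time is `O(q * 4 ^ L)`, where `4 ^ L < 4 * N`. All cells beyond the data structure are left
unchanged. -/
theorem structure_spec {s : NS} (hz : (z₀ : ℕ) = 0) (hN : 2 ≤ N) (hNb : 8 * N < 2 ^ b)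
    (hlay : ∀ L, 1 ≤ L → 4 ^ L < 4 * N → ∃ MB GB LB D, Lay b L q σ MB GB LB D)
    (hcost : ∀ L, 1 ≤ L → 4 ^ L < 4 * N → ∀ (v : Fin q) (u : Fin σ), (u : ℕ) < 2 ^ L →
      cost v u ≤ cc)
    (h0 : s.reg vR0 = b) (h1 : s.reg vR1 = N) (h2 : s.reg vR2 = q) (h3 : s.reg vR3 = σ)
    (h4 : s.reg vR4 = A.init) :
    wp b A cost structureCode (fun s' => ∃ L MB GB LB D dep root base idx,
      Lay b L q σ MB GB LB D ∧ N ≤ 4 ^ L ∧ 4 ^ L < 4 * N ∧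
      DS A z₀ b L MB GB D dep root base idx s'.mem ∧ (∀ x, D ≤ x → s'.mem x = s.mem x) ∧
      s'.time ≤ s.time + 20 * ((cc + 1500) * (q * 4 ^ L))) s := by
  refine wp_abs fun R hR => ?_
  unfold structureCode
  rw [wp_seq]
  refine wp_use (param_spec hN hNb hlay h0 h1 h2 h3 h4) ?_
  rintro s₁ ⟨L, MB, GB, LB, D, lay, n1, n2, r1, a0, a1, a2, a3, a4, a5, a6, t1⟩ -
  have lay' := lay
  obtain ⟨⟨b1, b2, b3, b4⟩, l1, l2, l3, l4, l5, l6, l7, l8⟩ := lay'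
  have hqP : 2 * 2 ^ L + 1 ≤ q * (2 * 2 ^ L + 1) := Nat.le_mul_of_pos_left _ l6
  have hPq : 2 ^ L + 2 ≤ (2 ^ L + 2) * q := Nat.le_mul_of_pos_right _ l6
  rw [wp_seq]
  refine wp_use (lenTable_spec lay r1) ?_
  rintro s₂ ⟨c1, c2, t2⟩ hf₂
  have r2 := r1.frame hf₂
  rw [wp_seq]
  refine wp_use (node_spec lay r2 hz fun v => hcost L b1 n2 v z₀
    (by rw [hz]; exact Nat.two_pow_pos L))
    ?_
  rintro s₃ ⟨d1, d2, t3⟩ hf₃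
  have r3 := r2.frame hf₃
  rw [wp_seq]
  refine wp_use (forest_spec (g := skipStep A z₀) (by omega) r3.rQ (fun w => (d1 w).1)
    (fun w => (d1 w).2.2.2.2)) ?_
  rintro s₄ ⟨dep, root, F, e1, e2, e3, e4, t4⟩ hf₄
  have r4 := r3.frame hf₄
  rw [wp_seq]
  refine wp_use (bucket_spec (by omega) r4.rQ e2 e1 (fun w => by
    rw [e4 _ (fun w' => by omega)]; exact (d1 w).2.2.2.1)) ?_
  rintro s₅ ⟨g1, g2, t5⟩ hf₅
  have r5 := r4.frame hf₅
  rw [wp_seq]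
  refine wp_use (paths_spec (g := skipStep A z₀) F e1 (P := 2 ^ L) (LB := LB) (D := D) (by omega) l4
    l5 l6 r5.rP r5.rQ r5.rLB
    (fun w => by rw [g2 _ (fun w' => by omega), e4 _ (fun w' => by omega)]; exact (d1 w).1)
    (fun w => by rw [g2 _ (fun w' => by omega)]; exact e2 w)
    (fun w => by
      rw [g2 _ (fun w' => by omega), e4 _ (fun w' => by omega)]; exact (d1 w).2.2.1) g1) ?_
  rintro s₆ ⟨al, V, p1, p2, p3, t6⟩ hf₆
  have r6 := r5.frame hf₆
  -- Cells that keep their contents while the records and ladders are computed.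
  have keep : ∀ x, 10 + 9 * q ≤ x → x < LB ∨ D ≤ x → s₆.mem x = s₂.mem x := fun x hx hx' => by
    rw [p3 x ⟨by omega, fun w => by omega⟩, g2 x (fun w => by omega), e4 x (fun w => by omega),
      d2 x (Or.inr hx)]
  have hM : ∀ v < 2 ^ L, s₆.mem (MB + v) = Nat.size v := fun v hv => by
    rw [keep _ (by omega) (by omega), c1 v hv]
  refine wp_use (table_spec lay ⟨⟨b1, b2, b3, b4⟩, hz, by omega, l8, fun v u hu =>
    hcost L b1 n2 v u hu⟩ r6 hM) ?_
  rintro s₇ ⟨q1, q2, t7⟩ -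
  have head : ∀ x < 10, s₇.mem x = s₁.mem x := fun x hx => by
    rw [q2 x (by omega), p3 x ⟨by omega, fun w => by omega⟩, g2 x (fun w => by omega),
      e4 x (fun w => by omega), d2 x (by omega), c2 x (by omega)]
  have node : ∀ (v : Fin q) (f : ℕ), f < 9 → s₇.mem (10 + f + 9 * v) = s₆.mem (10 + f + 9 * v) :=
    fun v f hf => q2 _ (by omega)
  have node' : ∀ (v : Fin q) (f : ℕ), f < 4 → s₇.mem (10 + f + 9 * v) = s₄.mem (10 + f + 9 * v) :=
    fun v f hf => by
      rw [node v f (by omega), p3 _ ⟨by omega, fun w => by omega⟩, g2 _ (fun w => by omega)]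
  have node'' : ∀ (v : Fin q) (f : ℕ), f < 2 → s₇.mem (10 + f + 9 * v) = s₃.mem (10 + f + 9 * v) :=
    fun v f hf => by
      rw [node' v f (by omega), e4 _ (fun w => by omega)]
  have hal : al ≤ D := by
    have h1 : V.card ≤ q := by simpa using Finset.card_le_univ V
    have h2 := Nat.mul_le_mul_left (2 ^ L + 2) h1
    have := p1.al_le
    omega
  refine hR _ ⟨L, MB, GB, LB, D, dep, root, fun v => s₆.mem (14 + 9 * v),
    fun v => s₆.mem (15 + 9 * v), lay, n1, n2, ?_, fun x hx => ?_, ?_⟩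
  · refine ⟨l5, ?_, ?_, ?_, ?_, ?_, ?_, by omega, fun v hv => ?_, by omega, fun v => ?_,
      fun v => ?_,
      fun v => ?_, fun v => ?_, fun v => ?_, fun v => ?_, F, e1, fun v => ?_, fun v d hd => ?_,
      by omega,
      fun v i hi => ?_⟩
    · rw [head _ (by norm_num), a0]
    · rw [head _ (by norm_num), a1]
    · rw [head _ (by norm_num), a2]
    · rw [head _ (by norm_num), a3]
    · rw [head _ (by norm_num), a4]
    · rw [head _ (by norm_num), a5]
    · rw [q2 _ (by omega), hM v hv]
    · rw [node'' v 0 (by norm_num)]; exact (d1 v).1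
    · rw [node'' v 1 (by norm_num)]; exact (d1 v).2.1
    · rw [node' v 2 (by norm_num)]; exact e2 v
    · rw [node' v 3 (by norm_num)]; exact e3 v
    · exact node v 4 (by norm_num)
    · exact node v 5 (by norm_num)
    · obtain ⟨bot, x1, x2, x3, x4, x5⟩ := p1.ladder v (p2 v)
      have y1 : s₇.mem (s₆.mem (14 + 9 * v)) = s₆.mem (s₆.mem (14 + 9 * v)) := q2 _ (by omega)
      refine ⟨bot, x1, ?_, ?_, fun j hj => ?_⟩
      · rw [y1]; omega
      · rw [y1]; exact x4
      · rw [y1] at hj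
        rw [q2 _ (by omega), x5 j hj]
    · exact (p1.growth F (p2 v) d hd).2
    · refine q1 v i hi ?_
      have := Nat.mul_le_mul_right (2 * 2 ^ L + 1) v.2
      rw [Nat.succ_mul] at this
      omega
  · rw [q2 x (by omega), keep x (by omega) (by omega), c2 x (by omega), a6 x (by omega)]
  · have := pre_time_le (L := L) (q := q) (cc := cc) (t := s₇.time - s.time) b1 l6 (by omega)
    omega

/-! ### The programs on the word RAM -/

/-- The preprocessing. For an empty alphabet, there is no symbol zero and nothing to be done. -/
def preCode : Cmd := .ite (.eq vR3 0) .skip structureCode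

theorem absState_reg {st : State b} {v : Var} {k n : ℕ} (hk : v.idx = k)
    (h : st.reg k = BitVec.ofNat b n) (hn : n < 2 ^ b) : (absState st).reg v = n := by
  simp only [absState, hk, h, BitVec.toNat_ofNat]
  exact Nat.mod_eq_of_lt hn

theorem Rep.mem_eq {st : State b} {s : NS} (h : Rep st s) (v : BitVec b) :
    (st.mem v).toNat = s.mem v.toNat := by
  rw [← h.mem _ v.isLt, BitVec.ofNat_toNat, BitVec.setWidth_eq]

theorem absState_mem (st : State b) (v : BitVec b) : (absState st).mem v.toNat = (st.mem v).toNat :=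
  ((rep_absState st).mem_eq v).symm

theorem getMsbD_eq_testBit (x : BitVec b) {i : ℕ} (hi : i < b) :
    x.getMsbD i = x.toNat.testBit (b - 1 - i) := by
  rw [BitVec.getMsbD_eq_getLsbD, decide_eq_true hi, Bool.true_and, BitVec.testBit_toNat]

theorem senc_eq (S : List (Fin σ)) : senc S = sparseEncoding (S.map Fin.val) := by
  have h : (do let a ← S; pure (a : ℕ) : List ℕ) = S.map Fin.val := by
    induction S with
    | nil => rfl
    | cons u S ih => simpa using ih
  rw [senc, h, List.map_id']

theorem senc_output (S : List (Fin σ)) : senc (A.output S) = sparseEncoding (outs A A.init S) :=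
  senc_eq _

theorem length_senc_le {M : ℕ} (hσ : σ ≤ 2 ^ M) (S : List (Fin σ)) (hS : S.length ≤ 2 ^ M) :
    (senc S).length ≤ 2 ^ M * (2 * M + 2) := by
  rw [senc_eq, sparseEncoding]
  refine (length_sea_le M _ (fun y hy => ?_) 0).trans ?_
  · obtain ⟨u, -, rfl⟩ := List.mem_map.1 hy
    exact u.2.trans_le hσ
  · rw [List.length_map]
    simpa using Nat.mul_le_mul_right (2 * M + 2) hS

theorem senc_eq_nil {S : List (Fin σ)} (h : senc S = []) : S = [] := by
  have h1 := lt_two_pow_length_sea 0 (S.map Fin.val)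
  rw [senc_eq, sparseEncoding] at h
  rw [h] at h1
  simpa using h1

theorem eight_mul_lt_two_pow {b : ℕ} (h : 6 ≤ b) : 8 * b < 2 ^ b := by
  induction b, h using Nat.le_induction with
  | base => norm_num
  | succ b hb ih => rw [pow_succ]; omega

theorem queryCode_nil {s : NS} (h1 : s.reg vR1 = 0) :
    wp b A cost queryCode (fun s' => s'.reg vR0 = 0 ∧ s'.mem = s.mem ∧
      s'.time ≤ s.time + 10) s := by
  unfold queryCode
  rw [wp_ite]
  refine ⟨by simp, fun h => ?_, fun h => ?_⟩
  · rw [wp_set]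
    simp
  · simp [h1] at h

/-- The parameters of an instance, where the word length is at least `8 * C + 40` times `w`. This
makes all numbers that occur fit into a word. -/
structure Big (b w C N q σ : ℕ) : Prop where
  hb : (8 * C + 40) * w ≤ b
  hN : 2 ≤ N
  hNw : N ≤ 2 ^ w
  hq0 : 0 < q
  hq : q ≤ 2 ^ (C * w)
  hσ : σ ≤ 2 ^ (C * w)

namespace Big

variable {w C : ℕ}

theorem w_pos (h : Big b w C N q σ) : 1 ≤ w := by
  have h1 := h.hN
  have h2 := h.hNw
  by_contra hw
  have : w = 0 := by omega
  subst this
  simp at h2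
  omega

theorem b_ge (h : Big b w C N q σ) : 8 * (C * w) + 40 * w ≤ b := by
  have h1 := h.hb
  have h2 : (8 * C + 40) * w = 8 * (C * w) + 40 * w := by ring
  omega

theorem pow_lt (h : Big b w C N q σ) {k : ℕ} (hk : k < 8 * (C * w) + 40 * w) : 2 ^ k < 2 ^ b :=
  Nat.pow_lt_pow_right (by norm_num) (hk.trans_le h.b_ge)

theorem b_lt (h : Big b w C N q σ) : 8 * b < 2 ^ b :=
  eight_mul_lt_two_pow (by have := h.b_ge; have := h.w_pos; omega)

theorem N_lt (h : Big b w C N q σ) : 8 * N < 2 ^ b := by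
  have h1 : 2 ^ (w + 3) < 2 ^ b := h.pow_lt (by have := h.w_pos; omega)
  have h2 := h.hNw
  rw [pow_add] at h1
  omega

theorem qσ_lt (h : Big b w C N q σ) : q < 2 ^ b ∧ σ < 2 ^ b := by
  have h1 : 2 ^ (C * w) < 2 ^ b := h.pow_lt (by have := h.w_pos; omega)
  exact ⟨h.hq.trans_lt h1, h.hσ.trans_lt h1⟩

theorem qN_le (h : Big b w C N q σ) : q * N ≤ 2 ^ (C * w + w) := by
  rw [pow_add]
  exact Nat.mul_le_mul h.hq h.hNw

theorem L_le (h : Big b w C N q σ) (hL : 4 ^ L < 4 * N) : 2 * L ≤ w + 1 ∧ 2 ^ L ≤ 2 * N := by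
  constructor
  · have h1 : 2 ^ (2 * L) < 2 ^ (w + 2) := by
      rw [pow_mul, pow_add]
      have := h.hNw
      norm_num
      omega
    have := (Nat.pow_lt_pow_iff_right (by norm_num)).1 h1
    omega
  · by_contra hc
    push Not at hc
    have h1 : (2 * N) * (2 * N) < 2 ^ L * 2 ^ L := Nat.mul_lt_mul'' hc hc
    rw [← mul_pow] at h1
    have h2 : 4 * N ≤ 2 * N * (2 * N) := by
      have := h.hN
      nlinarith
    norm_num at h1
    omega

theorem exists_lay (h : Big b w C N q σ) (hσ0 : 0 < σ) (hL1 : 1 ≤ L) (hL : 4 ^ L < 4 * N) :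
    ∃ MB GB LB D, Lay b L q σ MB GB LB D := by
  refine ⟨_, _, _, _, ⟨hL1, ?_, ?_, h.b_lt⟩, rfl, rfl, rfl, rfl, ?_, h.hq0, hσ0, h.qσ_lt.2⟩
  · have := h.b_ge
    have := h.w_pos
    have := (h.L_le hL).1
    omega
  all_goals
    have h1 := (h.L_le hL).2
    have h2 : 2 ^ (C * w + w + 8) < 2 ^ b := h.pow_lt (by have := h.w_pos; omega)
    have h3 := h.qN_le
    have h4 := h.hq0
    have h5 := h.hN
    have h7 : q * 2 ≤ q * N := Nat.mul_le_mul_left _ h5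
    have h8 : N ≤ q * N := Nat.le_mul_of_pos_left _ h4
    rw [pow_add] at h2
    nlinarith

/-- The data structure has size `O(q * N)`. -/
theorem lay_le (h : Big b w C N q σ) (hL : 4 ^ L < 4 * N) (lay : Lay b L q σ MB GB LB D) :
    D ≤ 60 * (q * N) := by
  have h1 := (h.L_le hL).2
  have h4 := h.hq0
  have h5 := h.hN
  have h6 : q * 2 ^ L ≤ q * (2 * N) := Nat.mul_le_mul_left _ h1
  have h7 : q * 2 ≤ q * N := Nat.mul_le_mul_left _ h5
  have h8 : N ≤ q * N := Nat.le_mul_of_pos_left _ h4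
  rw [lay.hD, lay.hLB, lay.hGB, lay.hMB]
  nlinarith

/-- Input and output are short enough for their lengths to fit into a word. -/
theorem lens (h : Big b w C N q σ) (S : List (Fin σ)) (hS : S.length ≤ 2 ^ (C * w)) :
    4 * (senc S).length + 4 * (senc (A.output S)).length < 2 ^ b := by
  have h1 := length_senc_le h.hσ S hS
  have h2 : (A.output S).length ≤ 2 ^ (C * w) := by
    have := length_outs (A := A) A.init S
    rw [outs, List.length_map] at this
    rw [Transducer.output, this]
    exact hS
  have h3 := length_senc_le h.hσ _ h2
  have h4 : C * w < 2 ^ (C * w) := Nat.lt_two_pow_self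
  have h5 : 2 ^ (C * w + C * w + 5) < 2 ^ b := h.pow_lt (by have := h.w_pos; omega)
  rw [pow_add, pow_add] at h5
  have h6 : 2 ^ (C * w) * (2 * (C * w) + 2) ≤ 2 ^ (C * w) * (2 * 2 ^ (C * w)) :=
    Nat.mul_le_mul_left _ (by omega)
  nlinarith

end Big

theorem preCode_spec {s : NS} {w C c : ℕ} (big : Big b w C N q σ) (hσ : 0 < σ)
    (hcost : ∀ L, 4 ^ L < 4 * N → ∀ (v : Fin q) (u : Fin σ),
      L * cost v u ≤ 2 * c * (L + Nat.size u))
    (h0 : s.reg vR0 = b) (h1 : s.reg vR1 = N) (h2 : s.reg vR2 = q) (h3 : s.reg vR3 = σ)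
    (h4 : s.reg vR4 = A.init) :
    wp b A cost preCode (fun s' => ∃ L MB GB LB D dep root base idx,
      Lay b L q σ MB GB LB D ∧ N ≤ 4 ^ L ∧ 4 ^ L < 4 * N ∧
      DS A ⟨0, hσ⟩ b L MB GB D dep root base idx s'.mem ∧
      (∀ x, D ≤ x → s'.mem x = s.mem x) ∧
      s'.time ≤ s.time + 3 + 20 * ((4 * c + 1500) * (q * 4 ^ L))) s := by
  refine wp_abs fun R hR => ?_
  unfold preCode
  rw [wp_ite]
  refine ⟨by simp, fun h => ?_, fun h => ?_⟩
  · simp [h3] at h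
    omega
  · refine wp_use (structure_spec (A := A) (cc := 4 * c) (N := N) (s := s.tick 3)
      (z₀ := ⟨0, hσ⟩) rfl big.hN big.N_lt (fun L hL1 hL => big.exists_lay hσ hL1 hL)
      (fun L hL1 hL v u hu => ?_) (by simpa using h0) (by simpa using h1) (by simpa using h2)
      (by simpa using h3) (by simpa using h4)) ?_
    · have h1 := hcost L hL v u
      have h2 : Nat.size u ≤ L := Nat.size_le.2 hu
      have h3 : L * cost v u ≤ L * (4 * c) :=
        calc L * cost v u ≤ 2 * c * (L + Nat.size u) := h1
          _ ≤ 2 * c * (L + L) := Nat.mul_le_mul_left _ (by omega)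
          _ = L * (4 * c) := by ring
      exact Nat.le_of_mul_le_mul_left h3 hL1
    · rintro s' h -
      exact hR s' h

theorem logb_two_nat_ge {N : ℕ} (hN : 2 ≤ N) : 1 ≤ Real.logb 2 N := by
  rw [Real.le_logb_iff_rpow_le (by norm_num) (by positivity)]
  simpa using (by exact_mod_cast hN : (2 : ℝ) ≤ N)

/-- Together with `logb_le_two_mul_L`: the length `L` of a block is proportional to `log N`. -/
theorem two_mul_L_lt {N : ℕ} (hN : 2 ≤ N) (hL : 4 ^ L < 4 * N) :
    2 * (L : ℝ) ≤ 2 + Real.logb 2 N := by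
  have h1 : ((2 : ℝ) ^ (2 * L)) ≤ 2 ^ 2 * N := by
    rw [pow_mul]
    norm_num
    exact_mod_cast hL.le
  have h2 := Real.logb_le_logb_of_le (b := 2) (by norm_num) (by positivity) h1
  rw [Real.logb_mul (by norm_num) (by positivity), Real.logb_pow, Real.logb_pow,
    Real.logb_self_eq_one (by norm_num)] at h2
  push_cast at h2
  linarith

theorem logb_le_two_mul_L {N : ℕ} (hN : 2 ≤ N) (hL : N ≤ 4 ^ L) :
    Real.logb 2 N ≤ 2 * (L : ℝ) := by
  have h1 : (N : ℝ) ≤ 2 ^ (2 * L) := by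
    rw [pow_mul]
    norm_num
    exact_mod_cast hL
  have h2 := Real.logb_le_logb_of_le (b := 2) (by norm_num) (by positivity) h1
  rw [Real.logb_pow, Real.logb_self_eq_one (by norm_num)] at h2
  push_cast at h2
  linarith

/-- The cost of a transition in terms of bit lengths. -/
theorem mul_cost_le {c x t : ℕ} (hN : 2 ≤ N) (hL : 4 ^ L < 4 * N)
    (h : (t : ℝ) ≤ c * (1 + Real.logb 2 (1 + (x : ℝ)) / Real.logb 2 N)) :
    L * t ≤ 2 * c * (L + Nat.size x) := by
  have h1 := logb_two_nat_ge hN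
  have h2 := two_mul_L_lt hN hL
  have h3 : Real.logb 2 (1 + (x : ℝ)) ≤ Nat.size x := by
    rw [Real.logb_le_iff_le_rpow (by norm_num) (by positivity), Real.rpow_natCast]
    have := Nat.lt_size_self x
    exact_mod_cast (by omega : 1 + x ≤ 2 ^ Nat.size x)
  have h4 : 0 ≤ Real.logb 2 (1 + (x : ℝ)) :=
    Real.logb_nonneg (by norm_num) (by have : (0 : ℝ) ≤ x := by positivity
                                       linarith)
  set ℓ := Real.logb 2 N
  set y := Real.logb 2 (1 + (x : ℝ))
  have h5 : (L : ℝ) * (y / ℓ) ≤ 2 * y := by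
    rw [mul_div_assoc', div_le_iff₀ (by linarith)]
    nlinarith
  have hL0 : (0 : ℝ) ≤ L := by positivity
  have hc0 : (0 : ℝ) ≤ c := by positivity
  have h6 : (L : ℝ) * t ≤ 2 * c * (L + Nat.size x) :=
    calc (L : ℝ) * t ≤ L * (c * (1 + y / ℓ)) := mul_le_mul_of_nonneg_left h hL0
      _ = c * (L + L * (y / ℓ)) := by ring
      _ ≤ c * (2 * (L + Nat.size x)) := by
        refine mul_le_mul_of_nonneg_left ?_ hc0
        linarith
      _ = 2 * c * (L + Nat.size x) := by ring
  exact_mod_cast h6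

/-- A time bound in terms of the block length `L` is turned into one in terms of `log N`. -/
theorem query_time_le {t k x : ℕ} (hN : 2 ≤ N) (hL1 : 1 ≤ L) (hL : N ≤ 4 ^ L)
    (h : L * t ≤ k * (L + x)) : (t : ℝ) ≤ 2 * k * (1 + (x : ℝ) / Real.logb 2 N) := by
  have h1 := logb_two_nat_ge hN
  have h2 := logb_le_two_mul_L hN hL
  set ℓ := Real.logb 2 N
  have h3 : (L : ℝ) * t ≤ k * (L + x) := by exact_mod_cast h
  have hL0 : (1 : ℝ) ≤ L := by exact_mod_cast hL1
  have hk0 : (0 : ℝ) ≤ k := by positivity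
  have h4 : (L : ℝ) + x ≤ L * (2 * (1 + x / ℓ)) := by
    have h5 : (x : ℝ) ≤ 2 * L * (x / ℓ) := by
      rw [mul_div_assoc', le_div_iff₀ (by linarith)]
      nlinarith
    nlinarith
  have h5 : (L : ℝ) * t ≤ L * (2 * k * (1 + x / ℓ)) := by
    calc (L : ℝ) * t ≤ k * (L + x) := h3
      _ ≤ k * (L * (2 * (1 + x / ℓ))) := mul_le_mul_of_nonneg_left h4 hk0
      _ = L * (2 * k * (1 + x / ℓ)) := by ring
  exact le_of_mul_le_mul_left h5 (by linarith)

/-- The query on an empty string. -/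
theorem query_exec_nil {st : State b} {K : ℕ} (hK : 10 ≤ K) {o : ℕ}
    (h1 : st.reg 1 = BitVec.ofNat b (senc ([] : List (Fin σ))).length) :
    ∃ (st₃ : State b) (t₂ : ℕ), Exec A cost queryCode.code st st₃ t₂ ∧
      (t₂ : ℝ) ≤ K * (1 + (((senc ([] : List (Fin σ))).length : ℝ) +
        ((senc (A.output [])).length : ℝ)) / Real.logb 2 N) ∧
      Stores st₃ o (senc (A.output [])) ∧
      (st₃.reg 0).toNat = (senc (A.output [])).length ∧
      (∀ v : BitVec b, (v.toNat < o ∨ o + cells b (senc (A.output [])) ≤ v.toNat) →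
        st₃.mem v = st.mem v) := by
  have e1 : senc ([] : List (Fin σ)) = [] := rfl
  have e2 : senc (A.output []) = [] := rfl
  obtain ⟨st₃, t, s', x1, x2, ⟨x3, x4, x5⟩, x6⟩ := queryCode.code_exec (A := A)
      (cost := cost) _ _ st
    (rep_absState st) (queryCode_nil (absState_reg (k := 1) rfl h1 (Nat.two_pow_pos b)))
  refine ⟨st₃, t, x1, ?_, ?_, ?_, fun v _ => ?_⟩
  · have h2 : t ≤ K := by
      have : (absState st).time = 0 := rfl
      omega
    rw [e1, e2]
    simpa using (by exact_mod_cast h2 : (t : ℝ) ≤ K)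
  · intro i hi
    rw [e2] at hi
    simp at hi
  · rw [e2]
    have := x2.reg vR0
    rw [x3] at this
    exact this
  · refine BitVec.eq_of_toNat_eq ?_
    rw [x2.mem_eq, x4, absState_mem]

/-- The query on a non-empty string. -/
theorem query_exec {st : State b} {dep : Fin q → ℕ} {root : Fin q → Fin q} {base idx : Fin q → ℕ}
    {m₁ : ℕ → ℕ} {M a o n : ℕ} {S : List (Fin σ)} (hN : 2 ≤ N) (hL : N ≤ 4 ^ L)
    (hq : QC A cost z₀ b L MB GB D dep root base idx m₁ (absState st).mem M cc a o n (senc S)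
      (senc (A.output S))) (hn : S.length ≤ n) (hS : S ≠ [])
    (h0 : st.reg 0 = BitVec.ofNat b a) (h1 : st.reg 1 = BitVec.ofNat b (senc S).length)
    (h2 : st.reg 2 = BitVec.ofNat b o) :
    ∃ (st₃ : State b) (t₂ : ℕ), Exec A cost queryCode.code st st₃ t₂ ∧
      (t₂ : ℝ) ≤ 2 * (100 * (1000 + cc) : ℕ) * (1 + (((senc S).length : ℝ) +
        ((senc (A.output S)).length : ℝ)) / Real.logb 2 N) ∧
      Stores st₃ o (senc (A.output S)) ∧
      (st₃.reg 0).toNat = (senc (A.output S)).length ∧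
      (∀ v : BitVec b, (v.toNat < o ∨ o + cells b (senc (A.output S)) ≤ v.toNat) →
        st₃.mem v = st.mem v) := by
  have hbL := hq.bnd.Lb
  have hra := hq.ra
  have hro := hq.ro
  have hlens := hq.lens
  have hd1 := Nat.zero_le ((senc S).length / b)
  have hd2 := Nat.zero_le ((senc (A.output S)).length / b)
  obtain ⟨st₃, t, s', x1, x2, ⟨x3, x4, x5, x6⟩, x7⟩ := queryCode.code_exec (A := A)
      (cost := cost) _ _
    st (rep_absState st) (query_spec hq (senc_eq S) (senc_output S) hn
      (absState_reg (k := 0) rfl h0 (by omega)) (absState_reg (k := 1) rfl h1 (by omega))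
      (absState_reg (k := 2) rfl h2 (by omega)) rfl (fun h => hS (senc_eq_nil h)))
  refine ⟨st₃, t, x1, ?_, fun i hi => ?_, ?_, fun v hv => ?_⟩
  · have e : (absState st).time = 0 := rfl
    rw [x7, e] at x6
    have := query_time_le (t := t) (k := 100 * (1000 + cc))
      (x := (senc S).length + (senc (A.output S)).length) hN hq.bnd.L1 hL (by
        rw [← add_assoc, mul_assoc]
        simpa using x6)
    push_cast at this ⊢
    exact this
  · have h3 := x3 i hi
    have h4 : i % b < b := Nat.mod_lt _ (by omega)
    have h5 : i / b ≤ (senc (A.output S)).length / b := Nat.div_le_div_right hi.le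
    rw [getMsbD_eq_testBit _ h4, x2.mem _ (by omega), h3]
  · have := x2.reg vR0
    rw [x4] at this
    exact this
  · refine BitVec.eq_of_toNat_eq ?_
    rw [x2.mem_eq, x5 _ hv, absState_mem]

end

end SparseTransducer

open SparseTransducer Var in
theorem mainTheorem9 :
    ∃ pre query : WordRAM.Prog, ∀ C : ℕ, ∃ κ : ℕ, ∀ c : ℕ, ∃ K : ℕ,
    ∀ (w b N q σ : ℕ), κ * w ≤ b → 2 ≤ N → N ≤ 2 ^ w → q ≤ 2 ^ (C * w) → σ ≤ 2 ^ (C * w) →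
    ∀ (A : Transducer q σ) (cost : Fin q → Fin σ → ℕ),
    (∀ (s : Fin q) (x : Fin σ),
      (cost s x : ℝ) ≤ c * (1 + Real.logb 2 (1 + ((x : ℕ) : ℝ)) / Real.logb 2 N)) →
    ∀ st₀ : WordRAM.State b,
    st₀.reg 0 = BitVec.ofNat b b → st₀.reg 1 = BitVec.ofNat b N →
    st₀.reg 2 = BitVec.ofNat b q → st₀.reg 3 = BitVec.ofNat b σ →
    st₀.reg 4 = BitVec.ofNat b (A.init : ℕ) →
    -- preprocessing: builds a data structure in the memory cells `0, …, D - 1`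
    ∃ (st₁ : WordRAM.State b) (t₁ D : ℕ),
      WordRAM.Exec A cost pre st₀ st₁ t₁ ∧
      t₁ ≤ K * (q * N) ∧ D ≤ K * (q * N) ∧
      (∀ v : BitVec b, D ≤ v.toNat → st₁.mem v = st₀.mem v) ∧
      -- processing an input string `S` with the help of the data structure
      ∀ S : List (Fin σ), S.length ≤ 2 ^ (C * w) →
        -- the memory is large enough for the data structure, the input, and the output
        D + WordRAM.cells b (senc S) + WordRAM.cells b (senc (A.output S)) ≤ 2 ^ b ∧
        ∀ (st₂ : WordRAM.State b) (a o : ℕ),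
        (∀ v : BitVec b, v.toNat < D → st₂.mem v = st₁.mem v) →
        D ≤ a → a + WordRAM.cells b (senc S) ≤ 2 ^ b →
        D ≤ o → o + WordRAM.cells b (senc (A.output S)) ≤ 2 ^ b →
        (a + WordRAM.cells b (senc S) ≤ o ∨ o + WordRAM.cells b (senc (A.output S)) ≤ a) →
        st₂.reg 0 = BitVec.ofNat b a →
        st₂.reg 1 = BitVec.ofNat b (senc S).length →
        st₂.reg 2 = BitVec.ofNat b o →
        WordRAM.Stores st₂ a (senc S) →
        ∃ (st₃ : WordRAM.State b) (t₂ : ℕ),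
          WordRAM.Exec A cost query st₂ st₃ t₂ ∧
          (t₂ : ℝ) ≤ K * (1 +
            (((senc S).length : ℝ) + ((senc (A.output S)).length : ℝ)) / Real.logb 2 N) ∧
          WordRAM.Stores st₃ o (senc (A.output S)) ∧
          (st₃.reg 0).toNat = (senc (A.output S)).length ∧
          (∀ v : BitVec b,
            (v.toNat < o ∨ o + WordRAM.cells b (senc (A.output S)) ≤ v.toNat) →
            st₃.mem v = st₂.mem v) := by
  -- Words have room for numbers that are products of constantly many parameters. The constants of
  -- the time bounds come from `preCode_spec` and `query_exec`, with `4 ^ L < 4 * N`.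
  refine ⟨preCode.code, queryCode.code, fun C => ⟨8 * C + 40, fun c => ⟨400 * c + 200000, ?_⟩⟩⟩
  intro w b N q σ hb hN hNw hq hσ A cost hcost st₀ r0 r1 r2 r3 r4
  have hq0 : 0 < q := A.init.pos
  have big : Big b w C N q σ := ⟨hb, hN, hNw, hq0, hq, hσ⟩
  have hqσ := big.qσ_lt
  have hNb := big.N_lt
  have hbb := big.b_lt
  have hb0 : b ≠ 0 := by
    have := big.b_ge
    have := big.w_pos
    omega
  have hqN : 1 ≤ q * N := Nat.mul_pos hq0 (by omega)
  have a3 : (absState st₀).reg vR3 = σ := absState_reg (k := 3) rfl r3 hqσ.2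
  rcases Nat.eq_zero_or_pos σ with h0 | h0
  · -- Without symbols there is nothing to prepare, and only the empty string can be queried.
    have hpre : wp b A cost preCode (fun s' => s'.mem = (absState st₀).mem ∧ s'.time ≤ 3)
        (absState st₀) := by
      unfold preCode
      rw [wp_ite]
      refine ⟨by simp, fun _ => ?_, fun h => ?_⟩
      · rw [wp_skip]
        exact ⟨rfl, le_rfl⟩
      · simp [a3, h0] at h
    obtain ⟨st₁, t, s', x1, x2, ⟨x3, x4⟩, x5⟩ := preCode.code_exec _ _ st₀ (rep_absState st₀) hpre
    refine ⟨st₁, t, 0, x1, ?_, by omega, fun v _ => ?_, fun S hS => ?_⟩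
    · have : (400 * c + 200000) * 1 ≤ (400 * c + 200000) * (q * N) := Nat.mul_le_mul_left _ hqN
      omega
    · refine BitVec.eq_of_toNat_eq ?_
      rw [x2.mem_eq, x3, absState_mem]
    · subst h0
      have hS0 : S = [] := by
        cases S with
        | nil => rfl
        | cons u S => exact u.elim0
      subst hS0
      refine ⟨?_, fun st₂ a o _ _ _ _ _ _ _ k1 _ _ => ?_⟩
      · have e1 : cells b (senc ([] : List (Fin 0))) = 1 := by
          change 0 / b + 1 = 1
          rw [Nat.zero_div]
        have e2 : cells b (senc (A.output [])) = 1 := by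
          change 0 / b + 1 = 1
          rw [Nat.zero_div]
        omega
      · exact query_exec_nil (by omega) k1
  have hcost' : ∀ L, 4 ^ L < 4 * N → ∀ (v : Fin q) (u : Fin σ),
      L * cost v u ≤ 2 * c * (L + Nat.size u) :=
    fun L hL v u => mul_cost_le hN hL (hcost v u)
  have hpre := preCode_spec (s := absState st₀) big h0 hcost'
    (absState_reg (k := 0) rfl r0 (by omega)) (absState_reg (k := 1) rfl r1 (by omega))
    (absState_reg (k := 2) rfl r2 hqσ.1) a3
    (absState_reg (k := 4) rfl r4 (A.init.2.trans hqσ.1))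
  obtain ⟨st₁, t, s₁, x1, x2, ⟨L, MB, GB, LB, D, dep, root, base, idx, lay, n1, n2, ds, x3, x4⟩,
      x5⟩ :=
    preCode.code_exec _ _ st₀ (rep_absState st₀) hpre
  have hD := big.lay_le n2 lay
  have hDb := lay.hDb
  refine ⟨st₁, t, D, x1, ?_, ?_, fun v hv => ?_, fun S hS => ?_⟩
  · have h1 : (4 * c + 1500) * (q * 4 ^ L) ≤ (4 * c + 1500) * (q * (4 * N)) :=
      Nat.mul_le_mul_left _ (Nat.mul_le_mul_left _ n2.le)
    have h3 : 20 * ((4 * c + 1500) * (q * (4 * N))) = (320 * c + 120000) * (q * N) := by ring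
    have h4 : (400 * c + 200000) * (q * N) =
      (320 * c + 120000) * (q * N) + 80 * c * (q * N) + 80000 * (q * N) := by ring
    omega
  · refine hD.trans (Nat.mul_le_mul_right _ (by omega))
  · refine BitVec.eq_of_toNat_eq ?_
    rw [x2.mem_eq, x3 _ hv, absState_mem]
  have hlens := big.lens (A := A) S hS
  have hc1 : cells b (senc S) ≤ (senc S).length + 1 := Nat.succ_le_succ (Nat.div_le_self _ _)
  have hc2 : cells b (senc (A.output S)) ≤ (senc (A.output S)).length + 1 :=
    Nat.succ_le_succ (Nat.div_le_self _ _)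
  refine ⟨by omega, fun st₂ a o m1 m2 m3 m4 m5 m6 k0 k1 k2 m7 => ?_⟩
  by_cases hS0 : S = []
  · subst hS0
    exact query_exec_nil (by omega) k1
  have hqc : QC A cost ⟨0, h0⟩ b L MB GB D dep root base idx s₁.mem (absState st₂).mem (C * w)
      (2 * c)
      a o (2 ^ (C * w)) (senc S) (senc (A.output S)) := by
    refine ⟨lay.bnd, ds, rfl, ?_, hσ, le_rfl, hcost' L n2, m4, m3, m5, m6, fun i hi => ?_,
      fun x hx => ?_, hlens⟩
    · have := big.b_ge
      have := big.w_pos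
      have := (big.L_le n2).1
      omega
    · have h1 := m7 i hi
      rwa [getMsbD_eq_testBit _ (Nat.mod_lt _ (by omega))] at h1
    · have h1 : x < 2 ^ b := by omega
      have h2 : (BitVec.ofNat b x).toNat = x := by
        rw [BitVec.toNat_ofNat, Nat.mod_eq_of_lt h1]
      have h3 := m1 (BitVec.ofNat b x) (by rwa [h2])
      rw [← x2.mem x h1, ← h3]
      rfl
  obtain ⟨st₃, t₂, y1, y2, y3⟩ := query_exec hN n1 hqc hS hS0 k0 k1 k2
  refine ⟨st₃, t₂, y1, y2.trans ?_, y3⟩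
  refine mul_le_mul_of_nonneg_right ?_ ?_
  · push_cast
    linarith
  · have := logb_two_nat_ge hN
    positivity
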